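/- Consider the square-octagon lattice $[4.8.8]$ on an $m\times n$ torus of square plaquettes, $m,n\ge 3$: each square plaquette has four corners (east, north, west, south), consecutive corners of a plaquette are joined by an edge, and the east (north) corner of each plaquette is joined by an edge, called a link, to the west (south) corner of the plaquette to its east (north). Put a spin $3/2$ on every site; for an edge $e$ let $H^{(e)}$ be the orthogonal projection onto the subspace where the two spins joined by $e$ have total spin $3$. For an induced subgraph $\Gamma$ let $\Psi_\Gamma$ be the AKLT map from the virtual space (one spin $1/2$ for each half-edge at $\Gamma$ that belongs to no edge of $\Gamma$) to the physical space of $\Gamma$, obtained by contracting the projectors $(\mathbb C^2)^{\otimes 3}\to\mathbb C^4$ onto spin $3/2$ at the sites of $\Gamma$ with the singlets on the edges of $\Gamma$. Let $\mathcal H_\Gamma$ be the image of $\Psi_\Gamma$ and $\Pi_\Gamma$ the orthogonal projection onto it. For a link $i$ let $\Gamma_i$ be the subgraph formed by $i$ and the two square plaquettes that it connects, and $\tilde H_i=\mathbb 1-\Pi_{\Gamma_i}$. For $i\ne j$ with $\Gamma_i\cap\Gamma_j\neq\varnothing$ write $i\parallel j$ or $i\perp j$ according to whether the links $i$ and $j$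 are collinear or perpendicular. For a set $S$ of links let $H_S=\sum_e H^{(e)}$, the sum being over the edges of $\bigcup_{i\in S}\Gamma_i$, and $\tilde H_S=\sum_{i\in S}\tilde H_i$, both acting on the spins of $\bigcup_{i\in S}\Gamma_i$ (if $S$ is the set of all links, $H_S$ is the AKLT Hamiltonian of the torus). There are real numbers $\eta_\parallel,\eta_\perp$ with $$|\eta_\parallel-0.1061446858|<5\cdot 10^{-11},\qquad |\eta_\perp-0.1589663310|<5\cdot 10^{-11},\qquad 2\eta_\parallel+4\eta_\perp<1,$$ such that the following hold for all $m,n\ge 3$. 1. For every link $i$ there are exactly $2$ links $j$ with $i\parallel j$ and exactly $4$ links $j$ with $i\perp j$. 2. If $i\parallel j$, then $\eta_\parallel$ is the least real $\eta$ such that $\tilde H_i\tilde H_j+\tilde H_j\tilde H_i\ge-\eta(\tilde H_i+\tilde H_j)$. Moreover, with $L=\Gamma_i\setminus\Gamma_j$, $C=\Gamma_i\cap\Gamma_j$, $R=\Gamma_j\setminus\Gamma_i$, the reduced operator, that is, the compression of $\Pi_{\Gamma_i}+\Pi_{\Gamma_j}$ to $\mathcal H_L\otimes\mathcal H_C\otimes\mathcal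 H_R$, acts on a space of dimension $2^{12}$, and its greatest non-integer eigenvalue is $1+\eta_\parallel$. The same holds with $\perp$ in place of $\parallel$ and $\eta_\perp$ in place of $\eta_\parallel$. 3. $\tilde H_S^2\ge(1-2\eta_\parallel-4\eta_\perp)\tilde H_S$ for every set $S$ of links. 4. There is $\gamma_0>0$, independent of $m,n$ and $S$, such that for every set $S$ of links: $H_S\ge\gamma_0\tilde H_S$; both $H_S$ and $\tilde H_S$ are self-adjoint with lowest eigenvalue $0$; every nonzero eigenvalue of $\tilde H_S$ is at least $1-2\eta_\parallel-4\eta_\perp$; and every nonzero eigenvalue of $H_S$ is at least $\gamma_0(1-2\eta_\parallel-4\eta_\perp)>0$. In particular the spin-$3/2$ AKLT model on the square-octagon lattice is gapped, uniformly in the system size. -/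

import Mathlib

/-! # The spin-3/2 AKLT model on the square-octagon lattice -/

namespace SquareOctagon

noncomputable section

/-! ## The lattice

The square plaquettes of the `[4.8.8]` lattice form a square grid; with periodic boundary conditions
they are indexed by `ZMod m × ZMod n`. The four corners of a plaquette point east (`0`), north (`1`),
west (`2`) and south (`3`). Every corner is joined to the next and to the previous corner of its
plaquette, and to the opposite corner of the plaquette lying in its direction. -/

/-- Square plaquettes. -/
abbrev Plaq (m n : ℕ) := ZMod m × ZMod n

/-- Lattice sites: a plaquette and one of its corners. -/
abbrev Site (m n : ℕ) := Plaq m n × Fin 4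

/-- Octagon-octagon edges, i.e. edges joining two square plaquettes:
`(p, 0)` goes east from `p` and `(p, 1)` goes north from `p`. -/
abbrev Link (m n : ℕ) := Plaq m n × Fin 2

/-- All edges: `inl (p, a)` joins the corners `a` and `a + 1` of `p`; `inr i` is a link. -/
abbrev Edge (m n : ℕ) := Site m n ⊕ Link m n

/-- Half-edges at a site: `0` leads to the next corner, `1` to the previous corner of the plaquette,
and `2` to another plaquette. -/
abbrev HalfEdge (m n : ℕ) := Site m n × Fin 3

/-- The plaquette reached from the plaquette of a link by following that link. -/
def Link.target {m n : ℕ} (i : Link m n) : Plaq m n :=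
  if i.2 = 0 then (i.1.1 + 1, i.1.2) else (i.1.1, i.1.2 + 1)

/-- The half-edge at which an edge starts. -/
def Edge.start {m n : ℕ} : Edge m n → HalfEdge m n
  | Sum.inl v => (v, 0)
  | Sum.inr i => ((i.1, if i.2 = 0 then 0 else 1), 2)

/-- The half-edge at which an edge ends. -/
def Edge.finish {m n : ℕ} : Edge m n → HalfEdge m n
  | Sum.inl v => ((v.1, v.2 + 1), 1)
  | Sum.inr i => ((Link.target i, if i.2 = 0 then 2 else 3), 2)

/-- The vertex set of the enlarged term at a link: the two square plaquettes which it connects. -/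
def pair {m n : ℕ} [NeZero m] [NeZero n] (i : Link m n) : Finset (Site m n) :=
  Finset.univ.filter fun v => v.1 = i.1 ∨ v.1 = Link.target i

/-- The two enlarged terms overlap and their links are collinear. -/
def Collinear {m n : ℕ} [NeZero m] [NeZero n] (i j : Link m n) : Prop :=
  i ≠ j ∧ ¬ Disjoint (pair i) (pair j) ∧ i.2 = j.2

/-- The two enlarged terms overlap and their links are perpendicular. -/
def Perpendicular {m n : ℕ} [NeZero m] [NeZero n] (i j : Link m n) : Prop :=
  i ≠ j ∧ ¬ Disjoint (pair i) (pair j) ∧ i.2 ≠ j.2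

/-! ## Spins and edge terms -/

/-- The physical space of a set `W` of spin-3/2 sites, the tensor product of `ℂ⁴` over `W`. The basis
vector `k : Fin 4` at a site has `S_z = 3/2 - k`. -/
abbrev Phys {m n : ℕ} (W : Finset (Site m n)) := EuclideanSpace ℂ (W → Fin 4)

/-- The spin-3/2 matrix `S_x`. -/
def spinX : Matrix (Fin 4) (Fin 4) ℂ :=
  (1 / 2 : ℂ) • !![0, (Real.sqrt 3 : ℂ), 0, 0;
                   (Real.sqrt 3 : ℂ), 0, 2, 0;
                   0, 2, 0, (Real.sqrt 3 : ℂ);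
                   0, 0, (Real.sqrt 3 : ℂ), 0]

/-- The spin-3/2 matrix `S_y`. -/
def spinY : Matrix (Fin 4) (Fin 4) ℂ :=
  (Complex.I / 2) • !![0, -(Real.sqrt 3 : ℂ), 0, 0;
                       (Real.sqrt 3 : ℂ), 0, -2, 0;
                       0, 2, 0, -(Real.sqrt 3 : ℂ);
                       0, 0, (Real.sqrt 3 : ℂ), 0]

/-- The spin-3/2 matrix `S_z`. -/
def spinZ : Matrix (Fin 4) (Fin 4) ℂ :=
  !![3 / 2, 0, 0, 0;
     0, 1 / 2, 0, 0;
     0, 0, -1 / 2, 0;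
     0, 0, 0, -3 / 2]

/-- The one-site matrix `A` acting at the site `v` of `W` (tensored with the identity elsewhere). -/
def siteOp {m n : ℕ} {W : Finset (Site m n)} (v : W) (A : Matrix (Fin 4) (Fin 4) ℂ) :
    Matrix (W → Fin 4) (W → Fin 4) ℂ :=
  Matrix.of fun σ τ => if ∀ u, u ≠ v → σ u = τ u then A (σ v) (τ v) else 0

/-- The square `(S_v + S_w)²` of the total spin of the sites `v` and `w`. -/
def totalSpinSq {m n : ℕ} {W : Finset (Site m n)} (v w : W) :
    Matrix (W → Fin 4) (W → Fin 4) ℂ :=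
  (siteOp v spinX + siteOp w spinX) ^ 2 + (siteOp v spinY + siteOp w spinY) ^ 2
    + (siteOp v spinZ + siteOp w spinZ) ^ 2

/-- The AKLT edge term: the orthogonal projection onto the subspace on which the total spin `s` of
`v` and `w` has its maximal value `3`, i.e. `s (s + 1) = 12`. -/
def edgeTerm {m n : ℕ} {W : Finset (Site m n)} (v w : W) : Phys W →L[ℂ] Phys W :=
  (Module.End.eigenspace (Matrix.toEuclideanLin (totalSpinSq v w)) 12).starProjection

/-! ## The AKLT construction on a subgraph -/

/-- The edges of the subgraph induced on `Γ`. -/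
abbrev InnerEdge {m n : ℕ} (Γ : Finset (Site m n)) :=
  {e : Edge m n // (Edge.start e).1 ∈ Γ ∧ (Edge.finish e).1 ∈ Γ}

/-- The half-edges at `Γ` which do not belong to an edge of the subgraph induced on `Γ`. They carry
the virtual indices of the AKLT construction on `Γ`. -/
abbrev FreeLeg {m n : ℕ} (Γ : Finset (Site m n)) :=
  {h : Γ × Fin 3 // ∀ e : InnerEdge Γ,
    Edge.start e.1 ≠ (h.1.1, h.2) ∧ Edge.finish e.1 ≠ (h.1.1, h.2)}

instance {m n : ℕ} [NeZero m] [NeZero n] (Γ : Finset (Site m n)) : Fintype (FreeLeg Γ) :=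
  Fintype.ofFinite _

/-- The projector of three spins 1/2 (`0` is up and `1` is down) onto spin 3/2, as a map
`ℂ² ⊗ ℂ² ⊗ ℂ² → ℂ⁴`: the entry in row `k` and column `x`. -/
def symProj (k : Fin 4) (x : Fin 3 → Fin 2) : ℂ :=
  if ∑ a, (x a : ℕ) = (k : ℕ) then 1 / (Real.sqrt (Nat.choose 3 k) : ℂ) else 0

/-- The singlet state of two spins 1/2. -/
def singlet (a b : Fin 2) : ℂ :=
  if a = b then 0 else if a = 0 then 1 / (Real.sqrt 2 : ℂ) else -1 / (Real.sqrt 2 : ℂ)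

open Classical in
/-- The AKLT construction `Ψ_Γ` from the virtual to the physical space of `Γ`: contract the
spin-3/2 projectors at the sites of `Γ` with the singlets on the edges inside `Γ`. -/
def aklt {m n : ℕ} [NeZero m] [NeZero n] (Γ : Finset (Site m n)) :
    Matrix (Γ → Fin 4) (FreeLeg Γ → Fin 2) ℂ :=
  Matrix.of fun σ b => ∑ x : Γ × Fin 3 → Fin 2,
    if ∀ h : FreeLeg Γ, x h.1 = b h then
      (∏ v : Γ, symProj (σ v) fun k => x (v, k)) *
        ∏ e : InnerEdge Γ,
          singlet (x (⟨(Edge.start e.1).1, e.2.1⟩, (Edge.start e.1).2))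
            (x (⟨(Edge.finish e.1).1, e.2.2⟩, (Edge.finish e.1).2))
    else 0

/-- Index set of a basis of the virtual space of `Γ` tensored with the physical space of `W \ Γ`. -/
abbrev VirtIndex {m n : ℕ} (Γ W : Finset (Site m n)) :=
  (FreeLeg Γ → Fin 2) × (↥(W \ Γ) → Fin 4)

instance {m n : ℕ} [NeZero m] [NeZero n] (Γ W : Finset (Site m n)) : Fintype (VirtIndex Γ W) :=
  instFintypeProd _ _

/-- `Ψ_Γ` tensored with the identity on `W \ Γ`, where `Γ ⊆ W`. -/
def akltOn {m n : ℕ} [NeZero m] [NeZero n] {Γ W : Finset (Site m n)} (h : Γ ⊆ W) :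
    Matrix (W → Fin 4) (VirtIndex Γ W) ℂ :=
  Matrix.of fun σ c =>
    if Finset.restrict₂ (π := fun _ => Fin 4) Finset.sdiff_subset σ = c.2 then
      aklt Γ (Finset.restrict₂ (π := fun _ => Fin 4) h σ) c.1
    else 0

/-- The image of `Ψ_Γ ⊗ 1` in the physical space of `W`. -/
def image {m n : ℕ} [NeZero m] [NeZero n] {Γ W : Finset (Site m n)} (h : Γ ⊆ W) :
    Submodule ℂ (Phys W) :=
  LinearMap.range (Matrix.toEuclideanLin (akltOn h))

/-- The orthogonal projection `Π_Γ ⊗ 1` onto the image of `Ψ_Γ ⊗ 1`. -/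
def proj {m n : ℕ} [NeZero m] [NeZero n] {Γ W : Finset (Site m n)} (h : Γ ⊆ W) :
    Phys W →L[ℂ] Phys W :=
  (image h).starProjection

/-- The enlarged term `1 - Π_Γ` of a link whose pair of plaquettes lies in `W`. -/
def enlarged {m n : ℕ} [NeZero m] [NeZero n] {W : Finset (Site m n)} (i : Link m n)
    (h : pair i ⊆ W) : Phys W →L[ℂ] Phys W :=
  1 - proj h

/-! ## Hamiltonians -/

/-- The sites of the union of the enlarged subgraphs of the links in `S`. -/
def region {m n : ℕ} [NeZero m] [NeZero n] (S : Finset (Link m n)) : Finset (Site m n) :=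
  S.biUnion pair

/-- The edges of the union of the enlarged subgraphs of the links in `S`. -/
abbrev RegionEdge {m n : ℕ} [NeZero m] [NeZero n] (S : Finset (Link m n)) :=
  {e : Edge m n // ∃ i ∈ S, (Edge.start e).1 ∈ pair i ∧ (Edge.finish e).1 ∈ pair i}

theorem RegionEdge.start_mem {m n : ℕ} [NeZero m] [NeZero n] {S : Finset (Link m n)}
    (e : RegionEdge S) : (Edge.start e.1).1 ∈ region S := by
  obtain ⟨i, hi, h, -⟩ := e.2
  exact Finset.mem_biUnion.2 ⟨i, hi, h⟩

theorem RegionEdge.finish_mem {m n : ℕ} [NeZero m] [NeZero n] {S : Finset (Link m n)}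
    (e : RegionEdge S) : (Edge.finish e.1).1 ∈ region S := by
  obtain ⟨i, hi, -, h⟩ := e.2
  exact Finset.mem_biUnion.2 ⟨i, hi, h⟩

open Classical in
/-- The AKLT Hamiltonian on the union of the enlarged subgraphs of the links in `S`. For
`S = Finset.univ` this is the AKLT Hamiltonian on the whole torus. -/
def hamiltonian {m n : ℕ} [NeZero m] [NeZero n] (S : Finset (Link m n)) :
    Phys (region S) →L[ℂ] Phys (region S) :=
  ∑ e : RegionEdge S, edgeTerm ⟨(Edge.start e.1).1, e.start_mem⟩ ⟨(Edge.finish e.1).1, e.finish_mem⟩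

/-- The sum of the enlarged terms of the links in `S`. -/
def enlargedHamiltonian {m n : ℕ} [NeZero m] [NeZero n] (S : Finset (Link m n)) :
    Phys (region S) →L[ℂ] Phys (region S) :=
  ∑ i : S, enlarged i.1 (Finset.subset_biUnion_of_mem pair i.2)

/-- The self-adjoint operator `H` has ground state energy `0`, and no other point of its spectrum
lies below `γ`. -/
def HasGap {E : Type*} [NormedAddCommGroup E] [InnerProductSpace ℂ E] [CompleteSpace E]
    (H : E →L[ℂ] E) (γ : ℝ) : Prop :=
  IsSelfAdjoint H ∧ IsLeast (spectrum ℝ H) 0 ∧ ∀ μ ∈ spectrum ℝ H, μ ≠ 0 → γ ≤ μ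

/-- `η` is the optimal constant in `E F + F E ≥ -η (E + F)`. -/
def IsOptimal {V : Type*} [NormedAddCommGroup V] [InnerProductSpace ℂ V] [CompleteSpace V]
    (E F : V →L[ℂ] V) (η : ℝ) : Prop :=
  IsLeast {t : ℝ | (-t) • (E + F) ≤ E * F + F * E} η

/-! ## The reduced operator -/

/-- The subspace `H_L ⊗ H_C ⊗ H_R` of the physical space of `Γ_i ∪ Γ_j`, where `L = Γ_i \ Γ_j`,
`C = Γ_i ∩ Γ_j`, `R = Γ_j \ Γ_i`, and `H_Γ` is the image of `Ψ_Γ`. -/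
def reducedSpace {m n : ℕ} [NeZero m] [NeZero n] (i j : Link m n) :
    Submodule ℂ (Phys (pair i ∪ pair j)) :=
  image (Finset.sdiff_subset.trans Finset.subset_union_left : pair i \ pair j ⊆ pair i ∪ pair j) ⊓
  image (Finset.inter_subset_left.trans Finset.subset_union_left :
    pair i ∩ pair j ⊆ pair i ∪ pair j) ⊓
  image (Finset.sdiff_subset.trans Finset.subset_union_right : pair j \ pair i ⊆ pair i ∪ pair j)

/-- The reduced operator `U† (Π_{Γ_i} + Π_{Γ_j}) U`, with `U` the inclusion of `H_L ⊗ H_C ⊗ H_R`. -/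
def reducedOp {m n : ℕ} [NeZero m] [NeZero n] (i j : Link m n) :
    reducedSpace i j →L[ℂ] reducedSpace i j :=
  (reducedSpace i j).orthogonalProjectionOnto ∘L
    (proj (Finset.subset_union_left : pair i ⊆ pair i ∪ pair j) +
      proj (Finset.subset_union_right : pair j ⊆ pair i ∪ pair j)) ∘L
    (reducedSpace i j).subtypeL

/-- `η` is the optimal constant for the enlarged terms of `i` and `j` (on every set of sites that
carries both of them); moreover the reduced operator acts on a space of dimension `2 ^ 12`, and its
greatest non-integer eigenvalue is `1 + η`. -/
def IsOverlapConstant {m n : ℕ} [NeZero m] [NeZero n] (i j : Link m n) (η : ℝ) : Prop :=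
  (∀ (W : Finset (Site m n)) (hi : pair i ⊆ W) (hj : pair j ⊆ W),
    IsOptimal (enlarged i hi) (enlarged j hj) η) ∧
  Module.finrank ℂ (reducedSpace i j) = 2 ^ 12 ∧
  IsGreatest {t : ℝ | t ∈ spectrum ℝ (reducedOp i j) ∧ t ∉ Set.range ((↑) : ℤ → ℝ)} (1 + η)

end

end SquareOctagon

/-! The argument concerns sums of projections E_i = 1 - Π_i. In the square of such a sum the
diagonal terms reproduce the sum. Pairs with disjoint supports contribute products of commuting
projections, which are nonnegative. Each overlapping pair costs at most η (E_i + E_j). A link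
overlaps two collinear and four perpendicular ones, so the square is at least 1 - 2η∥ - 4η⊥ times
the sum (`smul_le_sq_of_overlap`), and an operator with this property has no nonzero eigenvalue
below that number. The AKLT Hamiltonian inherits the gap (`exists_smul_enlargedHamiltonian_le`,
`hasGap_defectSum_of_le`): on the eight sites of one Γ_i the sum of the nine edge terms has the same
kernel as E_i, hence dominates a positive multiple of it, and every edge is used by boundedly many
links. The energy 0 is attained because the AKLT construction yields a nonzero state annihilated by
all terms.

It remains to determine η for one pair of links of each type.

Polynomials. A spin 3/2 is a polynomial of degree at most three in one variable. The edge term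
annihilates a state exactly when the difference of the two variables divides its polynomial
(`edgeTerm_eq`, `mem_sing_iff_dvd`). Different edges give independent conditions, so the common
kernel on a graph consists of the multiples of the product of all differences (`mem_iInf_sing_iff`).
The contraction of projectors with singlets produces exactly these multiples (`theta_contraction`,
`span_contraction`, `image_eq`). All spaces thereby become intersections of edge conditions with
explicit spanning sets.

Two projections. With D = E + F one has EF + FE = D² - D, so η is one minus the least nonzero
eigenvalue of D. Equivalently it governs the overlap of the two ranges modulo their intersection
(`le_of_overlap_le`, `overlap_le_of_le`), and only vectors which also satisfy the conditions of the
third plaquette matter. These are spanned by 1024 products of plaquette states with a singlet on one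
link. A reflection of the three plaquettes exchanges the two links, so the problem is to compare the
quadratic form x ↦ ⟨x, mirror x⟩ with the squared norm, on vectors orthogonal to the 256 states with
singlets on both links. Up to the factor 81³ both forms have integer matrices built from the 16 × 16
Gram matrix of a plaquette (`inner_linkState`, `inner_linkState_mirror`).

Certificates. Magnetization splits the matrices into eleven blocks of at most 256 rows, and the spin
flip leaves six of them. The upper bound for η is an approximate integer Cholesky decomposition of A
· norm ± T · cross + Z, where Z is a sum of squares vanishing on the relevant vectors
(`cholesky_sound`, `blockCheck_sound`, `abs_crossForm_le`). The lower bound is an explicit vector.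
It need not be exactly orthogonal to the common states, since a penalty controls its projection onto
them (`lowerCheck_sound`, `frame_bound`, `exists_spectrum_lt`).

Finally, `slice`, `liftOp` and `liftSub` transfer operator inequalities from the three abstract
plaquettes to any set of lattice sites, in either handedness of the perpendicular pair
(`isOptimal_enlarged`, `isGreatest_reducedOp`). -/

namespace SquareOctagon

noncomputable section

/-! ## Certified positivity of integer matrices

A column of an integer matrix is stored as one natural number, the residue modulo a power of `radix`
of the number whose (signed) digits are the entries. Eliminating a pivot then costs one
multiplication per column. The programs are written with recursors and `force`, so that the kernel
evaluates them eagerly. -/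

/-- `k n`, but the kernel evaluates `n` first. -/
def force {α : Type} (n : ℕ) (k : ℕ → α) : α := Nat.rec (k 0) (fun m _ => k (Nat.succ m)) n

@[simp] theorem force_eq {α : Type} (n : ℕ) (k : ℕ → α) : force n k = k n := by cases n <;> rfl

/-- The radix `2 ^ 160`. -/
def radix : ℕ := 1461501637330902918203684832716283019655932542976

/-- The offset `2 ^ 159` which makes signed digits nonnegative. -/
def half : ℕ := 730750818665451459101842416358141509827966271488

theorem radix_eq : radix = 2 * half := rfl

theorem radix_pos : 0 < radix := by norm_num [radix]

theorem half_pos : 0 < half := by norm_num [half]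

/-- The number with the given digits, the first one being the most significant. -/
def pack {ι : Type*} (f : ι → ℤ) (l : List ι) : ℤ := l.foldl (fun a i => a * radix + f i) 0

/-! ### Arithmetic of packed digit sequences -/

section pack

variable {ι : Type*} (f : ι → ℤ)

theorem foldl_pack (a : ℤ) (l : List ι) :
    l.foldl (fun a i => a * radix + f i) a = a * (radix : ℤ) ^ l.length + pack f l := by
  induction l generalizing a with
  | nil => simp [pack]
  | cons i l ih =>
    have h := ih (0 * radix + f i)
    rw [pack, List.foldl_cons, List.foldl_cons, ih, h]
    simp only [List.length_cons]
    ring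

@[simp] theorem pack_nil : pack f [] = 0 := rfl

theorem pack_cons (i : ι) (l : List ι) :
    pack f (i :: l) = f i * (radix : ℤ) ^ l.length + pack f l := by
  rw [pack, List.foldl_cons, foldl_pack]; ring

theorem pack_append (l l' : List ι) :
    pack f (l ++ l') = pack f l * (radix : ℤ) ^ l'.length + pack f l' := by
  rw [pack, List.foldl_append, foldl_pack]; rfl

theorem pack_concat (l : List ι) (i : ι) : pack f (l ++ [i]) = pack f l * radix + f i := by
  rw [pack_append]; simp [pack_cons]

variable {f}

theorem pack_congr {g : ι → ℤ} {l : List ι} (h : ∀ i ∈ l, f i = g i) : pack f l = pack g l := by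
  induction l with
  | nil => rfl
  | cons i l ih =>
    rw [pack_cons, pack_cons, h i (by simp), ih fun j hj => h j (by simp [hj])]

theorem pack_add (g : ι → ℤ) (l : List ι) : pack (fun i => f i + g i) l = pack f l + pack g l := by
  induction l with
  | nil => simp
  | cons i l ih => simp only [pack_cons, ih]; ring

theorem pack_sub (g : ι → ℤ) (l : List ι) : pack (fun i => f i - g i) l = pack f l - pack g l := by
  induction l with
  | nil => simp
  | cons i l ih => simp only [pack_cons, ih]; ring

theorem pack_mul_left (c : ℤ) (l : List ι) : pack (fun i => c * f i) l = c * pack f l := by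
  induction l with
  | nil => simp
  | cons i l ih => simp only [pack_cons, ih]; ring

theorem pack_map {κ : Type*} (g : κ → ι) (l : List κ) :
    pack f (l.map g) = pack (fun k => f (g k)) l := by
  induction l with
  | nil => rfl
  | cons i l ih => simp only [pack_cons, List.map_cons, List.length_map, ih]

theorem pack_nonneg_lt {l : List ι} (h : ∀ i ∈ l, 0 ≤ f i ∧ f i < radix) :
    0 ≤ pack f l ∧ pack f l < (radix : ℤ) ^ l.length := by
  induction l with
  | nil => simp
  | cons i l ih =>
    obtain ⟨h0, h1⟩ := ih fun j hj => h j (by simp [hj])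
    obtain ⟨h2, h3⟩ := h i (by simp)
    rw [pack_cons, List.length_cons, pow_succ]
    have hp : (0 : ℤ) < (radix : ℤ) ^ l.length := pow_pos (by exact_mod_cast radix_pos) _
    constructor
    · positivity
    · nlinarith [mul_le_mul_of_nonneg_right (Int.add_one_le_of_lt h3) hp.le]

end pack

/-- `C` is the residue of `z` modulo `radix ^ n`. -/
def IsResidue (n : ℕ) (z : ℤ) (C : ℕ) : Prop := (C : ℤ) ≡ z [ZMOD (radix : ℤ) ^ n]

/-- Quotients by `d` of the shifted digits of `X`, the `n` least significant ones. -/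
def digits (Z d n : ℕ) : ℕ → List ℕ → List ℕ :=
  Nat.rec (fun _ acc => acc) (fun _ ih X acc =>
    force (Nat.div (Nat.add (Nat.mod X radix) Z) d) fun l =>
      force (Nat.div X radix) fun X => ih X (List.cons l acc)) n

theorem digits_succ (Z d n X : ℕ) (acc : List ℕ) :
    digits Z d (n + 1) X acc = digits Z d n (X / radix) ((X % radix + Z) / d :: acc) := by
  simp only [digits, force_eq]; rfl

/-- Each step divides by the radix and peels off the least significant digit. Only `l.length` steps
are made, so the leading part `t` is never inspected. In the elimination this part is the pivot. -/
theorem digits_spec {ι : Type*} (D : ι → ℕ) (Z d : ℕ) (l : List ι) (hD : ∀ i ∈ l, D i < radix)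
    (t X : ℕ) (hX : (X : ℤ) = t * (radix : ℤ) ^ l.length + pack (fun i => (D i : ℤ)) l)
    (acc : List ℕ) :
    digits Z d l.length X acc = l.map (fun i => (D i + Z) / d) ++ acc := by
  induction l using List.reverseRecOn generalizing X acc with
  | nil => rfl
  | append_singleton l i ih =>
    rw [List.length_append, List.length_singleton, digits_succ]
    have hi : D i < radix := hD i (by simp)
    have hp := pack_nonneg_lt (f := fun i => (D i : ℤ)) (l := l) fun j hj =>
      ⟨by positivity, by exact_mod_cast hD j (by simp [hj])⟩
    lift pack (fun i => (D i : ℤ)) l to ℕ using hp.1 with p hpp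
    rw [pack_concat, ← hpp, List.length_append, List.length_singleton] at hX
    have hX' : X = D i + radix * (t * radix ^ l.length + p) := by
      zify; rw [hX]; ring
    have h1 : X % radix = D i := by
      rw [hX', Nat.add_mul_mod_self_left, Nat.mod_eq_of_lt hi]
    have h2 : X / radix = t * radix ^ l.length + p := by
      rw [hX', Nat.add_mul_div_left _ _ radix_pos, Nat.div_eq_of_lt hi, zero_add]
    rw [h1, h2, ih (fun j hj => hD j (by simp [hj])) _ (by push_cast; ring)]
    simp

/-- Packs a list of digits, provided that all of them lie between `lo` and `hi`. -/
def packChecked (lo hi : ℕ) (l : List ℕ) : ℕ → (ℕ → Bool) → Bool :=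
  List.rec (fun acc k => k acc) (fun a _ ih acc k =>
    Bool.rec false (Bool.rec false (force (Nat.add (Nat.mul acc radix) a) fun acc => ih acc k)
      (Nat.ble a hi)) (Nat.ble lo a)) l

/-- The program is in continuation-passing style. A final `true` therefore testifies both to the
range of every digit and to the success of the rest of the computation on the packed number. -/
theorem packChecked_spec {ι : Type*} (D : ι → ℕ) (lo hi : ℕ) (l : List ι) (acc : ℕ)
    (k : ℕ → Bool) (h : packChecked lo hi (l.map D) acc k = true) :
    (∀ i ∈ l, lo ≤ D i ∧ D i ≤ hi) ∧
      ∃ P : ℕ, (P : ℤ) = acc * (radix : ℤ) ^ l.length + pack (fun i => (D i : ℤ)) l ∧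
        k P = true := by
  induction l generalizing acc with
  | nil => exact ⟨by simp, acc, by simp, h⟩
  | cons i l ih =>
    have h : (Bool.rec false (Bool.rec false (packChecked lo hi (l.map D) (acc * radix + D i) k)
        (Nat.ble (D i) hi)) (Nat.ble lo (D i)) : Bool) = true := by
      simp only [packChecked, force_eq] at h ⊢
      exact h
    cases h1 : Nat.ble lo (D i) with
    | false => rw [h1] at h; cases h
    | true =>
      cases h2 : Nat.ble (D i) hi with
      | false => rw [h1, h2] at h; cases h
      | true =>
        rw [h1, h2] at h
        obtain ⟨h3, P, hP, hk⟩ := ih _ h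
        refine ⟨?_, P, ?_, hk⟩
        · intro j hj
          rcases List.mem_cons.1 hj with rfl | hj
          · exact ⟨Nat.le_of_ble_eq_true h1, Nat.le_of_ble_eq_true h2⟩
          · exact h3 j hj
        · rw [hP, pack_cons, List.length_cons]
          push_cast
          ring

/-- Reverses a list, adding it in front of another one. -/
def reverseOnto (l : List ℕ) : List ℕ → List ℕ :=
  List.rec (fun acc => acc) (fun a _ ih acc => ih (List.cons a acc)) l

theorem reverseOnto_eq (l acc : List ℕ) : reverseOnto l acc = l.reverse ++ acc := by
  induction l generalizing acc with
  | nil => rfl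
  | cons a l ih =>
    change reverseOnto l (a :: acc) = _
    rw [ih]; simp

/-- Adds to every column `C` the multiple `(l - half) * X` modulo `q`, where `Y = -X`
(in reverse order). -/
def update (X Y q : ℕ) (Cs : List ℕ) : List ℕ → List ℕ → List ℕ :=
  List.rec (fun _ acc => acc) (fun C _ ih ls acc => List.rec acc (fun l ls' _ =>
    force (Nat.mod (Nat.add C (Bool.rec (Nat.mul (Nat.sub half l) Y) (Nat.mul (Nat.sub l half) X)
      (Nat.ble half l))) q) fun v => ih ls' (List.cons v acc)) ls) Cs

/-- One step of `update`. -/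
def updated (X Y q C l : ℕ) : ℕ :=
  (C + if half ≤ l then (l - half) * X else (half - l) * Y) % q

theorem update_map {ι : Type*} (X Y q : ℕ) (C L : ι → ℕ) (l : List ι) (acc : List ℕ) :
    update X Y q (l.map C) (l.map L) acc =
      (l.map fun i => updated X Y q (C i) (L i)).reverse ++ acc := by
  induction l generalizing acc with
  | nil => rfl
  | cons i l ih =>
    have : update X Y q ((i :: l).map C) ((i :: l).map L) acc =
        update X Y q (l.map C) (l.map L) (updated X Y q (C i) (L i) :: acc) := by
      suffices h0 : updated X Y q (C i) (L i) = Nat.mod (Nat.add (C i)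
          (Bool.rec (Nat.mul (Nat.sub half (L i)) Y) (Nat.mul (Nat.sub (L i) half) X)
            (Nat.ble half (L i)))) q by
        rw [h0]
        simp only [update, force_eq, List.map_cons]
      unfold updated
      by_cases h : half ≤ L i
      · rw [if_pos h, Nat.ble_eq_true_of_le h]; rfl
      · have h' : Nat.ble half (L i) = false := by
          cases hb : Nat.ble half (L i) with
          | false => rfl
          | true => exact absurd (Nat.le_of_ble_eq_true hb) h
        rw [if_neg h, h']; rfl
    rw [this, ih]
    simp

/-- Both signs of the multiplier are handled without integers: `L` is the multiplier shifted by
`half`, and a negative multiple of `x` is a positive multiple of `-x`, whose residue `Y` is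
supplied. -/
theorem updated_residue {n : ℕ} {X Y C L : ℕ} {z x ℓ : ℤ} (hC : IsResidue n z C)
    (hX : IsResidue n x X) (hY : IsResidue n (-x) Y) (hL : (L : ℤ) = ℓ + half) :
    IsResidue n (z + ℓ * x) (updated X Y (radix ^ n) C L) := by
  unfold IsResidue updated at *
  rw [Int.natCast_mod, Nat.cast_pow]
  refine (Int.mod_modEq _ _).trans ?_
  rw [Nat.cast_add]
  refine hC.add ?_
  split_ifs with h
  · have : ((L - half : ℕ) : ℤ) = ℓ := by rw [Nat.cast_sub h]; linarith
    rw [Nat.cast_mul, this]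
    exact hX.mul_left _
  · have : ((half - L : ℕ) : ℤ) = -ℓ := by rw [Nat.cast_sub (by omega)]; linarith
    rw [Nat.cast_mul, this]
    have := hY.mul_left (-ℓ)
    rwa [neg_mul_neg] at this

/-- The column of offsets. -/
def offsets (n : ℕ) : ℕ := Nat.rec 0 (fun _ s => s * radix + half) n

theorem offsets_eq {ι : Type*} (l : List ι) :
    (offsets l.length : ℤ) = pack (fun _ => (half : ℤ)) l := by
  induction l using List.reverseRecOn with
  | nil => rfl
  | append_singleton l i ih =>
    rw [pack_concat, ← ih, List.length_append, List.length_singleton]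
    change ((offsets l.length * radix + half : ℕ) : ℤ) = _
    push_cast; ring

theorem offsets_lt (n : ℕ) : offsets n < radix ^ n := by
  have h := (pack_nonneg_lt (f := fun _ => (half : ℤ)) (l := List.replicate n ()) fun _ _ =>
    ⟨by positivity, by exact_mod_cast (by rw [radix_eq]; have := half_pos; omega)⟩).2
  rw [← offsets_eq, List.length_replicate] at h
  exact_mod_cast h

theorem offsets_mod (n : ℕ) : offsets (n + 1) % radix ^ n = offsets n := by
  have h := offsets_eq (List.replicate (n + 1) ())
  have h' := offsets_eq (List.replicate n ())
  rw [List.length_replicate] at h h'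
  rw [List.replicate_succ, pack_cons, List.length_replicate, ← h'] at h
  have : offsets (n + 1) = offsets n + radix ^ n * half := by
    zify; rw [h]; ring
  rw [this, Nat.add_mul_mod_self_left, Nat.mod_eq_of_lt (offsets_lt n)]

/-- Adding the offsets to a residue recovers the digits. -/
theorem add_offsets_mod {ι : Type*} {a : ι → ℤ} {l : List ι} (ha : ∀ i ∈ l, |a i| < half) {C : ℕ}
    (hC : IsResidue l.length (pack a l) C) :
    (((C + offsets l.length) % radix ^ l.length : ℕ) : ℤ) =
      pack (fun i => (((a i + half).toNat : ℕ) : ℤ)) l := by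
  have hnn : ∀ i ∈ l, 0 ≤ a i + half ∧ a i + half < radix := fun i hi => by
    have := abs_lt.1 (ha i hi)
    rw [radix_eq]; push_cast
    constructor <;> linarith
  have h := pack_nonneg_lt (f := fun i => a i + half) hnn
  rw [pack_congr (g := fun i => a i + half) fun i hi => Int.toNat_of_nonneg (hnn i hi).1]
  rw [Int.natCast_mod, Nat.cast_add, Nat.cast_pow, ← Int.emod_eq_of_lt h.1 h.2]
  rw [pack_add, ← offsets_eq]
  exact Int.ModEq.add hC rfl

/-- Newton's iteration for the integer square root. -/
def sqrtIter (fuel n : ℕ) : ℕ → ℕ :=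
  Nat.rec (fun x => x) (fun _ ih x => force (Nat.div (Nat.add x (Nat.div n x)) 2) fun y =>
    Bool.rec (ih y) x (Nat.ble x y)) fuel

/-- The integer square root. -/
def sqrtNewton (c : ℕ) : ℕ := sqrtIter 100 c (Nat.pow 2 (Nat.succ (Nat.div (Nat.log2 c) 2)))

/-- Approximate Cholesky decomposition of a matrix given by its columns. Returns `true` only if
the matrix is at least `-n * eps`. -/
def cholesky (root : ℕ → ℕ) (eps bnd : ℕ) (n : ℕ) : (offs q : ℕ) → List ℕ → Bool :=
  Nat.rec (fun _ _ _ => true) (fun n ih offs q Cs => List.rec false (fun C Cs _ =>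
    force (Nat.mod (Nat.add C offs) q) fun X =>
    force (Nat.div q radix) fun q =>
    force (Nat.sub (Nat.div X q) half) fun c =>
    force (root c) fun d =>
    Bool.rec false (Bool.rec false (Bool.rec false (
      force (Nat.mul half (Nat.pred d)) fun Z =>
      force (Nat.mod offs q) fun offs =>
      (fun ls => packChecked (Nat.sub half bnd) (Nat.add half bnd) ls 0 fun P =>
        force (Nat.mod (Nat.sub (Nat.add q P) offs) q) fun Y =>
        ih offs q (reverseOnto (update (Nat.sub q Y) Y q Cs ls List.nil) List.nil))
      (digits Z d n X List.nil))
      (Nat.ble (Nat.mul d d) c)) (Nat.ble d eps)) (Nat.ble 1 d)) Cs) n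

/-- The quadratic form of a matrix on a list of indices. -/
def quadForm {ι : Type*} (A : ι → ι → ℝ) (l : List ι) (x : ι → ℝ) : ℝ :=
  (l.map fun i => (l.map fun j => x i * x j * A i j).sum).sum

theorem sum_map_sub_real {ι : Type*} (f g : ι → ℝ) (l : List ι) :
    (l.map fun i => f i - g i).sum = (l.map f).sum - (l.map g).sum := by
  induction l with
  | nil => simp
  | cons i l ih => simp only [List.map_cons, List.sum_cons, ih]; ring

theorem quadForm_cons {ι : Type*} {A : ι → ι → ℝ} (hA : ∀ i j, A i j = A j i) (i : ι)
    (l : List ι) (x : ι → ℝ) :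
    quadForm A (i :: l) x =
      x i ^ 2 * A i i + 2 * x i * (l.map fun j => x j * A j i).sum + quadForm A l x := by
  have h1 : ∀ j, ((i :: l).map fun k => x j * x k * A j k).sum =
      x i * (x j * A j i) + (l.map fun k => x j * x k * A j k).sum := fun j => by
    rw [List.map_cons, List.sum_cons]; ring
  have h2 : (l.map fun k => x i * x k * A i k).sum = x i * (l.map fun j => x j * A j i).sum := by
    rw [← List.sum_map_mul_left]
    congr 1
    refine List.map_congr_left fun j _ => ?_
    rw [hA i j]; ring
  rw [quadForm, List.map_congr_left fun j _ => h1 j, List.sum_map_add, List.map_cons,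
    List.sum_cons, List.sum_map_mul_left, List.map_cons, List.sum_cons, h2]
  simp only [quadForm]
  ring

theorem quadForm_sub_mul {ι : Type*} (A : ι → ι → ℝ) (u : ι → ℝ) (l : List ι) (x : ι → ℝ) :
    quadForm (fun i j => A i j - u i * u j) l x =
      quadForm A l x - (l.map fun i => x i * u i).sum ^ 2 := by
  have : ∀ i, (l.map fun j => x i * x j * (A i j - u i * u j)).sum =
      (l.map fun j => x i * x j * A i j).sum - (x i * u i) * (l.map fun j => x j * u j).sum :=
    fun i => by
      rw [← List.sum_map_mul_left, ← sum_map_sub_real]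
      congr 1
      exact List.map_congr_left fun j _ => by ring
  rw [quadForm, List.map_congr_left fun i _ => this i, sum_map_sub_real, List.sum_map_mul_right]
  simp only [quadForm]
  ring

theorem cholesky_succ (root : ℕ → ℕ) (eps bnd n offs q C : ℕ) (Cs : List ℕ) :
    cholesky root eps bnd (n + 1) offs q (C :: Cs) =
      (fun X => (fun q => (fun c => (fun d =>
        Bool.rec false (Bool.rec false (Bool.rec false (
          (fun Z => (fun offs => packChecked (Nat.sub half bnd) (Nat.add half bnd)
            (digits Z d n X List.nil) 0 fun P =>
              (fun Y => cholesky root eps bnd n offs q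
                (reverseOnto (update (Nat.sub q Y) Y q Cs (digits Z d n X List.nil) List.nil)
                  List.nil))
              (Nat.mod (Nat.sub (Nat.add q P) offs) q))
            (Nat.mod offs q)) (Nat.mul half (Nat.pred d)))
          (Nat.ble (Nat.mul d d) c)) (Nat.ble d eps)) (Nat.ble 1 d))
        (root c))
        (Nat.sub (Nat.div X q) half)) (Nat.div q radix)) (Nat.mod (Nat.add C offs) q) := by
  simp only [cholesky, force_eq]

theorem natMod_eq (a b : ℕ) : Nat.mod a b = a % b := rfl

theorem natDiv_eq (a b : ℕ) : Nat.div a b = a / b := rfl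

/-- From e (a + x)² ≥ 0 follows 2 a x e ≥ -e (a² + x²) ≥ -eps (a² + x²), which is summed over the
list. -/
theorem sum_error_bound {ι : Type*} {e : ι → ℝ} (a eps : ℝ) (he : ∀ i, 0 ≤ e i ∧ e i ≤ eps)
    (x : ι → ℝ) (l : List ι) :
    -(l.length * eps * a ^ 2) - eps * (l.map fun i => x i ^ 2).sum ≤
      2 * a * (l.map fun i => x i * e i).sum := by
  induction l with
  | nil => simp
  | cons i l ih =>
    simp only [List.map_cons, List.sum_cons, List.length_cons] at ih ⊢
    push_cast
    obtain ⟨h8, h9⟩ := he i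
    nlinarith [mul_nonneg h8 (sq_nonneg (a + x i)),
      mul_le_mul_of_nonneg_right h9 (add_nonneg (sq_nonneg a) (sq_nonneg (x i)))]

/-- Elimination of the first index with d² at most the pivot and ℓ_i = ⌊A_ij / d⌋ leaves the matrix
A - ℓ ℓᵀ on the remaining indices. Completing the square gives (d x_j + Σ ℓ_i x_i)² up to the
rounding remainders, which lie in [0, d) and cost at most `eps` per remaining index on each side.
These losses add up to the length times `eps`. The function `root` is arbitrary because every value
is tested. The second summand in `hbnd` pays for the change of an entry by at most `bnd ^ 2` in each
step, so digits never overflow. -/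
theorem cholesky_sound {ι : Type*} (root : ℕ → ℕ) (eps bnd : ℕ) (l : List ι) (A : ι → ι → ℤ)
    (hA : ∀ i j, A i j = A j i) (hbnd : ∀ i ∈ l, ∀ j ∈ l, |A i j| + l.length * (bnd : ℤ) ^ 2 < half)
    (C : ι → ℕ) (hC : ∀ i ∈ l, IsResidue l.length (pack (fun r => A r i) l) (C i))
    (h : cholesky root eps bnd l.length (offsets l.length) (radix ^ l.length) (l.map C) = true)
    (x : ι → ℝ) :
    -(l.length * eps) * (l.map fun i => x i ^ 2).sum ≤ quadForm (fun i j => (A i j : ℝ)) l x := by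
  induction l generalizing A C with
  | nil => simp [quadForm]
  | cons j l ih =>
    rw [List.length_cons, List.map_cons, cholesky_succ] at h
    simp only [natMod_eq, natDiv_eq, Nat.add_eq, Nat.mul_eq, Nat.sub_eq, Nat.pred_eq_sub_one,
      pow_succ, Nat.mul_div_cancel _ radix_pos, offsets_mod] at h
    set X := (C j + offsets (l.length + 1)) % (radix ^ l.length * radix) with hXdef
    have hlt : ∀ i ∈ j :: l, |A i j| < half := fun i hi =>
      lt_of_le_of_lt (le_add_of_nonneg_right (by positivity)) (hbnd i hi j (by simp))
    have hX := add_offsets_mod (a := fun r => A r j) (l := j :: l) hlt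
      (hC j (by simp))
    rw [List.length_cons, pow_succ] at hX
    change (X : ℤ) = _ at hX
    set D : ι → ℕ := fun i => (A i j + half).toNat with hD
    have hDz : ∀ i ∈ j :: l, (D i : ℤ) = A i j + half := fun i hi =>
      Int.toNat_of_nonneg (by have := abs_lt.1 (hlt i hi); linarith)
    have hDr : ∀ i ∈ l, D i < radix := fun i hi => by
      have := abs_lt.1 (hlt i (by simp [hi]))
      zify; rw [hDz i (by simp [hi]), radix_eq]; push_cast; linarith
    rw [pack_cons] at hX
    have hpl := pack_nonneg_lt (f := fun i => (D i : ℤ)) (l := l) fun i hi =>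
      ⟨by positivity, by exact_mod_cast hDr i hi⟩
    have htop : X / radix ^ l.length = D j := by
      zify
      rw [hX, add_comm, Int.add_mul_ediv_right _ _ (pow_pos (by exact_mod_cast radix_pos) _).ne',
        Int.ediv_eq_zero_of_lt hpl.1 hpl.2, zero_add]
    rw [htop] at h
    set d := root (D j - half)
    cases h1 : Nat.ble 1 d with
    | false => rw [h1] at h; cases h
    | true =>
    cases h2 : Nat.ble d eps with
    | false => rw [h1, h2] at h; cases h
    | true =>
    cases h3 : Nat.ble (d * d) (D j - half) with
    | false => rw [h1, h2, h3] at h; cases h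
    | true =>
    rw [h1, h2, h3] at h
    replace h1 := Nat.le_of_ble_eq_true h1
    replace h2 := Nat.le_of_ble_eq_true h2
    replace h3 := Nat.le_of_ble_eq_true h3
    simp only at h
    have hdig := digits_spec D (half * (d - 1)) d l hDr (D j) X hX []
    rw [hdig, List.append_nil] at h
    -- The summand half · (d - 1) turns the shifted entry A + half into A + half · d. The
    -- natural-number quotient is therefore ⌊A / d⌋ + half, with the correct rounding for negative
    -- entries.
    set L : ι → ℕ := fun i => (D i + half * (d - 1)) / d with hL
    set ℓ : ι → ℤ := fun i => A i j / d with hℓ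
    have hd : (0 : ℤ) < d := by exact_mod_cast h1
    have hLz : ∀ i ∈ l, (L i : ℤ) = ℓ i + half := fun i hi => by
      have : ((half * (d - 1) : ℕ) : ℤ) = half * ((d : ℤ) - 1) := by
        rw [Nat.cast_mul, Nat.cast_sub h1, Nat.cast_one]
      simp only [hL, hℓ]
      rw [Int.natCast_div, Nat.cast_add, this, hDz i (by simp [hi]),
        show A i j + half + (half : ℤ) * (d - 1) = A i j + half * d by ring,
        Int.add_mul_ediv_right _ _ hd.ne']
    obtain ⟨hrange, P, hP, hk⟩ := packChecked_spec L _ _ l 0 _ h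
    have hℓb : ∀ i ∈ l, |ℓ i| ≤ bnd := fun i hi => by
      obtain ⟨ha, hb⟩ := hrange i hi
      zify at ha hb
      have hz := hLz i hi
      rw [abs_le]
      omega
    have hPz : (P : ℤ) = pack ℓ l + offsets l.length := by
      rw [hP, offsets_eq, ← pack_add]
      simp only [Nat.cast_zero, zero_mul, zero_add]
      exact pack_congr fun i hi => hLz i hi
    set q := radix ^ l.length with hqdef
    -- The extra `q` keeps the truncated subtraction of natural numbers exact.
    set Y := (q + P - offsets l.length) % q with hYdef
    have hY : IsResidue l.length (pack ℓ l) Y := by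
      unfold IsResidue
      change (((q + P - offsets l.length) % q : ℕ) : ℤ) ≡ _ [ZMOD _]
      have := offsets_lt l.length
      rw [Int.natCast_mod, Nat.cast_sub (by omega), Nat.cast_add, hPz, hqdef, Nat.cast_pow]
      refine (Int.mod_modEq _ _).trans ?_
      rw [show (radix : ℤ) ^ l.length + (pack ℓ l + offsets l.length) - offsets l.length =
        pack ℓ l + (radix : ℤ) ^ l.length by ring]
      exact Int.add_modEq_right
    have hYq : Y < q := Nat.mod_lt _ (pow_pos radix_pos _)
    have hX' : IsResidue l.length (-pack ℓ l) (q - Y) := by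
      unfold IsResidue at hY ⊢
      rw [Nat.cast_sub hYq.le, hqdef, Nat.cast_pow, sub_eq_add_neg]
      refine (Int.ModEq.add_left _ hY.neg).trans ?_
      exact Int.add_modEq_left
    rw [update_map, reverseOnto_eq, List.append_nil, List.append_nil, List.reverse_reverse] at hk
    set A' : ι → ι → ℤ := fun i k => A i k - ℓ i * ℓ k with hA'
    have hC' : ∀ i ∈ l, IsResidue l.length (pack (fun r => A' r i) l)
        (updated (q - Y) Y q (C i) (L i)) := fun i hi => by
      have h0 := updated_residue (z := pack (fun r => A r i) l) (C := C i) (L := L i) (ℓ := ℓ i)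
        (n := l.length) ?_ hX' (by rwa [neg_neg]) (hLz i hi)
      · rwa [mul_neg, ← sub_eq_add_neg, ← pack_mul_left, ← pack_sub,
          pack_congr (g := fun r => A' r i) fun r _ => by simp only [hA']; ring] at h0
      · have h1 := hC i (by simp [hi])
        unfold IsResidue at h1 ⊢
        -- Modulo the smaller power of the radix the leading digit, the entry in the pivot row,
        -- disappears. Hence the old residues remain valid for the shortened columns.
        rw [List.length_cons, pow_succ, pack_cons] at h1
        refine (h1.of_mul_right _).trans ?_
        exact Int.modEq_iff_dvd.2 ⟨-A j i, by ring⟩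
    have hfin := ih A' (fun i k => by simp only [hA']; rw [hA i k]; ring) ?_ _ hC' hk
    swap
    · intro i hi k hk
      have h4 := hbnd i (by simp [hi]) k (by simp [hk])
      have h5 : |ℓ i * ℓ k| ≤ (bnd : ℤ) ^ 2 := by
        rw [abs_mul, sq]
        exact mul_le_mul (hℓb i hi) (hℓb k hk) (abs_nonneg _) (Nat.cast_nonneg bnd)
      have h6 := abs_sub (A i k) (ℓ i * ℓ k)
      rw [List.length_cons] at h4
      push_cast at h4
      simp only [hA']
      linarith
    have hcast : (fun i k => ((A' i k : ℤ) : ℝ)) =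
        fun i k => (A i k : ℝ) - (ℓ i : ℝ) * (ℓ k : ℝ) := by
      funext i k; simp only [hA']; push_cast; ring
    rw [hcast, quadForm_sub_mul] at hfin
    rw [quadForm_cons fun i k => by exact_mod_cast hA i k]
    have hdiag : (d : ℝ) ^ 2 ≤ A j j := by
      have h4 := hDz j (by simp)
      have : (d : ℤ) * d ≤ A j j := by
        zify at h3
        have : half ≤ D j := by
          by_contra hcon
          rw [Nat.sub_eq_zero_of_le (Nat.le_of_lt (not_le.1 hcon)), Nat.cast_zero] at h3
          nlinarith
        rw [Nat.cast_sub this, h4] at h3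
        linarith
      rw [sq]; exact_mod_cast this
    set e : ι → ℝ := fun i => (A i j : ℝ) - d * ℓ i with he
    -- The error is the remainder of a division by `d`, and the program has checked `d ≤ eps`.
    have he0 : ∀ i, 0 ≤ e i ∧ e i ≤ eps := fun i => by
      have h4 : A i j - d * ℓ i = A i j % d := by
        simp only [hℓ]; rw [Int.emod_def]
      have h5 := Int.emod_nonneg (A i j) hd.ne'
      have h6 := Int.emod_lt_of_pos (A i j) hd
      have h7 : e i = ((A i j % d : ℤ) : ℝ) := by rw [← h4]; push_cast; rfl
      rw [h7]
      have : (A i j % d : ℤ) ≤ eps := by linarith [(by exact_mod_cast h2 : (d : ℤ) ≤ eps)]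
      exact ⟨by exact_mod_cast h5, by exact_mod_cast this⟩
    have hsplit : (l.map fun i => x i * (A i j : ℝ)).sum =
        d * (l.map fun i => x i * (ℓ i : ℝ)).sum + (l.map fun i => x i * e i).sum := by
      rw [← List.sum_map_mul_left, ← List.sum_map_add]
      congr 1
      exact List.map_congr_left fun i _ => by simp only [he]; ring
    have herr := sum_error_bound (x j) eps he0 x l
    rw [hsplit]
    simp only [List.map_cons, List.sum_cons, List.length_cons]
    push_cast
    have h10 : 0 ≤ (l.map fun i => x i ^ 2).sum :=
      List.sum_nonneg fun a ha => by
        obtain ⟨i, _, rfl⟩ := List.mem_map.1 ha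
        positivity
    nlinarith [sq_nonneg (d * x j + (l.map fun i => x i * (ℓ i : ℝ)).sum),
      mul_le_mul_of_nonneg_right hdiag (sq_nonneg (x j)),
      mul_nonneg (Nat.cast_nonneg (α := ℝ) eps) (sq_nonneg (x j))]

end

end SquareOctagon

namespace SquareOctagon

noncomputable section

/-! ## The overlap matrices of the reduced operators -/

/-- The Gram matrix of the plaquette tensors, times 81: the entry in row `x` and column `y` is the
byte number `16 * x + y`, minus 22. -/
def gramTable : ℕ := 0x5016161616161616161616161616161616680416221616160416161616161616160468160416161622161616161616161616166016002216162200161a161616162204166816161604161616161616161616160016a0001616001e16001616161616162216006016161a00162216161616161616161616681616160416220416160422160416161668161616161616161616162216001a16166000162216161616161600161e00161600a01600161616161616161616160416161668160422161616161a160022161622001660161616161616161616162216161604166804161616161616161604161616221604681616161616161616161616161616161650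

/-- The Gram matrix of the plaquette tensors, times 81. Bit `a` of an index belongs to corner
`a`. -/
def gram (x y : ℕ) : ℤ :=
  Int.subNatNat (Nat.mod (Nat.shiftRight gramTable
    (Nat.mul 8 (Nat.add (Nat.mul 16 (Nat.mod x 16)) (Nat.mod y 16)))) 256) 22

/-- The reflection of the corners of a plaquette which exchanges the corners `0` and `1` (for
perpendicular links, `b = true`) or `0` and `2` (for collinear links, `b = false`). -/
def reflect (b : Bool) (C : ℕ) : ℕ :=
  Bool.rec
    (Nat.add (Nat.add (Nat.mod (Nat.div C 4) 2) (Nat.mul 2 (Nat.mod (Nat.div C 2) 2)))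
      (Nat.add (Nat.mul 4 (Nat.mod C 2)) (Nat.mul 8 (Nat.mod (Nat.div C 8) 2))))
    (Nat.add (Nat.add (Nat.mod (Nat.div C 2) 2) (Nat.mul 2 (Nat.mod C 2)))
      (Nat.add (Nat.mul 4 (Nat.mod (Nat.div C 8) 2)) (Nat.mul 8 (Nat.mod (Nat.div C 4) 2)))) b

/-- Two plaquettes, in the states `R` and `C` of the one space and with a singlet on the link
joining their corners `0` in the other one. -/
def half2 (R C x : ℕ) : ℤ :=
  Int.sub
    (Int.mul (gram (Nat.mul 2 (Nat.mod x 8)) R) (gram (Nat.succ (Nat.mul 2 (Nat.div x 8))) C))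
    (Int.mul (gram (Nat.succ (Nat.mul 2 (Nat.mod x 8))) R) (gram (Nat.mul 2 (Nat.div x 8)) C))

/-- Overlaps of two pairs of plaquettes, each with a singlet on its link. -/
def full2 (y x : ℕ) : ℤ :=
  Int.sub (half2 (Nat.mul 2 (Nat.mod y 8)) (Nat.succ (Nat.mul 2 (Nat.div y 8))) x)
    (half2 (Nat.succ (Nat.mul 2 (Nat.mod y 8))) (Nat.mul 2 (Nat.div y 8)) x)

/-- The Gram matrix of the vectors with a singlet on the first link. -/
def normMat (i j : ℕ) : ℤ := full2 (j % 64) (i % 64) * gram (i / 64) (j / 64)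

/-- The overlaps of the vectors with a singlet on the first link with those with a singlet on the
second link. -/
def crossMat (b : Bool) (i j : ℕ) : ℤ :=
  half2 (j / 64) (reflect b (2 * (j % 64 / 8) + 1)) (i % 64) * gram (i / 64) (2 * (j % 64 % 8)) -
  half2 (j / 64) (reflect b (2 * (j % 64 / 8))) (i % 64) * gram (i / 64) (2 * (j % 64 % 8) + 1)

/-- Indices of the two terms of a vector with singlets on both links. -/
def common (b : Bool) (o u : ℕ) : ℕ :=
  o % 8 + 8 * (Bool.rec (o / 8 % 4 % 2 + 2 * (1 - u) + 4 * (o / 8 % 4 / 2))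
    ((1 - u) + 2 * (o / 8 % 4)) b) + 64 * (2 * (o / 32) + u)

/-- The overlaps with a vector with singlets on both links. -/
def commonVec (b : Bool) (o i : ℕ) : ℤ := normMat i (common b o 0) - normMat i (common b o 1)

/-- The number of ones among the four binary digits. -/
def ones (x : ℕ) : ℕ := x % 2 + x / 2 % 2 + x / 4 % 2 + x / 8 % 2

/-- The numbers below `64` with a given number of binary digits equal to one. -/
def sixBits : ℕ → List ℕ
  | 0 => [0]
  | 1 => [1, 2, 4, 8, 16, 32]
  | 2 => [3, 5, 6, 9, 10, 12, 17, 18, 20, 24, 33, 34, 36, 40, 48]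
  | 3 => [7, 11, 13, 14, 19, 21, 22, 25, 26, 28, 35, 37, 38, 41, 42, 44, 49, 50, 52, 56]
  | 4 => [15, 23, 27, 29, 30, 39, 43, 45, 46, 51, 53, 54, 57, 58, 60]
  | 5 => [31, 47, 55, 59, 61, 62]
  | 6 => [63]
  | _ => []

/-- The indices of the block with `w` ones. -/
def block (w : ℕ) : List ℕ :=
  (List.range 16).flatMap fun r =>
    Bool.rec [] ((sixBits (w - ones r)).map fun x => x + 64 * r) (Nat.ble (ones r) w)

/-- The indices of the vectors with singlets on both links in the block with `w` ones. -/
def commonBlock (w : ℕ) : List ℕ :=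
  (List.range 256).filter fun o => Nat.beq (ones (o % 32) + o / 16 % 2 + ones (o / 32) + 1) w

/-- `k z`, but the kernel evaluates `z` first. -/
def forceInt {α : Type} (z : ℤ) (k : ℤ → α) : α :=
  Int.rec (fun n => force n fun n => k (Int.ofNat n)) (fun n => force n fun n => k (Int.negSucc n)) z

/-- `pack`, evaluated eagerly. -/
def packEager (f : ℕ → ℤ) (l : List ℕ) : ℤ → ℤ :=
  List.rec (fun acc => acc) (fun i _ ih acc =>
    forceInt (Int.add (Int.mul acc (Int.ofNat radix)) (f i)) ih) l

/-- The nonnegative residue of an integer. -/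
def residue (q : ℕ) (z : ℤ) : ℕ :=
  Int.rec (fun n => Nat.mod n q) (fun n => Nat.sub q (Nat.succ (Nat.mod n q))) z

/-- `acc + z * X` modulo `q`, where `X` is only evaluated if `z` is not zero. -/
def addMul (q acc : ℕ) (z : ℤ) (X : ℕ) : ℕ :=
  Int.rec (fun n => Nat.rec acc (fun m _ => Nat.mod (Nat.add acc (Nat.mul (Nat.succ m) X)) q) n)
    (fun n => force X fun X => Nat.mod (Nat.add acc (Nat.mul (Nat.succ n) (Nat.sub q X))) q) z

/-- The residue of the packed column with the entry `x (i % 64) * gram (i / 64) s` in row `i`, where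
`X v` is the packed list of the values of `x` on `sixBits v`. -/
def prodCol (w s q : ℕ) (X : ℕ → ℤ) (rs : List ℕ) : ℕ → ℕ → ℕ :=
  List.rec (fun _ acc => acc) (fun r _ ih p acc => Bool.rec (ih p acc)
    (force (Nat.sub w (ones r)) fun v => force (Nat.mul p (Nat.pow radix (sixBits v).length)) fun p' =>
      force (addMul q acc (gram r s) (force (residue q (X v)) fun x => Nat.mod (Nat.mul x p) q)) fun acc =>
      ih p' acc) (Nat.ble (ones r) w)) rs

/-- The rows of the last plaquette, in reverse order. -/
def rowsDown : List ℕ := [15, 14, 13, 12, 11, 10, 9, 8, 7, 6, 5, 4, 3, 2, 1, 0]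

/-- A packed list of the values of `half2`. -/
def halfPack (R C v : ℕ) : ℤ := packEager (half2 R C) (sixBits v) 0

/-- A packed list of the values of `full2`. -/
def fullPack (y v : ℕ) : ℤ :=
  force (Nat.mul 2 (Nat.mod y 8)) fun l => force (Nat.mul 2 (Nat.div y 8)) fun c =>
    forceInt (halfPack l (Nat.succ c) v) fun X => forceInt (halfPack (Nat.succ l) c v) fun Y =>
      Int.sub X Y

/-- The residue of a packed column of `normMat`. -/
def normCol (w q j : ℕ) : ℕ :=
  force (Nat.mod j 64) fun y => force (Nat.div j 64) fun r =>
    prodCol w r q (fullPack y) rowsDown 1 0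

/-- The residue of a packed column of `crossMat`. -/
def crossCol (b : Bool) (w q j : ℕ) : ℕ :=
  force (Nat.mod j 64) fun y => force (Nat.div j 64) fun r => force (Nat.mul 2 (Nat.mod y 8)) fun l =>
    force (reflect b (Nat.mul 2 (Nat.div y 8))) fun c =>
    force (reflect b (Nat.succ (Nat.mul 2 (Nat.div y 8)))) fun c' =>
    force (prodCol w l q (halfPack r c') rowsDown 1 0) fun X =>
    force (prodCol w (Nat.succ l) q (halfPack r c) rowsDown 1 0) fun Y => Nat.add X (Nat.sub q Y)

/-- Residues of the columns of `A * normMat - N`, in reverse order. -/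
def normCols (w : ℕ) (A N q : ℕ) (l : List ℕ) : ℕ → List ℕ → List ℕ :=
  List.rec (fun _ acc => acc) (fun j _ ih one acc => force j fun j => force (normCol w q j) fun z =>
    force (Nat.mod (Nat.add (Nat.mul A z) (Nat.mul N (Nat.sub q one))) q) fun C =>
      force (Nat.div one radix) fun one => ih one (List.cons C acc)) l

/-- Residues of the columns of `T * crossMat`, in reverse order. -/
def crossCols (b : Bool) (w : ℕ) (T q : ℕ) (l : List ℕ) : List ℕ → List ℕ :=
  List.rec (fun acc => acc) (fun j _ ih acc => force j fun j => force (crossCol b w q j) fun z =>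
    force (Nat.mod (Nat.mul T z) q) fun C => ih (List.cons C acc)) l

/-- The residues of the vectors `commonVec`. -/
def commonCols (b : Bool) (w q : ℕ) (os : List ℕ) : List ℕ → List ℕ :=
  List.rec (fun acc => acc) (fun o _ ih acc => force o fun o =>
    force (common b o 0) fun i => force (common b o 1) fun j =>
    force (normCol w q i) fun x => force (normCol w q j) fun y =>
    force (Nat.mod (Nat.add x (Nat.sub q y)) q) fun X => ih (List.cons X acc)) os

/-- A combination of the numbers in a list with distinct coefficients. -/
def combine (q : ℕ) (Xs : List ℕ) : ℕ → ℕ → ℕ :=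
  List.rec (fun _ acc => acc) (fun X _ ih k acc =>
    force (Nat.succ k) fun k => force (Nat.mod (Nat.add acc (Nat.mul k X)) q) fun acc => ih k acc) Xs

/-- Multiples by `s` of the numbers in a list, plus distinct multiples of `S`. -/
def perturb (q s S : ℕ) (Xs : List ℕ) : ℕ → List ℕ → List ℕ :=
  List.rec (fun _ acc => acc) (fun X _ ih k acc => force (Nat.succ k) fun k =>
    force (Nat.mod (Nat.add (Nat.mul k S) (Nat.mul s X)) q) fun X => ih k (List.cons X acc)) Xs

/-- Adds the square of a vector. -/
def addSquare (n offs q X : ℕ) (Cs : List ℕ) : List ℕ :=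
  reverseOnto (update X (Nat.sub q X) q Cs
    (digits 0 1 n (Nat.mod (Nat.add X offs) q) List.nil) List.nil) List.nil

/-- Adds the squares of several vectors. -/
def addSquares (n offs q : ℕ) (Xs : List ℕ) : List ℕ → List ℕ :=
  List.rec (fun Cs => Cs) (fun X _ ih Cs => ih (addSquare n offs q X Cs)) Xs

/-- The sums of the entries of two lists modulo `q`, in reverse order. -/
def addLists (q : ℕ) (l : List ℕ) : List ℕ → List ℕ → List ℕ :=
  List.rec (fun _ acc => acc) (fun a _ ih l' acc => List.rec acc (fun b l' _ =>
    force (Nat.mod (Nat.add a b) q) fun c => ih l' (List.cons c acc)) l') l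

/-- The differences of the entries of two lists modulo `q`, in reverse order. -/
def subLists (q : ℕ) (l : List ℕ) : List ℕ → List ℕ → List ℕ :=
  List.rec (fun _ acc => acc) (fun a _ ih l' acc => List.rec acc (fun b l' _ =>
    force (Nat.mod (Nat.add a (Nat.sub q b)) q) fun c => ih l' (List.cons c acc)) l') l

/-- `k l`, but the kernel evaluates the head of `l` first. -/
def forceList {α : Type} (l : List ℕ) (k : List ℕ → α) : α :=
  List.rec (k List.nil) (fun a l _ => k (List.cons a l)) l

/-- Certifies that the matrices `A * normMat ± T * crossMat + Z`, with `Z` a sum of squares of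
combinations of the vectors `commonVec`, are positive on a block. The combinations are chosen to have
few zeros, since the kernel is slow on sparse packed columns. -/
def blockCheck (b : Bool) (eps bnd A T s w : ℕ) : Bool :=
  forceList (block w) fun l => force l.length fun n => force (offsets n) fun offs =>
  force (Nat.pow radix n) fun q => force (Nat.mul n eps) fun N =>
  forceList (commonCols b w q (commonBlock w) List.nil) fun Xs =>
  force (combine q Xs 0 0) fun S =>
  forceList (addSquares n offs q (perturb q s S Xs 0 List.nil)
    (reverseOnto (normCols w A N q l (Nat.pow radix (Nat.pred n)) List.nil) List.nil)) fun X =>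
  forceList (reverseOnto (crossCols b w T q l List.nil) List.nil) fun Y =>
  Bool.rec false (cholesky sqrtNewton eps bnd n offs q (reverseOnto (subLists q X Y List.nil) List.nil))
    (cholesky sqrtNewton eps bnd n offs q (reverseOnto (addLists q X Y List.nil) List.nil))

end

end SquareOctagon

namespace SquareOctagon

noncomputable section

/-! ### Properties of the overlap matrices -/

theorem gram_mod (x y : ℕ) : gram x y = gram (x % 16) (y % 16) := by
  simp only [gram, show ∀ a b, Nat.mod a b = a % b from fun _ _ => rfl, Nat.mod_mod]

theorem forall_gram {p : ℤ → ℕ → ℕ → Prop} (h : ∀ x < 16, ∀ y < 16, p (gram x y) x y) (x y : ℕ) :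
    p (gram x y) (x % 16) (y % 16) := by
  rw [gram_mod]
  exact h _ (Nat.mod_lt _ (by norm_num)) _ (Nat.mod_lt _ (by norm_num))

theorem gram_comm (x y : ℕ) : gram x y = gram y x := by
  have h : ∀ x < 16, ∀ y < 16, gram x y = gram y x := by decide +kernel
  rw [gram_mod y x]
  exact forall_gram (p := fun z x y => z = gram y x) h x y

theorem gram_abs_le (x y : ℕ) : |gram x y| ≤ 138 := by
  have h : ∀ x < 16, ∀ y < 16, |gram x y| ≤ 138 := by decide +kernel
  exact forall_gram (p := fun z _ _ => |z| ≤ 138) h x y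

theorem ones_mod (x : ℕ) : ones (x % 16) = ones x := by
  unfold ones
  omega

/-- Conservation of magnetization, read off from the table. -/
theorem gram_eq_zero {x y : ℕ} (hxy : ones x ≠ ones y) : gram x y = 0 := by
  have h : ∀ x < 16, ∀ y < 16, ones x ≠ ones y → gram x y = 0 := by decide +kernel
  refine forall_gram (p := fun z x y => ones x ≠ ones y → z = 0) h x y ?_
  rwa [ones_mod, ones_mod]

theorem reflect_mod (b : Bool) (x : ℕ) : reflect b (x % 16) = reflect b x := by
  simp only [reflect, show ∀ a b, Nat.mod a b = a % b from fun _ _ => rfl,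
    show ∀ a b, Nat.div a b = a / b from fun _ _ => rfl]
  rw [show x % 16 % 2 = x % 2 by omega, show x % 16 / 2 % 2 = x / 2 % 2 by omega,
    show x % 16 / 4 % 2 = x / 4 % 2 by omega, show x % 16 / 8 % 2 = x / 8 % 2 by omega]

/-- Reflecting a plaquette is a unitary involution permuting its states, so it can be moved to the
other argument. This makes `crossMat` symmetric. -/
theorem gram_reflect (b : Bool) (x y : ℕ) : gram (reflect b x) y = gram x (reflect b y) := by
  have h : ∀ b, ∀ x < 16, ∀ y < 16, gram (reflect b x) y = gram x (reflect b y) := by decide +kernel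
  rw [gram_mod, ← reflect_mod b x, gram_mod x, ← reflect_mod b y]
  have := h b (x % 16) (Nat.mod_lt _ (by norm_num)) (y % 16) (Nat.mod_lt _ (by norm_num))
  rw [gram_mod (reflect b _), gram_mod (x % 16)] at this
  simpa using this

theorem ones_reflect (b : Bool) (x : ℕ) : ones (reflect b x) = ones x := by
  have h : ∀ b, ∀ x < 16, ones (reflect b x) = ones x := by decide +kernel
  rw [← reflect_mod b x, h b _ (Nat.mod_lt _ (by norm_num)), ones_mod]

theorem half2_eq (R C x : ℕ) : half2 R C x =
    gram (2 * (x % 8)) R * gram (2 * (x / 8) + 1) C -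
      gram (2 * (x % 8) + 1) R * gram (2 * (x / 8)) C := rfl

theorem full2_eq (y x : ℕ) : full2 y x =
    half2 (2 * (y % 8)) (2 * (y / 8) + 1) x - half2 (2 * (y % 8) + 1) (2 * (y / 8)) x := rfl

theorem normMat_comm (i j : ℕ) : normMat i j = normMat j i := by
  simp only [normMat, full2_eq, half2_eq, gram_comm (j / 64)]
  simp only [gram_comm (2 * (j % 64 % 8)), gram_comm (2 * (j % 64 % 8) + 1),
    gram_comm (2 * (j % 64 / 8)), gram_comm (2 * (j % 64 / 8) + 1)]
  ring

theorem crossMat_eq (b : Bool) (i j : ℕ) : crossMat b i j =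
    half2 (j / 64) (reflect b (2 * (j % 64 / 8) + 1)) (i % 64) * gram (i / 64) (2 * (j % 64 % 8)) -
    half2 (j / 64) (reflect b (2 * (j % 64 / 8))) (i % 64) * gram (i / 64) (2 * (j % 64 % 8) + 1) :=
  rfl

theorem crossMat_comm (b : Bool) (i j : ℕ) : crossMat b i j = crossMat b j i := by
  simp only [crossMat_eq, half2_eq, ← gram_reflect, gram_comm (j / 64)]
  simp only [gram_reflect, gram_comm (2 * (j % 64 / 8)), gram_comm (2 * (j % 64 / 8) + 1),
    gram_comm (i / 64)]
  ring

/-- The crude entry bounds that begin here serve only to show that all digits stay far below `half`.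
The value 138 is the greatest modulus accepted for an entry of the Gram table in `gram_abs_le`. -/
theorem half2_abs_le (R C x : ℕ) : |half2 R C x| ≤ 2 * 138 ^ 2 := by
  have h := fun x y => abs_le.1 (gram_abs_le x y)
  have key : ∀ a b c d : ℕ, |gram a b * gram c d| ≤ 138 ^ 2 := fun a b c d => by
    rw [abs_mul, sq]
    exact mul_le_mul (gram_abs_le _ _) (gram_abs_le _ _) (abs_nonneg _) (by norm_num)
  rw [half2_eq]
  refine (abs_sub _ _).trans ?_
  linarith [key (2 * (x % 8)) R (2 * (x / 8) + 1) C, key (2 * (x % 8) + 1) R (2 * (x / 8)) C]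

theorem normMat_abs_le (i j : ℕ) : |normMat i j| ≤ 2 ^ 24 := by
  have h1 : |full2 (j % 64) (i % 64)| ≤ 4 * 138 ^ 2 := by
    rw [full2_eq]
    refine (abs_sub _ _).trans ?_
    linarith [half2_abs_le (2 * (j % 64 % 8)) (2 * (j % 64 / 8) + 1) (i % 64),
      half2_abs_le (2 * (j % 64 % 8) + 1) (2 * (j % 64 / 8)) (i % 64)]
  rw [normMat, abs_mul]
  exact (mul_le_mul h1 (gram_abs_le _ _) (abs_nonneg _) (by norm_num)).trans (by norm_num)

theorem crossMat_abs_le (b : Bool) (i j : ℕ) : |crossMat b i j| ≤ 2 ^ 24 := by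
  have key : ∀ R C a c, |half2 R C (i % 64) * gram a c| ≤ 2 * 138 ^ 3 := fun R C a c => by
    rw [abs_mul, pow_succ, ← mul_assoc]
    exact mul_le_mul (half2_abs_le _ _ _) (gram_abs_le _ _) (abs_nonneg _) (by norm_num)
  rw [crossMat_eq]
  refine (abs_sub _ _).trans ((add_le_add (key _ _ _ _) (key _ _ _ _)).trans (by norm_num))

theorem commonVec_abs_le (b : Bool) (o i : ℕ) : |commonVec b o i| ≤ 2 ^ 25 := by
  rw [commonVec]
  refine (abs_sub _ _).trans ((add_le_add (normMat_abs_le _ _) (normMat_abs_le _ _)).trans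
    (by norm_num))

/-- The weight of an index. -/
def weight (i : ℕ) : ℕ := ones (2 * (i % 64 % 8)) + ones (2 * (i % 64 / 8)) + ones (i / 64)

theorem ones_two_mul_add_one (x : ℕ) : ones (2 * x + 1) = ones (2 * x) + 1 := by
  unfold ones; omega

/-- The additional 1 is the leg occupied in either term of the singlet. Each of the two terms
violates conservation of magnetization in one of its Gram factors. -/
theorem half2_eq_zero {R C x : ℕ} (hx : x < 64)
    (h : ones (2 * (x % 8)) + ones (2 * (x / 8)) + 1 ≠ ones R + ones C) : half2 R C x = 0 := by
  have h1 := ones_two_mul_add_one (x % 8)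
  have h2 := ones_two_mul_add_one (x / 8)
  rw [half2_eq]
  have k1 : gram (2 * (x % 8)) R * gram (2 * (x / 8) + 1) C = 0 := by
    by_contra hne
    have hR := not_imp_comm.1 gram_eq_zero (left_ne_zero_of_mul hne)
    have hC := not_imp_comm.1 gram_eq_zero (right_ne_zero_of_mul hne)
    omega
  have k2 : gram (2 * (x % 8) + 1) R * gram (2 * (x / 8)) C = 0 := by
    by_contra hne
    have hR := not_imp_comm.1 gram_eq_zero (left_ne_zero_of_mul hne)
    have hC := not_imp_comm.1 gram_eq_zero (right_ne_zero_of_mul hne)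
    omega
  rw [k1, k2, sub_zero]

/-- With the analogous statement for `crossMat` this makes the forms block diagonal, so positivity
can be certified for each magnetization separately. -/
theorem normMat_eq_zero {i j : ℕ} (h : weight i ≠ weight j) : normMat i j = 0 := by
  have h1 := ones_two_mul_add_one (j % 64 % 8)
  have h2 := ones_two_mul_add_one (j % 64 / 8)
  by_contra hne
  have hR := not_imp_comm.1 gram_eq_zero (right_ne_zero_of_mul (normMat.eq_1 i j ▸ hne))
  have hF := left_ne_zero_of_mul (normMat.eq_1 i j ▸ hne)
  refine hF ?_
  unfold weight at h
  rw [full2_eq, half2_eq_zero (Nat.mod_lt _ (by norm_num)) (by omega),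
    half2_eq_zero (Nat.mod_lt _ (by norm_num)) (by omega), sub_zero]

theorem crossMat_eq_zero (b : Bool) {i j : ℕ} (h : weight i ≠ weight j) : crossMat b i j = 0 := by
  have h1 := ones_two_mul_add_one (j % 64 % 8)
  have h2 := ones_two_mul_add_one (j % 64 / 8)
  unfold weight at h
  have k : ∀ C c, ones C + ones c = ones (2 * (j % 64 / 8)) + ones (2 * (j % 64 % 8)) + 1 →
      half2 (j / 64) C (i % 64) * gram (i / 64) c = 0 := fun C c hc => by
    by_contra hne
    have hR := not_imp_comm.1 gram_eq_zero (right_ne_zero_of_mul hne)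
    refine left_ne_zero_of_mul hne (half2_eq_zero (Nat.mod_lt _ (by norm_num)) (by omega))
  rw [crossMat_eq, k _ _ (by rw [ones_reflect]; omega), k _ _ (by rw [ones_reflect]; omega), sub_zero]

/-! ### The columns -/

theorem residue_spec (n : ℕ) (z : ℤ) : IsResidue n z (residue (radix ^ n) z) := by
  unfold IsResidue
  cases z with
  | ofNat m =>
    change ((m % radix ^ n : ℕ) : ℤ) ≡ (m : ℤ) [ZMOD _]
    push_cast
    exact Int.mod_modEq _ _
  | negSucc m =>
    change ((radix ^ n - (m % radix ^ n + 1) : ℕ) : ℤ) ≡ _ [ZMOD _]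
    have h : m % radix ^ n + 1 ≤ radix ^ n := Nat.mod_lt _ (pow_pos radix_pos n)
    have e : ((m % radix ^ n : ℕ) : ℤ) ≡ (m : ℤ) [ZMOD (radix : ℤ) ^ n] := by
      push_cast; exact Int.mod_modEq _ _
    rw [Nat.cast_sub h, Int.negSucc_eq]
    have h0 : ((radix ^ n : ℕ) : ℤ) ≡ 0 [ZMOD (radix : ℤ) ^ n] := by
      push_cast; exact Int.modEq_zero_iff_dvd.2 dvd_rfl
    simpa using h0.sub (e.add_right 1)

theorem IsResidue.add {n : ℕ} {a b : ℤ} {A B : ℕ} (hA : IsResidue n a A) (hB : IsResidue n b B) :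
    IsResidue n (a + b) (A + B) := by
  unfold IsResidue at *
  rw [Nat.cast_add]
  exact Int.ModEq.add hA hB

theorem IsResidue.mul {n : ℕ} {a b : ℤ} {A B : ℕ} (hA : IsResidue n a A) (hB : IsResidue n b B) :
    IsResidue n (a * b) (A * B) := by
  unfold IsResidue at *
  rw [Nat.cast_mul]
  exact Int.ModEq.mul hA hB

theorem IsResidue.natCast (n k : ℕ) : IsResidue n k k := Int.ModEq.refl _

theorem IsResidue.mod {n : ℕ} {a : ℤ} {A : ℕ} (hA : IsResidue n a A) :
    IsResidue n a (A % radix ^ n) := by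
  unfold IsResidue at *
  rw [Int.natCast_mod, Nat.cast_pow]
  exact (Int.mod_modEq _ _).trans hA

theorem IsResidue.neg {n : ℕ} {a : ℤ} {A : ℕ} (hA : IsResidue n a A) (h : A ≤ radix ^ n) :
    IsResidue n (-a) (radix ^ n - A) := by
  unfold IsResidue at *
  rw [Nat.cast_sub h]
  have h0 : ((radix ^ n : ℕ) : ℤ) ≡ 0 [ZMOD (radix : ℤ) ^ n] := by
    push_cast; exact Int.modEq_zero_iff_dvd.2 dvd_rfl
  simpa using h0.sub hA

theorem mod_radix_lt (n A : ℕ) : A % radix ^ n < radix ^ n := Nat.mod_lt _ (pow_pos radix_pos n)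

theorem addMul_spec {n : ℕ} {a x : ℤ} {acc X : ℕ} (z : ℤ) (ha : IsResidue n a acc)
    (hX : IsResidue n x X) (hle : X ≤ radix ^ n) :
    IsResidue n (a + z * x) (addMul (radix ^ n) acc z X) := by
  cases z with
  | ofNat m =>
    cases m with
    | zero =>
      change IsResidue n (a + ((0 : ℕ) : ℤ) * x) acc
      simpa using ha
    | succ m => exact (ha.add ((IsResidue.natCast n (m + 1)).mul hX)).mod
  | negSucc m =>
    have : addMul (radix ^ n) acc (Int.negSucc m) X =
        (acc + (m + 1) * (radix ^ n - X)) % radix ^ n := by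
      simp only [addMul, force_eq]; rfl
    rw [this, Int.negSucc_eq, neg_mul_comm]
    exact (ha.add ((IsResidue.natCast n (m + 1)).mul (hX.neg hle))).mod

@[simp] theorem forceInt_eq {α : Type} (z : ℤ) (k : ℤ → α) : forceInt z k = k z := by
  cases z <;> simp [forceInt]

theorem packEager_eq (f : ℕ → ℤ) (l : List ℕ) (acc : ℤ) :
    packEager f l acc = acc * (radix : ℤ) ^ l.length + pack f l := by
  rw [← foldl_pack]
  induction l generalizing acc with
  | nil => rfl
  | cons i l ih =>
    rw [List.foldl_cons, ← ih]
    simp only [packEager, forceInt_eq]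
    rfl

theorem halfPack_eq (R C v : ℕ) : halfPack R C v = pack (half2 R C) (sixBits v) := by
  rw [halfPack, packEager_eq, zero_mul, zero_add]

theorem fullPack_eq (y v : ℕ) : fullPack y v = pack (full2 y) (sixBits v) := by
  simp only [fullPack, force_eq, forceInt_eq, halfPack_eq]
  exact (pack_sub _ _).symm

/-- The indices of the block with `w` ones and with a given last plaquette. -/
def rowBlock (w r : ℕ) : List ℕ :=
  Bool.rec [] ((sixBits (w - ones r)).map fun x => x + 64 * r) (Nat.ble (ones r) w)

theorem sixBits_lt {v x : ℕ} (hx : x ∈ sixBits v) : x < 64 := by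
  have h : ∀ v < 7, ∀ x ∈ sixBits v, x < 64 := by decide
  by_cases hv : v < 7
  · exact h v hv x hx
  · obtain ⟨k, rfl⟩ := Nat.exists_eq_add_of_le' (not_lt.1 hv)
    simp [sixBits] at hx

/-- A column is a tensor product: for a fixed state `r` of the third plaquette, the entries are
those of one packed vector multiplied by a single Gram entry. So a column is a sum of at most
sixteen shifted multiples of shared packed vectors. The rows are traversed downwards because the
least significant part, represented by `L`, is built first. -/
theorem prodCol_spec {n : ℕ} (w s : ℕ) (x : ℕ → ℤ) (rs : List ℕ) (L : List ℕ) (acc : ℕ)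
    (h : IsResidue n (pack (fun i => x (i % 64) * gram (i / 64) s) L) acc) :
    IsResidue n (pack (fun i => x (i % 64) * gram (i / 64) s) (rs.reverse.flatMap (rowBlock w) ++ L))
      (prodCol w s (radix ^ n) (fun v => pack x (sixBits v)) rs (radix ^ L.length) acc) := by
  induction rs generalizing L acc with
  | nil => exact h
  | cons r rs ih =>
    rw [List.reverse_cons, List.flatMap_append, List.append_assoc, List.flatMap_singleton]
    cases hb : Nat.ble (ones r) w with
    | false =>
      have e1 : rowBlock w r = [] := by simp [rowBlock, hb]
      have e2 : prodCol w s (radix ^ n) (fun v => pack x (sixBits v)) (r :: rs) (radix ^ L.length) acc =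
          prodCol w s (radix ^ n) (fun v => pack x (sixBits v)) rs (radix ^ L.length) acc := by
        simp only [prodCol, hb]
      rw [e1, e2]
      exact ih L acc h
    | true =>
      have e1 : rowBlock w r = (sixBits (w - ones r)).map fun x => x + 64 * r := by
        simp [rowBlock, hb]
      have e2 : prodCol w s (radix ^ n) (fun v => pack x (sixBits v)) (r :: rs) (radix ^ L.length) acc =
          prodCol w s (radix ^ n) (fun v => pack x (sixBits v)) rs
            (radix ^ (rowBlock w r ++ L).length)
            (addMul (radix ^ n) acc (gram r s)
              (residue (radix ^ n) (pack x (sixBits (w - ones r))) * radix ^ L.length % radix ^ n)) := by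
        rw [List.length_append, e1, List.length_map, add_comm, pow_add]
        simp only [prodCol, hb, force_eq]
        rfl
      rw [e2]
      refine ih _ _ ?_
      rw [pack_append, add_comm]
      have e3 : pack (fun i => x (i % 64) * gram (i / 64) s) (rowBlock w r) =
          gram r s * pack x (sixBits (w - ones r)) := by
        rw [e1, pack_map, ← pack_mul_left]
        refine pack_congr fun i hi => ?_
        have := sixBits_lt hi
        rw [show (i + 64 * r) % 64 = i by omega, show (i + 64 * r) / 64 = r by omega, mul_comm]
      rw [e3, mul_assoc]
      refine addMul_spec _ h (((residue_spec n _).mul ?_).mod) (mod_radix_lt _ _).le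
      exact_mod_cast IsResidue.natCast n (radix ^ L.length)

theorem block_eq (w : ℕ) : block w = rowsDown.reverse.flatMap (rowBlock w) ++ [] := by
  rw [List.append_nil]; rfl

theorem normCol_spec (n w j : ℕ) :
    IsResidue n (pack (fun i => normMat i j) (block w)) (normCol w (radix ^ n) j) := by
  simp only [normCol, force_eq]
  rw [show fullPack (Nat.mod j 64) = fun v => pack (full2 (j % 64)) (sixBits v) from
    funext fun v => fullPack_eq _ _, block_eq]
  exact prodCol_spec w (j / 64) (full2 (j % 64)) rowsDown [] 0 (IsResidue.natCast n 0)

theorem prodCol_lt {n w s : ℕ} {X : ℕ → ℤ} (rs : List ℕ) {p acc : ℕ} (h : acc < radix ^ n) :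
    prodCol w s (radix ^ n) X rs p acc < radix ^ n := by
  have key : ∀ acc z X, acc < radix ^ n → addMul (radix ^ n) acc z X < radix ^ n :=
    fun acc z X h => by
      cases z with
      | ofNat m => cases m with
        | zero => exact h
        | succ m => exact mod_radix_lt _ _
      | negSucc m => simp only [addMul, force_eq]; exact mod_radix_lt _ _
  induction rs generalizing p acc with
  | nil => exact h
  | cons r rs ih =>
    cases hb : Nat.ble (ones r) w with
    | false =>
      have e : prodCol w s (radix ^ n) X (r :: rs) p acc = prodCol w s (radix ^ n) X rs p acc := by
        simp only [prodCol, hb]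
      rw [e]; exact ih h
    | true =>
      have e : prodCol w s (radix ^ n) X (r :: rs) p acc =
          prodCol w s (radix ^ n) X rs (p * radix ^ (sixBits (w - ones r)).length)
            (addMul (radix ^ n) acc (gram r s)
              (residue (radix ^ n) (X (w - ones r)) * p % radix ^ n)) := by
        simp only [prodCol, hb, force_eq]; rfl
      rw [e]; exact ih (key _ _ _ h)

theorem normCol_lt (n w j : ℕ) : normCol w (radix ^ n) j < radix ^ n := by
  simp only [normCol, force_eq]
  exact prodCol_lt _ (pow_pos radix_pos n)

theorem crossCol_spec (n : ℕ) (b : Bool) (w j : ℕ) :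
    IsResidue n (pack (fun i => crossMat b i j) (block w)) (crossCol b w (radix ^ n) j) := by
  simp only [crossCol, force_eq]
  rw [show ∀ R C, halfPack R C = fun v => pack (half2 R C) (sixBits v) from
    fun R C => funext fun v => halfPack_eq _ _ _, show halfPack (Nat.div j 64) _ =
    fun v => pack (half2 _ _) (sixBits v) from funext fun v => halfPack_eq _ _ _]
  simp only [crossMat_eq]
  rw [pack_sub, sub_eq_add_neg, block_eq]
  exact (prodCol_spec w _ (half2 (j / 64) (reflect b (2 * (j % 64 / 8) + 1))) rowsDown [] 0
    (IsResidue.natCast n 0)).add ((prodCol_spec w _ (half2 (j / 64) (reflect b (2 * (j % 64 / 8))))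
      rowsDown [] 0 (IsResidue.natCast n 0)).neg (prodCol_lt _ (pow_pos radix_pos n)).le)

end

end SquareOctagon

/-! ### Soundness of the positivity certificates -/

namespace SquareOctagon

noncomputable section

/-- The list `Cs` consists of residues of the columns of the matrix `f`. -/
def Represents (L : List ℕ) (f : ℕ → ℕ → ℤ) (Cs : List ℕ) : Prop :=
  ∃ C : ℕ → ℕ, Cs = L.map C ∧ ∀ j ∈ L, C j < radix ^ L.length ∧
    IsResidue L.length (pack (fun i => f i j) L) (C j)

/-- This is the elimination step with the opposite sign: the vector itself supplies the multipliers,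
after its digits have been recovered by adding the offsets. -/
theorem addSquare_spec {L : List ℕ} {f : ℕ → ℕ → ℤ} {Cs : List ℕ} (h : Represents L f Cs)
    {u : ℕ → ℤ} {X : ℕ} (hX : IsResidue L.length (pack u L) X) (hlt : X < radix ^ L.length)
    (hu : ∀ i ∈ L, |u i| < half) :
    Represents L (fun i j => f i j + u i * u j)
      (addSquare L.length (offsets L.length) (radix ^ L.length) X Cs) := by
  obtain ⟨C, rfl, hC⟩ := h
  have hnn : ∀ i ∈ L, 0 ≤ u i + half ∧ u i + half < radix := fun i hi => by
    have := abs_lt.1 (hu i hi)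
    rw [radix_eq]; push_cast
    constructor <;> linarith
  have hd : digits 0 1 L.length ((X + offsets L.length) % radix ^ L.length) [] =
      L.map fun i => (u i + half).toNat := by
    rw [digits_spec (fun i => (u i + half).toNat) 0 1 L ?_ 0 _ ?_ []]
    · simp
    · intro i hi
      have := hnn i hi
      omega
    · rw [add_offsets_mod hu hX]; simp
  refine ⟨fun j => updated X (radix ^ L.length - X) (radix ^ L.length) (C j) (u j + half).toNat,
    ?_, fun j hj => ⟨mod_radix_lt _ _, ?_⟩⟩
  · rw [addSquare, show Nat.mod (Nat.add X (offsets L.length)) (radix ^ L.length) =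
      (X + offsets L.length) % radix ^ L.length from rfl, hd,
      show Nat.sub (radix ^ L.length) X = radix ^ L.length - X from rfl, update_map]
    simp [reverseOnto_eq]
  · have := updated_residue (hC j hj).2 hX (hX.neg hlt.le) (ℓ := u j)
      (L := (u j + half).toNat) (Int.toNat_of_nonneg (hnn j hj).1)
    refine (congrArg (fun z => IsResidue L.length z _) ?_).mp this
    rw [← pack_mul_left, ← pack_add]
    exact pack_congr fun i _ => by ring

/-- The vector `x` is orthogonal to the vectors `commonVec` of a block. -/
def CommonZero (b : Bool) (w : ℕ) (x : ℕ → ℝ) : Prop :=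
  ∀ o ∈ commonBlock w, ((block w).map fun i => x i * (commonVec b o i : ℝ)).sum = 0

/-- The number `X` is the residue of a packed bounded combination of the vectors `commonVec`. -/
def IsCommon (b : Bool) (w : ℕ) (B : ℤ) (X : ℕ) : Prop :=
  ∃ u : ℕ → ℤ, X < radix ^ (block w).length ∧ IsResidue (block w).length (pack u (block w)) X ∧
    (∀ i, |u i| ≤ B) ∧
    ∀ x : ℕ → ℝ, CommonZero b w x → ((block w).map fun i => x i * (u i : ℝ)).sum = 0

/-- Combinations keep the only property of the vectors that matters, orthogonality to every vector
satisfying `CommonZero`. The bound is carried along to exclude overflow. -/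
theorem IsCommon.linear {b : Bool} {w : ℕ} {B B' : ℤ} {X Y : ℕ} (hX : IsCommon b w B X)
    (hY : IsCommon b w B' Y) (c d : ℕ) :
    IsCommon b w (c * B + d * B') ((c * X + d * Y) % radix ^ (block w).length) := by
  obtain ⟨u, -, hu2, hu3, hu4⟩ := hX
  obtain ⟨v, -, hv2, hv3, hv4⟩ := hY
  refine ⟨fun i => c * u i + d * v i, mod_radix_lt _ _, ?_, fun i => ?_, fun x hx => ?_⟩
  · rw [pack_add, pack_mul_left, pack_mul_left]
    exact (((IsResidue.natCast _ c).mul hu2).add ((IsResidue.natCast _ d).mul hv2)).mod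
  · refine (abs_add_le _ _).trans (add_le_add ?_ ?_) <;> rw [abs_mul, Nat.abs_cast]
    exacts [mul_le_mul_of_nonneg_left (hu3 i) (by positivity),
      mul_le_mul_of_nonneg_left (hv3 i) (by positivity)]
  · have : ∀ i, x i * ((c * u i + d * v i : ℤ) : ℝ) = c * (x i * u i) + d * (x i * v i) := fun i => by
      push_cast; ring
    simp only [this]
    rw [List.sum_map_add, List.sum_map_mul_left, List.sum_map_mul_left, hu4 x hx, hv4 x hx]
    simp

theorem commonCols_spec (b : Bool) (w : ℕ) (os : List ℕ) (hos : ∀ o ∈ os, o ∈ commonBlock w)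
    (acc : List ℕ) (h : ∀ X ∈ acc, IsCommon b w (2 ^ 25) X) :
    (∀ X ∈ commonCols b w (radix ^ (block w).length) os acc, IsCommon b w (2 ^ 25) X) ∧
      (commonCols b w (radix ^ (block w).length) os acc).length = os.length + acc.length := by
  induction os generalizing acc with
  | nil => exact ⟨h, by simp [commonCols]⟩
  | cons o os ih =>
    set q := radix ^ (block w).length with hq
    have e : commonCols b w q (o :: os) acc = commonCols b w q os
        ((normCol w q (common b o 0) + (q - normCol w q (common b o 1))) % q :: acc) := by
      simp only [commonCols, force_eq]; rfl
    rw [e]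
    obtain ⟨h1, h2⟩ := ih (fun o' ho' => hos o' (by simp [ho']))
      ((normCol w q (common b o 0) + (q - normCol w q (common b o 1))) % q :: acc) (by
        intro X hX
        rcases List.mem_cons.1 hX with rfl | hX
        · refine ⟨commonVec b o, mod_radix_lt _ _, ?_, fun i => commonVec_abs_le _ _ _,
            fun x hx => hx o (hos o (by simp))⟩
          rw [show commonVec b o = fun i => normMat i (common b o 0) - normMat i (common b o 1) from
            rfl, pack_sub, sub_eq_add_neg, hq]
          exact ((normCol_spec _ _ _).add ((normCol_spec _ _ _).neg (normCol_lt _ _ _).le)).mod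
        · exact h X hX)
    exact ⟨h1, by rw [h2]; simp; omega⟩

theorem IsCommon.mono {b : Bool} {w : ℕ} {B B' : ℤ} {X : ℕ} (hX : IsCommon b w B X) (h : B ≤ B') :
    IsCommon b w B' X := by
  obtain ⟨u, h1, h2, h3, h4⟩ := hX
  exact ⟨u, h1, h2, fun i => (h3 i).trans h, h4⟩

/-- The coefficients are the successive counters, all at most `N`. After `M` summands the entries
are thus at most M · N · B. -/
theorem combine_spec {b : Bool} {w : ℕ} {B : ℤ} (hB : 0 ≤ B) (Xs : List ℕ)
    (h : ∀ X ∈ Xs, IsCommon b w B X) (k : ℕ) (N : ℕ) (hk : k + Xs.length ≤ N) (M : ℕ) (acc : ℕ)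
    (ha : IsCommon b w (M * (N * B)) acc) :
    IsCommon b w ((M + Xs.length : ℕ) * (N * B)) (combine (radix ^ (block w).length) Xs k acc) := by
  induction Xs generalizing k M acc with
  | nil => exact ha
  | cons X Xs ih =>
    have e : combine (radix ^ (block w).length) (X :: Xs) k acc =
        combine (radix ^ (block w).length) Xs (k + 1)
          ((1 * acc + (k + 1) * X) % radix ^ (block w).length) := by
      simp only [combine, force_eq, one_mul]; rfl
    rw [List.length_cons] at hk
    rw [e, List.length_cons, show M + (Xs.length + 1) = (M + 1) + Xs.length by omega]
    refine ih (fun Y hY => h Y (by simp [hY])) _ (by omega) _ _ ?_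
    refine (ha.linear (h X (by simp)) 1 (k + 1)).mono ?_
    have : ((k + 1 : ℕ) : ℤ) ≤ N := by exact_mod_cast (by omega)
    push_cast at this ⊢
    nlinarith [mul_le_mul_of_nonneg_right this hB]

theorem perturb_spec {b : Bool} {w : ℕ} {B B' : ℤ} (hB' : 0 ≤ B') (s S : ℕ)
    (hS : IsCommon b w B' S) (Xs : List ℕ) (h : ∀ X ∈ Xs, IsCommon b w B X) (k N : ℕ)
    (hk : k + Xs.length ≤ N) (acc : List ℕ) (ha : ∀ X ∈ acc, IsCommon b w (N * B' + s * B) X) :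
    (∀ X ∈ perturb (radix ^ (block w).length) s S Xs k acc, IsCommon b w (N * B' + s * B) X) ∧
      (perturb (radix ^ (block w).length) s S Xs k acc).length = Xs.length + acc.length := by
  induction Xs generalizing k acc with
  | nil => exact ⟨ha, by simp [perturb]⟩
  | cons X Xs ih =>
    have e : perturb (radix ^ (block w).length) s S (X :: Xs) k acc =
        perturb (radix ^ (block w).length) s S Xs (k + 1)
          (((k + 1) * S + s * X) % radix ^ (block w).length :: acc) := by
      simp only [perturb, force_eq]; rfl
    rw [List.length_cons] at hk
    rw [e]
    obtain ⟨h1, h2⟩ := ih (fun Y hY => h Y (by simp [hY])) (k + 1) (by omega)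
      (((k + 1) * S + s * X) % radix ^ (block w).length :: acc) (by
        intro Y hY
        rcases List.mem_cons.1 hY with rfl | hY
        · refine (hS.linear (h X (by simp)) (k + 1) s).mono ?_
          have : ((k + 1 : ℕ) : ℤ) ≤ N := by exact_mod_cast (by omega)
          nlinarith [mul_le_mul_of_nonneg_right this hB']
        · exact ha Y hY)
    exact ⟨h1, by rw [h2]; simp; omega⟩

/-- The added matrix `Z` is a sum of squares of linear forms which vanish under `CommonZero`. It
makes the matrix positive in the directions of the common states without affecting the form on the
vectors of interest. -/
theorem addSquares_spec {b : Bool} {w : ℕ} {B : ℤ} (hB : B < half) (Xs : List ℕ)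
    (h : ∀ X ∈ Xs, IsCommon b w B X) (f : ℕ → ℕ → ℤ) (Cs : List ℕ) (hC : Represents (block w) f Cs) :
    ∃ Z : ℕ → ℕ → ℤ, (∀ i j, Z i j = Z j i) ∧ (∀ i j, |Z i j| ≤ Xs.length * B ^ 2) ∧
      (∀ x : ℕ → ℝ, CommonZero b w x → quadForm (fun i j => (Z i j : ℝ)) (block w) x = 0) ∧
      Represents (block w) (fun i j => f i j + Z i j) (addSquares (block w).length
        (offsets (block w).length) (radix ^ (block w).length) Xs Cs) := by
  induction Xs generalizing f Cs with
  | nil => exact ⟨fun _ _ => 0, by simp, by simp, by simp [quadForm], by simpa [addSquares] using hC⟩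
  | cons X Xs ih =>
    obtain ⟨u, hu1, hu2, hu3, hu4⟩ := h X (by simp)
    obtain ⟨Z, hZ1, hZ2, hZ3, hZ4⟩ := ih (fun Y hY => h Y (by simp [hY])) _ _
      (addSquare_spec hC hu2 hu1 fun i _ => (hu3 i).trans_lt hB)
    refine ⟨fun i j => u i * u j + Z i j, fun i j => by simp only [hZ1 i j, mul_comm (u i)], fun i j => ?_,
      fun x hx => ?_, ?_⟩
    · refine (abs_add_le _ _).trans ?_
      have : |u i * u j| ≤ B ^ 2 := by
        rw [abs_mul, sq]
        exact mul_le_mul (hu3 i) (hu3 j) (abs_nonneg _) ((abs_nonneg _).trans (hu3 i))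
      rw [List.length_cons]
      push_cast
      linarith [hZ2 i j]
    · have h1 := quadForm_sub_mul (fun i j => -(Z i j : ℝ)) (fun i => (u i : ℝ)) (block w) x
      rw [hu4 x hx] at h1
      have h2 : ∀ g : ℕ → ℕ → ℝ, quadForm (fun i j => -g i j) (block w) x =
          -quadForm g (block w) x := fun g => by
        simp only [quadForm, mul_neg, ← neg_one_mul (List.sum _), ← neg_one_mul (_ * _),
          List.sum_map_mul_left]
      rw [h2, hZ3 x hx] at h1
      rw [← neg_eq_zero, ← h2]
      convert h1 using 2
      · ext i j; push_cast; ring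
      · norm_num
    · simp only [add_assoc] at hZ4
      exact hZ4

theorem pack_delta {L₁ L₂ : List ℕ} {j : ℕ} (h : (L₁ ++ j :: L₂).Nodup) :
    pack (fun i => if i = j then (1 : ℤ) else 0) (L₁ ++ j :: L₂) = (radix : ℤ) ^ L₂.length := by
  have h' := List.nodup_append.1 h
  have h1 : ∀ i ∈ L₁, i ≠ j := fun i hi => h'.2.2 i hi j (by simp)
  have h2 : ∀ i ∈ L₂, i ≠ j := fun i hi e => (List.nodup_cons.1 h'.2.1).1 (e ▸ hi)
  have h0 : ∀ l : List ℕ, pack (fun _ => (0 : ℤ)) l = 0 := fun l => by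
    induction l with
    | nil => rfl
    | cons i l ih => rw [pack_cons, ih]; simp
  rw [pack_append, pack_cons, pack_congr (g := fun _ => 0) fun i hi => if_neg (h1 i hi),
    pack_congr (g := fun _ => 0) (l := L₂) fun i hi => if_neg (h2 i hi), h0, h0]
  simp

theorem exists_eq_map {L : List ℕ} (hL : L.Nodup) {Cs : List ℕ} {R : ℕ → ℕ → Prop}
    (h : List.Forall₂ R L Cs) : ∃ C : ℕ → ℕ, Cs = L.map C ∧ ∀ j ∈ L, R j (C j) := by
  induction h with
  | nil => exact ⟨fun _ => 0, rfl, by simp⟩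
  | @cons a c L Cs hac _ ih =>
    obtain ⟨ha, hL⟩ := List.nodup_cons.1 hL
    obtain ⟨C, rfl, hC⟩ := ih hL
    refine ⟨Function.update C a c, ?_, fun j hj => ?_⟩
    · rw [List.map_cons, Function.update_self]
      congr 1
      exact List.map_congr_left fun j hj => (Function.update_of_ne (ne_of_mem_of_not_mem hj ha) _ _).symm
    · rcases List.mem_cons.1 hj with rfl | hj
      · rwa [Function.update_self]
      · rw [Function.update_of_ne (ne_of_mem_of_not_mem hj ha)]
        exact hC j hj

/-- The argument `one` runs through the packed unit vectors, a power of the radix that loses one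
factor per column. Subtracting `N` on the diagonal reserves room for the rounding error of the
Cholesky decomposition. -/
theorem normCols_spec {w : ℕ} (hL : (block w).Nodup) (A N : ℕ) :
    Represents (block w) (fun i j => A * normMat i j - N * if i = j then 1 else 0)
      (reverseOnto (normCols w A N (radix ^ (block w).length) (block w)
        (radix ^ ((block w).length - 1)) []) []) := by
  set n := (block w).length
  have key : ∀ (L₂ L₁ acc : List ℕ), L₁ ++ L₂ = block w →
      ∃ Cs, normCols w A N (radix ^ n) L₂ (radix ^ (L₂.length - 1)) acc = Cs.reverse ++ acc ∧
        List.Forall₂ (fun j C => C < radix ^ n ∧ IsResidue n (pack (fun i => A * normMat i j -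
          N * if i = j then 1 else 0) (block w)) C) L₂ Cs := by
    intro L₂
    induction L₂ with
    | nil => exact fun L₁ acc _ => ⟨[], rfl, List.Forall₂.nil⟩
    | cons j L₂ ih =>
      intro L₁ acc hL₁
      set C := (A * normCol w (radix ^ n) j + N * (radix ^ n - radix ^ L₂.length)) % radix ^ n
      have e : normCols w A N (radix ^ n) (j :: L₂) (radix ^ ((j :: L₂).length - 1)) acc =
          normCols w A N (radix ^ n) L₂ (radix ^ L₂.length / radix) (C :: acc) := by
        simp only [normCols, force_eq]; rfl
      have e' : normCols w A N (radix ^ n) L₂ (radix ^ L₂.length / radix) (C :: acc) =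
          normCols w A N (radix ^ n) L₂ (radix ^ (L₂.length - 1)) (C :: acc) := by
        cases L₂ with
        | nil => rfl
        | cons k L₂ =>
          rw [List.length_cons, Nat.add_sub_cancel, pow_succ, Nat.mul_div_cancel _ radix_pos]
      obtain ⟨Cs, h1, h2⟩ := ih (L₁ ++ [j]) (C :: acc) (by simpa using hL₁)
      refine ⟨C :: Cs, by rw [e, e', h1]; simp, List.Forall₂.cons ⟨mod_radix_lt _ _, ?_⟩ h2⟩
      rw [pack_sub, pack_mul_left, pack_mul_left, sub_eq_add_neg, ← mul_neg]
      refine (((IsResidue.natCast _ A).mul (normCol_spec _ _ _)).add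
        ((IsResidue.natCast _ N).mul (IsResidue.neg ?_ ?_))).mod
      · rw [← hL₁, pack_delta (hL₁ ▸ hL)]
        exact_mod_cast IsResidue.natCast n (radix ^ L₂.length)
      · refine Nat.pow_le_pow_right radix_pos ?_
        have := congrArg List.length hL₁
        simp only [List.length_append, List.length_cons] at this
        omega
  obtain ⟨Cs, h1, h2⟩ := key (block w) [] [] rfl
  obtain ⟨C, rfl, hC⟩ := exists_eq_map hL h2
  refine ⟨C, ?_, hC⟩
  rw [h1]
  simp [reverseOnto_eq]

theorem crossCols_spec {w : ℕ} (b : Bool) (T : ℕ) :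
    Represents (block w) (fun i j => T * crossMat b i j)
      (reverseOnto (crossCols b w T (radix ^ (block w).length) (block w) []) []) := by
  set n := (block w).length
  have key : ∀ (L acc : List ℕ), crossCols b w T (radix ^ n) L acc =
      (L.map fun j => T * crossCol b w (radix ^ n) j % radix ^ n).reverse ++ acc := by
    intro L
    induction L with
    | nil => exact fun acc => rfl
    | cons j L ih =>
      intro acc
      have e : crossCols b w T (radix ^ n) (j :: L) acc =
          crossCols b w T (radix ^ n) L (T * crossCol b w (radix ^ n) j % radix ^ n :: acc) := by
        simp only [crossCols, force_eq]; rfl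
      rw [e, ih]; simp
  refine ⟨_, by rw [key, List.append_nil, reverseOnto_eq, List.reverse_reverse, List.append_nil],
    fun j _ => ⟨mod_radix_lt _ _, ?_⟩⟩
  rw [pack_mul_left]
  exact ((IsResidue.natCast _ T).mul (crossCol_spec _ _ _ _)).mod

theorem addLists_spec {L : List ℕ} {f g : ℕ → ℕ → ℤ} {Xs Ys : List ℕ} (hX : Represents L f Xs)
    (hY : Represents L g Ys) :
    Represents L (fun i j => f i j + g i j)
      (reverseOnto (addLists (radix ^ L.length) Xs Ys []) []) := by
  obtain ⟨C, rfl, hC⟩ := hX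
  obtain ⟨D, rfl, hD⟩ := hY
  set n := L.length
  have key : ∀ (l acc : List ℕ), addLists (radix ^ n) (l.map C) (l.map D) acc =
      (l.map fun j => (C j + D j) % radix ^ n).reverse ++ acc := by
    intro l
    induction l with
    | nil => exact fun acc => rfl
    | cons j l ih =>
      intro acc
      have e : addLists (radix ^ n) ((j :: l).map C) ((j :: l).map D) acc =
          addLists (radix ^ n) (l.map C) (l.map D) ((C j + D j) % radix ^ n :: acc) := by
        simp only [addLists, force_eq, List.map_cons]; rfl
      rw [e, ih]; simp
  refine ⟨_, by rw [key, List.append_nil, reverseOnto_eq, List.reverse_reverse, List.append_nil],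
    fun j hj => ⟨mod_radix_lt _ _, ?_⟩⟩
  rw [pack_add]
  exact ((hC j hj).2.add (hD j hj).2).mod

theorem subLists_spec {L : List ℕ} {f g : ℕ → ℕ → ℤ} {Xs Ys : List ℕ} (hX : Represents L f Xs)
    (hY : Represents L g Ys) :
    Represents L (fun i j => f i j - g i j)
      (reverseOnto (subLists (radix ^ L.length) Xs Ys []) []) := by
  obtain ⟨C, rfl, hC⟩ := hX
  obtain ⟨D, rfl, hD⟩ := hY
  set n := L.length
  have key : ∀ (l acc : List ℕ), subLists (radix ^ n) (l.map C) (l.map D) acc =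
      (l.map fun j => (C j + (radix ^ n - D j)) % radix ^ n).reverse ++ acc := by
    intro l
    induction l with
    | nil => exact fun acc => rfl
    | cons j l ih =>
      intro acc
      have e : subLists (radix ^ n) ((j :: l).map C) ((j :: l).map D) acc =
          subLists (radix ^ n) (l.map C) (l.map D) ((C j + (radix ^ n - D j)) % radix ^ n :: acc) := by
        simp only [subLists, force_eq, List.map_cons]; rfl
      rw [e, ih]; simp
  refine ⟨_, by rw [key, List.append_nil, reverseOnto_eq, List.reverse_reverse, List.append_nil],
    fun j hj => ⟨mod_radix_lt _ _, ?_⟩⟩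
  rw [pack_sub, sub_eq_add_neg]
  exact ((hC j hj).2.add ((hD j hj).2.neg (hD j hj).1.le)).mod

theorem cholesky_sound_of_represents (eps bnd : ℕ) {L : List ℕ} {A : ℕ → ℕ → ℤ} {Cs : List ℕ}
    (hA : ∀ i j, A i j = A j i) (hbnd : ∀ i j, |A i j| + L.length * (bnd : ℤ) ^ 2 < half)
    (hC : Represents L A Cs)
    (h : cholesky sqrtNewton eps bnd L.length (offsets L.length) (radix ^ L.length) Cs = true)
    (x : ℕ → ℝ) :
    -(L.length * eps) * (L.map fun i => x i ^ 2).sum ≤ quadForm (fun i j => (A i j : ℝ)) L x := by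
  obtain ⟨C, rfl, hC⟩ := hC
  exact cholesky_sound sqrtNewton eps bnd L A hA (fun i _ j _ => hbnd i j) C
    (fun i hi => (hC i hi).2) h x

@[simp] theorem forceList_eq {α : Type} (l : List ℕ) (k : List ℕ → α) : forceList l k = k l := by
  cases l <;> rfl

theorem quadForm_linear (a b : ℝ) (F G : ℕ → ℕ → ℝ) (L : List ℕ) (x : ℕ → ℝ) :
    quadForm (fun i j => a * F i j + b * G i j) L x = a * quadForm F L x + b * quadForm G L x := by
  have : ∀ i, (L.map fun j => x i * x j * (a * F i j + b * G i j)).sum =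
      a * (L.map fun j => x i * x j * F i j).sum + b * (L.map fun j => x i * x j * G i j).sum :=
    fun i => by
      rw [← List.sum_map_mul_left, ← List.sum_map_mul_left, ← List.sum_map_add]
      congr 1
      exact List.map_congr_left fun j _ => by ring
  simp only [quadForm, this]
  rw [List.sum_map_add, List.sum_map_mul_left, List.sum_map_mul_left]

theorem quadForm_delta {L : List ℕ} (hL : L.Nodup) (x : ℕ → ℝ) :
    quadForm (fun i j => if i = j then 1 else 0) L x = (L.map fun i => x i ^ 2).sum := by
  unfold quadForm
  congr 1
  refine List.map_congr_left fun i hi => ?_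
  simp only [mul_ite, mul_one, mul_zero]
  rw [← List.sum_toFinset _ hL, Finset.sum_ite_eq, if_pos (List.mem_toFinset.2 hi), sq]

theorem eq_true_of_boolRec {c d : Bool} (h : (Bool.rec false c d : Bool) = true) :
    c = true ∧ d = true := by
  cases d <;> simp_all

/-- Soundness of `blockCheck`. -/
theorem blockCheck_sound {b : Bool} {eps bnd A T s w : ℕ} (hL : (block w).Nodup)
    (hlen : (block w).length ≤ 256) (hcom : (commonBlock w).length ≤ 256)
    (hA : A ≤ 2 ^ 120) (hT : T ≤ 2 ^ 120) (hs : s ≤ 2 ^ 42) (he : eps ≤ 2 ^ 100) (hb : bnd ≤ 2 ^ 75)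
    (h : blockCheck b eps bnd A T s w = true) {x : ℕ → ℝ} (hx : CommonZero b w x) :
    |T * quadForm (fun i j => (crossMat b i j : ℝ)) (block w) x| ≤
      A * quadForm (fun i j => (normMat i j : ℝ)) (block w) x := by
  set n := (block w).length with hn
  obtain ⟨hX, hXl⟩ := commonCols_spec b w (commonBlock w) (fun _ h => h) [] (by simp)
  set Xs := commonCols b w (radix ^ n) (commonBlock w) [] with hXs
  have hXl' : Xs.length ≤ 256 := by rw [hXl]; simpa using hcom
  have hS := combine_spec (by norm_num) Xs hX 0 256 (by simpa using hXl') 0 0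
    ⟨fun _ => 0, pow_pos radix_pos _, by
      rw [show pack (fun _ => (0 : ℤ)) (block w) = 0 * pack (fun _ => 0) (block w) by
        rw [← pack_mul_left]; simp, zero_mul]
      exact IsResidue.natCast _ 0, by simp, by simp⟩
  set S := combine (radix ^ n) Xs 0 0 with hSdef
  -- At most 2 ^ 8 vectors with entries at most 2 ^ 25 are combined with coefficients at most 2 ^ 8.
  have hS' : IsCommon b w (2 ^ 41) S := hS.mono (by
    rw [zero_add]
    have : (Xs.length : ℤ) ≤ 256 := by exact_mod_cast hXl'
    push_cast
    linarith)
  obtain ⟨hP, hPl⟩ := perturb_spec (by norm_num) s S hS' Xs hX 0 256 (by simpa using hXl') []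
    (by simp)
  set Ps := perturb (radix ^ n) s S Xs 0 [] with hPs
  -- The multiple of `S` contributes at most 2 ^ 8 · 2 ^ 41 and the multiple by `s` at most 2 ^ 42 ·
  -- 2 ^ 25. With at most 2 ^ 8 vectors the entries of `Z` are then at most 2 ^ 144.
  have hP' : ∀ X ∈ Ps, IsCommon b w (2 ^ 68) X := fun X hX => (hP X hX).mono (by
    have : (s : ℤ) ≤ 2 ^ 42 := by exact_mod_cast hs
    push_cast
    linarith)
  obtain ⟨Z, hZ1, hZ2, hZ3, hZ4⟩ := addSquares_spec (B := 2 ^ 68) (by norm_num [half]) Ps hP' _ _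
    (normCols_spec hL A (n * eps))
  have hcross := crossCols_spec (w := w) b T
  -- The two runs of the Cholesky program differ only in this sign. Together they bound the modulus
  -- of the cross form.
  have hh : ∀ s' : ℤ, (s' = 1 ∨ s' = -1) →
      0 ≤ A * quadForm (fun i j => (normMat i j : ℝ)) (block w) x +
        s' * (T * quadForm (fun i j => (crossMat b i j : ℝ)) (block w) x) := by
    intro s' hs'
    set M : ℕ → ℕ → ℤ := fun i j =>
      A * normMat i j - (n * eps : ℕ) * (if i = j then 1 else 0) + Z i j + s' * (T * crossMat b i j)
      with hM
    have hMsymm : ∀ i j, M i j = M j i := fun i j => by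
      simp only [hM, normMat_comm i j, hZ1 i j, crossMat_comm b i j, @eq_comm _ i j]
    have hMbnd : ∀ i j, |M i j| + n * (bnd : ℤ) ^ 2 < half := fun i j => by
      have h1 : |(A : ℤ) * normMat i j| ≤ 2 ^ 144 := by
        rw [abs_mul, Nat.abs_cast, show (2 : ℤ) ^ 144 = 2 ^ 120 * 2 ^ 24 by norm_num]
        exact mul_le_mul (by exact_mod_cast hA) (normMat_abs_le _ _) (abs_nonneg _) (by norm_num)
      have h2 : |s' * ((T : ℤ) * crossMat b i j)| ≤ 2 ^ 144 := by
        have : |s'| = 1 := by rcases hs' with rfl | rfl <;> simp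
        rw [abs_mul, this, one_mul, abs_mul, Nat.abs_cast,
          show (2 : ℤ) ^ 144 = 2 ^ 120 * 2 ^ 24 by norm_num]
        exact mul_le_mul (by exact_mod_cast hT) (crossMat_abs_le _ _ _) (abs_nonneg _) (by norm_num)
      have hn' : (n : ℤ) ≤ 256 := by exact_mod_cast hlen
      have h3 : |((n * eps : ℕ) : ℤ) * (if i = j then 1 else 0)| ≤ 2 ^ 108 := by
        have he' : (eps : ℤ) ≤ 2 ^ 100 := by exact_mod_cast he
        split_ifs
        · rw [mul_one, Nat.abs_cast]
          push_cast
          exact (mul_le_mul hn' he' (by positivity) (by norm_num)).trans (by norm_num)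
        · norm_num
      have h4 : |Z i j| ≤ 2 ^ 144 := (hZ2 i j).trans (by
        have : (Ps.length : ℤ) ≤ 256 := by
          rw [hPl]; simpa using (show (Xs.length : ℤ) ≤ 256 by exact_mod_cast hXl')
        linarith)
      have h5 : (n : ℤ) * (bnd : ℤ) ^ 2 ≤ 2 ^ 158 := by
        have hb' : (bnd : ℤ) ≤ 2 ^ 75 := by exact_mod_cast hb
        have := pow_le_pow_left₀ (by positivity) hb' 2
        exact (mul_le_mul hn' this (by positivity) (by norm_num)).trans (by norm_num)
      have h6 : |M i j| ≤ 2 ^ 144 + 2 ^ 108 + 2 ^ 144 + 2 ^ 144 := by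
        simp only [hM]
        refine (abs_add_le _ _).trans (add_le_add ((abs_add_le _ _).trans (add_le_add
          ((abs_sub _ _).trans (add_le_add h1 h3)) h4)) h2)
      have h7 : (half : ℤ) = 2 ^ 159 := by norm_num [half]
      rw [h7]
      linarith
    have hrun : ∃ Cs, Represents (block w) M Cs ∧
        cholesky sqrtNewton eps bnd n (offsets n) (radix ^ n) Cs = true := by
      simp only [blockCheck, forceList_eq, force_eq] at h
      obtain ⟨h1, h2⟩ := eq_true_of_boolRec h
      rcases hs' with rfl | rfl
      · refine ⟨_, ?_, h2⟩
        simp only [hM, one_mul]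
        exact addLists_spec hZ4 hcross
      · refine ⟨_, ?_, h1⟩
        simp only [hM, neg_one_mul, ← sub_eq_add_neg]
        exact subLists_spec hZ4 hcross
    obtain ⟨Cs, hCs, hrun⟩ := hrun
    have h1 := cholesky_sound_of_represents eps bnd hMsymm hMbnd hCs hrun x
    -- The form of `Z` vanishes at `x`, and the multiple of the identity subtracted from `M` cancels
    -- exactly the error term in the conclusion of the Cholesky certificate.
    have h2 : quadForm (fun i j => (M i j : ℝ)) (block w) x =
        A * quadForm (fun i j => (normMat i j : ℝ)) (block w) x +
          s' * (T * quadForm (fun i j => (crossMat b i j : ℝ)) (block w) x) -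
          n * eps * ((block w).map fun i => x i ^ 2).sum := by
      rw [← quadForm_delta hL, ← mul_assoc, ← quadForm_linear]
      have e : ∀ F G : ℕ → ℕ → ℝ, quadForm F (block w) x - n * eps * quadForm G (block w) x =
          quadForm (fun i j => 1 * F i j + (-(n * eps : ℝ)) * G i j) (block w) x := fun F G => by
        rw [quadForm_linear]; ring
      rw [e]
      have e' : ∀ F : ℕ → ℕ → ℝ, quadForm F (block w) x =
          quadForm (fun i j => 1 * F i j + 1 * (Z i j : ℝ)) (block w) x := fun F => by
        rw [quadForm_linear, hZ3 x hx]; ring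
      rw [e' (fun i j => 1 * _ + _)]
      congr 1
      ext i j
      simp only [hM]
      push_cast
      ring
    rw [h2] at h1
    linarith
  have h1 := hh 1 (Or.inl rfl)
  have h2 := hh (-1) (Or.inr rfl)
  push_cast at h1 h2
  exact abs_le.2 ⟨by linarith, by linarith⟩

end

end SquareOctagon

namespace SquareOctagon

noncomputable section

/-! ### Certified vectors -/

/-- The integer vector stored in `t`: the entry `i` has `48` bits and is shifted by `2 ^ 47`. -/
def entry (t i : ℕ) : ℤ :=
  Int.subNatNat (Nat.mod (Nat.shiftRight t (Nat.mul 48 i)) 281474976710656) 140737488355328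

/-- The scalar product of the vector stored in `t` with a list of shifted digits. -/
def dotDigits (t : ℕ) (l : List ℕ) : List ℕ → ℤ → ℤ :=
  List.rec (fun _ acc => acc) (fun i _ ih ds acc => List.rec acc (fun d ds _ =>
    force i fun i => forceInt (Int.add acc (Int.mul (entry t i) (Int.subNatNat d half))) fun acc =>
      ih ds acc) ds) l

/-- The scalar product of the vector stored in `t` with a packed column. -/
def dotCol (t n offs q : ℕ) (l : List ℕ) (C : ℕ) : ℤ :=
  dotDigits t l (digits 0 1 n (Nat.mod (Nat.add C offs) q) List.nil) 0

/-- The residue of the linear combination of columns with the coefficients stored in `t`. -/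
def combineCols (t q : ℕ) (C : ℕ → ℕ) (js : List ℕ) : ℕ → ℕ :=
  List.rec (fun acc => acc) (fun j _ ih acc => force j fun j =>
    force (addMul q acc (entry t j) (force (C j) fun C => Nat.mod C q)) ih) js

/-- The sum of the squares of the scalar products with several columns, given the scalar product
`y` with the column `Y`. -/
def squareCols (t n offs q : ℕ) (l : List ℕ) (Y : ℕ) (y : ℤ) (Xs : List ℕ) : ℤ → ℤ :=
  List.rec (fun acc => acc) (fun X _ ih acc =>
    forceInt (Int.sub (dotCol t n offs q l (Nat.add X Y)) y) fun z =>
    forceInt (Int.add acc (Int.mul z z)) ih) Xs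

/-- Certifies that `lo * normMat ± unit * crossMat` with a penalty for the vectors `commonVec` is
negative on the vector stored in `t`. -/
def lowerCheck (b : Bool) (t lo unit w : ℕ) : Bool :=
  forceList (block w) fun l => force l.length fun n => force (offsets n) fun offs =>
  force (Nat.pow radix n) fun q =>
  force (combineCols t q (normCol w q) l 0) fun Y => forceInt (dotCol t n offs q l Y) fun N =>
  forceInt (dotCol t n offs q l (combineCols t q (crossCol b w q) l 0)) fun X =>
  forceList (commonCols b w q (commonBlock w) List.nil) fun Xs =>
  forceInt (squareCols t n offs q l Y N Xs 0) fun Z =>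
  Int.rec (fun _ => false) (fun _ => true)
    (Int.add (Int.mul 4 (Int.add (Int.mul (Int.ofNat lo) N)
      (Int.mul (Bool.rec (Int.negSucc (Nat.pred unit)) (Int.ofNat unit) b) X)))
      (Int.mul (Int.ofNat unit) Z))

theorem entry_abs_le (t i : ℕ) : |entry t i| ≤ 2 ^ 48 := by
  have h : Nat.shiftRight t (48 * i) % 281474976710656 < 281474976710656 := Nat.mod_lt _ (by norm_num)
  have e : entry t i =
      ((Nat.shiftRight t (48 * i) % 281474976710656 : ℕ) : ℤ) - 140737488355328 := by
    rw [entry, Int.subNatNat_eq_coe]; rfl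
  rw [e, abs_le]
  constructor <;> omega

theorem dotDigits_spec (t : ℕ) (l : List ℕ) (D : ℕ → ℕ) (acc : ℤ) :
    dotDigits t l (l.map D) acc = acc + (l.map fun i => entry t i * ((D i : ℤ) - half)).sum := by
  induction l generalizing acc with
  | nil => simp [dotDigits]
  | cons i l ih =>
    have e : dotDigits t (i :: l) ((i :: l).map D) acc =
        dotDigits t l (l.map D) (acc + entry t i * Int.subNatNat (D i) half) := by
      simp only [dotDigits, force_eq, forceInt_eq, List.map_cons]; rfl
    rw [e, ih, Int.subNatNat_eq_coe, List.map_cons, List.sum_cons, add_assoc]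

theorem dotCol_spec (t : ℕ) {l : List ℕ} {u : ℕ → ℤ} {C : ℕ} (hu : ∀ i ∈ l, |u i| < half)
    (hC : IsResidue l.length (pack u l) C) :
    dotCol t l.length (offsets l.length) (radix ^ l.length) l C =
      (l.map fun i => entry t i * u i).sum := by
  have hnn : ∀ i ∈ l, 0 ≤ u i + half ∧ u i + half < radix := fun i hi => by
    have := abs_lt.1 (hu i hi)
    rw [radix_eq]; push_cast
    constructor <;> linarith
  have hd : digits 0 1 l.length ((C + offsets l.length) % radix ^ l.length) [] =
      l.map fun i => (u i + half).toNat := by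
    rw [digits_spec (fun i => (u i + half).toNat) 0 1 l ?_ 0 _ ?_ []]
    · simp
    · intro i hi
      have := hnn i hi
      omega
    · rw [add_offsets_mod hu hC]; simp
  have e : dotCol t l.length (offsets l.length) (radix ^ l.length) l C =
      dotDigits t l (digits 0 1 l.length ((C + offsets l.length) % radix ^ l.length) []) 0 := rfl
  rw [e, hd, dotDigits_spec, zero_add]
  congr 1
  refine List.map_congr_left fun i hi => ?_
  rw [Int.toNat_of_nonneg (hnn i hi).1, add_sub_cancel_right]

theorem combineCols_spec {n : ℕ} (t : ℕ) {l : List ℕ} {f : ℕ → ℕ → ℤ} {C : ℕ → ℕ}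
    (hC : ∀ j, IsResidue n (pack (fun i => f i j) l) (C j)) (js : List ℕ) {u : ℕ → ℤ} {acc : ℕ}
    (ha : IsResidue n (pack u l) acc) :
    IsResidue n (pack (fun i => u i + (js.map fun j => entry t j * f i j).sum) l)
      (combineCols t (radix ^ n) C js acc) := by
  induction js generalizing u acc with
  | nil => simpa [combineCols] using ha
  | cons j js ih =>
    have e : combineCols t (radix ^ n) C (j :: js) acc =
        combineCols t (radix ^ n) C js (addMul (radix ^ n) acc (entry t j) (C j % radix ^ n)) := by
      simp only [combineCols, force_eq]; rfl
    rw [e]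
    have h := addMul_spec (entry t j) ha (hC j).mod (mod_radix_lt _ _).le
    rw [← pack_mul_left, ← pack_add] at h
    have := ih h
    simp only [List.map_cons, List.sum_cons, ← add_assoc]
    exact this

/-- The scalar products are taken with the sum of a column and `Y`. By linearity, subtracting the
known product with `Y` gives the product with the column itself. -/
theorem squareCols_spec (t : ℕ) {l : List ℕ} {v : ℕ → ℤ} {Y : ℕ}
    (hY : IsResidue l.length (pack v l) Y) (U : ℕ → ℕ → ℤ) (X : ℕ → ℕ) (os : List ℕ)
    (hX : ∀ o ∈ os, IsResidue l.length (pack (U o) l) (X o))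
    (hU : ∀ o ∈ os, ∀ i ∈ l, |U o i + v i| < half) (acc : ℤ) :
    squareCols t l.length (offsets l.length) (radix ^ l.length) l Y
      (l.map fun i => entry t i * v i).sum (os.map X) acc =
      acc + (os.map fun o => (l.map fun i => entry t i * U o i).sum ^ 2).sum := by
  induction os generalizing acc with
  | nil => simp [squareCols]
  | cons o os ih =>
    have e : ∀ y, squareCols t l.length (offsets l.length) (radix ^ l.length) l Y y
        ((o :: os).map X) acc =
        squareCols t l.length (offsets l.length) (radix ^ l.length) l Y y (os.map X) (acc +
        (dotCol t l.length (offsets l.length) (radix ^ l.length) l (X o + Y) - y) *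
        (dotCol t l.length (offsets l.length) (radix ^ l.length) l (X o + Y) - y)) := fun y => by
      simp only [squareCols, forceInt_eq, List.map_cons]; rfl
    rw [e, ih (fun o' h => hX o' (by simp [h])) (fun o' h => hU o' (by simp [h])),
      dotCol_spec t (u := fun i => U o i + v i) (hU o (by simp))
        (by rw [pack_add]; exact (hX o (by simp)).add hY)]
    have h : (l.map fun i => entry t i * (U o i + v i)).sum =
        (l.map fun i => entry t i * U o i).sum + (l.map fun i => entry t i * v i).sum := by
      rw [← List.sum_map_add]
      simp only [mul_add]
    rw [h, List.map_cons, List.sum_cons]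
    ring

theorem commonCols_eq (b : Bool) (w q : ℕ) (os acc : List ℕ) :
    commonCols b w q os acc = (os.reverse.map fun o =>
      (normCol w q (common b o 0) + (q - normCol w q (common b o 1))) % q) ++ acc := by
  induction os generalizing acc with
  | nil => rfl
  | cons o os ih =>
    have e : commonCols b w q (o :: os) acc = commonCols b w q os
        ((normCol w q (common b o 0) + (q - normCol w q (common b o 1))) % q :: acc) := by
      simp only [commonCols, force_eq]; rfl
    rw [e, ih]
    simp

theorem abs_sum_entry_le (t : ℕ) (l : List ℕ) (f : ℕ → ℤ) (hf : ∀ j, |f j| ≤ 2 ^ 24) :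
    |(l.map fun j => entry t j * f j).sum| ≤ l.length * 2 ^ 72 := by
  induction l with
  | nil => simp
  | cons j l ih =>
    rw [List.map_cons, List.sum_cons, List.length_cons]
    have : |entry t j * f j| ≤ 2 ^ 72 := by
      rw [abs_mul, show (2 : ℤ) ^ 72 = 2 ^ 48 * 2 ^ 24 by norm_num]
      exact mul_le_mul (entry_abs_le _ _) (hf j) (abs_nonneg _) (by norm_num)
    refine (abs_add_le _ _).trans ?_
    push_cast
    linarith

theorem cast_quadForm (f : ℕ → ℕ → ℤ) (t : ℕ) (l : List ℕ) :
    quadForm (fun i j => (f i j : ℝ)) l (fun i => (entry t i : ℝ)) =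
      (((l.map fun i => entry t i * (0 + (l.map fun j => entry t j * f i j).sum)).sum : ℤ) : ℝ) := by
  have hc : ∀ (g : ℕ → ℤ) (l : List ℕ), (((l.map g).sum : ℤ) : ℝ) = (l.map fun i => (g i : ℝ)).sum :=
    fun g l => by
      induction l with
      | nil => simp
      | cons i l ih => simp only [List.map_cons, List.sum_cons, Int.cast_add, ih]
  rw [quadForm, hc]
  congr 1
  refine List.map_congr_left fun i _ => ?_
  rw [Int.cast_mul, zero_add, hc, ← List.sum_map_mul_left]
  congr 1
  exact List.map_congr_left fun j _ => by push_cast; ring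

/-- Soundness of `lowerCheck`. -/
theorem lowerCheck_sound {b : Bool} {t lo unit w : ℕ} (hlen : (block w).length ≤ 256)
    (hunit : 0 < unit) (h : lowerCheck b t lo unit w = true) :
    4 * (lo * quadForm (fun i j => (normMat i j : ℝ)) (block w) (fun i => (entry t i : ℝ)) +
      (if b then 1 else -1) *
      (unit * quadForm (fun i j => (crossMat b i j : ℝ)) (block w) (fun i => (entry t i : ℝ)))) +
    unit * ((commonBlock w).map fun o =>
      ((block w).map fun i => (entry t i : ℝ) * (commonVec b o i : ℝ)).sum ^ 2).sum < 0 := by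
  set l := block w with hl
  set n := l.length with hn
  set q := radix ^ n with hq
  have hbnd : ∀ f : ℕ → ℕ → ℤ, (∀ i j, |f i j| ≤ 2 ^ 24) →
      ∀ i, |0 + (l.map fun j => entry t j * f i j).sum| ≤ 2 ^ 80 := fun f hf i => by
    rw [zero_add]
    refine (abs_sum_entry_le t l (f i) (hf i)).trans ?_
    have : (l.length : ℤ) ≤ 256 := by exact_mod_cast hlen
    linarith
  have hhalf : (half : ℤ) = 2 ^ 159 := by norm_num [half]
  have hzero : IsResidue n (pack (fun _ => (0 : ℤ)) l) 0 := by
    rw [show pack (fun _ => (0 : ℤ)) l = 0 * pack (fun _ => 0) l by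
      rw [← pack_mul_left]; simp, zero_mul]
    exact IsResidue.natCast _ 0
  have hY := combineCols_spec t (f := normMat) (normCol_spec n w) l hzero
  have hX := combineCols_spec t (f := crossMat b) (crossCol_spec n b w) l hzero
  have hN := dotCol_spec t (fun i _ => (hbnd normMat normMat_abs_le i).trans_lt
    (by rw [hhalf]; norm_num)) hY
  have hT := dotCol_spec t (fun i _ => (hbnd (crossMat b) (crossMat_abs_le b) i).trans_lt
    (by rw [hhalf]; norm_num)) hX
  have hZ := squareCols_spec t hY (commonVec b)
    (fun o => (normCol w q (common b o 0) + (q - normCol w q (common b o 1))) % q)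
    (commonBlock w).reverse (fun o _ => by
      rw [show commonVec b o = fun i => normMat i (common b o 0) - normMat i (common b o 1) from
        rfl, pack_sub, sub_eq_add_neg, hq]
      exact ((normCol_spec _ _ _).add ((normCol_spec _ _ _).neg (normCol_lt _ _ _).le)).mod)
    (fun o _ i _ => by
      refine (abs_add_le _ _).trans_lt ((add_le_add (commonVec_abs_le b o i)
        (hbnd normMat normMat_abs_le i)).trans_lt ?_)
      rw [hhalf]; norm_num) 0
  have hcols := commonCols_eq b w q (commonBlock w) []
  rw [List.append_nil] at hcols
  rw [← hcols, ← hN, zero_add, List.map_reverse, List.sum_reverse] at hZ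
  have h' : ∀ z : ℤ, (Int.rec (fun _ => false) (fun _ => true) z : Bool) = true → z < 0 := by
    rintro (z | z) hz
    · cases hz
    · exact Int.negSucc_lt_zero z
  simp only [lowerCheck, forceList_eq, force_eq, forceInt_eq] at h
  have key := h' _ h
  rw [show Nat.pow radix (block w).length = q from rfl] at key
  erw [hZ, hN, hT] at key
  -- The program encodes -unit as `Int.negSucc (unit - 1)`, which is correct only because `unit` is
  -- positive.
  have hs : (Bool.rec (Int.negSucc (Nat.pred unit)) (Int.ofNat unit) b : ℤ) =
      (if b then 1 else -1) * unit := by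
    cases b
    · obtain ⟨k, rfl⟩ := Nat.exists_eq_succ_of_ne_zero hunit.ne'
      simp [Int.negSucc_eq]
    · simp
  rw [hs] at key
  have hc : ∀ (g : ℕ → ℤ) (l : List ℕ), (((l.map g).sum : ℤ) : ℝ) = (l.map fun i => (g i : ℝ)).sum :=
    fun g l => by
      induction l with
      | nil => simp
      | cons i l ih => simp only [List.map_cons, List.sum_cons, Int.cast_add, ih]
  have hZ' : ((commonBlock w).map fun o =>
      (l.map fun i => (entry t i : ℝ) * (commonVec b o i : ℝ)).sum ^ 2).sum =
      ((((commonBlock w).map fun o =>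
        (l.map fun i => entry t i * commonVec b o i).sum ^ 2).sum : ℤ) : ℝ) := by
    rw [hc]
    congr 1
    refine List.map_congr_left fun o _ => ?_
    rw [Int.cast_pow, hc]
    simp only [Int.cast_mul]
  rw [cast_quadForm, cast_quadForm, hZ']
  have key' := (Int.cast_lt (R := ℝ)).2 key
  simp only [Int.mul_def, Int.add_def, Int.ofNat_eq_natCast] at key'
  push_cast at key'
  push_cast
  simp only [mul_assoc] at key' ⊢
  exact key'

end

end SquareOctagon

namespace SquareOctagon

noncomputable section

/-! ### The quadratic forms -/

/-- The squared norm of a combination of the vectors with a singlet on the first link. -/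
def normForm (x : ℕ → ℝ) : ℝ :=
  ∑ i ∈ Finset.range 1024, ∑ j ∈ Finset.range 1024, x i * x j * normMat i j

/-- The overlap of a combination of the vectors with a singlet on the first link with its mirror
image. -/
def crossForm (b : Bool) (x : ℕ → ℝ) : ℝ :=
  ∑ i ∈ Finset.range 1024, ∑ j ∈ Finset.range 1024, x i * x j * crossMat b i j

/-- The overlap with a vector with singlets on both links. -/
def commonForm (b : Bool) (o : ℕ) (x : ℕ → ℝ) : ℝ :=
  ∑ i ∈ Finset.range 1024, x i * commonVec b o i

theorem mem_sixBits {v x : ℕ} :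
    x ∈ sixBits v ↔ x < 64 ∧ ones (2 * (x % 8)) + ones (2 * (x / 8)) = v := by
  have h : ∀ v < 7, ∀ x < 64, x ∈ sixBits v ↔ ones (2 * (x % 8)) + ones (2 * (x / 8)) = v := by
    decide +kernel
  have hlt : ∀ x < 64, ones (2 * (x % 8)) + ones (2 * (x / 8)) < 7 := by decide +kernel
  by_cases hv : v < 7
  · constructor
    · exact fun hx => ⟨sixBits_lt hx, (h v hv x (sixBits_lt hx)).1 hx⟩
    · exact fun hx => (h v hv x hx.1).2 hx.2
  · obtain ⟨k, rfl⟩ := Nat.exists_eq_add_of_le' (not_lt.1 hv)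
    simp only [sixBits, List.not_mem_nil, false_iff, not_and]
    intro hx
    have := hlt x hx
    omega

theorem mem_block {w i : ℕ} : i ∈ block w ↔ i < 1024 ∧ weight i = w := by
  simp only [block, List.mem_flatMap, List.mem_range]
  constructor
  · rintro ⟨r, hr, hi⟩
    cases hb : Nat.ble (ones r) w with
    | false => simp [hb] at hi
    | true =>
      simp only [hb, List.mem_map, mem_sixBits] at hi
      obtain ⟨x, ⟨hx, hv⟩, rfl⟩ := hi
      have := Nat.le_of_ble_eq_true hb
      refine ⟨by omega, ?_⟩
      rw [weight, show (x + 64 * r) % 64 = x by omega, show (x + 64 * r) / 64 = r by omega]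
      omega
  · rintro ⟨hi, rfl⟩
    refine ⟨i / 64, by omega, ?_⟩
    have hb : Nat.ble (ones (i / 64)) (weight i) = true := Nat.ble_eq_true_of_le (by unfold weight; omega)
    simp only [hb, List.mem_map, mem_sixBits]
    refine ⟨i % 64, ⟨by omega, by unfold weight; omega⟩, by omega⟩

theorem mem_commonBlock {w o : ℕ} (ho : o < 256) (b : Bool) (u : ℕ) (hu : u < 2) :
    o ∈ commonBlock w ↔ weight (common b o u) = w := by
  have h : ∀ b, ∀ o < 256, ∀ u < 2,
      ones (o % 32) + o / 16 % 2 + ones (o / 32) + 1 = weight (common b o u) := by decide +kernel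
  rw [← h b o ho u hu]
  simp [commonBlock, ho]

theorem block_facts : ∀ w < 11, (block w).Pairwise (· < ·) ∧ (block w).length ≤ 256 ∧
    (commonBlock w).length ≤ 256 := by
  -- Comparing neighbours is a linear number of tests. Transitivity then gives the order of all
  -- pairs and hence the absence of repetitions.
  have h : ∀ w < 11, (block w).IsChain (· < ·) ∧ (block w).length ≤ 256 ∧
    (commonBlock w).length ≤ 256 := by decide +kernel
  exact fun w hw => ⟨List.isChain_iff_pairwise.1 (h w hw).1, (h w hw).2⟩

theorem block_nodup {w : ℕ} (hw : w < 11) : (block w).Nodup :=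
  (block_facts w hw).1.imp fun h => h.ne

theorem sum_block {w : ℕ} (hw : w < 11) (f : ℕ → ℝ) :
    ((block w).map f).sum = ∑ i ∈ (Finset.range 1024).filter (weight · = w), f i := by
  rw [← List.sum_toFinset _ (block_nodup hw)]
  refine Finset.sum_congr (Finset.ext fun i => ?_) fun _ _ => rfl
  rw [List.mem_toFinset, mem_block, Finset.mem_filter, Finset.mem_range]

theorem weight_lt (i : ℕ) : weight i < 11 := by
  have h : ∀ x, ones (2 * x) ≤ 3 ∧ ones x ≤ 4 := fun x => by unfold ones; omega
  have h1 := (h (i % 64 % 8)).1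
  have h2 := (h (i % 64 / 8)).1
  have h3 := (h (i / 64)).2
  unfold weight
  omega

theorem sum_weight (s : Finset ℕ) (f : ℕ → ℝ) : ∑ i ∈ s, f i =
    ∑ w ∈ Finset.range 11, ∑ i ∈ s.filter (weight · = w), f i := by
  have h : ∀ i ∈ s, weight i ∈ Finset.range 11 := fun i _ => Finset.mem_range.2 (weight_lt i)
  exact (Finset.sum_fiberwise_of_maps_to h f).symm

/-- The part of a quadratic form which belongs to a block. -/
def blockForm (M : ℕ → ℕ → ℤ) (w : ℕ) (x : ℕ → ℝ) : ℝ :=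
  ∑ i ∈ (Finset.range 1024).filter (weight · = w), ∑ j ∈ (Finset.range 1024).filter (weight · = w),
    x i * x j * M i j

theorem sum_blockForm {M : ℕ → ℕ → ℤ} (hM : ∀ i j, weight i ≠ weight j → M i j = 0) (x : ℕ → ℝ) :
    ∑ i ∈ Finset.range 1024, ∑ j ∈ Finset.range 1024, x i * x j * M i j =
      ∑ w ∈ Finset.range 11, blockForm M w x := by
  rw [sum_weight]
  refine Finset.sum_congr rfl fun w _ => Finset.sum_congr rfl fun i hi => ?_
  rw [Finset.sum_filter]
  refine Finset.sum_congr rfl fun j _ => ?_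
  split_ifs with h
  · rfl
  · rw [hM i j fun e => h (e ▸ (Finset.mem_filter.1 hi).2), Int.cast_zero, mul_zero]

theorem quadForm_block {w : ℕ} (hw : w < 11) (M : ℕ → ℕ → ℤ) (x : ℕ → ℝ) :
    quadForm (fun i j => (M i j : ℝ)) (block w) x = blockForm M w x := by
  rw [quadForm, sum_block hw, blockForm]
  exact Finset.sum_congr rfl fun i _ => sum_block hw _

theorem commonVec_eq_zero {b : Bool} {w o i : ℕ} (ho : o ∈ commonBlock w) (hi : weight i ≠ w) :
    commonVec b o i = 0 := by
  have h : o < 256 := by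
    have := (List.mem_filter.1 ho).1
    simpa using this
  rw [commonVec, normMat_eq_zero, normMat_eq_zero, sub_zero] <;>
  · rwa [(mem_commonBlock h b _ (by norm_num)).1 ho]

theorem sum_commonVec {b : Bool} {w o : ℕ} (hw : w < 11) (ho : o ∈ commonBlock w) (x : ℕ → ℝ) :
    ((block w).map fun i => x i * (commonVec b o i : ℝ)).sum = commonForm b o x := by
  rw [sum_block hw, commonForm, Finset.sum_filter]
  refine Finset.sum_congr rfl fun i _ => ?_
  split_ifs with h
  · rfl
  · rw [commonVec_eq_zero ho h, Int.cast_zero, mul_zero]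

/-! The spin flip exchanges the blocks `w` and `10 - w`. -/

theorem gram_flip {x y : ℕ} (hx : x < 16) (hy : y < 16) : gram (15 - x) (15 - y) = gram x y := by
  have h : ∀ x < 16, ∀ y < 16, gram (15 - x) (15 - y) = gram x y := by decide +kernel
  exact h x hx y hy

/-- The sign is the antisymmetry of the one singlet involved. It occurs in both terms or in both
factors of the later matrices, so `normMat` and `crossMat` are invariant under the flip. -/
theorem half2_flip {R C x : ℕ} (hR : R < 16) (hC : C < 16) (hx : x < 64) :
    half2 (15 - R) (15 - C) (63 - x) = -half2 R C x := by
  rw [half2_eq, half2_eq, show 2 * ((63 - x) % 8) = 15 - (2 * (x % 8) + 1) by omega,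
    show 2 * ((63 - x) / 8) + 1 = 15 - 2 * (x / 8) by omega,
    show 15 - (2 * (x % 8) + 1) + 1 = 15 - 2 * (x % 8) by omega,
    show 2 * ((63 - x) / 8) = 15 - (2 * (x / 8) + 1) by omega,
    gram_flip (by omega) hR, gram_flip (by omega) hC, gram_flip (by omega) hR,
    gram_flip (by omega) hC]
  ring

theorem normMat_flip {i j : ℕ} (hi : i < 1024) (hj : j < 1024) :
    normMat (1023 - i) (1023 - j) = normMat i j := by
  simp only [normMat, full2_eq]
  rw [show (1023 - i) % 64 = 63 - i % 64 by omega, show (1023 - j) % 64 = 63 - j % 64 by omega,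
    show (1023 - i) / 64 = 15 - i / 64 by omega, show (1023 - j) / 64 = 15 - j / 64 by omega,
    show 2 * ((63 - j % 64) % 8) = 15 - (2 * (j % 64 % 8) + 1) by omega,
    show 2 * ((63 - j % 64) / 8) + 1 = 15 - 2 * (j % 64 / 8) by omega,
    show 15 - (2 * (j % 64 % 8) + 1) + 1 = 15 - 2 * (j % 64 % 8) by omega,
    show 2 * ((63 - j % 64) / 8) = 15 - (2 * (j % 64 / 8) + 1) by omega,
    gram_flip (by omega) (by omega), half2_flip (by omega) (by omega) (by omega),
    half2_flip (by omega) (by omega) (by omega)]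
  ring

theorem reflect_flip (b : Bool) {x : ℕ} (hx : x < 16) :
    reflect b (15 - x) = 15 - reflect b x ∧ reflect b x < 16 := by
  have h : ∀ b, ∀ x < 16, reflect b (15 - x) = 15 - reflect b x ∧ reflect b x < 16 := by
    decide +kernel
  exact h b x hx

theorem crossMat_flip (b : Bool) {i j : ℕ} (hi : i < 1024) (hj : j < 1024) :
    crossMat b (1023 - i) (1023 - j) = crossMat b i j := by
  have hc : ∀ c, c < 16 → reflect b (15 - c) = 15 - reflect b c := fun c hc => (reflect_flip b hc).1
  have hc' : ∀ c, c < 16 → reflect b c < 16 := fun c hc => (reflect_flip b hc).2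
  simp only [crossMat_eq]
  rw [show (1023 - i) % 64 = 63 - i % 64 by omega, show (1023 - j) % 64 = 63 - j % 64 by omega,
    show (1023 - i) / 64 = 15 - i / 64 by omega, show (1023 - j) / 64 = 15 - j / 64 by omega,
    show 2 * ((63 - j % 64) % 8) = 15 - (2 * (j % 64 % 8) + 1) by omega,
    show 2 * ((63 - j % 64) / 8) + 1 = 15 - 2 * (j % 64 / 8) by omega,
    show 15 - (2 * (j % 64 % 8) + 1) + 1 = 15 - 2 * (j % 64 % 8) by omega,
    show 2 * ((63 - j % 64) / 8) = 15 - (2 * (j % 64 / 8) + 1) by omega,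
    hc _ (by omega), hc _ (by omega),
    gram_flip (by omega) (by omega), gram_flip (by omega) (by omega),
    half2_flip (by omega) (hc' _ (by omega)) (by omega),
    half2_flip (by omega) (hc' _ (by omega)) (by omega)]
  ring

theorem weight_flip {i : ℕ} (hi : i < 1024) : weight (1023 - i) = 10 - weight i := by
  have h : ∀ i < 1024, weight (1023 - i) = 10 - weight i := by decide +kernel
  exact h i hi

theorem sum_block_flip {w : ℕ} (hw : w < 11) (f : ℕ → ℝ) :
    ∑ i ∈ (Finset.range 1024).filter (weight · = 10 - w), f (1023 - i) =
      ∑ i ∈ (Finset.range 1024).filter (weight · = w), f i := by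
  refine Finset.sum_nbij' (1023 - ·) (1023 - ·) ?_ ?_ ?_ ?_ ?_
  · intro i hi
    simp only [Finset.mem_filter, Finset.mem_range] at hi ⊢
    have := weight_flip hi.1
    omega
  · intro i hi
    simp only [Finset.mem_filter, Finset.mem_range] at hi ⊢
    have := weight_flip hi.1
    omega
  · intro i hi
    simp only [Finset.mem_filter, Finset.mem_range] at hi
    omega
  · intro i hi
    simp only [Finset.mem_filter, Finset.mem_range] at hi
    omega
  · intro i hi; rfl

theorem blockForm_flip {M : ℕ → ℕ → ℤ}
    (hM : ∀ i j, i < 1024 → j < 1024 → M (1023 - i) (1023 - j) = M i j) {w : ℕ} (hw : w < 11)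
    (x : ℕ → ℝ) : blockForm M (10 - w) (fun i => x (1023 - i)) = blockForm M w x := by
  rw [blockForm, blockForm, ← sum_block_flip hw]
  refine Finset.sum_congr rfl fun i hi => ?_
  rw [← sum_block_flip hw]
  refine Finset.sum_congr rfl fun j hj => ?_
  rw [hM i j (Finset.mem_range.1 (Finset.mem_filter.1 hi).1)
    (Finset.mem_range.1 (Finset.mem_filter.1 hj).1)]

/-- The flip exchanges the two terms of the singlet on the second link, which produces the sign.
Consequently orthogonality to all the common states is preserved, and the certificates of the blocks
up to five also cover the complementary ones. -/
theorem commonForm_flip (b : Bool) {o : ℕ} (ho : o < 256) (x : ℕ → ℝ) :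
    commonForm b (255 - o) (fun i => x (1023 - i)) = -commonForm b o x := by
  have h : ∀ b, ∀ o < 256, common b (255 - o) 0 = 1023 - common b o 1 ∧
      common b (255 - o) 1 = 1023 - common b o 0 ∧ common b o 0 < 1024 ∧ common b o 1 < 1024 := by
    decide +kernel
  obtain ⟨h0, h1, h2, h3⟩ := h b o ho
  rw [commonForm, commonForm, ← Finset.sum_range_reflect (fun i => x i * (commonVec b o i : ℝ)),
    ← Finset.sum_neg_distrib]
  refine Finset.sum_congr rfl fun i hi => ?_
  have hi := Finset.mem_range.1 hi
  have e : commonVec b (255 - o) i = -commonVec b o (1023 - i) := by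
    have h' : ∀ k < 1024, normMat i (1023 - k) = normMat (1023 - i) k := fun k hk => by
      rw [← normMat_flip hi (j := 1023 - k) (by omega), show 1023 - (1023 - k) = k by omega]
    rw [commonVec, commonVec, h0, h1, h' _ h2, h' _ h3]
    ring
  rw [e, show 1024 - 1 - i = 1023 - i by omega]
  push_cast
  ring

/-- The certificates of half of the blocks bound the overlaps. -/
theorem abs_crossForm_le {b : Bool} {eps bnd A T s : ℕ} (hA : A ≤ 2 ^ 120) (hT : T ≤ 2 ^ 120)
    (hs : s ≤ 2 ^ 42) (he : eps ≤ 2 ^ 100) (hb : bnd ≤ 2 ^ 75)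
    (h : ∀ w < 6, blockCheck b eps bnd A T s w = true) {x : ℕ → ℝ}
    (hx : ∀ o < 256, commonForm b o x = 0) :
    T * |crossForm b x| ≤ A * normForm x := by
  have key : ∀ w < 6, ∀ x : ℕ → ℝ, (∀ o < 256, commonForm b o x = 0) →
      |T * blockForm (crossMat b) w x| ≤ A * blockForm normMat w x := fun w hw x hx => by
    have hw' : w < 11 := by omega
    obtain ⟨-, h2, h3⟩ := block_facts w hw'
    rw [← quadForm_block hw', ← quadForm_block hw']
    refine blockCheck_sound (block_nodup hw') h2 h3 hA hT hs he hb (h w hw) fun o ho => ?_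
    rw [sum_commonVec hw' ho]
    refine hx o ?_
    have := (List.mem_filter.1 ho).1
    simpa using this
  have key' : ∀ w ∈ Finset.range 11,
      |T * blockForm (crossMat b) w x| ≤ A * blockForm normMat w x := fun w hw => by
    have hw := Finset.mem_range.1 hw
    by_cases h6 : w < 6
    · exact key w h6 x hx
    · rw [← blockForm_flip (fun i j hi hj => crossMat_flip b hi hj) hw,
        ← blockForm_flip (fun i j hi hj => normMat_flip hi hj) hw]
      -- A block above five is the flip of a certified block, and the flipped vector is again
      -- orthogonal to all common states.
      refine key (10 - w) (by omega) _ fun o ho => ?_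
      have := commonForm_flip b (o := 255 - o) (by omega) x
      rw [show 255 - (255 - o) = o by omega] at this
      rw [this, hx _ (by omega), neg_zero]
  rw [normForm, crossForm, sum_blockForm fun i j => normMat_eq_zero,
    sum_blockForm fun i j => crossMat_eq_zero b, ← abs_of_nonneg (Nat.cast_nonneg (α := ℝ) T),
    ← abs_mul, Finset.mul_sum, Finset.mul_sum]
  refine (Finset.abs_sum_le_sum_abs _ _).trans (Finset.sum_le_sum fun w hw => ?_)
  exact key' w hw

/-- A certified vector violates a bound for the overlaps. -/
theorem exists_lt_crossForm {b : Bool} {t lo unit w : ℕ} (hw : w < 11) (hunit : 0 < unit)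
    (h : lowerCheck b t lo unit w = true) :
    ∃ x : ℕ → ℝ, 4 * (lo * normForm x + (if b then 1 else -1) * (unit * crossForm b x)) +
      unit * ∑ o ∈ Finset.range 256, commonForm b o x ^ 2 < 0 := by
  obtain ⟨-, h2, -⟩ := block_facts w hw
  have key := lowerCheck_sound h2 hunit h
  -- The stored vector is cut down to the certified block, so that the other blocks contribute
  -- nothing to the global forms.
  set x : ℕ → ℝ := fun i => if weight i = w then (entry t i : ℝ) else 0 with hx
  have hform : ∀ M : ℕ → ℕ → ℤ, (∀ i j, weight i ≠ weight j → M i j = 0) →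
      ∑ i ∈ Finset.range 1024, ∑ j ∈ Finset.range 1024, x i * x j * M i j =
      quadForm (fun i j => (M i j : ℝ)) (block w) (fun i => (entry t i : ℝ)) := fun M hM => by
    rw [sum_blockForm hM, quadForm_block hw, Finset.sum_eq_single w]
    · refine Finset.sum_congr rfl fun i hi => Finset.sum_congr rfl fun j hj => ?_
      simp only [hx, (Finset.mem_filter.1 hi).2, (Finset.mem_filter.1 hj).2, if_true]
    · intro v _ hv
      refine Finset.sum_eq_zero fun i hi => Finset.sum_eq_zero fun j _ => ?_
      simp [hx, (Finset.mem_filter.1 hi).2, hv]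
    · intro h; exact absurd (Finset.mem_range.2 hw) h
  refine ⟨x, ?_⟩
  rw [normForm, crossForm, hform _ fun i j => normMat_eq_zero, hform _ fun i j => crossMat_eq_zero b]
  refine lt_of_eq_of_lt ?_ key
  have hnd : (commonBlock w).Nodup := List.Nodup.filter _ List.nodup_range
  have hcommon : ∑ o ∈ Finset.range 256, commonForm b o x ^ 2 = ((commonBlock w).map fun o =>
      ((block w).map fun i => (entry t i : ℝ) * (commonVec b o i : ℝ)).sum ^ 2).sum := by
    rw [← List.sum_toFinset _ hnd, ← Finset.sum_subset (s₁ := (commonBlock w).toFinset)]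
    · refine Finset.sum_congr rfl fun o ho => ?_
      have ho := List.mem_toFinset.1 ho
      rw [← sum_commonVec hw ho]
      congr 2
      refine List.map_congr_left fun i hi => ?_
      simp [hx, (mem_block.1 hi).2]
    · intro o ho
      have := (List.mem_filter.1 (List.mem_toFinset.1 ho)).1
      simpa using this
    · intro o ho hno
      have ho := Finset.mem_range.1 ho
      have h' : ¬ weight (common b o 0) = w ∧ ¬ weight (common b o 1) = w := by
        constructor
        · exact fun e => hno (List.mem_toFinset.2 ((mem_commonBlock ho b 0 (by norm_num)).2 e))
        · exact fun e => hno (List.mem_toFinset.2 ((mem_commonBlock ho b 1 (by norm_num)).2 e))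
      rw [commonForm, Finset.sum_eq_zero, zero_pow two_ne_zero]
      intro i _
      by_cases hi : weight i = w
      · rw [commonVec, normMat_eq_zero fun e => h'.1 (e ▸ hi), normMat_eq_zero fun e => h'.2 (e ▸ hi)]
        simp
      · simp [hx, hi]
  rw [hcommon]

end

end SquareOctagon

namespace SquareOctagon

noncomputable section

/-! ### The certificates -/

set_option maxRecDepth 100000

/-- The six perpendicular certificates share their data. The quotient of the third and fourth
numbers is just below 0.15896633105, the upper end of the claimed interval. The first two are 2 ^ 69
and 2 ^ 75, the bounds for square roots of pivots and for Cholesky entries. The last is the weight,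
about 2 ^ 41, of the individual common vectors in the penalty. -/
theorem blockCheck_perp_zero :
    blockCheck true 590295810358705651712 37778931862957161709568
      114547313484925527708173825535 720575940379279360000123456789
      2199031930861 0 = true := by decide +kernel

theorem blockCheck_perp_one :
    blockCheck true 590295810358705651712 37778931862957161709568
      114547313484925527708173825535 720575940379279360000123456789
      2199031930861 1 = true := by decide +kernel

theorem blockCheck_perp_two :
    blockCheck true 590295810358705651712 37778931862957161709568
      114547313484925527708173825535 720575940379279360000123456789
      2199031930861 2 = true := by decide +kernel

theorem blockCheck_perp_three :
    blockCheck true 590295810358705651712 37778931862957161709568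
      114547313484925527708173825535 720575940379279360000123456789
      2199031930861 3 = true := by decide +kernel

theorem blockCheck_perp_four :
    blockCheck true 590295810358705651712 37778931862957161709568
      114547313484925527708173825535 720575940379279360000123456789
      2199031930861 4 = true := by decide +kernel

theorem blockCheck_perp_five :
    blockCheck true 590295810358705651712 37778931862957161709568
      114547313484925527708173825535 720575940379279360000123456789
      2199031930861 5 = true := by decide +kernel

/-- Only the numerator differs from the perpendicular case: the quotient is now just below
0.10614468585. -/
theorem blockCheck_par_zero :
    blockCheck false 590295810358705651712 37778931862957161709568
      76485306822554879922564232345 720575940379279360000123456789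
      2199031930861 0 = true := by decide +kernel

theorem blockCheck_par_one :
    blockCheck false 590295810358705651712 37778931862957161709568
      76485306822554879922564232345 720575940379279360000123456789
      2199031930861 1 = true := by decide +kernel

theorem blockCheck_par_two :
    blockCheck false 590295810358705651712 37778931862957161709568
      76485306822554879922564232345 720575940379279360000123456789
      2199031930861 2 = true := by decide +kernel

theorem blockCheck_par_three :
    blockCheck false 590295810358705651712 37778931862957161709568
      76485306822554879922564232345 720575940379279360000123456789
      2199031930861 3 = true := by decide +kernel

theorem blockCheck_par_four :
    blockCheck false 590295810358705651712 37778931862957161709568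
      76485306822554879922564232345 720575940379279360000123456789
      2199031930861 4 = true := by decide +kernel

theorem blockCheck_par_five :
    blockCheck false 590295810358705651712 37778931862957161709568
      76485306822554879922564232345 720575940379279360000123456789
      2199031930861 5 = true := by decide +kernel

/-- An approximate minimizer. -/
def perpVector : ℕ := 0x802583fb53e1800000000000800000000000800000000000800000000000800000000000800000000000800000000000800000000000800000000000800000000000800000000000800000000000800000000000800000000000800000000000800000000000800000000000800000000000800000000000800000000000800000000000800000000000800000000000800000000000800000000000800000000000800000000000800000000000800000000000800000000000800000000000800b08f0fa948000000000008000000000008000000000008000000000008000000000008000000000008000000000008000000000008000000000008000000000008000000000008000000000008000000000008000000000008000000000008018118a1420800000000000800000000000800000000000800000000000800000000000800000000000800000000000800ca74e6f0d8000000000008000000000008000000000007fd6c99aa5368000000000007ffd2705e3f17fd6c99aa5368000000000008000000000008000000000008000000000008000000000008000000000008000000000008000000000008000000000008000000000008000000000008000000000008000000000008000000000008000000000008000000000008000000000008000000000008000000000008000000000008000000000008000000000008000000000008000000000008000000000008000000000008000000000008000000000008000000000008000000000008000000000008000000000007ff3aefe9e7b8000000000008000000000008000000000008000000000008000000000008000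000000008000000000008000000000008000000000008000000000008000000000008000000000008000000000008000000000008000000000007ff28f61e4738000000000008000000000008000000000008000000000008000000000008000000000008000000000007fef083808ca80000000000080000000000080000000000080048db8deb58000000000007ffc19fa62fd80048db8deb58000000000008000000000008000000000008000000000008000000000008000000000008000000000008000000000008000000000008000000000008000000000008000000000008000000000008000000000008000000000008000000000007ff8510c18098000000000008000000000008000000000008000000000008000000000008000000000008000000000007ff7f284fbaf8000000000008000000000008000000000008008c0870f2a8000000000007fff837134e58008c0870f2a8000000000008000000000008000000000008000000000008000000000008000000000008000000000008000000000007ff33e0ffa6c8000000000008000000000008000000000008005dfb90a218000000000007ffe1085e0b68005dfb90a21800000000000800000000000800000000000800000000000800d20de727c8000000000007ffede27ad16800d20de727c800000000000800000000000800526707b308003c11d751e800000000000800526707b30800000000000800000000000800000000000800000000000800000000000800000000000800000000000800000000000800000000000800000000000800000000000800000000000800000000000800000000000800000000000800000000000800000000000800000000000800000000000800000000000800000000000800000000000800000000000800000000000800000000000800000000000800000000000800000000000800000000000800000000000800000000000800000000000800000000000800000000000801a73469cdb8000000000008000000000008000000000008000000000008000000000008000000000008000000000008000000000008000000000008000000000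008000000000008000000000008000000000008000000000008000000000008037bf8d6400800000000000800000000000800000000000800000000000800000000000800000000000800000000000802955c30cf48000000000008000000000008000000000007fb1389619868000000000007ffc82416b457fb138961986800000000000800000000000800000000000800000000000800000000000800000000000800000000000800000000000800000000000800000000000800000000000800000000000800000000000800000000000800000000000800000000000800e2f0105558000000000008000000000008000000000008000000000008000000000008000000000008000000000008006fa3ffadd8000000000008000000000008000000000007fe361ca19768000000000007ffe96f335727fe361ca197680000000000080000000000080000000000080000000000080000000000080000000000080000000000080000000000080118f3779a38000000000008000000000008000000000007fc9a28634928000000000007ffd2ba39fc47fc9a28634928000000000008000000000008000000000008000000000007fdacbc23e998000000000007ffbe1f2924e7fdacbc23e9980000000000080000000000080075917a4a380e8d4a5100080000000000080075917a4a38000000000008000000000008000000000008000000000008000000000008000000000008000000000008000000000008000000000008000000000008000000000008000000000008000000000008000000000008000000000008000000000008000000000008000000000007fdc3e403f688000000000008000000000008000000000008000000000008000000000008000000000008000000000007fe1566df27a800000000000800000000000800000000000801c7adbab058000000000007ffb53553cbd801c7adbab058000000000008000000000008000000000008000000000008000000000008000000000008000000000008000000000007fd3ffd63dec8000000000008000000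0000080000000000080173e4b26348000000000007ff6f663edd280173e4b2634800000000000800000000000800000000000800000000000801d10dd6bc48000000000007ff82a05e253801d10dd6bc4800000000000800000000000800e7802926e7feaf7aa385a800000000000800e7802926e8000000000008000000000008000000000008000000000008000000000008000000000008000000000008000000000008000000000008000000000007fede4276d03800000000000800000000000800000000000801844baca318000000000007ffed415a1d4801844baca318000000000008000000000008000000000008000000000008018dd683b3c80000000000080001dd533808018dd683b3c8000000000008000000000008003d02dc1cc7fc2708265228000000000008003d02dc1cc800000000000800000000000800000000000800000000000800000000000800000000000801e2b0437ca8000000000007ffcf8b2716e801e2b0437ca800000000000800000000000800900553f387fd9cf6159e5800000000000800900553f388000000000008000000000008000000000008000000000008007ffac1cad7fbbfa6953738000000000008007ffac1cad8000000000008000000000008000000000007fd03846300d8000000000008000000000008000000000008000000000008000000000008000000000008000000000008000000000008000000000008000000000008000000000008000000000008000000000008000000000008000000000008000000000008000000000008000000000008000000000008000000000008000000000008000000000008000000000008000000000008000000000008000000000008000000000008000000000008000000000008000000000008000000000008000000000008000000000008000000000008000000000008000000000008000000000008000000000007ff3aefe9e7b8000000000008000000000008000000000008000000000008000000000008000000000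008000000000008000000000008000000000008000000000008000000000008000000000008000000000008000000000008000000000007ff28f61e4738000000000008000000000008000000000008000000000008000000000008000000000008000000000007fef083808ca80000000000080000000000080000000000080048db8deb58000000000007ffc19fa62fd80048db8deb58000000000008000000000008000000000008000000000008000000000008000000000008000000000008000000000008000000000008000000000008000000000008000000000008000000000008000000000008000000000008000000000007ff8510c18098000000000008000000000008000000000008000000000008000000000008000000000008000000000007ff7f284fbaf8000000000008000000000008000000000008008c0870f2a8000000000007fff837134e58008c0870f2a8000000000008000000000008000000000008000000000008000000000008000000000008000000000008000000000007ff33e0ffa6c8000000000008000000000008000000000008005dfb90a218000000000007ffe1085e0b68005dfb90a21800000000000800000000000800000000000800000000000800d20de727c8000000000007ffede27ad16800d20de727c800000000000800000000000800526707b308003c11d751e800000000000800526707b3080000000000080000000000080000000000080000000000080000000000080000000000080000000000080000000000080000000000080000000000080000000000080000000000080000000000080000000000080000000000080000000000080000000000080000000000080079c4c7baf8000000000008000000000008000000000008000000000008000000000008000000000008000000000008012ee1a68aa8000000000008000000000008000000000007ffe117b6e7b8000000000008001f4a501b97ffe117b6e7b8000000000008000000000008000000000008000000000008000000000008000000000008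0000000000080000000000080135384fef18000000000008000000000008000000000007ffef76efb2d8000000000008002028cc6207ffef76efb2d8000000000008000000000008000000000008000000000007ffb8b0e3840800000000000800497d416517ffb8b0e38408000000000008000000000007fff9e82adee7ffeb212f2c08000000000007fff9e82adee800000000000800000000000800000000000800000000000800000000000800000000000800000000000800000000000800000000000800000000000800d1df341d68000000000008000000000008000000000007ffcb2ccf46b80000000000080013e0e29937ffcb2ccf46b8000000000008000000000008000000000008000000000007ff6ae8621dc8000000000008002b1dc1a6a7ff6ae8621dc8000000000008000000000007ffd8a4728407fff81dc34ab8000000000007ffd8a4728408000000000008000000000008000000000008000000000008000000000008000000000007ffad153a32880000000000080036fc084117ffad153a3288000000000008000000000007ffe974c65687fff2db1f3968000000000007ffe974c65688000000000008000000000008000000000008000000000007ffbc51ff8847ffcee3b253f8000000000007ffbc51ff8848000000000008000000000008000000000007ffe2de8d5858000000000008000000000008000000000008000000000008000000000008000000000008000000000008000000000008000000000008000000000008000000000008000000000008000000000008000000000008000000000008000000000008000000000008000000000008000000000008000000000008000000000008000000000007fdc3e403f688000000000008000000000008000000000008000000000008000000000008000000000008000000000007fe1566df27a8000000000008000000000008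00000000000801c7adbab058000000000007ffb53553cbd801c7adbab058000000000008000000000008000000000008000000000008000000000008000000000008000000000008000000000007fd3ffd63dec80000000000080000000000080000000000080173e4b26348000000000007ff6f663edd280173e4b2634800000000000800000000000800000000000800000000000801d10dd6bc48000000000007ff82a05e253801d10dd6bc4800000000000800000000000800e7802926e7feaf7aa385a800000000000800e7802926e8000000000008000000000008000000000008000000000008000000000008000000000008000000000008000000000008000000000008000000000007fede4276d03800000000000800000000000800000000000801844baca318000000000007ffed415a1d4801844baca318000000000008000000000008000000000008000000000008018dd683b3c80000000000080001dd533808018dd683b3c8000000000008000000000008003d02dc1cc7fc2708265228000000000008003d02dc1cc800000000000800000000000800000000000800000000000800000000000800000000000801e2b0437ca8000000000007ffcf8b2716e801e2b0437ca800000000000800000000000800900553f387fd9cf6159e5800000000000800900553f388000000000008000000000008000000000008000000000008007ffac1cad7fbbfa6953738000000000008007ffac1cad8000000000008000000000008000000000007fd03846300d800000000000800000000000800000000000800000000000800000000000800000000000800000000000800000000000800000000000800000000000800000000000800000000000800000000000800000000000805cfb81943f8000000000008000000000008000000000007fecae20d52280000000000080098f6fc6fe7fecae20d5228000000000008000000000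008000000000008000000000007fdceec1c62980000000000080138c0491d07fdceec1c6298000000000008000000000007ff5249e1600800a374c8a308000000000007ff5249e16008000000000008000000000008000000000008000000000008000000000008000000000007fe84adaa19d80000000000080171b97adbf7fe84adaa19d8000000000008000000000007ff7b2d1f4c08005e02d4ced8000000000007ff7b2d1f4c08000000000008000000000008000000000008000000000007ff03641f2bd8014e35895b58000000000007ff03641f2bd800000000000800000000000800000000000800663c62fb98000000000008000000000008000000000008000000000008000000000008000000000008000000000008000000000008000000000008000000000007fd6b35a5304800000000000800cb787a9dc7fd6b35a53048000000000008000000000007ff5696790f58019f8dabe178000000000007ff5696790f58000000000008000000000008000000000008000000000007fee6776a17580358d16ad0b8000000000007fee6776a1758000000000008000000000008000000000008021dfe10bbe8000000000008000000000008000000000008000000000008000000000008000000000008000000000008000000000007fef65dda0bc801a749157e68000000000007fef65dda0bc8000000000008000000000008000000000008012e5f1f5b6800000000000800000000000800000000000800000000000800000000000800000000000800000000000802637f19934800000000000800000000000800000000000800000000000800000000000800000000000800000000000800000000000800000000000800000000000800000000000800000000000800000000000800000000000800000000000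

/-- The quotient of the two constants is 0.15896633095, the lower end of the claimed interval. The
vector lives in the block of weight four, and the form is negative with the plus sign, so its
overlap with its mirror image is negative. -/
theorem lowerCheck_perp : lowerCheck true perpVector 1589663309500 10000000000000 4 = true := by
  decide +kernel

/-- An approximate minimizer. -/
def parVector : ℕ := 0x801bb5ea25dd80000000000080000000000080000000000080000000000080000000000080000000000080000000000080000000000080000000000080000000000080000000000080000000000080000000000080000000000080000000000080000000000080000000000080000000000080000000000080000000000080000000000080000000000080000000000080000000000080000000000080000000000080000000000080000000000080000000000080000000000080000000000080114298c522800000000000800000000000800000000000800000000000800000000000800000000000800000000000800000000000800000000000800000000000800000000000800000000000800000000000800000000000800000000000800e39c835de80000000000080000000000080000000000080000000000080000000000080000000000080000000000080114298c5228000000000008000000000008000000000007fdb5cc9768e8000000000007ffcd1892ce47fdb5cc9768e8000000000008000000000008000000000008000000000008000000000008000000000008000000000008000000000008000000000008000000000008000000000008000000000008000000000008000000000008000000000008000000000008000000000008000000000008000000000008000000000008000000000008000000000008000000000008000000000008000000000008000000000008000000000008000000000008000000000008000000000008000000000008000000000007ff592847c9780000000000080000000000080000000000080000000000080000000000080000000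00008000000000008000000000008000000000008000000000008000000000008000000000008000000000008000000000008000000000007ff47711583e8000000000008000000000008000000000008000000000008000000000008000000000008000000000007ff592847c9780000000000080000000000080000000000080035ca057338000000000007ffdf4bada5280035ca057338000000000008000000000008000000000008000000000008000000000008000000000008000000000008000000000008000000000008000000000008000000000008000000000008000000000008000000000008000000000008000000000007ff5b8a3e1938000000000008000000000008000000000008000000000008000000000008000000000008000000000007ff6c7e147c68000000000008000000000008000000000008006d84caec68000000000007ffef9c437628006d84caec68000000000008000000000008000000000008000000000008000000000008000000000008000000000008000000000007ff5b8a3e193800000000000800000000000800000000000800953ba64b58000000000007fff3669e554800953ba64b58000000000008000000000008000000000008000000000008006d84caec68000000000007ffef9c437628006d84caec6800000000000800000000000800407e4d25980063a5d9da5800000000000800407e4d259800000000000800000000000800000000000800000000000800000000000800000000000800000000000800000000000800000000000800000000000800000000000800000000000800000000000800000000000800000000000800000000000800000000000800000000000800000000000800000000000800000000000800000000000800000000000800000000000800000000000800000000000800000000000800000000000800000000000800000000000800000000000800000000000800000000000800000000000802826825d9a8000000000008000000000008000000000008000000000008000000000008000000000008000000000008000000000008000000000008000000000008000000000008000000000008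000000000008000000000008000000000008022efabfac2800000000000800000000000800000000000800000000000800000000000800000000000800000000000802826825d9a8000000000008000000000008000000000007fbab44200228000000000007ffba4e123e87fbab442002280000000000080000000000080000000000080000000000080000000000080000000000080000000000080000000000080000000000080000000000080000000000080000000000080000000000080000000000080000000000080000000000080119dc28f0680000000000080000000000080000000000080000000000080000000000080000000000080000000000080180f47d86a8000000000008000000000008000000000007fd0290ca4fe8000000000007ffc97c12bd87fd0290ca4fe80000000000080000000000080000000000080000000000080000000000080000000000080000000000080000000000080119dc28f068000000000008000000000008000000000007fd7b457ee1d8000000000007ffc3256d5197fd7b457ee1d8000000000008000000000008000000000008000000000007fd0290ca4fe8000000000007ffc97c12bd87fd0290ca4fe800000000000800000000000800913de413680e8d4a51000800000000000800913de41368000000000008000000000008000000000008000000000008000000000008000000000008000000000008000000000008000000000008000000000008000000000008000000000008000000000008000000000008000000000008000000000008000000000008000000000007fd944699d018000000000008000000000008000000000008000000000008000000000008000000000008000000000007fd63ef86437800000000000800000000000800000000000801bcf5d6e338000000000007ffb24dc4832801bcf5d6e338000000000008000000000008000000000008000000000008000000000008000000000008000000000008000000000007fd944699d0180000000000080000000000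0800000000000801d1b90d9938000000000007ffbd94dbfd6801d1b90d993800000000000800000000000800000000000800000000000801bcf5d6e338000000000007ffb24dc4832801bcf5d6e33800000000000800000000000800a21aed8c67fe3132319ec800000000000800a21aed8c68000000000008000000000008000000000008000000000008000000000008000000000008000000000008000000000008000000000008000000000007fe4d791910c800000000000800000000000800000000000801e0c1aa5638000000000007ffe75691693801e0c1aa563800000000000800000000000800000000000800000000000801c440c18fa8000000000007ffd8a34b898801c440c18fa8000000000008000000000008006a50042b47fcc3a223cf78000000000008006a50042b4800000000000800000000000800000000000800000000000800000000000800000000000801e0c1aa5638000000000007ffe75691693801e0c1aa5638000000000008000000000008005e98fac4b7fbfda97dc8a8000000000008005e98fac4b8000000000008000000000008000000000008000000000008006a50042b47fcc3a223cf78000000000008006a50042b48000000000008000000000008000000000007fd58efde1f78000000000008000000000008000000000008000000000008000000000008000000000008000000000008000000000008000000000008000000000008000000000008000000000008000000000008000000000008000000000008000000000008000000000008000000000008000000000008000000000008000000000008000000000008000000000008000000000008000000000008000000000008000000000008000000000008000000000008000000000008000000000008000000000008000000000008000000000008000000000008000000000008000000000008000000000007ff592847c9780000000000080000000000080000000000080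00000000008000000000008000000000008000000000008000000000008000000000008000000000008000000000008000000000008000000000008000000000008000000000007ff47711583e8000000000008000000000008000000000008000000000008000000000008000000000008000000000007ff592847c9780000000000080000000000080000000000080035ca057338000000000007ffdf4bada5280035ca057338000000000008000000000008000000000008000000000008000000000008000000000008000000000008000000000008000000000008000000000008000000000008000000000008000000000008000000000008000000000008000000000007ff5b8a3e1938000000000008000000000008000000000008000000000008000000000008000000000008000000000007ff6c7e147c68000000000008000000000008000000000008006d84caec68000000000007ffef9c437628006d84caec68000000000008000000000008000000000008000000000008000000000008000000000008000000000008000000000007ff5b8a3e193800000000000800000000000800000000000800953ba64b58000000000007fff3669e554800953ba64b58000000000008000000000008000000000008000000000008006d84caec68000000000007ffef9c437628006d84caec6800000000000800000000000800407e4d25980063a5d9da5800000000000800407e4d259800000000000800000000000800000000000800000000000800000000000800000000000800000000000800000000000800000000000800000000000800000000000800000000000800000000000800000000000800000000000800000000000800000000000800000000000800d3d3af7a88000000000008000000000008000000000008000000000008000000000008000000000008000000000008008f163b98a8000000000008000000000008000000000007ffeb2b7e1f3800000000000800146e891ba7ffeb2b7e1f3800000000000800000000000800000000000800000000000800000000000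800000000000800000000000800000000000800d3d3af7a88000000000008000000000008000000000007ffd55e301838000000000008001eba15d2c7ffd55e301838000000000008000000000008000000000008000000000007ffeb2b7e1f3800000000000800146e891ba7ffeb2b7e1f38000000000008000000000007fffce8be55e7ffebce0a6d58000000000007fffce8be55e800000000000800000000000800000000000800000000000800000000000800000000000800000000000800000000000800000000000800000000000800f2cc75ac08000000000008000000000008000000000007ffb013777ac80000000000080022246fb1b7ffb013777ac8000000000008000000000008000000000008000000000007ffc6b80ff8180000000000080017b105d287ffc6b80ff818000000000008000000000007ffe941bd39f7ffd9bda75b58000000000007ffe941bd39f8000000000008000000000008000000000008000000000008000000000008000000000007ffb013777ac80000000000080022246fb1b7ffb013777ac8000000000008000000000007ffdb17e70fb7ffc4ebad4c08000000000007ffdb17e70fb8000000000008000000000008000000000008000000000007ffe941bd39f7ffd9bda75b58000000000007ffe941bd39f8000000000008000000000008000000000007ffd47f45db78000000000008000000000008000000000008000000000008000000000008000000000008000000000008000000000008000000000008000000000008000000000008000000000008000000000008000000000008000000000008000000000008000000000008000000000008000000000008000000000008000000000008000000000007fd944699d018000000000008000000000008000000000008000000000008000000000008000000000008000000000007fd6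3ef86437800000000000800000000000800000000000801bcf5d6e338000000000007ffb24dc4832801bcf5d6e338000000000008000000000008000000000008000000000008000000000008000000000008000000000008000000000007fd944699d01800000000000800000000000800000000000801d1b90d9938000000000007ffbd94dbfd6801d1b90d993800000000000800000000000800000000000800000000000801bcf5d6e338000000000007ffb24dc4832801bcf5d6e33800000000000800000000000800a21aed8c67fe3132319ec800000000000800a21aed8c68000000000008000000000008000000000008000000000008000000000008000000000008000000000008000000000008000000000008000000000007fe4d791910c800000000000800000000000800000000000801e0c1aa5638000000000007ffe75691693801e0c1aa563800000000000800000000000800000000000800000000000801c440c18fa8000000000007ffd8a34b898801c440c18fa8000000000008000000000008006a50042b47fcc3a223cf78000000000008006a50042b4800000000000800000000000800000000000800000000000800000000000800000000000801e0c1aa5638000000000007ffe75691693801e0c1aa5638000000000008000000000008005e98fac4b7fbfda97dc8a8000000000008005e98fac4b8000000000008000000000008000000000008000000000008006a50042b47fcc3a223cf78000000000008006a50042b48000000000008000000000008000000000007fd58efde1f7800000000000800000000000800000000000800000000000800000000000800000000000800000000000800000000000800000000000800000000000800000000000800000000000800000000000800000000000807381bc52c08000000000008000000000008000000000007fded79f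44aa800000000000800f08f6f2407fded79f44aa8000000000008000000000008000000000008000000000007fe60b57e011800000000000800af83f6b267fe60b57e0118000000000008000000000007ff73714403e800d9481dcae8000000000007ff73714403e8000000000008000000000008000000000008000000000008000000000008000000000007fded79f44aa800000000000800f08f6f2407fded79f44aa8000000000008000000000007ff427ea9f5380169bd222af8000000000007ff427ea9f538000000000008000000000008000000000008000000000007ff73714403e800d9481dcae8000000000007ff73714403e8000000000008000000000008000000000008009580349488000000000008000000000008000000000008000000000008000000000008000000000008000000000008000000000008000000000008000000000007fd215a7cd34800000000000800f770996007fd215a7cd348000000000008000000000007ff1397327bf8026bfd903f08000000000007ff1397327bf8000000000008000000000008000000000008000000000007ff4809e9841801e6ac889048000000000007ff4809e9841800000000000800000000000800000000000801730bda6ba8000000000008000000000008000000000008000000000008000000000008000000000008000000000008000000000007ff1397327bf8026bfd903f08000000000007ff1397327bf800000000000800000000000800000000000801fe091479e800000000000800000000000800000000000800000000000800000000000800000000000800000000000801730bda6ba800000000000800000000000800000000000800000000000800000000000800000000000800000000000800000000000800000000000800000000000800000000000800000000000800000000000800000000000800000000000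

/-- Here the quotient is 0.10614468575 and the sign is reversed: the vector has a positive overlap
with its mirror image. -/
theorem lowerCheck_par : lowerCheck false parVector 1061446857500 10000000000000 4 = true := by
  decide +kernel

end

end SquareOctagon

namespace SquareOctagon

noncomputable section

set_option linter.unusedSectionVars false

/-! ## Restricting states of a spin system to some of its sites -/

/-- The states of a system of spins 3/2. -/
abbrev Spins (I : Type*) [Fintype I] [DecidableEq I] := EuclideanSpace ℂ (I → Fin 4)

section Lift

variable {I₀ I₁ I : Type*} [Fintype I₀] [DecidableEq I₀] [Fintype I₁] [DecidableEq I₁] [Fintype I]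
  [DecidableEq I]

open scoped InnerProductSpace ComplexOrder

theorem extend_comp_self {f : I₀ → I} (hf : f.Injective) (σ : I → Fin 4) :
    Function.extend f (σ ∘ f) σ = σ := by
  ext v
  by_cases h : ∃ u, f u = v
  · obtain ⟨u, rfl⟩ := h
    rw [hf.extend_apply]; rfl
  · rw [Function.extend_apply' _ _ _ h]

theorem extend_extend {f : I₀ → I} (hf : f.Injective) (σ ρ : I₀ → Fin 4) (τ : I → Fin 4) :
    Function.extend f σ (Function.extend f ρ τ) = Function.extend f σ τ := by
  ext v
  by_cases h : ∃ u, f u = v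
  · obtain ⟨u, rfl⟩ := h
    rw [hf.extend_apply, hf.extend_apply]
  · rw [Function.extend_apply' _ _ _ h, Function.extend_apply' _ _ _ h,
      Function.extend_apply' _ _ _ h]

theorem extend_comm {f : I₀ → I} {g : I₁ → I} (hf : f.Injective) (hg : g.Injective)
    (hfg : ∀ u v, f u ≠ g v) (σ : I₀ → Fin 4) (ρ : I₁ → Fin 4) (τ : I → Fin 4) :
    Function.extend f σ (Function.extend g ρ τ) = Function.extend g ρ (Function.extend f σ τ) := by
  ext v
  by_cases h : ∃ u, f u = v
  · obtain ⟨u, rfl⟩ := h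
    rw [hf.extend_apply, Function.extend_apply' ρ (Function.extend f σ τ) (f u)
      (fun ⟨w, hw⟩ => hfg u w hw.symm), hf.extend_apply]
  · rw [Function.extend_apply' _ _ _ h]
    by_cases h' : ∃ w, g w = v
    · obtain ⟨w, rfl⟩ := h'
      rw [hg.extend_apply, hg.extend_apply]
    · rw [Function.extend_apply' _ _ _ h', Function.extend_apply' _ _ _ h',
        Function.extend_apply' _ _ _ h]

theorem extend_update {f : I₀ → I} (hf : f.Injective) (σ : I₀ → Fin 4) (τ : I → Fin 4) (v : I₀)
    (a : Fin 4) :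
    Function.extend f (Function.update σ v a) τ =
      Function.update (Function.extend f σ τ) (f v) a := by
  ext u
  by_cases h : ∃ w, f w = u
  · obtain ⟨w, rfl⟩ := h
    rw [hf.extend_apply]
    by_cases hw : w = v
    · subst hw; simp
    · rw [Function.update_of_ne hw, Function.update_of_ne (hf.ne hw), hf.extend_apply]
  · rw [Function.extend_apply' _ _ _ h, Function.update_of_ne (fun e => h ⟨v, e.symm⟩),
      Function.extend_apply' _ _ _ h]

/-- The state of the sites in the range of `f` when the other sites are in the state `τ`. -/
def slice (f : I₀ → I) (τ : I → Fin 4) : Spins I →ₗ[ℂ] Spins I₀ where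
  toFun ψ := WithLp.toLp 2 fun σ => ψ (Function.extend f σ τ)
  map_add' _ _ := rfl
  map_smul' _ _ := rfl

theorem slice_apply (f : I₀ → I) (τ : I → Fin 4) (ψ : Spins I) (σ : I₀ → Fin 4) :
    slice f τ ψ σ = ψ (Function.extend f σ τ) := rfl

theorem slice_extend {f : I₀ → I} (hf : f.Injective) (τ : I → Fin 4) (σ : I₀ → Fin 4) (ψ : Spins I) :
    slice f (Function.extend f σ τ) ψ = slice f τ ψ := by
  ext ρ
  rw [slice_apply, slice_apply, extend_extend hf]

theorem slice_self_apply {f : I₀ → I} (hf : f.Injective) (ψ : Spins I) (σ : I → Fin 4) :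
    slice f σ ψ (σ ∘ f) = ψ σ := by
  rw [slice_apply, extend_comp_self hf]

theorem slice_ext {f : I₀ → I} (hf : f.Injective) {ψ φ : Spins I}
    (h : ∀ τ, slice f τ ψ = slice f τ φ) : ψ = φ := by
  ext σ
  rw [← slice_self_apply hf ψ, ← slice_self_apply hf φ, h]

/-- The map (τ, σ) ↦ (`extend f σ τ`, τ ∘ f), which exchanges the inner values with those of τ, is
an involution on pairs. Slices indexed by all states of the large system therefore cover each
configuration equally often. This redundancy avoids splitting the sites into two sets, at the price
of a constant factor. -/
theorem sum_extend {f : I₀ → I} (hf : f.Injective) (F : (I → Fin 4) → ℂ) :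
    ∑ τ : I → Fin 4, ∑ σ : I₀ → Fin 4, F (Function.extend f σ τ) =
      (Fintype.card (I₀ → Fin 4) : ℂ) * ∑ σ, F σ := by
  let e : (I → Fin 4) × (I₀ → Fin 4) ≃ (I → Fin 4) × (I₀ → Fin 4) :=
    { toFun := fun p => (Function.extend f p.2 p.1, p.1 ∘ f)
      invFun := fun p => (Function.extend f p.2 p.1, p.1 ∘ f)
      left_inv := fun p => by
        ext1
        · exact (extend_extend hf _ _ _).trans (extend_comp_self hf _)
        · exact Function.extend_comp hf _ _
      right_inv := fun p => by
        ext1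
        · exact (extend_extend hf _ _ _).trans (extend_comp_self hf _)
        · exact Function.extend_comp hf _ _ }
  rw [← Fintype.sum_prod_type', Fintype.sum_equiv e (fun p => F (Function.extend f p.2 p.1))
    (fun p => F p.1) fun p => rfl, Fintype.sum_prod_type, Finset.mul_sum]
  refine Finset.sum_congr rfl fun σ _ => ?_
  change ∑ _ρ : I₀ → Fin 4, F σ = _
  rw [Finset.sum_const, nsmul_eq_mul, Finset.card_univ]

theorem sum_inner_slice {f : I₀ → I} (hf : f.Injective) (ψ φ : Spins I) :
    ∑ τ, ⟪slice f τ ψ, slice f τ φ⟫_ℂ = (Fintype.card (I₀ → Fin 4) : ℂ) * ⟪ψ, φ⟫_ℂ := by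
  simp only [PiLp.inner_apply]
  exact sum_extend hf fun σ => ⟪ψ σ, φ σ⟫_ℂ

/-- The operator which acts as `T` on the sites in the range of `f`. -/
def liftOp (f : I₀ → I) (T : Spins I₀ →L[ℂ] Spins I₀) : Spins I →L[ℂ] Spins I :=
  LinearMap.toContinuousLinearMap
    { toFun := fun ψ => WithLp.toLp 2 fun σ => T (slice f σ ψ) (σ ∘ f)
      map_add' := fun ψ φ => by ext σ; simp
      map_smul' := fun c ψ => by ext σ; simp }

theorem liftOp_apply (f : I₀ → I) (T : Spins I₀ →L[ℂ] Spins I₀) (ψ : Spins I) (σ : I → Fin 4) :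
    liftOp f T ψ σ = T (slice f σ ψ) (σ ∘ f) := rfl

theorem slice_liftOp {f : I₀ → I} (hf : f.Injective) (T : Spins I₀ →L[ℂ] Spins I₀) (τ : I → Fin 4)
    (ψ : Spins I) : slice f τ (liftOp f T ψ) = T (slice f τ ψ) := by
  ext σ
  rw [slice_apply, liftOp_apply, slice_extend hf, Function.extend_comp hf]

theorem liftOp_mul {f : I₀ → I} (hf : f.Injective) (S T : Spins I₀ →L[ℂ] Spins I₀) :
    liftOp f (S * T) = liftOp f S * liftOp f T := by
  ext1 ψ
  refine slice_ext hf fun τ => ?_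
  change _ = slice f τ (liftOp f S (liftOp f T ψ))
  rw [slice_liftOp hf, slice_liftOp hf, slice_liftOp hf]
  rfl

theorem liftOp_add (f : I₀ → I) (S T : Spins I₀ →L[ℂ] Spins I₀) :
    liftOp f (S + T) = liftOp f S + liftOp f T := by
  ext ψ σ; rfl

theorem liftOp_sub (f : I₀ → I) (S T : Spins I₀ →L[ℂ] Spins I₀) :
    liftOp f (S - T) = liftOp f S - liftOp f T := by
  ext ψ σ; rfl

theorem liftOp_smul (f : I₀ → I) (c : ℝ) (T : Spins I₀ →L[ℂ] Spins I₀) :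
    liftOp f (c • T) = c • liftOp f T := by
  ext ψ σ; rfl

theorem liftOp_zero (f : I₀ → I) : liftOp f (0 : Spins I₀ →L[ℂ] Spins I₀) = 0 := by
  ext ψ σ; rfl

theorem liftOp_sum {ι : Type*} (f : I₀ → I) (s : Finset ι) (T : ι → Spins I₀ →L[ℂ] Spins I₀) :
    liftOp f (∑ i ∈ s, T i) = ∑ i ∈ s, liftOp f (T i) := by
  classical
  induction s using Finset.induction_on with
  | empty => exact liftOp_zero f
  | insert i s hi ih => rw [Finset.sum_insert hi, Finset.sum_insert hi, liftOp_add, ih]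

theorem liftOp_one {f : I₀ → I} (hf : f.Injective) :
    liftOp f (1 : Spins I₀ →L[ℂ] Spins I₀) = 1 := by
  ext1 ψ
  exact slice_ext hf fun τ => slice_liftOp hf _ _ _

theorem sum_inner_liftOp {f : I₀ → I} (hf : f.Injective) (T : Spins I₀ →L[ℂ] Spins I₀)
    (ψ φ : Spins I) : ∑ τ, ⟪slice f τ ψ, T (slice f τ φ)⟫_ℂ =
      (Fintype.card (I₀ → Fin 4) : ℂ) * ⟪ψ, liftOp f T φ⟫_ℂ := by
  rw [← sum_inner_slice hf]
  simp only [slice_liftOp hf]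

theorem card_ne_zero_complex (I₀ : Type*) [Fintype I₀] [DecidableEq I₀] :
    (Fintype.card (I₀ → Fin 4) : ℂ) ≠ 0 :=
  Nat.cast_ne_zero.2 Fintype.card_ne_zero

theorem nonneg_iff_inner {E : Type*} [NormedAddCommGroup E] [InnerProductSpace ℂ E]
    [CompleteSpace E] {T : E →L[ℂ] E} : 0 ≤ T ↔ ∀ x, 0 ≤ ⟪x, T x⟫_ℂ := by
  rw [ContinuousLinearMap.nonneg_iff_isPositive]
  refine ⟨fun h x => h.inner_nonneg_right x, fun h => ?_⟩
  rw [ContinuousLinearMap.isPositive_iff_complex]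
  intro x
  have hx := star_nonneg_iff.2 (h x)
  rw [show star ⟪x, T x⟫_ℂ = ⟪T x, x⟫_ℂ from inner_conj_symm _ _, Complex.le_def] at hx
  exact ⟨Complex.ext rfl hx.2, hx.1⟩

/-- The quadratic form of the lifted operator is, up to a positive factor, the sum of the quadratic
forms of the slices. This gives one direction. For the other, a state independent of the outer sites
has all its slices equal to a prescribed one. -/
theorem liftOp_nonneg_iff {f : I₀ → I} (hf : f.Injective) {T : Spins I₀ →L[ℂ] Spins I₀} :
    0 ≤ liftOp f T ↔ 0 ≤ T := by
  rw [nonneg_iff_inner, nonneg_iff_inner]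
  constructor
  · intro h φ
    have hs : ∀ τ, slice f τ (WithLp.toLp 2 fun σ => φ (σ ∘ f)) = φ := fun τ => by
      ext σ
      rw [slice_apply]
      change φ _ = _
      rw [Function.extend_comp hf]
    have key := sum_inner_liftOp hf T (WithLp.toLp 2 fun σ => φ (σ ∘ f))
      (WithLp.toLp 2 fun σ => φ (σ ∘ f))
    simp only [hs, Finset.sum_const, nsmul_eq_mul] at key
    have h5 : (0 : ℂ) < (Finset.univ : Finset (I → Fin 4)).card := by
      rw [Finset.card_univ]
      exact Nat.cast_pos.2 Fintype.card_pos
    exact le_of_mul_le_mul_left (a := ((Finset.univ : Finset (I → Fin 4)).card : ℂ))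
      ((mul_zero _).le.trans (key ▸ mul_nonneg (Nat.cast_nonneg _) (h _))) h5
  · intro h ψ
    have h2 : 0 ≤ (Fintype.card (I₀ → Fin 4) : ℂ) * ⟪ψ, liftOp f T ψ⟫_ℂ := by
      rw [← sum_inner_liftOp hf]
      exact Finset.sum_nonneg fun τ _ => h _
    exact le_of_mul_le_mul_left ((mul_zero _).le.trans h2) (Nat.cast_pos.2 Fintype.card_pos)

theorem liftOp_le_iff {f : I₀ → I} (hf : f.Injective) {S T : Spins I₀ →L[ℂ] Spins I₀} :
    liftOp f S ≤ liftOp f T ↔ S ≤ T := by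
  rw [← sub_nonneg, ← liftOp_sub, liftOp_nonneg_iff hf, sub_nonneg]

/-- The states whose restriction to the sites in the range of `f` lies in `U`. -/
def liftSub (f : I₀ → I) (U : Submodule ℂ (Spins I₀)) : Submodule ℂ (Spins I) where
  carrier := {ψ | ∀ τ, slice f τ ψ ∈ U}
  add_mem' hψ hφ τ := by rw [map_add]; exact U.add_mem (hψ τ) (hφ τ)
  zero_mem' τ := by rw [map_zero]; exact U.zero_mem
  smul_mem' c ψ hψ τ := by rw [map_smul]; exact U.smul_mem c (hψ τ)

theorem mem_liftSub {f : I₀ → I} {U : Submodule ℂ (Spins I₀)} {ψ : Spins I} :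
    ψ ∈ liftSub f U ↔ ∀ τ, slice f τ ψ ∈ U := Iff.rfl

theorem liftSub_inf (f : I₀ → I) (U V : Submodule ℂ (Spins I₀)) :
    liftSub f (U ⊓ V) = liftSub f U ⊓ liftSub f V := by
  ext ψ
  simp only [mem_liftSub, Submodule.mem_inf]
  exact forall_and

theorem liftSub_iInf {ι : Sort*} (f : I₀ → I) (U : ι → Submodule ℂ (Spins I₀)) :
    liftSub f (⨅ i, U i) = ⨅ i, liftSub f (U i) := by
  ext ψ
  simp only [mem_liftSub, Submodule.mem_iInf]
  exact forall_comm

/-- Membership and orthogonality are both tested slice by slice, and `liftOp` acts on each slice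
separately. -/
theorem starProjection_liftSub {f : I₀ → I} (hf : f.Injective) (U : Submodule ℂ (Spins I₀)) :
    (liftSub f U).starProjection = liftOp f U.starProjection := by
  ext1 ψ
  have h1 : liftOp f U.starProjection ψ ∈ liftSub f U := mem_liftSub.2 fun τ => by
    rw [slice_liftOp hf]
    exact Submodule.starProjection_apply_mem _ _
  have h2 : ∀ φ ∈ liftSub f U, ⟪ψ - liftOp f U.starProjection ψ, φ⟫_ℂ = 0 := fun φ hφ => by
    have h := sum_inner_slice hf (ψ - liftOp f U.starProjection ψ) φ
    have h0 : ∀ τ, ⟪slice f τ (ψ - liftOp f U.starProjection ψ), slice f τ φ⟫_ℂ = 0 := fun τ => by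
      rw [map_sub, slice_liftOp hf]
      exact Submodule.starProjection_inner_eq_zero _ _ (hφ τ)
    rw [Finset.sum_congr rfl fun τ _ => h0 τ, Finset.sum_const_zero] at h
    exact (mul_eq_zero.1 h.symm).resolve_left (card_ne_zero_complex I₀)
  exact Submodule.eq_starProjection_of_mem_of_inner_eq_zero h1 h2

/-- An operator on some sites preserves a condition on other sites. -/
theorem liftOp_mem_liftSub {f : I₀ → I} {g : I₁ → I} (hf : f.Injective) (hg : g.Injective)
    (hfg : ∀ u v, f u ≠ g v) (T : Spins I₀ →L[ℂ] Spins I₀) {U : Submodule ℂ (Spins I₁)}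
    {ψ : Spins I} (hψ : ψ ∈ liftSub g U) : liftOp f T ψ ∈ liftSub g U := by
  intro τ
  have h : slice g τ (liftOp f T ψ) = ∑ ρ : I₀ → Fin 4,
      (T (EuclideanSpace.single ρ 1) (τ ∘ f)) • slice g (Function.extend f ρ τ) ψ := by
    ext σ
    have hτ : (Function.extend g σ τ) ∘ f = τ ∘ f := by
      ext u
      simp only [Function.comp_apply]
      rw [Function.extend_apply' _ _ _ (fun ⟨w, hw⟩ => hfg u w hw.symm)]
    have hs : slice f (Function.extend g σ τ) ψ = ∑ ρ : I₀ → Fin 4,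
        (slice g (Function.extend f ρ τ) ψ σ) • EuclideanSpace.single ρ (1 : ℂ) := by
      ext ρ
      rw [slice_apply, extend_comm hf hg hfg]
      simp [slice_apply, Finset.sum_apply, Pi.single_apply]
    rw [slice_apply, liftOp_apply, hτ, hs, map_sum]
    simp [Finset.sum_apply, mul_comm]
  rw [h]
  exact Submodule.sum_mem _ fun ρ _ => Submodule.smul_mem _ _ (hψ _)

/-- The condition on the states of two spins 3/2 that they contain no component of total spin 3. -/
def sing {I : Type*} [Fintype I] [DecidableEq I] (v w : I) : Submodule ℂ (Spins I) where
  carrier := {ψ | ∀ (σ : I → Fin 4) (k : ℕ), ∑ a : Fin 4, ∑ b : Fin 4,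
    (if (a : ℕ) + b = k then (Real.sqrt (Nat.choose 3 a) * Real.sqrt (Nat.choose 3 b) : ℂ) *
      ψ (Function.update (Function.update σ v a) w b) else 0) = 0}
  add_mem' {ψ φ} hψ hφ σ k := by
    refine Eq.trans ?_ ((congrArg₂ (· + ·) (hψ σ k) (hφ σ k)).trans (add_zero 0))
    simp only [← Finset.sum_add_distrib, PiLp.add_apply]
    refine Finset.sum_congr rfl fun a _ => Finset.sum_congr rfl fun b _ => ?_
    split_ifs <;> ring
  zero_mem' σ k := by simp
  smul_mem' c ψ hψ σ k := by
    refine Eq.trans ?_ ((congrArg (c * ·) (hψ σ k)).trans (mul_zero c))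
    simp only [Finset.mul_sum, PiLp.smul_apply, smul_eq_mul]
    refine Finset.sum_congr rfl fun a _ => Finset.sum_congr rfl fun b _ => ?_
    split_ifs <;> ring

theorem mem_sing {v w : I} {ψ : Spins I} : ψ ∈ sing v w ↔ ∀ (σ : I → Fin 4) (k : ℕ),
    ∑ a : Fin 4, ∑ b : Fin 4,
    (if (a : ℕ) + b = k then (Real.sqrt (Nat.choose 3 a) * Real.sqrt (Nat.choose 3 b) : ℂ) *
      ψ (Function.update (Function.update σ v a) w b) else 0) = 0 := Iff.rfl

theorem sing_map {f : I₀ → I} (hf : f.Injective) (v w : I₀) :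
    sing (f v) (f w) = liftSub f (sing v w) := by
  ext ψ
  simp only [mem_liftSub, mem_sing, slice_apply, extend_update hf]
  refine ⟨fun h τ σ k => h _ k, fun h σ k => ?_⟩
  have := h σ (σ ∘ f) k
  rwa [extend_comp_self hf] at this

end Lift

end

end SquareOctagon

namespace SquareOctagon

noncomputable section

/-! ## Two orthogonal projections on a finite-dimensional space -/

section Projections

open scoped InnerProductSpace ComplexOrder

variable {V : Type*} [NormedAddCommGroup V] [InnerProductSpace ℂ V] [FiniteDimensional ℂ V]

theorem mem_spectrum_real_iff {T : V →L[ℂ] V} {μ : ℝ} :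
    μ ∈ spectrum ℝ T ↔ ∃ x : V, x ≠ 0 ∧ T x = (μ : ℂ) • x := by
  have h : μ ∈ spectrum ℝ T ↔ ¬ IsUnit (algebraMap ℝ (V →L[ℂ] V) μ - T) := Iff.rfl
  have hu : IsUnit (algebraMap ℝ (V →L[ℂ] V) μ - T) ↔
      Function.Injective (algebraMap ℝ (V →L[ℂ] V) μ - T) := by
    constructor
    · rintro ⟨u, hu⟩ x y hxy
      have h1 : ∀ x, (↑u⁻¹ : V →L[ℂ] V) ((u : V →L[ℂ] V) x) = x := fun x => by
        change ((↑u⁻¹ : V →L[ℂ] V) * (u : V →L[ℂ] V)) x = x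
        rw [Units.inv_mul]; rfl
      rw [← hu] at hxy
      rw [← h1 x, hxy, h1]
    · intro hi
      let e := (LinearEquiv.ofInjectiveEndo
        (algebraMap ℝ (V →L[ℂ] V) μ - T : V →L[ℂ] V).toLinearMap hi).toContinuousLinearEquiv
      have he : ∀ x, (algebraMap ℝ (V →L[ℂ] V) μ - T) x = e x := fun x => rfl
      refine ⟨⟨_, (e.symm : V →L[ℂ] V), ?_, ?_⟩, rfl⟩
      · ext x
        change (algebraMap ℝ (V →L[ℂ] V) μ - T) (e.symm x) = x
        rw [he, e.apply_symm_apply]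
      · ext x
        change e.symm ((algebraMap ℝ (V →L[ℂ] V) μ - T) x) = x
        rw [he, e.symm_apply_apply]
  have ha : ∀ x, (algebraMap ℝ (V →L[ℂ] V) μ - T) x = (μ : ℂ) • x - T x := fun x => by
    rw [Algebra.algebraMap_eq_smul_one]
    rfl
  rw [h, hu, injective_iff_map_eq_zero]
  push Not
  refine exists_congr fun x => ?_
  rw [ha, sub_eq_zero, and_comm, ne_eq, eq_comm (a := T x)]

theorem nonneg_polynomial_of_spectrum {T : V →L[ℂ] V} (hT : IsSelfAdjoint T) (f : Polynomial ℝ)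
    (h : ∀ μ ∈ spectrum ℝ T, 0 ≤ f.eval μ) : 0 ≤ Polynomial.aeval T f := by
  rw [← cfc_polynomial (R := ℝ) f T hT]
  exact cfc_nonneg h

/-- The sum of the projections along `A` and along `B`. -/
def defect (A B : Submodule ℂ V) : V →L[ℂ] V :=
  (1 - A.starProjection) + (1 - B.starProjection)

variable (A B : Submodule ℂ V)

theorem isSelfAdjoint_one_sub : IsSelfAdjoint (1 - A.starProjection : V →L[ℂ] V) :=
  (IsSelfAdjoint.one _).sub (isSelfAdjoint_starProjection A)

theorem isSelfAdjoint_defect : IsSelfAdjoint (defect A B) :=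
  (isSelfAdjoint_one_sub A).add (isSelfAdjoint_one_sub B)

theorem one_sub_mul_self :
    (1 - A.starProjection : V →L[ℂ] V) * (1 - A.starProjection) = 1 - A.starProjection :=
  A.isIdempotentElem_starProjection.one_sub

/-- This identity makes the optimal constant a spectral quantity of the single operator `defect A
B`. -/
theorem anticommutator_eq : (1 - A.starProjection) * (1 - B.starProjection) +
    (1 - B.starProjection) * (1 - A.starProjection) = defect A B ^ 2 - defect A B := by
  have hA := one_sub_mul_self A
  have hB := one_sub_mul_self B
  rw [defect, sq, mul_add, add_mul, add_mul, hA, hB]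
  abel

theorem inner_starProjection_left (x y : V) :
    ⟪A.starProjection x, y⟫_ℂ = ⟪x, A.starProjection y⟫_ℂ :=
  A.inner_starProjection_left_eq_right x y

theorem one_sub_nonneg : 0 ≤ (1 - A.starProjection : V →L[ℂ] V) := by
  rw [← one_sub_mul_self A]
  nth_rewrite 1 [← (isSelfAdjoint_one_sub A).star_eq]
  exact star_mul_self_nonneg _

theorem defect_nonneg : 0 ≤ defect A B := add_nonneg (one_sub_nonneg A) (one_sub_nonneg B)

variable {A B}

theorem spectrum_nonneg {T : V →L[ℂ] V} (hT : 0 ≤ T) {g : ℝ} (hg : g ∈ spectrum ℝ T) : 0 ≤ g :=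
  spectrum_nonneg_of_nonneg hT hg

theorem defect_apply (x : V) :
    defect A B x = (2 : ℂ) • x - (A.starProjection x + B.starProjection x) := by
  change (x - A.starProjection x) + (x - B.starProjection x) = _
  rw [two_smul]
  abel

theorem defect_eq_zero_iff {x : V} : defect A B x = 0 ↔ x ∈ A ⊓ B := by
  constructor
  · intro h
    have h1 : ∀ U : Submodule ℂ V, ⟪x, (1 - U.starProjection : V →L[ℂ] V) x⟫_ℂ =
        ((‖(1 - U.starProjection : V →L[ℂ] V) x‖ ^ 2 : ℝ) : ℂ) := fun U => by
      nth_rewrite 1 [← one_sub_mul_self U]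
      change ⟪x, (1 - U.starProjection : V →L[ℂ] V) ((1 - U.starProjection : V →L[ℂ] V) x)⟫_ℂ = _
      rw [← ContinuousLinearMap.adjoint_inner_left, ← ContinuousLinearMap.star_eq_adjoint,
        (isSelfAdjoint_one_sub U).star_eq, inner_self_eq_norm_sq_to_K]
      push_cast
      rfl
    have h2 : ⟪x, defect A B x⟫_ℂ = 0 := by rw [h, inner_zero_right]
    change ⟪x, (1 - A.starProjection : V →L[ℂ] V) x + (1 - B.starProjection : V →L[ℂ] V) x⟫_ℂ = 0
      at h2
    rw [inner_add_right, h1, h1, ← Complex.ofReal_add, Complex.ofReal_eq_zero] at h2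
    have ha : ‖(1 - A.starProjection : V →L[ℂ] V) x‖ = 0 := by nlinarith [sq_nonneg ‖(1 - B.starProjection : V →L[ℂ] V) x‖, sq_nonneg ‖(1 - A.starProjection : V →L[ℂ] V) x‖]
    have hb : ‖(1 - B.starProjection : V →L[ℂ] V) x‖ = 0 := by nlinarith [sq_nonneg ‖(1 - B.starProjection : V →L[ℂ] V) x‖, sq_nonneg ‖(1 - A.starProjection : V →L[ℂ] V) x‖]
    have hc : ∀ U : Submodule ℂ V, ‖(1 - U.starProjection : V →L[ℂ] V) x‖ = 0 → x ∈ U :=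
      fun U hU => by
        have h3 : x - U.starProjection x = 0 := norm_eq_zero.1 hU
        rw [sub_eq_zero.1 h3]
        exact Submodule.starProjection_apply_mem _ _
    exact ⟨hc A ha, hc B hb⟩
  · rintro ⟨ha, hb⟩
    rw [defect_apply, Submodule.starProjection_eq_self_iff.2 ha,
      Submodule.starProjection_eq_self_iff.2 hb, two_smul, sub_self]

/-- Functional calculus: the inequality says D² - D + tD ≥ 0, that is, g (g - (1 - t)) ≥ 0 for every
eigenvalue g of D. As D ≥ 0, this is a condition on the nonzero eigenvalues only. -/
theorem neg_smul_defect_le_iff {t : ℝ} :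
    (-t) • ((1 - A.starProjection : V →L[ℂ] V) + (1 - B.starProjection)) ≤
      (1 - A.starProjection) * (1 - B.starProjection) +
        (1 - B.starProjection) * (1 - A.starProjection) ↔
      ∀ g ∈ spectrum ℝ (defect A B), g ≠ 0 → 1 - t ≤ g := by
  rw [anticommutator_eq, ← sub_nonneg]
  change 0 ≤ defect A B ^ 2 - defect A B - (-t) • defect A B ↔ _
  constructor
  · intro h g hg hg0
    have hpos := spectrum_nonneg (defect_nonneg A B) hg
    obtain ⟨x, hx, hgx⟩ := mem_spectrum_real_iff.1 hg
    have h1 := (nonneg_iff_inner.1 h x)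
    have h2 : (defect A B ^ 2 - defect A B - (-t) • defect A B) x =
        ((g * g - g + t * g : ℝ) : ℂ) • x := by
      rw [sq]
      change defect A B (defect A B x) - defect A B x - (-t) • defect A B x = _
      rw [hgx, map_smul, hgx, smul_smul, ← Complex.coe_smul, smul_smul, ← sub_smul, ← sub_smul]
      congr 1
      push_cast
      ring
    rw [h2, inner_smul_right, inner_self_eq_norm_sq_to_K] at h1
    have h3 : 0 ≤ (g * g - g + t * g) * ‖x‖ ^ 2 := by
      rw [← Complex.zero_le_real, Complex.ofReal_mul, Complex.ofReal_pow]
      exact h1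
    have h4 : 0 ≤ g * g - g + t * g :=
      nonneg_of_mul_nonneg_left h3 (pow_pos (norm_pos_iff.2 hx) 2)
    have h5 : 0 ≤ g * (g - (1 - t)) := by linarith
    have h6 := nonneg_of_mul_nonneg_right h5 (lt_of_le_of_ne hpos (Ne.symm hg0))
    linarith
  · intro h
    have h1 := nonneg_polynomial_of_spectrum (isSelfAdjoint_defect A B)
      (Polynomial.X ^ 2 - Polynomial.X - Polynomial.C (-t) * Polynomial.X) fun g hg => by
        have hpos := spectrum_nonneg (defect_nonneg A B) hg
        simp only [Polynomial.eval_sub, Polynomial.eval_pow, Polynomial.eval_X,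
          Polynomial.eval_mul, Polynomial.eval_C]
        by_cases h0 : g = 0
        · simp [h0]
        · nlinarith [h g hg h0]
    simpa [Algebra.smul_def] using h1

theorem finite_spectrum_real (T : V →L[ℂ] V) : (spectrum ℝ T).Finite := by
  have h : (fun μ : ℝ => (μ : ℂ)) '' spectrum ℝ T ⊆ spectrum ℂ (T.toLinearMap : Module.End ℂ V) := by
    rintro _ ⟨μ, hμ, rfl⟩
    obtain ⟨x, hx, h⟩ := mem_spectrum_real_iff.1 hμ
    exact (Module.End.hasEigenvalue_of_hasEigenvector
      (Module.End.hasEigenvector_iff.2 ⟨Module.End.mem_eigenspace_iff.2 h, hx⟩)).mem_spectrum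
  exact Set.Finite.of_finite_image ((Module.End.finite_spectrum _).subset h)
    Complex.ofReal_injective.injOn

/-- The optimal constant is determined by the least nonzero eigenvalue. -/
theorem exists_isOptimal (h : ∃ g ∈ spectrum ℝ (defect A B), g ≠ 0) :
    ∃ g, (g ∈ spectrum ℝ (defect A B) ∧ g ≠ 0) ∧
      (∀ g' ∈ spectrum ℝ (defect A B), g' ≠ 0 → g ≤ g') ∧
      IsOptimal (1 - A.starProjection : V →L[ℂ] V) (1 - B.starProjection) (1 - g) := by
  have hfin : {g | g ∈ spectrum ℝ (defect A B) ∧ g ≠ 0}.Finite :=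
    (finite_spectrum_real (defect A B)).subset fun g hg => hg.1
  obtain ⟨g, hg, hmin⟩ := hfin.exists_minimal h
  have hm : ∀ g' ∈ spectrum ℝ (defect A B), g' ≠ 0 → g ≤ g' := fun g' h1 h2 => by
    rcases le_total g g' with h3 | h3
    · exact h3
    · exact hmin ⟨h1, h2⟩ h3
  refine ⟨g, hg, hm, neg_smul_defect_le_iff.2 fun g' h1 h2 => ?_, fun t ht => ?_⟩
  · linarith [hm g' h1 h2]
  · linarith [neg_smul_defect_le_iff.1 ht g hg.1 hg.2]

theorem isOptimal_spectrum {η : ℝ}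
    (h : IsOptimal (1 - A.starProjection : V →L[ℂ] V) (1 - B.starProjection) η) :
    (1 - η ∈ spectrum ℝ (defect A B)) ∧
      ∀ g ∈ spectrum ℝ (defect A B), g ≠ 0 → 1 - η ≤ g := by
  refine ⟨?_, neg_smul_defect_le_iff.1 h.1⟩
  by_cases hne : ∃ g ∈ spectrum ℝ (defect A B), g ≠ 0
  · obtain ⟨g, hg, -, h3⟩ := exists_isOptimal hne
    have := h3.unique h
    rw [← this]
    simpa using hg.1
  -- If D had no nonzero eigenvalue, every real number would satisfy the inequality and there would
  -- be no least one. The number η - 1 provides the contradiction.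
  · push Not at hne
    have := h.2 (neg_smul_defect_le_iff (t := η - 1).2 fun g h1 h2 => (h2 (hne g h1)).elim)
    linarith

/-- An upper bound for the overlap of `A` and `B` modulo their intersection bounds the defect. -/
theorem le_of_overlap_le {N₁ N₂ : Submodule ℂ V} (hA : A ≤ N₁) (hB : B ≤ N₂)
    (hPA : ∀ x ∈ N₂, A.starProjection x ∈ N₂) (hPB : ∀ x ∈ N₁, B.starProjection x ∈ N₁)
    {c : ℝ} (hc : 0 ≤ c)
    (h : ∀ p ∈ A ⊓ N₂, ∀ q ∈ B ⊓ N₁, (∀ k ∈ A ⊓ B, ⟪k, p⟫_ℂ = 0) → (∀ k ∈ A ⊓ B, ⟪k, q⟫_ℂ = 0) →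
      2 * (⟪p, q⟫_ℂ).re ≤ c * (‖p‖ ^ 2 + ‖q‖ ^ 2)) :
    ∀ g ∈ spectrum ℝ (defect A B), g ≠ 0 → 1 - c ≤ g := by
  intro g hg hg0
  by_contra! hlt
  obtain ⟨ψ, hψ, hgψ⟩ := mem_spectrum_real_iff.1 hg
  have hgc : (g : ℂ) ≠ 0 := Complex.ofReal_ne_zero.2 hg0
  have hort : ∀ k ∈ A ⊓ B, ⟪k, ψ⟫_ℂ = 0 := fun k hk => by
    have h1 : ⟪k, defect A B ψ⟫_ℂ = 0 := by
      rw [← ContinuousLinearMap.adjoint_inner_left, ← ContinuousLinearMap.star_eq_adjoint,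
        (isSelfAdjoint_defect A B).star_eq, defect_eq_zero_iff.2 hk, inner_zero_left]
    rw [hgψ, inner_smul_right] at h1
    exact (mul_eq_zero.1 h1).resolve_left hgc
  have hsum : A.starProjection ψ + B.starProjection ψ = ((2 - g : ℝ) : ℂ) • ψ := by
    have h1 := defect_apply (A := A) (B := B) ψ
    rw [hgψ, eq_sub_iff_add_eq, ← eq_sub_iff_add_eq', ← sub_smul] at h1
    rw [h1]
    push_cast
    rfl
  set p := A.starProjection ψ with hp
  set q := B.starProjection ψ with hq
  have hpA : p ∈ A := Submodule.starProjection_apply_mem _ _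
  have hqB : q ∈ B := Submodule.starProjection_apply_mem _ _
  have hPp : A.starProjection p = p := Submodule.starProjection_eq_self_iff.2 hpA
  have hQq : B.starProjection q = q := Submodule.starProjection_eq_self_iff.2 hqB
  have hPq : A.starProjection q = ((1 - g : ℝ) : ℂ) • p := by
    have h1 := congrArg A.starProjection hsum
    rw [map_add, map_smul, hPp, ← hp] at h1
    rw [← eq_sub_iff_add_eq'] at h1
    rw [h1]
    nth_rewrite 2 [← one_smul ℂ p]
    rw [← sub_smul]
    congr 1
    push_cast
    ring
  have hQp : B.starProjection p = ((1 - g : ℝ) : ℂ) • q := by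
    have h1 := congrArg B.starProjection hsum
    rw [map_add, map_smul, hQq, ← hq] at h1
    rw [← eq_sub_iff_add_eq] at h1
    rw [h1]
    nth_rewrite 2 [← one_smul ℂ q]
    rw [← sub_smul]
    congr 1
    push_cast
    ring
  -- Here c ≥ 0 enters: it gives g < 1, so the relation P_A q = (1 - g) p can be solved for p. Since
  -- q lies in B ≤ N₂ and P_A preserves N₂, the vector p lies in N₂ as well; q lies in N₁ by
  -- symmetry.
  have hne : ((1 - g : ℝ) : ℂ) ≠ 0 := Complex.ofReal_ne_zero.2 (by linarith)
  have hpN : p ∈ N₂ := by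
    have h1 := hPA q (hB hqB)
    rw [hPq] at h1
    exact (Submodule.smul_mem_iff _ hne).1 h1
  have hqN : q ∈ N₁ := by
    have h1 := hPB p (hA hpA)
    rw [hQp] at h1
    exact (Submodule.smul_mem_iff _ hne).1 h1
  have hpK : ∀ k ∈ A ⊓ B, ⟪k, p⟫_ℂ = 0 := fun k hk => by
    rw [hp, ← inner_starProjection_left, Submodule.starProjection_eq_self_iff.2 hk.1, hort k hk]
  have hqK : ∀ k ∈ A ⊓ B, ⟪k, q⟫_ℂ = 0 := fun k hk => by
    rw [hq, ← inner_starProjection_left, Submodule.starProjection_eq_self_iff.2 hk.2, hort k hk]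
  have key := h p ⟨hpA, hpN⟩ q ⟨hqB, hqN⟩ hpK hqK
  have e1 : ⟪p, q⟫_ℂ = (((1 - g) * ‖p‖ ^ 2 : ℝ) : ℂ) := by
    rw [← hPp, inner_starProjection_left, hPq, inner_smul_right, inner_self_eq_norm_sq_to_K]
    push_cast
    rw [hPp]
    rfl
  have e2 : ⟪p, q⟫_ℂ = (((1 - g) * ‖q‖ ^ 2 : ℝ) : ℂ) := by
    rw [← hQq, ← inner_starProjection_left, hQp, inner_smul_left, inner_self_eq_norm_sq_to_K,
      Complex.conj_ofReal]
    push_cast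
    rw [hQq]
    rfl
  have r1 : (⟪p, q⟫_ℂ).re = (1 - g) * ‖p‖ ^ 2 := by rw [e1, Complex.ofReal_re]
  have r2 : (⟪p, q⟫_ℂ).re = (1 - g) * ‖q‖ ^ 2 := by rw [e2, Complex.ofReal_re]
  -- The hypothesis bounds (1 - g)(‖p‖² + ‖q‖²) by c (‖p‖² + ‖q‖²), although 1 - g > c. Hence both
  -- vectors vanish, and so does the eigenvector, because p + q = (2 - g) ψ.
  have hz : ‖p‖ ^ 2 + ‖q‖ ^ 2 ≤ 0 := by
    by_contra! hpos
    nlinarith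
  have hp0 : p = 0 := by
    have : ‖p‖ = 0 := by nlinarith [sq_nonneg ‖p‖, sq_nonneg ‖q‖]
    exact norm_eq_zero.1 this
  have hq0 : q = 0 := by
    have : ‖q‖ = 0 := by nlinarith [sq_nonneg ‖p‖, sq_nonneg ‖q‖]
    exact norm_eq_zero.1 this
  rw [hp0, hq0, add_zero] at hsum
  rcases smul_eq_zero.1 hsum.symm with h1 | h1
  · have := Complex.ofReal_eq_zero.1 h1
    linarith
  · exact hψ h1

/-- Conversely, a bound for the defect bounds the overlap. -/
theorem overlap_le_of_le {c : ℝ} (hc : 0 ≤ c)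
    (h : ∀ g ∈ spectrum ℝ (defect A B), g ≠ 0 → 1 - c ≤ g) {p q : V} (hp : p ∈ A) (hq : q ∈ B)
    (hpK : ∀ k ∈ A ⊓ B, ⟪k, p⟫_ℂ = 0) (hqK : ∀ k ∈ A ⊓ B, ⟪k, q⟫_ℂ = 0) :
    2 * (⟪p, q⟫_ℂ).re ≤ c * (‖p‖ ^ 2 + ‖q‖ ^ 2) := by
  have hsa := isSelfAdjoint_defect A B
  have hadj : ∀ x y, ⟪defect A B x, y⟫_ℂ = ⟪x, defect A B y⟫_ℂ := fun x y => by
    rw [← ContinuousLinearMap.adjoint_inner_right, ← ContinuousLinearMap.star_eq_adjoint,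
      hsa.star_eq]
  -- The sum p + q is orthogonal to A ⊓ B, the kernel of the self-adjoint operator D, hence lies in
  -- its range.
  obtain ⟨x, hx⟩ : ∃ x, defect A B x = p + q := by
    have h1 : p + q ∈ (LinearMap.range (defect A B).toLinearMap)ᗮᗮ := by
      refine (Submodule.mem_orthogonal _ _).2 fun k hk => ?_
      have h2 : defect A B k = 0 := by
        refine ext_inner_right ℂ fun y => ?_
        have h3 : ⟪defect A B y, k⟫_ℂ = 0 := (Submodule.mem_orthogonal _ _).1 hk _ ⟨y, rfl⟩
        rw [inner_zero_left, hadj, ← inner_conj_symm, h3, map_zero]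
      have h3 := defect_eq_zero_iff.1 h2
      rw [inner_add_right, hpK k h3, hqK k h3, add_zero]
    rw [Submodule.orthogonal_orthogonal] at h1
    exact h1
  -- The polynomial is nonnegative on the spectrum, including the eigenvalue 0. Evaluated at the
  -- preimage x of y = p + q it gives ⟨y, D y⟩ ≥ (1 - c) ‖y‖².
  have hcub := nonneg_polynomial_of_spectrum hsa
    (Polynomial.X ^ 3 - Polynomial.C (1 - c) * Polynomial.X ^ 2) fun g hg => by
      have hpos := spectrum_nonneg (defect_nonneg A B) hg
      simp only [Polynomial.eval_sub, Polynomial.eval_pow, Polynomial.eval_X,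
        Polynomial.eval_mul, Polynomial.eval_C]
      by_cases h0 : g = 0
      · simp [h0]
      · nlinarith [h g hg h0, mul_nonneg (sq_nonneg g) (sub_nonneg.2 (h g hg h0))]
  set y := p + q with hy
  have h1 : (1 - c) * ‖y‖ ^ 2 ≤ (⟪y, defect A B y⟫_ℂ).re := by
    have h2 := nonneg_iff_inner.1 hcub x
    have h3 : (Polynomial.aeval (defect A B)
        (Polynomial.X ^ 3 - Polynomial.C (1 - c) * Polynomial.X ^ 2)) x =
        defect A B (defect A B y) - ((1 - c : ℝ) : ℂ) • defect A B y := by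
      rw [← hx, map_sub, map_mul, map_pow, map_pow, Polynomial.aeval_X, Polynomial.aeval_C,
        ← Algebra.smul_def, Complex.coe_smul]
      rfl
    rw [h3, inner_sub_right, inner_smul_right, ← hadj x (defect A B y), ← hadj x y, hx,
      inner_self_eq_norm_sq_to_K] at h2
    have h4 := (Complex.le_def.1 h2).1
    rw [Complex.sub_re, Complex.zero_re] at h4
    have h5 : (((1 - c : ℝ) : ℂ) * ((‖y‖ : ℂ)) ^ 2).re = (1 - c) * ‖y‖ ^ 2 := by
      rw [← Complex.ofReal_pow, ← Complex.ofReal_mul, Complex.ofReal_re]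
    have h6 : (((1 - c : ℝ) : ℂ) * ((RCLike.ofReal ‖y‖ : ℂ)) ^ 2).re = (1 - c) * ‖y‖ ^ 2 := h5
    linarith
  set a := A.starProjection y with ha
  set b := B.starProjection y with hb
  have hPa : ∀ (U : Submodule ℂ V) z, (⟪z, U.starProjection z⟫_ℂ).re = ‖U.starProjection z‖ ^ 2 :=
    fun U z => by
      have h2 : U.starProjection (U.starProjection z) = U.starProjection z :=
        Submodule.starProjection_eq_self_iff.2 (Submodule.starProjection_apply_mem _ _)
      rw [← h2, ← inner_starProjection_left, inner_self_eq_norm_sq_to_K, h2]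
      change (((‖U.starProjection z‖ : ℂ)) ^ 2).re = _
      rw [← Complex.ofReal_pow, Complex.ofReal_re]
  have h2 : (⟪y, defect A B y⟫_ℂ).re = 2 * ‖y‖ ^ 2 - (‖a‖ ^ 2 + ‖b‖ ^ 2) := by
    rw [defect_apply, inner_sub_right, inner_add_right, inner_smul_right,
      inner_self_eq_norm_sq_to_K, Complex.sub_re, Complex.add_re, hPa, hPa]
    change (2 * ((‖y‖ : ℂ)) ^ 2).re - _ = _
    rw [← Complex.ofReal_pow, ← Complex.ofReal_ofNat, ← Complex.ofReal_mul, Complex.ofReal_re]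
  -- As p and q lie in the ranges, ‖y‖² = ⟨P_A y, p⟩ + ⟨P_B y, q⟩. Combined with the bound for ‖a‖²
  -- + ‖b‖² this yields ‖p + q‖² ≤ (1 + c)(‖p‖² + ‖q‖²), whose expansion is the claim.
  have h3 : ‖y‖ ^ 2 ≤ ‖a‖ * ‖p‖ + ‖b‖ * ‖q‖ := by
    have e : ((‖y‖ : ℂ)) ^ 2 = ⟪a, p⟫_ℂ + ⟪b, q⟫_ℂ := by
      rw [ha, hb, inner_starProjection_left, inner_starProjection_left,
        Submodule.starProjection_eq_self_iff.2 hp, Submodule.starProjection_eq_self_iff.2 hq,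
        ← inner_add_right, ← hy]
      exact (inner_self_eq_norm_sq_to_K y).symm
    have e2 := congrArg Complex.re e
    rw [← Complex.ofReal_pow, Complex.ofReal_re, Complex.add_re] at e2
    rw [e2]
    exact add_le_add (re_inner_le_norm (𝕜 := ℂ) a p) (re_inner_le_norm (𝕜 := ℂ) b q)
  have h4 : ‖y‖ ^ 2 = ‖p‖ ^ 2 + 2 * (⟪p, q⟫_ℂ).re + ‖q‖ ^ 2 := norm_add_sq (𝕜 := ℂ) p q
  have h5 : ‖a‖ ^ 2 + ‖b‖ ^ 2 ≤ (1 + c) * ‖y‖ ^ 2 := by linarith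
  have h6 : (‖y‖ ^ 2) ^ 2 ≤ (‖a‖ ^ 2 + ‖b‖ ^ 2) * (‖p‖ ^ 2 + ‖q‖ ^ 2) := by
    have h7 : (‖y‖ ^ 2) ^ 2 ≤ (‖a‖ * ‖p‖ + ‖b‖ * ‖q‖) ^ 2 :=
      pow_le_pow_left₀ (sq_nonneg _) h3 2
    nlinarith [sq_nonneg (‖a‖ * ‖q‖ - ‖b‖ * ‖p‖)]
  have h7 : ‖y‖ ^ 2 * ‖y‖ ^ 2 ≤ ‖y‖ ^ 2 * ((1 + c) * (‖p‖ ^ 2 + ‖q‖ ^ 2)) := by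
    nlinarith [mul_le_mul_of_nonneg_right h5 (add_nonneg (sq_nonneg ‖p‖) (sq_nonneg ‖q‖))]
  have h8 : ‖y‖ ^ 2 ≤ (1 + c) * (‖p‖ ^ 2 + ‖q‖ ^ 2) := by
    rcases (sq_nonneg ‖y‖).eq_or_lt with h0 | h0
    · rw [← h0]
      positivity
    · exact le_of_mul_le_mul_left h7 h0
  linarith

/-- The spectrum of `P_A + P_B` compressed to a space containing `A` and `B`. -/
theorem isGreatest_spectrum_compression {N : Submodule ℂ V} (hA : A ≤ N) (hB : B ≤ N) {η : ℝ}
    (h0 : 0 < η) (h1 : η < 1)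
    (h : IsOptimal (1 - A.starProjection : V →L[ℂ] V) (1 - B.starProjection) η) :
    IsGreatest {t : ℝ | t ∈ spectrum ℝ (N.orthogonalProjectionOnto ∘L
      (A.starProjection + B.starProjection) ∘L N.subtypeL) ∧ t ∉ Set.range ((↑) : ℤ → ℝ)}
      (1 + η) := by
  obtain ⟨hη, hmin⟩ := isOptimal_spectrum h
  have happ : ∀ (x : N), ((N.orthogonalProjectionOnto ∘L
      (A.starProjection + B.starProjection) ∘L N.subtypeL) x : V) =
      A.starProjection x + B.starProjection x := fun x =>
    Submodule.starProjection_eq_self_iff.2 (N.add_mem (hA (Submodule.starProjection_apply_mem _ _))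
      (hB (Submodule.starProjection_apply_mem _ _)))
  refine ⟨⟨?_, ?_⟩, ?_⟩
  · obtain ⟨ψ, hψ, hgψ⟩ := mem_spectrum_real_iff.1 hη
    have hsum : A.starProjection ψ + B.starProjection ψ = ((1 + η : ℝ) : ℂ) • ψ := by
      have h1 := defect_apply (A := A) (B := B) ψ
      rw [hgψ, eq_sub_iff_add_eq, ← eq_sub_iff_add_eq', ← sub_smul] at h1
      rw [h1]
      congr 1
      push_cast
      ring
    have hN : ψ ∈ N := by
      rw [← Submodule.smul_mem_iff N (s := ((1 + η : ℝ) : ℂ))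
        (Complex.ofReal_ne_zero.2 (by linarith)), ← hsum]
      exact N.add_mem (hA (Submodule.starProjection_apply_mem _ _))
        (hB (Submodule.starProjection_apply_mem _ _))
    refine mem_spectrum_real_iff.2 ⟨⟨ψ, hN⟩, fun h => hψ (congrArg Subtype.val h), ?_⟩
    exact Subtype.ext ((happ _).trans hsum)
  · rintro ⟨k, hk⟩
    have a1 : (1 : ℝ) < k := by rw [hk]; linarith
    have a2 : (k : ℝ) < 2 := by rw [hk]; linarith
    have a3 : (1 : ℤ) < k := by exact_mod_cast a1
    have a4 : k < (2 : ℤ) := by exact_mod_cast a2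
    omega
  · rintro t ⟨ht, hint⟩
    obtain ⟨x, hx, hxt⟩ := mem_spectrum_real_iff.1 ht
    have h2 : A.starProjection (x : V) + B.starProjection x = (t : ℂ) • (x : V) := by
      rw [← happ, hxt]
      rfl
    have h3 : 2 - t ∈ spectrum ℝ (defect A B) := by
      refine mem_spectrum_real_iff.2 ⟨x, fun h => hx (Subtype.ext h), ?_⟩
      rw [defect_apply, h2, ← sub_smul]
      push_cast
      rfl
    -- The kernel of the defect corresponds to the eigenvalue 2 of the sum of the projections, which
    -- is excluded as an integer.
    have h4 : 2 - t ≠ 0 := fun h => hint ⟨2, by push_cast; linarith⟩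
    linarith [hmin _ h3 h4]

end Projections

end

end SquareOctagon

namespace SquareOctagon

noncomputable section

/-! ## The edge terms -/

section EdgeTerm

open scoped InnerProductSpace Matrix

/-- The square root of the binomial coefficient. -/
def root (a : Fin 4) : ℂ := (Real.sqrt (Nat.choose 3 a) : ℂ)

theorem root_values : root 0 = 1 ∧ root 1 = (Real.sqrt 3 : ℂ) ∧ root 2 = (Real.sqrt 3 : ℂ) ∧
    root 3 = 1 := by
  have h : ((3 : Fin 4) : ℕ) = 3 := rfl
  have h2 : ((2 : Fin 4) : ℕ) = 2 := rfl
  refine ⟨?_, ?_, ?_, ?_⟩ <;> simp [root, h, h2, Nat.choose]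

theorem root_ne_zero (a : Fin 4) : root a ≠ 0 :=
  Complex.ofReal_ne_zero.2 (Real.sqrt_ne_zero'.2 (Nat.cast_pos.2 (Nat.choose_pos (by omega))))

theorem root_mul_self (a : Fin 4) : root a * root a = (Nat.choose 3 a : ℂ) := by
  rw [root, ← Complex.ofReal_mul, Real.mul_self_sqrt (Nat.cast_nonneg _)]
  simp

theorem sqrt_three_sq : (Real.sqrt 3 : ℂ) ^ 2 = 3 := by
  rw [← Complex.ofReal_pow, Real.sq_sqrt (by norm_num)]
  norm_num

theorem casimir (a b : Fin 4) : ∑ c, (spinX a c * spinX c b + spinY a c * spinY c b +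
    spinZ a c * spinZ c b) = if a = b then 15 / 4 else 0 := by
  have h := sqrt_three_sq
  have hI := Complex.I_sq
  fin_cases a <;> fin_cases b <;> simp [Fin.sum_univ_four, spinX, spinY, spinZ] <;> ring_nf <;>
    simp only [h, hI] <;> norm_num

/-- After division by the square roots of binomial coefficients, the Heisenberg coupling becomes its
greatest value 9/2 plus a weighted difference operator along lines of constant total magnetization.
The indices wrap around in `Fin 4`, but exactly there the coefficients vanish. -/
theorem coupling (χ : Fin 4 → Fin 4 → ℂ) (a b : Fin 4) :
    2 * ∑ c, ∑ d, (spinX a c * spinX b d + spinY a c * spinY b d + spinZ a c * spinZ b d) *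
      (root c * root d * χ c d) = root a * root b * (9 / 2 * χ a b +
        (a : ℕ) * (3 - (b : ℕ)) * (χ (a - 1) (b + 1) - χ a b) +
        (3 - (a : ℕ)) * (b : ℕ) * (χ (a + 1) (b - 1) - χ a b)) := by
  obtain ⟨r0, r1, r2, r3⟩ := root_values
  have h := sqrt_three_sq
  have h3 : (Real.sqrt 3 : ℂ) ^ 3 = 3 * (Real.sqrt 3 : ℂ) := by rw [pow_succ, h]
  have h4 : (Real.sqrt 3 : ℂ) ^ 4 = 9 := by
    rw [show 4 = 2 * 2 by rfl, pow_mul, h]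
    norm_num
  have hI := Complex.I_sq
  have e2 : ((2 : Fin 4) : ℕ) = 2 := rfl
  have e3 : ((3 : Fin 4) : ℕ) = 3 := rfl
  have s1 : (3 : Fin 4) + 1 = 0 := rfl
  have s2 : (2 : Fin 4) + 1 = 3 := rfl
  have s3 : (1 : Fin 4) + 1 = 2 := rfl
  have s4 : (3 : Fin 4) - 1 = 2 := rfl
  have s5 : (2 : Fin 4) - 1 = 1 := rfl
  fin_cases a <;> fin_cases b <;>
    simp [Fin.sum_univ_four, spinX, spinY, spinZ, r0, r1, r2, r3, e2, e3, s1, s2, s3, s4, s5] <;>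
    ring_nf <;> simp only [h, h3, h4, hI] <;> ring

/-- The difference equation of the eigenvectors with the greatest total spin forces them to depend
only on the total magnetization. -/
theorem eq_of_harmonic {χ : Fin 4 → Fin 4 → ℂ}
    (h : ∀ a b : Fin 4, (a : ℕ) * (3 - (b : ℕ)) * (χ (a - 1) (b + 1) - χ a b) +
        (3 - (a : ℕ)) * (b : ℕ) * (χ (a + 1) (b - 1) - χ a b) = 0) :
    ∃ c : ℕ → ℂ, ∀ a b : Fin 4, χ a b = c (a + b) := by
  have e2 : ((2 : Fin 4) : ℕ) = 2 := rfl
  have e3 : ((3 : Fin 4) : ℕ) = 3 := rfl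
  have h01 := h 0 1
  have h02 := h 0 2
  have h11 := h 1 1
  have h03 := h 0 3
  have h12 := h 1 2
  have h21 := h 2 1
  have h13 := h 1 3
  have h22 := h 2 2
  have h23 := h 2 3
  simp [e2, e3, show (2 : Fin 4) + 1 = 3 from rfl, show (2 : Fin 4) - 1 = 1 from rfl,
    show (1 : Fin 4) + 1 = 2 from rfl, show (3 : Fin 4) - 1 = 2 from rfl]
    at h01 h02 h11 h03 h12 h21 h13 h22 h23
  refine ⟨fun k => if k = 0 then χ 0 0 else if k = 1 then χ 0 1 else if k = 2 then χ 0 2 else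
    if k = 3 then χ 0 3 else if k = 4 then χ 1 3 else if k = 5 then χ 2 3 else χ 3 3,
    fun a b => ?_⟩
  fin_cases a <;> fin_cases b <;> simp <;> grind

section

variable {I : Type*} [Fintype I] [DecidableEq I]

theorem sum_update (v : I) (F : (I → Fin 4) → ℂ) :
    ∑ σ : I → Fin 4, ∑ a : Fin 4, F (Function.update σ v a) = 4 * ∑ σ, F σ := by
  let e : (I → Fin 4) × Fin 4 ≃ (I → Fin 4) × Fin 4 :=
    { toFun := fun p => (Function.update p.1 v p.2, p.1 v)
      invFun := fun p => (Function.update p.1 v p.2, p.1 v)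
      left_inv := fun p => by simp
      right_inv := fun p => by simp }
  rw [← Fintype.sum_prod_type', Fintype.sum_equiv e (fun p => F (Function.update p.1 v p.2))
    (fun p => F p.1) fun p => rfl, Fintype.sum_prod_type, Finset.mul_sum]
  simp

theorem sum_update_update (v w : I) (F : (I → Fin 4) → ℂ) :
    ∑ σ : I → Fin 4, ∑ a : Fin 4, ∑ b : Fin 4, F (Function.update (Function.update σ v a) w b) =
      16 * ∑ σ, F σ := by
  rw [sum_update v fun σ => ∑ b : Fin 4, F (Function.update σ w b), sum_update]
  ring

theorem update_update_eq {v w : I} {σ τ : I → Fin 4} (h : ∀ u, u ≠ v → u ≠ w → σ u = τ u) :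
    Function.update (Function.update σ v (τ v)) w (τ w) = τ := by
  ext u
  by_cases hw : u = w
  · subst hw; simp
  · rw [Function.update_of_ne hw]
    by_cases hv : u = v
    · subst hv; simp
    · rw [Function.update_of_ne hv, h u hv hw]

end

variable {m n : ℕ} {W : Finset (Site m n)}

theorem siteOp_mulVec (v : W) (A : Matrix (Fin 4) (Fin 4) ℂ) (ψ : (W → Fin 4) → ℂ)
    (σ : W → Fin 4) :
    (siteOp v A *ᵥ ψ) σ = ∑ a, A (σ v) a * ψ (Function.update σ v a) := by
  simp only [Matrix.mulVec, dotProduct, siteOp, Matrix.of_apply]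
  symm
  refine Finset.sum_of_injOn (fun a => Function.update σ v a)
    (fun a _ b _ h => by simpa using congrFun h v) (fun _ _ => Finset.mem_coe.2 (Finset.mem_univ _))
    (fun τ _ hτ => ?_) (fun a _ => ?_)
  · rw [if_neg fun h => hτ ⟨τ v, Finset.mem_coe.2 (Finset.mem_univ _), ?_⟩, zero_mul]
    ext u
    change (Function.update σ v (τ v) u : ℕ) = _
    by_cases hu : u = v
    · subst hu; simp
    · rw [Function.update_of_ne hu, h u hu]
  · rw [if_pos fun u hu => (Function.update_of_ne hu _ _).symm]
    simp

theorem siteOp_add_sq_mulVec {v w : W} (hvw : v ≠ w) (A : Matrix (Fin 4) (Fin 4) ℂ)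
    (ψ : (W → Fin 4) → ℂ) (σ : W → Fin 4) :
    ((siteOp v A + siteOp w A) ^ 2 *ᵥ ψ) σ =
      (∑ a, (∑ c, A (σ v) c * A c a) * ψ (Function.update σ v a)) +
      (∑ a, (∑ c, A (σ w) c * A c a) * ψ (Function.update σ w a)) +
      2 * ∑ a, ∑ b, A (σ v) a * A (σ w) b *
        ψ (Function.update (Function.update σ v a) w b) := by
  have h1 : ∀ v : W, (siteOp v A *ᵥ (siteOp v A *ᵥ ψ)) σ =
      ∑ a, (∑ c, A (σ v) c * A c a) * ψ (Function.update σ v a) := fun v => by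
    rw [siteOp_mulVec]
    simp only [siteOp_mulVec, Function.update_self, Function.update_idem, Finset.mul_sum,
      Finset.sum_mul]
    rw [Finset.sum_comm]
    simp only [mul_assoc]
  have h2 : (siteOp v A *ᵥ (siteOp w A *ᵥ ψ)) σ = ∑ a, ∑ b, A (σ v) a * A (σ w) b *
        ψ (Function.update (Function.update σ v a) w b) := by
    rw [siteOp_mulVec]
    simp only [siteOp_mulVec, Finset.mul_sum, Function.update_of_ne hvw.symm, mul_assoc]
  have h3 : (siteOp w A *ᵥ (siteOp v A *ᵥ ψ)) σ = ∑ a, ∑ b, A (σ v) a * A (σ w) b *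
        ψ (Function.update (Function.update σ v a) w b) := by
    rw [siteOp_mulVec]
    simp only [siteOp_mulVec, Finset.mul_sum, Function.update_of_ne hvw]
    rw [Finset.sum_comm]
    refine Finset.sum_congr rfl fun a _ => Finset.sum_congr rfl fun b _ => ?_
    rw [Function.update_comm hvw]
    ring
  rw [sq, ← Matrix.mulVec_mulVec, Matrix.add_mulVec, Matrix.add_mulVec, Matrix.mulVec_add,
    Matrix.mulVec_add]
  simp only [Pi.add_apply]
  rw [h1, h1, h2, h3]
  ring

theorem totalSpinSq_mulVec {v w : W} (hvw : v ≠ w) (ψ : (W → Fin 4) → ℂ) (σ : W → Fin 4) :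
    (totalSpinSq v w *ᵥ ψ) σ = 15 / 2 * ψ σ + 2 * ∑ a, ∑ b,
      (spinX (σ v) a * spinX (σ w) b + spinY (σ v) a * spinY (σ w) b +
        spinZ (σ v) a * spinZ (σ w) b) * ψ (Function.update (Function.update σ v a) w b) := by
  have hc : ∀ u : W, (∑ a, (∑ c, spinX (σ u) c * spinX c a) * ψ (Function.update σ u a)) +
      (∑ a, (∑ c, spinY (σ u) c * spinY c a) * ψ (Function.update σ u a)) +
      (∑ a, (∑ c, spinZ (σ u) c * spinZ c a) * ψ (Function.update σ u a)) = 15 / 4 * ψ σ :=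
    fun u => by
      rw [← Finset.sum_add_distrib, ← Finset.sum_add_distrib]
      have : ∀ a, (∑ c, spinX (σ u) c * spinX c a) * ψ (Function.update σ u a) +
          (∑ c, spinY (σ u) c * spinY c a) * ψ (Function.update σ u a) +
          (∑ c, spinZ (σ u) c * spinZ c a) * ψ (Function.update σ u a) =
          if σ u = a then 15 / 4 * ψ (Function.update σ u a) else 0 := fun a => by
        rw [← add_mul, ← add_mul, ← Finset.sum_add_distrib, ← Finset.sum_add_distrib, casimir,
          ite_mul, zero_mul]
      simp only [this, Finset.sum_ite_eq, Finset.mem_univ, if_true, Function.update_eq_self]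
  rw [totalSpinSq, Matrix.add_mulVec, Matrix.add_mulVec]
  simp only [Pi.add_apply]
  rw [siteOp_add_sq_mulVec hvw, siteOp_add_sq_mulVec hvw, siteOp_add_sq_mulVec hvw]
  simp only [add_mul, Finset.sum_add_distrib]
  linear_combination hc v + hc w

/-- The eigenspace of the greatest total spin. -/
theorem mem_eigenspace_iff {v w : W} (hvw : v ≠ w) (ψ : Phys W) :
    ψ ∈ Module.End.eigenspace (Matrix.toEuclideanLin (totalSpinSq v w)) 12 ↔
      ∀ σ, ∃ c : ℕ → ℂ, ∀ a b : Fin 4,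
        ψ (Function.update (Function.update σ v a) w b) = root a * root b * c (a + b) := by
  -- The eigenvalue 12 is 15/2 from the two single spins plus 9/2 from the coupling, so precisely
  -- the difference operator must vanish.
  have hχ : ∀ σ : W → Fin 4, (totalSpinSq v w *ᵥ ψ.ofLp) σ = 12 * ψ σ ↔
      ((σ v : ℕ) * (3 - (σ w : ℕ)) *
        (ψ (Function.update (Function.update σ v (σ v - 1)) w (σ w + 1)) /
          (root (σ v - 1) * root (σ w + 1)) - ψ σ / (root (σ v) * root (σ w))) +
        (3 - (σ v : ℕ)) * (σ w : ℕ) *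
        (ψ (Function.update (Function.update σ v (σ v + 1)) w (σ w - 1)) /
          (root (σ v + 1) * root (σ w - 1)) - ψ σ / (root (σ v) * root (σ w))) : ℂ) = 0 := by
    intro σ
    have hr : ∀ a b, root a * root b ≠ 0 := fun a b => mul_ne_zero (root_ne_zero a) (root_ne_zero b)
    have h1 := coupling (fun a b => ψ (Function.update (Function.update σ v a) w b) /
      (root a * root b)) (σ v) (σ w)
    simp only [mul_div_cancel₀ _ (hr _ _)] at h1
    rw [totalSpinSq_mulVec hvw, h1, update_update_eq (fun _ _ _ => rfl)]
    set y := (σ v : ℕ) * (3 - (σ w : ℕ)) *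
        (ψ (Function.update (Function.update σ v (σ v - 1)) w (σ w + 1)) /
          (root (σ v - 1) * root (σ w + 1)) - ψ σ / (root (σ v) * root (σ w))) with hy
    set z := (3 - (σ v : ℕ)) * (σ w : ℕ) *
        (ψ (Function.update (Function.update σ v (σ v + 1)) w (σ w - 1)) /
          (root (σ v + 1) * root (σ w - 1)) - ψ σ / (root (σ v) * root (σ w))) with hz
    have h2 : root (σ v) * root (σ w) * (ψ σ / (root (σ v) * root (σ w))) = ψ σ :=
      mul_div_cancel₀ _ (hr _ _)
    constructor
    · intro h
      refine (mul_eq_zero.1 (?_ : root (σ v) * root (σ w) * (y + z) = 0)).resolve_left (hr _ _)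
      linear_combination h - 9 / 2 * h2
    · intro h
      linear_combination root (σ v) * root (σ w) * h + 9 / 2 * h2
  rw [Module.End.mem_eigenspace_iff]
  have h0 : Matrix.toEuclideanLin (totalSpinSq v w) ψ = (12 : ℂ) • ψ ↔
      ∀ σ, (totalSpinSq v w *ᵥ ψ.ofLp) σ = 12 * ψ σ := by
    constructor
    · intro h σ
      exact congrArg (fun φ : Phys W => φ σ) h
    · intro h
      ext σ
      exact h σ
  rw [h0]
  constructor
  · intro h σ
    obtain ⟨c, hc⟩ := eq_of_harmonic (χ := fun a b =>
      ψ (Function.update (Function.update σ v a) w b) / (root a * root b)) fun a b => by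
        have h1 := (hχ (Function.update (Function.update σ v a) w b)).1 (h _)
        simp only [Function.update_self, Function.update_of_ne hvw,
          Function.update_comm hvw.symm, Function.update_idem] at h1
        exact h1
    refine ⟨c, fun a b => ?_⟩
    rw [← hc, mul_div_cancel₀ _ (mul_ne_zero (root_ne_zero a) (root_ne_zero b))]
  · intro h σ
    obtain ⟨c, hc⟩ := h σ
    rw [hχ, hc, hc, mul_div_cancel_left₀ _ (mul_ne_zero (root_ne_zero _) (root_ne_zero _)),
      mul_div_cancel_left₀ _ (mul_ne_zero (root_ne_zero _) (root_ne_zero _))]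
    have h1 : ψ σ = root (σ v) * root (σ w) * c (σ v + σ w) := by
      rw [← hc, update_update_eq (fun _ _ _ => rfl)]
    rw [h1, mul_div_cancel_left₀ _ (mul_ne_zero (root_ne_zero _) (root_ne_zero _))]
    generalize σ v = a
    generalize σ w = b
    fin_cases a <;> fin_cases b <;> simp

/-- In the states of total spin 3 the dependence on the two sites is through the symmetric vectors
only, one for each total magnetization. The defining equations of `sing` say that a state is
orthogonal to these vectors for every configuration of the other sites. -/
theorem eigenspace_eq {v w : W} (hvw : v ≠ w) :
    Module.End.eigenspace (Matrix.toEuclideanLin (totalSpinSq v w)) 12 = (sing v w)ᗮ := by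
  refine le_antisymm (fun ψ hψ => (Submodule.mem_orthogonal _ _).2 fun s hs => ?_) ?_
  · rw [mem_eigenspace_iff hvw] at hψ
    have h1 := sum_update_update v w fun σ => ⟪s σ, ψ σ⟫_ℂ
    have h2 : ∀ σ : W → Fin 4, ∑ a : Fin 4, ∑ b : Fin 4,
        ⟪s (Function.update (Function.update σ v a) w b),
          ψ (Function.update (Function.update σ v a) w b)⟫_ℂ = 0 := fun σ => by
      obtain ⟨c, hc⟩ := hψ σ
      have h3 : ∀ a b : Fin 4, ⟪s (Function.update (Function.update σ v a) w b),
          ψ (Function.update (Function.update σ v a) w b)⟫_ℂ = ∑ k ∈ Finset.range 7,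
          c k * starRingEnd ℂ (if (a : ℕ) + b = k then
            (Real.sqrt (Nat.choose 3 a) * Real.sqrt (Nat.choose 3 b) : ℂ) *
              s (Function.update (Function.update σ v a) w b) else 0) := fun a b => by
        rw [Finset.sum_eq_single ((a : ℕ) + b)]
        · rw [if_pos rfl, hc]
          simp only [RCLike.inner_apply, root, map_mul, Complex.conj_ofReal]
          ring
        · intro k _ hk
          rw [if_neg hk.symm, map_zero, mul_zero]
        · intro h
          exact (h (Finset.mem_range.2 (by omega))).elim
      simp only [h3]
      rw [Finset.sum_congr rfl fun a _ => Finset.sum_comm, Finset.sum_comm]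
      refine Finset.sum_eq_zero fun k _ => ?_
      simp only [← Finset.mul_sum, ← map_sum]
      rw [hs σ k, map_zero, mul_zero]
    rw [Finset.sum_eq_zero fun σ _ => h2 σ] at h1
    rw [PiLp.inner_apply]
    exact (mul_eq_zero.1 h1.symm).resolve_left (by norm_num)
  · rw [← Submodule.orthogonal_le_orthogonal_iff, Submodule.orthogonal_orthogonal]
    intro ψ hψ σ k
    let u : Phys W := WithLp.toLp 2 fun τ => if (∀ x, x ≠ v → x ≠ w → σ x = τ x) ∧
      (τ v : ℕ) + τ w = k then root (τ v) * root (τ w) else 0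
    have hu : ∀ τ, u τ = if (∀ x, x ≠ v → x ≠ w → σ x = τ x) ∧
      (τ v : ℕ) + τ w = k then root (τ v) * root (τ w) else 0 := fun τ => rfl
    have hmem : u ∈ Module.End.eigenspace (Matrix.toEuclideanLin (totalSpinSq v w)) 12 := by
      rw [mem_eigenspace_iff hvw]
      intro τ
      refine ⟨fun l => if (∀ x, x ≠ v → x ≠ w → σ x = τ x) ∧ l = k then 1 else 0, fun a b => ?_⟩
      rw [hu]
      simp only [Function.update_self, Function.update_of_ne hvw]
      have : (∀ x, x ≠ v → x ≠ w → σ x = Function.update (Function.update τ v a) w b x) ↔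
          ∀ x, x ≠ v → x ≠ w → σ x = τ x :=
        forall_congr' fun x => forall_congr' fun hv => forall_congr' fun hw => by
          rw [Function.update_of_ne hw, Function.update_of_ne hv]
      simp only [this]
      split_ifs <;> simp
    have h1 := (Submodule.mem_orthogonal _ _).1 hψ u hmem
    rw [PiLp.inner_apply] at h1
    refine Eq.trans ?_ h1
    rw [← Fintype.sum_prod_type']
    refine Finset.sum_of_injOn (fun p : Fin 4 × Fin 4 =>
      Function.update (Function.update σ v p.1) w p.2) (fun p _ q _ h => ?_)
      (fun _ _ => Finset.mem_coe.2 (Finset.mem_univ _)) (fun τ _ hτ => ?_) (fun p _ => ?_)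
    · have hv := congrFun h v
      have hw := congrFun h w
      simp only [Function.update_self, Function.update_of_ne hvw] at hv hw
      exact Prod.ext hv hw
    · rw [hu, if_neg fun h => hτ ⟨(τ v, τ w), Finset.mem_coe.2 (Finset.mem_univ _),
        update_update_eq h.1⟩, inner_zero_left]
    · rw [hu]
      have : ∀ x, x ≠ v → x ≠ w →
          σ x = Function.update (Function.update σ v p.1) w p.2 x := fun x hv hw => by
        rw [Function.update_of_ne hw, Function.update_of_ne hv]
      simp only [Function.update_self, Function.update_of_ne hvw]
      by_cases hk : (p.1 : ℕ) + p.2 = k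
      · rw [if_pos hk, if_pos ⟨this, hk⟩]
        simp only [RCLike.inner_apply, root, map_mul, Complex.conj_ofReal]
        ring
      · rw [if_neg hk, if_neg fun h => hk h.2, inner_zero_left]

theorem edgeTerm_eq {v w : W} (hvw : v ≠ w) :
    edgeTerm v w = 1 - (sing v w).starProjection := by
  rw [edgeTerm]
  simp only [eigenspace_eq hvw]
  exact Submodule.starProjection_orthogonal' _

end EdgeTerm

end

end SquareOctagon

namespace SquareOctagon

noncomputable section

set_option linter.unusedSectionVars false

/-! ## States as polynomials

A spin 3/2 is a polynomial of degree at most three in one variable. Two spins contain no component of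
total spin 3 if and only if the polynomial vanishes where the two variables agree. -/

section Polynomial

open MvPolynomial

variable {I : Type*} [Fintype I] [DecidableEq I]

/-- The exponents of the monomial of a basis state. -/
def exps (σ : I → Fin 4) : I →₀ ℕ := Finsupp.equivFunOnFinite.symm fun v => (σ v : ℕ)

theorem exps_apply (σ : I → Fin 4) (v : I) : exps σ v = σ v := rfl

theorem exps_injective : Function.Injective (exps : (I → Fin 4) → I →₀ ℕ) := fun σ τ h =>
  funext fun v => Fin.ext (DFunLike.congr_fun h v)

/-- The normalization of the monomial of a basis state. -/
def amp (σ : I → Fin 4) : ℂ := ∏ v, root (σ v)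

theorem amp_ne_zero (σ : I → Fin 4) : amp σ ≠ 0 := Finset.prod_ne_zero_iff.2 fun _ _ =>
  root_ne_zero _

/-- The polynomial of a state. -/
def theta : Spins I →ₗ[ℂ] MvPolynomial I ℂ where
  toFun ψ := ∑ σ, monomial (exps σ) (ψ σ * amp σ)
  map_add' ψ φ := by simp [add_mul, Finset.sum_add_distrib]
  map_smul' c ψ := by
    simp only [PiLp.smul_apply, smul_eq_mul, mul_assoc, RingHom.id_apply, Finset.smul_sum,
      smul_monomial]

theorem theta_apply (ψ : Spins I) : theta ψ = ∑ σ, monomial (exps σ) (ψ σ * amp σ) := rfl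

theorem coeff_theta (ψ : Spins I) (σ : I → Fin 4) : coeff (exps σ) (theta ψ) = ψ σ * amp σ := by
  rw [theta_apply, coeff_sum, Finset.sum_eq_single σ]
  · rw [coeff_monomial, if_pos rfl]
  · intro τ _ h
    rw [coeff_monomial, if_neg fun e => h (exps_injective e)]
  · exact fun h => (h (Finset.mem_univ _)).elim

theorem theta_injective : Function.Injective (theta : Spins I → MvPolynomial I ℂ) := fun ψ φ h => by
  ext σ
  have h1 := congrArg (coeff (exps σ)) h
  rw [coeff_theta, coeff_theta] at h1
  exact mul_right_cancel₀ (amp_ne_zero σ) h1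

theorem degreeOf_theta_le (ψ : Spins I) (v : I) : degreeOf v (theta ψ) ≤ 3 := by
  rw [degreeOf_eq_sup, Finset.sup_le_iff]
  intro m hm
  by_contra h
  refine mem_support_iff.1 hm ?_
  rw [theta_apply, coeff_sum]
  refine Finset.sum_eq_zero fun σ _ => ?_
  rw [coeff_monomial, if_neg]
  rintro rfl
  exact h (by rw [exps_apply]; omega)

/-- The state of a polynomial. -/
def ofPoly : MvPolynomial I ℂ →ₗ[ℂ] Spins I where
  toFun p := WithLp.toLp 2 fun σ => coeff (exps σ) p / amp σ
  map_add' p q := by ext σ; simp [add_div]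
  map_smul' c p := by ext σ; simp [mul_div_assoc]

theorem ofPoly_apply (p : MvPolynomial I ℂ) (σ : I → Fin 4) :
    ofPoly p σ = coeff (exps σ) p / amp σ := rfl

theorem theta_ofPoly {p : MvPolynomial I ℂ} (hp : ∀ v, degreeOf v p ≤ 3) :
    theta (ofPoly p) = p := by
  ext m
  by_cases hm : ∃ σ, exps σ = m
  · obtain ⟨σ, rfl⟩ := hm
    rw [coeff_theta, ofPoly_apply, div_mul_cancel₀ _ (amp_ne_zero σ)]
  · rw [theta_apply, coeff_sum, Finset.sum_eq_zero fun σ _ => by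
      rw [coeff_monomial, if_neg fun h => hm ⟨σ, h⟩]]
    by_contra h
    refine hm ⟨fun v => ⟨m v, ?_⟩, Finsupp.ext fun v => rfl⟩
    have h1 := hp v
    rw [degreeOf_eq_sup, Finset.sup_le_iff] at h1
    exact Nat.lt_succ_of_le (h1 m (mem_support_iff.2 (Ne.symm h)))

theorem ofPoly_theta (ψ : Spins I) : ofPoly (theta ψ) = ψ :=
  theta_injective (theta_ofPoly (degreeOf_theta_le ψ))

/-- Identify the variable `w` with the variable `v`. -/
def merge (v w : I) : MvPolynomial I ℂ →ₐ[ℂ] MvPolynomial I ℂ :=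
  aeval fun u => X (if u = w then v else u)

theorem merge_X (v w u : I) : merge v w (X u) = X (if u = w then v else u) := aeval_X _ _

theorem merge_sub (v w : I) : merge v w (X w - X v) = 0 := by
  rw [map_sub, merge_X, merge_X, if_pos rfl]
  split_ifs <;> exact sub_self _

/-- Modulo the ideal generated by the difference, identifying the variables does not change a
polynomial. -/
theorem sub_dvd_iff (v w : I) (p : MvPolynomial I ℂ) : X w - X v ∣ p ↔ merge v w p = 0 := by
  constructor
  · rintro ⟨q, rfl⟩
    rw [map_mul, merge_sub, zero_mul]
  · intro h
    have h1 : (Ideal.Quotient.mkₐ ℂ (Ideal.span {(X w - X v : MvPolynomial I ℂ)})).comp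
        (merge v w) = Ideal.Quotient.mkₐ ℂ (Ideal.span {(X w - X v : MvPolynomial I ℂ)}) := by
      refine algHom_ext fun u => ?_
      rw [AlgHom.comp_apply, merge_X]
      split_ifs with hu
      · subst hu
        rw [Ideal.Quotient.mkₐ_eq_mk, eq_comm, Ideal.Quotient.eq, Ideal.mem_span_singleton]
      · rfl
    have h2 := AlgHom.congr_fun h1 p
    rw [AlgHom.comp_apply, h, map_zero, Ideal.Quotient.mkₐ_eq_mk, eq_comm,
      Ideal.Quotient.eq_zero_iff_mem, Ideal.mem_span_singleton] at h2
    exact h2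

/-- The exponents of the monomial of a basis state after the variables have been identified. -/
def mergeExps (v w : I) (σ : I → Fin 4) : I →₀ ℕ := Finsupp.equivFunOnFinite.symm fun u =>
  if u = w then 0 else if u = v then (σ v : ℕ) + σ w else σ u

theorem monomial_exps (σ : I → Fin 4) (c : ℂ) :
    monomial (exps σ) c = C c * ∏ u, X u ^ (σ u : ℕ) := by
  rw [monomial_eq, Finsupp.prod_fintype _ _ fun _ => pow_zero _]
  rfl

theorem merge_monomial {v w : I} (hvw : v ≠ w) (σ : I → Fin 4) (c : ℂ) :
    merge v w (monomial (exps σ) c) = monomial (mergeExps v w σ) c := by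
  rw [monomial_exps, map_mul, map_prod, monomial_eq, Finsupp.prod_fintype _ _ fun _ => pow_zero _,
    ← algebraMap_eq, AlgHom.commutes]
  congr 1
  simp only [map_pow, merge_X]
  have hw : w ∈ Finset.univ.erase v := Finset.mem_erase.2 ⟨hvw.symm, Finset.mem_univ _⟩
  rw [← Finset.mul_prod_erase _ _ (Finset.mem_univ v), ← Finset.mul_prod_erase _ _ hw,
    ← Finset.mul_prod_erase _ _ (Finset.mem_univ v), ← Finset.mul_prod_erase _ _ hw]
  change _ = X v ^ (if v = w then 0 else if v = v then (σ v : ℕ) + σ w else σ v) *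
    (X w ^ (if w = w then 0 else if w = v then (σ v : ℕ) + σ w else σ w) *
      ∏ u ∈ (Finset.univ.erase v).erase w,
        X u ^ (if u = w then 0 else if u = v then (σ v : ℕ) + σ w else (σ u : ℕ)))
  rw [if_neg hvw, if_pos rfl, if_pos rfl, if_pos rfl, if_neg hvw, pow_zero, one_mul, ← mul_assoc,
    ← pow_add]
  congr 1
  refine Finset.prod_congr rfl fun u hu => ?_
  rw [Finset.mem_erase, Finset.mem_erase] at hu
  rw [if_neg hu.1, if_neg hu.1, if_neg hu.2.1]

/-- Two basis monomials become equal after the identification exactly when they agree away from `v`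
and `w` and have the same total exponent there. The resulting coefficient is the sum that defines
`sing`, up to the nonzero amplitude of the other sites. -/
theorem coeff_merge_theta {v w : I} (hvw : v ≠ w) (ψ : Spins I) (σ : I → Fin 4) :
    coeff (mergeExps v w σ) (merge v w (theta ψ)) =
      (∏ u ∈ (Finset.univ.erase v).erase w, root (σ u)) * ∑ a : Fin 4, ∑ b : Fin 4,
      if (a : ℕ) + b = σ v + σ w then root a * root b *
        ψ (Function.update (Function.update σ v a) w b) else 0 := by
  rw [theta_apply, map_sum, coeff_sum, ← Fintype.sum_prod_type', Finset.mul_sum]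
  symm
  have hw : w ∈ Finset.univ.erase v := Finset.mem_erase.2 ⟨hvw.symm, Finset.mem_univ _⟩
  have hexp : ∀ τ, mergeExps v w τ = mergeExps v w σ ↔
      (∀ u, u ≠ v → u ≠ w → σ u = τ u) ∧ (τ v : ℕ) + τ w = σ v + σ w := fun τ => by
    constructor
    · intro h
      refine ⟨fun u hv hw => ?_, ?_⟩
      · have h1 : (if u = w then 0 else if u = v then (τ v : ℕ) + τ w else τ u) =
          if u = w then 0 else if u = v then (σ v : ℕ) + σ w else σ u := DFunLike.congr_fun h u
        rw [if_neg hw, if_neg hv, if_neg hw, if_neg hv] at h1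
        exact Fin.ext h1.symm
      · have h1 : (if v = w then 0 else if v = v then (τ v : ℕ) + τ w else τ v) =
          if v = w then 0 else if v = v then (σ v : ℕ) + σ w else σ v := DFunLike.congr_fun h v
        rwa [if_neg hvw, if_pos rfl, if_neg hvw, if_pos rfl] at h1
    · rintro ⟨h1, h2⟩
      ext u
      change (if u = w then 0 else if u = v then (τ v : ℕ) + τ w else (τ u : ℕ)) =
          if u = w then 0 else if u = v then (σ v : ℕ) + σ w else (σ u : ℕ)
      by_cases hw : u = w
      · rw [if_pos hw, if_pos hw]
      · by_cases hv : u = v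
        · rw [if_neg hw, if_pos hv, if_neg hw, if_pos hv, h2]
        · rw [if_neg hw, if_neg hv, if_neg hw, if_neg hv, h1 u hv hw]
  refine Finset.sum_of_injOn (fun p : Fin 4 × Fin 4 =>
    Function.update (Function.update σ v p.1) w p.2) (fun p _ q _ h => ?_)
    (fun _ _ => Finset.mem_coe.2 (Finset.mem_univ _)) (fun τ _ hτ => ?_) (fun p _ => ?_)
  · have hv := congrFun h v
    have hw := congrFun h w
    simp only [Function.update_self, Function.update_of_ne hvw] at hv hw
    exact Prod.ext hv hw
  · rw [merge_monomial hvw, coeff_monomial, if_neg fun h => hτ ⟨(τ v, τ w),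
      Finset.mem_coe.2 (Finset.mem_univ _), update_update_eq ((hexp τ).1 h).1⟩]
  · have h1 : ∀ u, u ≠ v → u ≠ w →
        σ u = Function.update (Function.update σ v p.1) w p.2 u := fun u hv hw => by
      rw [Function.update_of_ne hw, Function.update_of_ne hv]
    have h2 : amp (Function.update (Function.update σ v p.1) w p.2) = root p.1 * root p.2 *
        ∏ u ∈ (Finset.univ.erase v).erase w, root (σ u) := by
      rw [amp, ← Finset.mul_prod_erase _ _ (Finset.mem_univ v), ← Finset.mul_prod_erase _ _ hw,
        Function.update_self, Function.update_of_ne hvw, Function.update_self, mul_assoc]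
      congr 2
      refine Finset.prod_congr rfl fun u hu => ?_
      rw [Finset.mem_erase, Finset.mem_erase] at hu
      rw [← h1 u hu.2.1 hu.1]
    rw [merge_monomial hvw, coeff_monomial, h2]
    simp only [hexp, Function.update_self, Function.update_of_ne hvw]
    by_cases hk : (p.1 : ℕ) + p.2 = σ v + σ w
    · rw [if_pos hk, if_pos ⟨h1, hk⟩]
      ring
    · rw [if_neg hk, if_neg fun h => hk h.2, mul_zero]

theorem mem_sing_iff_merge {v w : I} (hvw : v ≠ w) (ψ : Spins I) :
    ψ ∈ sing v w ↔ merge v w (theta ψ) = 0 := by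
  constructor
  · intro h
    ext m
    by_cases hm : ∃ σ, mergeExps v w σ = m
    · obtain ⟨σ, rfl⟩ := hm
      rw [coeff_merge_theta hvw]
      have := h σ (σ v + σ w)
      simp only [root]
      rw [this, mul_zero, coeff_zero]
    · rw [theta_apply, map_sum, coeff_sum]
      refine Finset.sum_eq_zero fun σ _ => ?_
      rw [merge_monomial hvw, coeff_monomial, if_neg fun h => hm ⟨σ, h⟩]
  · intro h σ k
    by_cases hk : ∃ a b : Fin 4, (a : ℕ) + b = k
    · obtain ⟨a, b, rfl⟩ := hk
      have h1 := coeff_merge_theta hvw ψ (Function.update (Function.update σ v a) w b)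
      rw [h, coeff_zero] at h1
      have h2 := (mul_eq_zero.1 h1.symm).resolve_left
        (Finset.prod_ne_zero_iff.2 fun _ _ => root_ne_zero _)
      simp only [Function.update_self, Function.update_of_ne hvw, Function.update_comm hvw.symm,
        Function.update_idem] at h2
      simp only [Function.update_comm hvw.symm]
      exact h2
    · push Not at hk
      exact Finset.sum_eq_zero fun a _ => Finset.sum_eq_zero fun b _ => if_neg (hk a b)

theorem mem_sing_iff_dvd {v w : I} (hvw : v ≠ w) (ψ : Spins I) :
    ψ ∈ sing v w ↔ X w - X v ∣ theta ψ := by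
  rw [mem_sing_iff_merge hvw, sub_dvd_iff]

theorem sing_comm {v w : I} (hvw : v ≠ w) : sing v w = sing w v := by
  ext ψ
  rw [mem_sing_iff_dvd hvw, mem_sing_iff_dvd hvw.symm, ← neg_dvd, neg_sub]

/-! ### Several edges -/

variable {ι : Type*}

/-- The product of the differences of the variables along the edges. -/
def diffProd [Fintype ι] (s t : ι → I) : MvPolynomial I ℂ := ∏ e, (X (t e) - X (s e))

/-- The edges have different end points, and no two of them have the same end points. -/
structure IsSimple (s t : ι → I) : Prop where
  ne : ∀ e, s e ≠ t e
  inj : ∀ e e', s e = s e' → t e = t e' → e = e'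
  cross : ∀ e e', s e = t e' → t e = s e' → e = e'

theorem merge_sub_ne_zero {v w a b : I} (hab : a ≠ b) (h1 : ¬ (a = v ∧ b = w))
    (h2 : ¬ (a = w ∧ b = v)) : merge v w (X b - X a) ≠ 0 := by
  rw [map_sub, merge_X, merge_X, sub_ne_zero]
  intro h
  have := X_injective h
  split_ifs at this with hb ha ha
  · exact hab (ha.trans hb.symm)
  · exact h1 ⟨this.symm, hb⟩
  · exact h2 ⟨ha, this⟩
  · exact hab this.symm

theorem diff_ne_zero {v w : I} (h : v ≠ w) : (X w - X v : MvPolynomial I ℂ) ≠ 0 := by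
  rw [sub_ne_zero]
  exact fun e => h (X_injective e).symm

theorem diffProd_ne_zero [Fintype ι] {s t : ι → I} (h : IsSimple s t) : diffProd s t ≠ 0 :=
  Finset.prod_ne_zero_iff.2 fun e _ => diff_ne_zero (h.ne e)

/-- The factors are accumulated one at a time. Identifying the ends of a new edge leaves every
earlier factor nonzero, since no two edges share both end points. As polynomials over ℂ form a
domain, the new factor must divide the cofactor. -/
theorem mem_iInf_sing_iff [Fintype ι] {s t : ι → I} (h : IsSimple s t) (ψ : Spins I) :
    ψ ∈ ⨅ e, sing (s e) (t e) ↔ diffProd s t ∣ theta ψ := by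
  classical
  rw [Submodule.mem_iInf]
  constructor
  · intro hψ
    have key : ∀ S : Finset ι, ∏ e ∈ S, (X (t e) - X (s e)) ∣ theta ψ := fun S => by
      induction S using Finset.induction_on with
      | empty => exact one_dvd _
      | insert e S he ih =>
        obtain ⟨q, hq⟩ := ih
        have h1 := (mem_sing_iff_merge (h.ne e) ψ).1 (hψ e)
        rw [hq, map_mul, map_prod] at h1
        have h2 := (mul_eq_zero.1 h1).resolve_left (Finset.prod_ne_zero_iff.2 fun e' he' =>
          merge_sub_ne_zero (h.ne e')
            (fun hh => he (by rw [← h.inj _ _ hh.1 hh.2]; exact he'))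
            (fun hh => he (by rw [← h.cross _ _ hh.1 hh.2]; exact he')))
        obtain ⟨r, rfl⟩ := (sub_dvd_iff _ _ _).2 h2
        rw [Finset.prod_insert he]
        exact ⟨r, by rw [hq, mul_left_comm, ← mul_assoc]⟩
    exact key Finset.univ
  · intro hd e
    have h1 : (X (t e) - X (s e) : MvPolynomial I ℂ) ∣ diffProd s t :=
      Finset.dvd_prod_of_mem (fun e => (X (t e) - X (s e) : MvPolynomial I ℂ)) (Finset.mem_univ e)
    exact (mem_sing_iff_dvd (h.ne e) ψ).2 (h1.trans hd)

/-- The number of edges at a vertex. -/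
def valency [Fintype ι] (s t : ι → I) (v : I) : ℕ := ∑ e, if s e = v ∨ t e = v then 1 else 0

theorem degreeOf_diff {v w : I} (h : v ≠ w) (u : I) :
    degreeOf u (X w - X v : MvPolynomial I ℂ) = if v = u ∨ w = u then 1 else 0 := by
  have key : ∀ v w : I, v ≠ w → degreeOf w (X w - X v : MvPolynomial I ℂ) = 1 := fun v w h => by
    rw [sub_eq_add_neg, degreeOf_add_eq_of_degreeOf_lt, degreeOf_X_self]
    rw [degreeOf_neg, degreeOf_X_self, degreeOf_X_of_ne h.symm]
    exact one_pos
  by_cases hw : w = u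
  · subst hw
    rw [key _ _ h, if_pos (Or.inr rfl)]
  · by_cases hv : v = u
    · subst hv
      rw [← neg_sub, degreeOf_neg, key _ _ h.symm, if_pos (Or.inl rfl)]
    · rw [if_neg (by tauto)]
      have := degreeOf_sub_le u (X w : MvPolynomial I ℂ) (X v)
      rw [degreeOf_X_of_ne (Ne.symm hw), degreeOf_X_of_ne (Ne.symm hv)] at this
      omega

theorem degreeOf_diffProd [Fintype ι] {s t : ι → I} (h : IsSimple s t) (v : I) :
    degreeOf v (diffProd s t) = valency s t v := by
  rw [diffProd, degreeOf_prod_eq _ _ fun e _ => diff_ne_zero (h.ne e)]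
  exact Finset.sum_congr rfl fun e _ => degreeOf_diff (h.ne e) v

/-- The state with singlets on the edges and given exponents on the free legs. -/
def bondState [Fintype ι] (s t : ι → I) (μ : I →₀ ℕ) : Spins I :=
  ofPoly (diffProd s t * monomial μ 1)

theorem theta_bondState [Fintype ι] {s t : ι → I} (h : IsSimple s t) {μ : I →₀ ℕ}
    (hμ : ∀ v, μ v + valency s t v ≤ 3) : theta (bondState s t μ) = diffProd s t * monomial μ 1 := by
  refine theta_ofPoly fun v => ?_
  have h1 : (monomial μ (1 : ℂ)) ≠ 0 := by simp
  rw [degreeOf_mul_eq (diffProd_ne_zero h) h1, degreeOf_diffProd h, degreeOf_monomial_eq _ _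
    one_ne_zero]
  have := hμ v
  omega

theorem bondState_mem [Fintype ι] {s t : ι → I} (h : IsSimple s t) {μ : I →₀ ℕ}
    (hμ : ∀ v, μ v + valency s t v ≤ 3) : bondState s t μ ∈ ⨅ e, sing (s e) (t e) :=
  (mem_iInf_sing_iff h _).2 ⟨_, theta_bondState h hμ⟩

/-- The states without a component of total spin 3 on any edge. -/
theorem iInf_sing_eq_span [Fintype ι] {s t : ι → I} (h : IsSimple s t) :
    ⨅ e, sing (s e) (t e) =
      Submodule.span ℂ (bondState s t '' {μ | ∀ v, μ v + valency s t v ≤ 3}) := by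
  refine le_antisymm (fun ψ hψ => ?_) (Submodule.span_le.2 ?_)
  · obtain ⟨q, hq⟩ := (mem_iInf_sing_iff h ψ).1 hψ
    have h1 : ψ = ∑ μ ∈ q.support, coeff μ q • bondState s t μ := by
      rw [← ofPoly_theta ψ, hq]
      conv_lhs => rw [q.as_sum, Finset.mul_sum, map_sum]
      refine Finset.sum_congr rfl fun μ _ => ?_
      rw [bondState, ← map_smul, ← mul_smul_comm, smul_monomial, smul_eq_mul, mul_one]
    rw [h1]
    refine Submodule.sum_mem _ fun μ hμ => Submodule.smul_mem _ _ (Submodule.subset_span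
      ⟨μ, fun v => ?_, rfl⟩)
    have hq0 : q ≠ 0 := fun e => by simp [e] at hμ
    have h2 := degreeOf_theta_le ψ v
    rw [hq, degreeOf_mul_eq (diffProd_ne_zero h) hq0, degreeOf_diffProd h] at h2
    have h3 : μ v ≤ degreeOf v q := by
      rw [degreeOf_eq_sup]
      exact Finset.le_sup (f := fun m : I →₀ ℕ => m v) hμ
    omega
  · rintro _ ⟨μ, hμ, rfl⟩
    exact bondState_mem h hμ

theorem linearIndependent_bondState [Fintype ι] {s t : ι → I} (h : IsSimple s t) :
    LinearIndependent ℂ fun μ : {μ : I →₀ ℕ // ∀ v, μ v + valency s t v ≤ 3} =>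
      bondState s t μ := by
  have h1 : LinearIndependent ℂ fun μ : {μ : I →₀ ℕ // ∀ v, μ v + valency s t v ≤ 3} =>
      (monomial (μ : I →₀ ℕ) (1 : ℂ)) := by
    have := (basisMonomials I ℂ).linearIndependent.comp
      (fun μ : {μ : I →₀ ℕ // ∀ v, μ v + valency s t v ≤ 3} => (μ : I →₀ ℕ)) Subtype.val_injective
    simpa [Function.comp_def] using this
  have h2 := h1.map' (LinearMap.mulLeft ℂ (diffProd s t))
    (LinearMap.ker_eq_bot.2 (mul_right_injective₀ (diffProd_ne_zero h)))
  refine LinearIndependent.of_comp theta ?_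
  have e : (theta ∘ fun μ : {μ : I →₀ ℕ // ∀ v, μ v + valency s t v ≤ 3} => bondState s t μ) =
      LinearMap.mulLeft ℂ (diffProd s t) ∘
        fun μ : {μ : I →₀ ℕ // ∀ v, μ v + valency s t v ≤ 3} => monomial (μ : I →₀ ℕ) (1 : ℂ) :=
    funext fun μ => theta_bondState h μ.2
  rw [e]
  exact h2

end Polynomial

end

end SquareOctagon

namespace SquareOctagon

noncomputable section

set_option linter.unusedSectionVars false

/-! ## The image of the AKLT construction -/

section Contraction

open MvPolynomial

variable {I : Type*} [Fintype I] [DecidableEq I] {ι F : Type*} [Fintype ι] [Fintype F]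

open Classical in
/-- Contract the projectors at the sites with the singlets on the edges, where `s` and `t` give the
half-edges of an edge and `j` the half-edges which belong to no edge. -/
def contraction (s t : ι → I × Fin 3) (j : F → I × Fin 3) (b : F → Fin 2) : Spins I :=
  WithLp.toLp 2 fun σ => ∑ x : I × Fin 3 → Fin 2, if ∀ h, x (j h) = b h then
    (∏ v, symProj (σ v) fun k => x (v, k)) * ∏ e, singlet (x (s e)) (x (t e)) else 0

/-- The number of half-edges at `v` in the state one. -/
def occupation (x : I × Fin 3 → Fin 2) : I →₀ ℕ :=
  Finsupp.equivFunOnFinite.symm fun v => ∑ k, (x (v, k) : ℕ)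

theorem monomial_occupation (x : I × Fin 3 → Fin 2) :
    (monomial (occupation x) 1 : MvPolynomial I ℂ) = ∏ h : I × Fin 3, X h.1 ^ (x h : ℕ) := by
  rw [monomial_eq, Finsupp.prod_fintype _ _ fun _ => pow_zero _, map_one, one_mul,
    Fintype.prod_prod_type]
  refine Finset.prod_congr rfl fun v _ => ?_
  change X v ^ (∑ k, (x (v, k) : ℕ)) = ∏ k, X v ^ (x (v, k) : ℕ)
  rw [Finset.prod_pow_eq_pow_sum]

theorem root_mul_symProj (k : Fin 4) (y : Fin 3 → Fin 2) :
    symProj k y * root k = if ∑ a, (y a : ℕ) = (k : ℕ) then 1 else 0 := by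
  rw [symProj]
  split_ifs
  · exact one_div_mul_cancel (root_ne_zero k)
  · exact zero_mul _

/-- The normalization of the spin-3/2 projector is the inverse of that of the monomial. Hence a
product configuration of half-edges becomes the bare monomial counting its ones. -/
theorem sum_monomial_symProj (x : I × Fin 3 → Fin 2) :
    ∑ σ : I → Fin 4, monomial (exps σ) ((∏ v, symProj (σ v) fun k => x (v, k)) * amp σ) =
      (monomial (occupation x) 1 : MvPolynomial I ℂ) := by
  have h1 : ∀ v, ∑ k, (x (v, k) : ℕ) < 4 := fun v => by
    have := Finset.sum_le_card_nsmul Finset.univ (fun k : Fin 3 => (x (v, k) : ℕ)) 1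
      fun k _ => by omega
    simp at this
    omega
  have h2 : ∀ σ : I → Fin 4, (∏ v, symProj (σ v) fun k => x (v, k)) * amp σ =
      if σ = fun v => ⟨∑ k, (x (v, k) : ℕ), h1 v⟩ then 1 else 0 := fun σ => by
    rw [amp, ← Finset.prod_mul_distrib, Finset.prod_congr rfl fun v _ => root_mul_symProj _ _]
    split_ifs with h
    · refine Finset.prod_eq_one fun v _ => if_pos ?_
      rw [h]
    · obtain ⟨v, hv⟩ := Function.ne_iff.1 h
      exact Finset.prod_eq_zero (Finset.mem_univ v) (if_neg fun e => hv (Fin.ext e.symm))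
  rw [Finset.sum_eq_single fun v => ⟨∑ k, (x (v, k) : ℕ), h1 v⟩]
  · rw [h2, if_pos rfl]
    rfl
  · intro σ _ h
    rw [h2, if_neg h, monomial_zero]
  · exact fun h => (h (Finset.mem_univ _)).elim

theorem sum_singlet (v w : I) :
    ∑ a : Fin 2, ∑ b : Fin 2, C (singlet a b) * (X v ^ (a : ℕ) * X w ^ (b : ℕ)) =
      C (1 / (Real.sqrt 2 : ℂ)) * (X w - X v : MvPolynomial I ℂ) := by
  simp only [Fin.sum_univ_two, singlet]
  simp [neg_div]
  ring

/-- The half-edges split into free legs, starts and ends. Summing over the states at the two ends of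
an edge turns its singlet into (X_t - X_s) / √2, while each free leg in the state one contributes
its variable. -/
theorem theta_contraction {s t : ι → I × Fin 3} {j : F → I × Fin 3}
    (hΦ : Function.Bijective (Sum.elim j (Sum.elim s t))) (b : F → Fin 2) :
    theta (contraction s t j b) = C ((1 / (Real.sqrt 2 : ℂ)) ^ Fintype.card ι) *
      (diffProd (fun e => (s e).1) (fun e => (t e).1) * ∏ h, X (j h).1 ^ (b h : ℕ)) := by
  classical
  have h1 : theta (contraction s t j b) = ∑ x : I × Fin 3 → Fin 2,
      if ∀ h, x (j h) = b h then C (∏ e, singlet (x (s e)) (x (t e))) *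
        ∏ h : I × Fin 3, X h.1 ^ (x h : ℕ) else 0 := by
    have h2 : ∀ σ : I → Fin 4, monomial (exps σ) (contraction s t j b σ * amp σ) =
        ∑ x : I × Fin 3 → Fin 2, if ∀ h, x (j h) = b h then
          C (∏ e, singlet (x (s e)) (x (t e))) *
          monomial (exps σ) ((∏ v, symProj (σ v) fun k => x (v, k)) * amp σ) else 0 := fun σ => by
      rw [contraction]
      simp only [Finset.sum_mul, map_sum]
      refine Finset.sum_congr rfl fun x _ => ?_
      split_ifs
      · rw [C_mul_monomial]
        congr 1
        ring
      · rw [zero_mul, monomial_zero]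
    rw [theta_apply, Finset.sum_congr rfl fun σ _ => h2 σ, Finset.sum_comm]
    refine Finset.sum_congr rfl fun x _ => ?_
    split_ifs
    · rw [← Finset.mul_sum, sum_monomial_symProj, monomial_occupation]
    · exact Finset.sum_const_zero
  let e : F ⊕ ι ⊕ ι ≃ I × Fin 3 := Equiv.ofBijective _ hΦ
  let E : (F → Fin 2) × (ι → Fin 2) × (ι → Fin 2) ≃ (I × Fin 3 → Fin 2) :=
    ((Equiv.refl _).prodCongr (Equiv.sumArrowEquivProdArrow ι ι (Fin 2)).symm).trans
      ((Equiv.sumArrowEquivProdArrow F (ι ⊕ ι) (Fin 2)).symm.trans (e.arrowCongr (Equiv.refl _)))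
  have hE : ∀ p h, E p (e h) = Sum.elim p.1 (Sum.elim p.2.1 p.2.2) h := fun p h => by
    change Sum.elim p.1 (Sum.elim p.2.1 p.2.2) (e.symm (e h)) = _
    rw [e.symm_apply_apply]
  have hj : ∀ p h, E p (j h) = p.1 h := fun p h => hE p (Sum.inl h)
  have hs : ∀ p i, E p (s i) = p.2.1 i := fun p i => hE p (Sum.inr (Sum.inl i))
  have ht : ∀ p i, E p (t i) = p.2.2 i := fun p i => hE p (Sum.inr (Sum.inr i))
  have hprod : ∀ p, ∏ h : I × Fin 3, (X h.1 ^ (E p h : ℕ) : MvPolynomial I ℂ) =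
      (∏ h, X (j h).1 ^ (p.1 h : ℕ)) * ((∏ i, X (s i).1 ^ (p.2.1 i : ℕ)) *
        ∏ i, X (t i).1 ^ (p.2.2 i : ℕ)) := fun p => by
    rw [← Equiv.prod_comp e, Fintype.prod_sum_type, Fintype.prod_sum_type]
    simp only [hE, Sum.elim_inl, Sum.elim_inr]
    rfl
  rw [h1, ← Equiv.sum_comp E, Fintype.sum_prod_type, Finset.sum_eq_single b]
  · simp only [hj, hs, ht, hprod, implies_true, if_true, Fintype.sum_prod_type]
    have h3 : ∏ i, ∑ a : Fin 2, ∑ b : Fin 2,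
        (C (singlet a b) * (X (s i).1 ^ (a : ℕ) * X (t i).1 ^ (b : ℕ)) : MvPolynomial I ℂ) =
        ∑ y : ι → Fin 2, ∑ z : ι → Fin 2, C (∏ i, singlet (y i) (z i)) *
          ((∏ i, X (s i).1 ^ (y i : ℕ)) * ∏ i, X (t i).1 ^ (z i : ℕ)) := by
      rw [Finset.prod_univ_sum, Fintype.piFinset_univ]
      refine Finset.sum_congr rfl fun y _ => ?_
      rw [Finset.prod_univ_sum, Fintype.piFinset_univ]
      refine Finset.sum_congr rfl fun z _ => ?_
      rw [Finset.prod_mul_distrib, Finset.prod_mul_distrib, map_prod]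
    simp only [sum_singlet, Finset.prod_mul_distrib, Finset.prod_const, Finset.card_univ] at h3
    rw [map_pow, diffProd, ← mul_assoc, h3, Finset.sum_mul]
    refine Finset.sum_congr rfl fun y _ => ?_
    rw [Finset.sum_mul]
    refine Finset.sum_congr rfl fun z _ => ?_
    ring
  · intro b' _ hb
    refine Finset.sum_eq_zero fun p _ => if_neg fun h => hb (funext fun i => ?_)
    rw [← h i, hj]
  · exact fun h => (h (Finset.mem_univ _)).elim

/-- Every site has three half-edges, each either free or used by exactly one edge. So a site has as
many free legs as the degree bound leaves for the cofactor. -/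
theorem sum_ite_add_valency {s t : ι → I × Fin 3} {j : F → I × Fin 3}
    (hΦ : Function.Bijective (Sum.elim j (Sum.elim s t))) (hst : ∀ e, (s e).1 ≠ (t e).1) (v : I) :
    (Finset.univ.filter fun h => (j h).1 = v).card +
      valency (fun e => (s e).1) (fun e => (t e).1) v = 3 := by
  have h1 : ∑ h : I × Fin 3, (if h.1 = v then 1 else 0) = 3 := by
    rw [Fintype.sum_prod_type_right]
    simp
  rw [← Equiv.sum_comp (Equiv.ofBijective _ hΦ), Fintype.sum_sum_type, Fintype.sum_sum_type] at h1
  rw [← Finset.sum_add_distrib] at h1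
  refine Eq.trans ?_ h1
  rw [Finset.card_filter, valency]
  congr 1
  refine Finset.sum_congr rfl fun e _ => ?_
  change _ = (if (s e).1 = v then 1 else 0) + if (t e).1 = v then 1 else 0
  have := hst e
  split_ifs with h2 h3 h4 h5 h6 <;> first | rfl | (exfalso; grind)

/-- The contractions span the states without a component of total spin 3 on any edge. -/
theorem span_contraction {s t : ι → I × Fin 3} {j : F → I × Fin 3}
    (hΦ : Function.Bijective (Sum.elim j (Sum.elim s t)))
    (h : IsSimple (fun e => (s e).1) (fun e => (t e).1)) :
    Submodule.span ℂ (Set.range (contraction s t j)) = ⨅ e, sing (s e).1 (t e).1 := by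
  classical
  have hc : (1 / (Real.sqrt 2 : ℂ)) ^ Fintype.card ι ≠ 0 :=
    pow_ne_zero _ (one_div_ne_zero (Complex.ofReal_ne_zero.2 (by positivity)))
  refine le_antisymm (Submodule.span_le.2 ?_) ?_
  · rintro _ ⟨b, rfl⟩
    refine (mem_iInf_sing_iff h _).2 ?_
    rw [theta_contraction hΦ]
    exact (dvd_mul_right _ _).mul_left _
  · rw [iInf_sing_eq_span h, Submodule.span_le]
    rintro _ ⟨μ, hμ, rfl⟩
    have h1 : ∀ v, ∃ T ⊆ Finset.univ.filter fun h => (j h).1 = v, T.card = μ v := fun v => by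
      refine Finset.exists_subset_card_eq ?_
      have h2 := sum_ite_add_valency hΦ h.ne v
      have h3 := hμ v
      omega
    choose T hT hcard using h1
    -- Any exponents allowed by the degree bound arise from free legs: at each site the required
    -- number of them is put in the state one.
    let b : F → Fin 2 := fun i => if i ∈ T (j i).1 then 1 else 0
    have hprod : ∏ i, X (j i).1 ^ (b i : ℕ) = (monomial μ 1 : MvPolynomial I ℂ) := by
      rw [monomial_eq, Finsupp.prod_fintype _ _ fun _ => pow_zero _, map_one, one_mul,
        ← Finset.prod_fiberwise Finset.univ (fun i => (j i).1)]
      refine Finset.prod_congr rfl fun v _ => ?_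
      have h4 : ∀ i ∈ Finset.univ.filter fun i => (j i).1 = v, X (j i).1 ^ (b i : ℕ) =
          (X v ^ (if i ∈ T v then 1 else 0) : MvPolynomial I ℂ) := fun i hi => by
        rw [(Finset.mem_filter.1 hi).2]
        simp only [b, (Finset.mem_filter.1 hi).2]
        split_ifs <;> rfl
      rw [Finset.prod_congr rfl h4, Finset.prod_pow_eq_pow_sum, ← Finset.card_filter,
        Finset.filter_mem_eq_inter, Finset.inter_eq_right.2 (hT v), hcard]
    have h5 : bondState (fun e => (s e).1) (fun e => (t e).1) μ =
        ((1 / (Real.sqrt 2 : ℂ)) ^ Fintype.card ι)⁻¹ • contraction s t j b := by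
      refine theta_injective ?_
      rw [theta_bondState h hμ, map_smul, theta_contraction hΦ, hprod, smul_eq_C_mul, ← mul_assoc,
        ← C_mul, inv_mul_cancel₀ hc, C_1, one_mul]
    rw [h5]
    exact Submodule.smul_mem _ _ (Submodule.subset_span ⟨b, rfl⟩)

theorem contraction_ne_zero {s t : ι → I × Fin 3} {j : F → I × Fin 3}
    (hΦ : Function.Bijective (Sum.elim j (Sum.elim s t)))
    (h : IsSimple (fun e => (s e).1) (fun e => (t e).1)) (b : F → Fin 2) :
    contraction s t j b ≠ 0 := by
  intro h0
  have h1 := theta_contraction hΦ b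
  rw [h0, map_zero] at h1
  refine mul_ne_zero ?_ (mul_ne_zero (diffProd_ne_zero h) (Finset.prod_ne_zero_iff.2 fun i _ =>
    pow_ne_zero _ (X_ne_zero _))) h1.symm
  rw [Ne, C_eq_zero]
  exact pow_ne_zero _ (one_div_ne_zero (Complex.ofReal_ne_zero.2 (by positivity)))

end Contraction

/-! ### Half-edges of lattice subgraphs and the range of the AKLT map -/

section Image

variable {m n : ℕ} [NeZero m] [NeZero n] {Γ W : Finset (Site m n)}

/-- The half-edge at which an edge of the subgraph induced on `Γ` starts. -/
def InnerEdge.start (e : InnerEdge Γ) : Γ × Fin 3 :=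
  (⟨(Edge.start e.1).1, e.2.1⟩, (Edge.start e.1).2)

/-- The half-edge at which an edge of the subgraph induced on `Γ` ends. -/
def InnerEdge.finish (e : InnerEdge Γ) : Γ × Fin 3 :=
  (⟨(Edge.finish e.1).1, e.2.2⟩, (Edge.finish e.1).2)

theorem Link.target_injective {i j : Link m n} (h : Link.target i = Link.target j) (h2 : i.2 = j.2) :
    i = j := by
  obtain ⟨⟨a, b⟩, k⟩ := i
  obtain ⟨⟨c, d⟩, l⟩ := j
  simp only at h2
  subst h2
  simp only [Link.target] at h
  split_ifs at h <;> simpa using h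

theorem Edge.start_injective : Function.Injective (Edge.start : Edge m n → HalfEdge m n) := by
  rintro (v | i) (w | j) h
  · simp only [Edge.start, Prod.mk.injEq, and_true] at h
    rw [h]
  · simp [Edge.start] at h
  · simp [Edge.start] at h
  · obtain ⟨p, k⟩ := i
    obtain ⟨q, l⟩ := j
    simp only [Edge.start, Prod.mk.injEq, and_true] at h
    obtain ⟨rfl, h⟩ := h
    have : k = l := by fin_cases k <;> fin_cases l <;> simp_all
    rw [this]

theorem Edge.finish_injective : Function.Injective (Edge.finish : Edge m n → HalfEdge m n) := by
  rintro (v | i) (w | j) h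
  · simp only [Edge.finish, Prod.mk.injEq, and_true, add_left_inj] at h
    rw [Prod.ext h.1 h.2]
  · simp [Edge.finish] at h
  · simp [Edge.finish] at h
  · simp only [Edge.finish, Prod.mk.injEq, and_true] at h
    have : i.2 = j.2 := by
      have := h.2
      generalize i.2 = k at this ⊢
      generalize j.2 = l at this ⊢
      fin_cases k <;> fin_cases l <;> simp_all
    rw [Link.target_injective h.1 this]

theorem Edge.start_ne_finish (e e' : Edge m n) : Edge.start e ≠ Edge.finish e' := by
  rcases e with v | i <;> rcases e' with w | j <;> intro h
  · simp [Edge.start, Edge.finish] at h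
  · simp [Edge.start, Edge.finish] at h
  · simp [Edge.start, Edge.finish] at h
  · simp only [Edge.start, Edge.finish, Prod.mk.injEq] at h
    have := h.1.2
    generalize i.2 = k at this
    generalize j.2 = l at this
    fin_cases k <;> fin_cases l <;> simp_all

theorem Edge.start_ne_finish_vertex (e : Edge m n) : (Edge.start e).1 ≠ (Edge.finish e).1 := by
  rcases e with ⟨p, c⟩ | ⟨p, k⟩ <;> intro h
  · have := congrArg Prod.snd h
    simp only [Edge.start, Edge.finish] at this
    revert this
    fin_cases c <;> simp
  · have := congrArg Prod.snd h
    simp only [Edge.start, Edge.finish] at this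
    fin_cases k <;> simp at this

theorem Edge.eq_of_vertices {e e' : Edge m n} (h1 : (Edge.start e).1 = (Edge.start e').1)
    (h2 : (Edge.finish e).1 = (Edge.finish e').1) : e = e' := by
  rcases e with ⟨p, c⟩ | ⟨p, k⟩ <;> rcases e' with ⟨q, d⟩ | ⟨q, l⟩ <;>
    simp only [Edge.start, Edge.finish, Prod.mk.injEq] at h1 h2
  · rw [h1.1, h1.2]
  · obtain ⟨-, h1⟩ := h1
    obtain ⟨-, h2⟩ := h2
    subst h1
    fin_cases l <;> simp at h2
  · obtain ⟨-, h1⟩ := h1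
    obtain ⟨-, h2⟩ := h2
    subst h1
    fin_cases k <;> simp at h2
  · obtain ⟨rfl, h1⟩ := h1
    have : k = l := by fin_cases k <;> fin_cases l <;> simp_all
    rw [this]

theorem Edge.not_reversed {e e' : Edge m n} (h1 : (Edge.start e).1 = (Edge.finish e').1)
    (h2 : (Edge.finish e).1 = (Edge.start e').1) : False := by
  rcases e with ⟨p, c⟩ | ⟨p, k⟩ <;> rcases e' with ⟨q, d⟩ | ⟨q, l⟩ <;>
    simp only [Edge.start, Edge.finish, Prod.mk.injEq] at h1 h2
  · obtain ⟨-, h1⟩ := h1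
    obtain ⟨-, h2⟩ := h2
    subst h1
    fin_cases d <;> simp at h2
  · obtain ⟨-, h1⟩ := h1
    obtain ⟨-, h2⟩ := h2
    subst h1
    fin_cases l <;> simp at h2
  · obtain ⟨-, h1⟩ := h1
    obtain ⟨-, h2⟩ := h2
    subst h2
    fin_cases k <;> simp at h1
  · obtain ⟨-, h1⟩ := h1
    fin_cases k <;> fin_cases l <;> simp at h1

/-- This partition of the half-edges is what the abstract contraction requires: no half-edge lies on
two edges, and the free legs are by definition those on none. -/
theorem innerEdge_bijective [Fintype (InnerEdge Γ)] : Function.Bijective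
    (Sum.elim (fun h : FreeLeg Γ => h.1) (Sum.elim (InnerEdge.start (Γ := Γ)) InnerEdge.finish)) := by
  have key : ∀ {h h' : Γ × Fin 3}, h = h' ↔ ((h.1.1, h.2) : HalfEdge m n) = (h'.1.1, h'.2) :=
    fun {h h'} => ⟨fun e => by rw [e], fun e => by
      rw [Prod.mk.injEq] at e
      exact Prod.ext (Subtype.ext e.1) e.2⟩
  constructor
  · rintro (h | e | e) (h' | e' | e') he
    · exact congrArg _ (Subtype.ext he)
    · exact ((h.2 e').1 (key.1 he).symm).elim
    · exact ((h.2 e').2 (key.1 he).symm).elim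
    · exact ((h'.2 e).1 (key.1 he)).elim
    · exact congrArg _ (congrArg _ (Subtype.ext (Edge.start_injective (key.1 he))))
    · exact (Edge.start_ne_finish _ _ (key.1 he)).elim
    · exact ((h'.2 e).2 (key.1 he)).elim
    · exact (Edge.start_ne_finish _ _ (key.1 he).symm).elim
    · exact congrArg _ (congrArg _ (Subtype.ext (Edge.finish_injective (key.1 he))))
  · intro h
    by_cases hs : ∃ e : InnerEdge Γ, Edge.start e.1 = (h.1.1, h.2)
    · obtain ⟨e, he⟩ := hs
      exact ⟨Sum.inr (Sum.inl e), key.2 he⟩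
    · by_cases ht : ∃ e : InnerEdge Γ, Edge.finish e.1 = (h.1.1, h.2)
      · obtain ⟨e, he⟩ := ht
        exact ⟨Sum.inr (Sum.inr e), key.2 he⟩
      · exact ⟨Sum.inl ⟨h, fun e => ⟨fun he => hs ⟨e, he⟩, fun he => ht ⟨e, he⟩⟩⟩, rfl⟩

theorem innerEdge_isSimple : IsSimple (fun e : InnerEdge Γ => e.start.1)
    (fun e : InnerEdge Γ => e.finish.1) where
  ne e h := Edge.start_ne_finish_vertex e.1 (congrArg Subtype.val h)
  inj e e' h1 h2 := Subtype.ext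
    (Edge.eq_of_vertices (congrArg Subtype.val h1) (congrArg Subtype.val h2))
  cross e e' h1 h2 :=
    (Edge.not_reversed (congrArg Subtype.val h1) (congrArg Subtype.val h2)).elim

theorem contraction_eq [Fintype (InnerEdge Γ)] (b : FreeLeg Γ → Fin 2) :
    contraction InnerEdge.start InnerEdge.finish (fun h : FreeLeg Γ => h.1) b =
      WithLp.toLp 2 fun σ => aklt Γ σ b := by
  ext σ
  simp only [contraction, aklt, Matrix.of_apply]
  refine Finset.sum_congr rfl fun x _ => ?_
  split_ifs
  · congr 1
    convert rfl <;> rfl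
  · rfl

/-- The inclusion of sets of sites. -/
def incl (h : Γ ⊆ W) : Γ → W := fun v => ⟨v.1, h v.2⟩

theorem incl_injective (h : Γ ⊆ W) : Function.Injective (incl h) := fun _ _ e =>
  Subtype.ext (congrArg (fun u : W => u.1) e)

theorem range_aklt (Γ : Finset (Site m n)) : LinearMap.range (Matrix.toEuclideanLin (aklt Γ)) =
    ⨅ e : InnerEdge Γ, sing e.start.1 e.finish.1 := by
  have := Fintype.ofFinite (InnerEdge Γ)
  rw [← span_contraction innerEdge_bijective innerEdge_isSimple]
  refine le_antisymm ?_ (Submodule.span_le.2 ?_)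
  · rintro _ ⟨x, rfl⟩
    have : Matrix.toEuclideanLin (aklt Γ) x = ∑ b, x b •
        contraction InnerEdge.start InnerEdge.finish (fun h : FreeLeg Γ => h.1) b := by
      ext σ
      simp only [contraction_eq]
      change (aklt Γ).mulVec x.ofLp σ = _
      simp [Matrix.mulVec, dotProduct, mul_comm]
    rw [this]
    exact Submodule.sum_mem _ fun b _ => Submodule.smul_mem _ _ (Submodule.subset_span ⟨b, rfl⟩)
  · rintro _ ⟨b, rfl⟩
    refine ⟨EuclideanSpace.single b 1, ?_⟩
    rw [contraction_eq]
    ext σ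
    change (aklt Γ).mulVec (EuclideanSpace.single b (1 : ℂ)).ofLp σ = _
    simp

/-- The matrix acts as the identity outside Γ, so a state lies in its range precisely when every
slice with the outer sites fixed lies in the range of the AKLT map. -/
theorem image_eq_liftSub (h : Γ ⊆ W) :
    image h = liftSub (incl h) (LinearMap.range (Matrix.toEuclideanLin (aklt Γ))) := by
  have happ : ∀ (x : EuclideanSpace ℂ (VirtIndex Γ W)) (σ : W → Fin 4),
      Matrix.toEuclideanLin (akltOn h) x σ = Matrix.toEuclideanLin (aklt Γ)
        (WithLp.toLp 2 fun b =>
          x (b, Finset.restrict₂ (π := fun _ => Fin 4) Finset.sdiff_subset σ)) (σ ∘ incl h) :=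
    fun x σ => by
      change (akltOn h).mulVec x.ofLp σ = (aklt Γ).mulVec _ _
      simp only [Matrix.mulVec, dotProduct, akltOn, Matrix.of_apply]
      refine (Fintype.sum_prod_type _).trans (Finset.sum_congr rfl fun b _ => ?_)
      simp only [ite_mul, zero_mul, Finset.sum_ite_eq, Finset.mem_univ, if_true]
      rfl
  have hout : ∀ (τ : W → Fin 4) (σ : Γ → Fin 4),
      Finset.restrict₂ (π := fun _ => Fin 4) (Finset.sdiff_subset : W \ Γ ⊆ W)
        (Function.extend (incl h) σ τ) =
      Finset.restrict₂ (π := fun _ => Fin 4) Finset.sdiff_subset τ := fun τ σ => by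
    ext1 u
    exact Function.extend_apply' _ _ _ fun ⟨v, hv⟩ =>
      (Finset.mem_sdiff.1 u.2).2 ((congrArg (fun w : W => w.1) hv) ▸ v.2)
  ext ψ
  rw [mem_liftSub]
  constructor
  · rintro ⟨x, rfl⟩ τ
    refine ⟨WithLp.toLp 2 fun b =>
      x (b, Finset.restrict₂ (π := fun _ => Fin 4) Finset.sdiff_subset τ), ?_⟩
    ext σ
    rw [slice_apply, happ, hout, Function.extend_comp (incl_injective h)]
  · intro hψ
    choose y hy using hψ
    -- A slice does not depend on the values inside Γ. The value 0 there is an arbitrary choice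
    -- which makes the preimage depend on the outer sites alone.
    let ext : (↥(W \ Γ) → Fin 4) → W → Fin 4 := fun ρ w =>
      if hw : w.1 ∈ Γ then 0 else ρ ⟨w.1, Finset.mem_sdiff.2 ⟨w.2, hw⟩⟩
    refine ⟨WithLp.toLp 2 fun c => y (ext c.2) c.1, ?_⟩
    ext σ
    rw [happ]
    change Matrix.toEuclideanLin (aklt Γ) (y (ext _)) (σ ∘ incl h) = _
    rw [hy, slice_apply]
    refine congrArg ψ.ofLp (funext fun w => ?_)
    by_cases hw : w.1 ∈ Γ
    · exact (incl_injective h).extend_apply (σ ∘ incl h) _ ⟨w.1, hw⟩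
    · rw [Function.extend_apply' _ _ _ fun ⟨v, hv⟩ =>
        hw ((congrArg (fun w : W => w.1) hv) ▸ v.2)]
      change (if hw : w.1 ∈ Γ then 0 else _) = _
      rw [dif_neg hw]

/-- The image of the AKLT construction consists of the states without a component of total spin 3
on any edge. -/
theorem image_eq (h : Γ ⊆ W) :
    image h = ⨅ e : InnerEdge Γ, sing (incl h e.start.1) (incl h e.finish.1) := by
  rw [image_eq_liftSub, range_aklt, liftSub_iInf]
  simp only [sing_map (incl_injective h)]

end Image

end

end SquareOctagon

namespace SquareOctagon

noncomputable section

set_option linter.unusedSectionVars false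

/-! ## Product states -/

section Tensor

open MvPolynomial

open scoped InnerProductSpace

variable {T J : Type*} [Fintype T] [DecidableEq T] [Fintype J] [DecidableEq J]

/-- The product of states of several groups of sites. -/
def tensor (φ : T → Spins J) : Spins (T × J) :=
  WithLp.toLp 2 fun σ => ∏ t, φ t fun a => σ (t, a)

theorem tensor_apply (φ : T → Spins J) (σ : T × J → Fin 4) :
    tensor φ σ = ∏ t, φ t fun a => σ (t, a) := rfl

theorem inner_tensor (φ χ : T → Spins J) : ⟪tensor φ, tensor χ⟫_ℂ = ∏ t, ⟪φ t, χ t⟫_ℂ := by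
  simp only [PiLp.inner_apply, RCLike.inner_apply]
  rw [Finset.prod_univ_sum, Fintype.piFinset_univ, ← Equiv.sum_comp (Equiv.curry T J (Fin 4))]
  refine Finset.sum_congr rfl fun σ _ => ?_
  rw [tensor_apply, tensor_apply, map_prod, ← Finset.prod_mul_distrib]
  rfl

theorem theta_tensor (φ : T → Spins J) :
    theta (tensor φ) = ∏ t, rename (fun a => (t, a)) (theta (φ t)) := by
  simp only [theta_apply, map_sum]
  rw [Finset.prod_univ_sum, Fintype.piFinset_univ, ← Equiv.sum_comp (Equiv.curry T J (Fin 4))]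
  refine Finset.sum_congr rfl fun σ _ => ?_
  simp only [monomial_exps, map_mul, rename_C, map_prod, map_pow, rename_X, Finset.prod_mul_distrib]
  rw [tensor_apply, amp, Fintype.prod_prod_type, Fintype.prod_prod_type]
  simp only [amp, map_prod]
  rfl

end Tensor

/-! ## The states of one plaquette -/

section Plaquette

open MvPolynomial

open scoped InnerProductSpace ComplexOrder

/-- The binary digits of a number. -/
def bits (y : ℕ) : Fin 4 →₀ ℕ := Finsupp.equivFunOnFinite.symm fun a => y / 2 ^ (a : ℕ) % 2

theorem bits_apply (y : ℕ) (a : Fin 4) : bits y a = y / 2 ^ (a : ℕ) % 2 := rfl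

/-- The state of a plaquette with given exponents on its four legs. -/
def plaqState (y : ℕ) : Spins (Fin 4) := bondState id (· + 1) (bits y)

/-- The exponents of a term of the product of the differences around a plaquette. -/
def cyc (x : ℕ) : Fin 4 →₀ ℕ := Finsupp.equivFunOnFinite.symm fun a =>
  (1 - x / 2 ^ ((a + 3 : Fin 4) : ℕ) % 2) + x / 2 ^ (a : ℕ) % 2

theorem cyc_apply (x : ℕ) (a : Fin 4) :
    cyc x a = (1 - x / 2 ^ ((a + 3 : Fin 4) : ℕ) % 2) + x / 2 ^ (a : ℕ) % 2 := rfl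

theorem monomial_fin_four (e : Fin 4 →₀ ℕ) (c : ℂ) : monomial e c =
    C c * (X 0 ^ e 0 * X 1 ^ e 1 * X 2 ^ e 2 * X 3 ^ e 3 : MvPolynomial (Fin 4) ℂ) := by
  rw [monomial_eq, Finsupp.prod_fintype _ _ fun _ => pow_zero _, Fin.prod_univ_four]

theorem diffProd_plaquette : (diffProd id (· + 1) : MvPolynomial (Fin 4) ℂ) =
    ∑ x ∈ Finset.range 16, monomial (cyc x) ((-1) ^ ones x) := by
  rw [diffProd, Fin.prod_univ_four]
  simp only [Finset.sum_range_succ, Finset.sum_range_zero, monomial_fin_four, cyc_apply]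
  have h2 : ((2 : Fin 4) : ℕ) = 2 := rfl
  have h3 : ((3 : Fin 4) : ℕ) = 3 := rfl
  have e0 : (0 : Fin 4) + 3 = 3 := rfl
  have e1 : (1 : Fin 4) + 3 = 0 := rfl
  have e2 : (2 : Fin 4) + 3 = 1 := rfl
  have e3 : (3 : Fin 4) + 3 = 2 := rfl
  have f1 : (1 : Fin 4) + 1 = 2 := rfl
  have f2 : (2 : Fin 4) + 1 = 3 := rfl
  have f3 : (3 : Fin 4) + 1 = 0 := rfl
  simp [h2, h3, e0, e1, e2, e3, f1, f2, f3, ones]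
  ring

/-- Monomials are orthogonal, with squared norm the product of the inverse binomial coefficients.
All Gram entries are computed from this. -/
theorem inner_ofPoly_monomial {e e' : Fin 4 →₀ ℕ} (he : ∀ a, e a ≤ 3) :
    ⟪ofPoly (monomial e (1 : ℂ)), ofPoly (monomial e' (1 : ℂ))⟫_ℂ =
      if e = e' then ∏ a, (1 / (Nat.choose 3 (e a) : ℂ)) else 0 := by
  rw [PiLp.inner_apply]
  let σ : Fin 4 → Fin 4 := fun a => ⟨e a, Nat.lt_succ_of_le (he a)⟩
  have hσ : exps σ = e := Finsupp.ext fun a => rfl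
  rw [Finset.sum_eq_single σ]
  · rw [ofPoly_apply, ofPoly_apply, coeff_monomial, coeff_monomial, hσ, if_pos rfl,
      RCLike.inner_apply]
    by_cases h : e = e'
    · have hr : ∀ k, starRingEnd ℂ (root k) = root k := fun k => Complex.conj_ofReal _
      rw [if_pos h.symm, if_pos h, map_div₀, map_one, amp, map_prod, div_mul_div_comm, one_mul,
        ← Finset.prod_mul_distrib, Finset.prod_div_distrib, Finset.prod_const_one]
      congr 1
      refine Finset.prod_congr rfl fun a _ => ?_
      rw [hr, root_mul_self]
    · rw [if_neg (Ne.symm h), if_neg h, zero_div, zero_mul]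
  · intro τ _ hτ
    rw [ofPoly_apply, coeff_monomial, if_neg, zero_div, inner_zero_left]
    exact fun h => hτ (exps_injective (h.symm.trans hσ.symm))
  · exact fun h => (h (Finset.mem_univ _)).elim

/-- Three over a binomial coefficient. -/
def wt (d : ℕ) : ℤ := if d = 0 ∨ d = 3 then 3 else 1

/-- The exponents of a term of a plaquette state, in base four. -/
def code (x y : ℕ) : ℕ := (1 - x / 8 % 2 + x % 2 + y % 2) + 4 * (1 - x % 2 + x / 2 % 2 + y / 2 % 2) +
  16 * (1 - x / 2 % 2 + x / 4 % 2 + y / 4 % 2) + 64 * (1 - x / 4 % 2 + x / 8 % 2 + y / 8 % 2)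

/-- The overlap of two terms of plaquette states. -/
def codeWeight (c : ℕ) : ℤ := wt (c % 4) * wt (c / 4 % 4) * wt (c / 16 % 4) * wt (c / 64)

/-- The overlaps of plaquette states. -/
def gramSum (y z : ℕ) : ℤ := ∑ x ∈ Finset.range 16, ∑ x' ∈ Finset.range 16,
  if code x y = code x' z then (-1) ^ ones x * (-1) ^ ones x' * codeWeight (code x y) else 0

-- The table used by the certificates is validated here: expanding the product of the four
-- differences gives sixteen signed monomials, and the overlaps are sums over coinciding pairs. The
-- factor 81 = 3⁴ clears the denominators, one 3 for each site.
set_option maxRecDepth 100000 in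
theorem gramSum_eq : ∀ y < 16, ∀ z < 16, gramSum y z = gram y z := by
  decide +kernel

end Plaquette

end

end SquareOctagon

/-! ### The Gram matrix of the plaquette states -/

namespace SquareOctagon

noncomputable section

set_option linter.unusedSectionVars false

section PlaquetteGram

open MvPolynomial

open scoped InnerProductSpace ComplexOrder

theorem bits_le (y : ℕ) (a : Fin 4) : bits y a ≤ 1 := by
  rw [bits_apply]
  omega

theorem plaqState_eq (y : ℕ) : plaqState y =
    ∑ x ∈ Finset.range 16, ((-1 : ℂ) ^ ones x) • ofPoly (monomial (cyc x + bits y) (1 : ℂ)) := by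
  rw [plaqState, bondState, diffProd_plaquette, Finset.sum_mul, map_sum]
  refine Finset.sum_congr rfl fun x _ => ?_
  rw [monomial_mul, mul_one, ← map_smul, smul_monomial, smul_eq_mul, mul_one]

theorem cyc_add_bits_le (x y : ℕ) (a : Fin 4) : (cyc x + bits y) a ≤ 3 := by
  rw [Finsupp.add_apply, cyc_apply, bits_apply]
  omega

theorem code_eq (x y : ℕ) : code x y = (cyc x + bits y) 0 + 4 * (cyc x + bits y) 1 +
    16 * (cyc x + bits y) 2 + 64 * (cyc x + bits y) 3 := by
  simp only [Finsupp.add_apply, cyc_apply, bits_apply, code, Fin.val_zero,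
    Fin.val_one, pow_zero, pow_one, Nat.div_one, show ((2 : Fin 4) : ℕ) = 2 from rfl,
    show ((3 : Fin 4) : ℕ) = 3 from rfl, show (0 : Fin 4) + 3 = 3 from rfl,
    show (1 : Fin 4) + 3 = 0 from rfl, show (2 : Fin 4) + 3 = 1 from rfl,
    show (3 : Fin 4) + 3 = 2 from rfl, show 2 ^ 2 = 4 from rfl, show 2 ^ 3 = 8 from rfl]

/-- All exponents are at most three, so the base-four encoding is faithful. -/
theorem code_eq_iff (x y x' y' : ℕ) : code x y = code x' y' ↔ cyc x + bits y = cyc x' + bits y' := by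
  have h := cyc_add_bits_le x y
  have h' := cyc_add_bits_le x' y'
  rw [code_eq, code_eq]
  generalize cyc x + bits y = e at *
  generalize cyc x' + bits y' = e' at *
  constructor
  · intro hc
    have h0 := h 0
    have h1 := h 1
    have h2 := h 2
    have h3 := h 3
    have h0' := h' 0
    have h1' := h' 1
    have h2' := h' 2
    have h3' := h' 3
    ext a
    fin_cases a
    · change e 0 = e' 0
      omega
    · change e 1 = e' 1
      omega
    · change e 2 = e' 2
      omega
    · change e 3 = e' 3
      omega
  · rintro rfl
    rfl

theorem wt_eq {d : ℕ} (h : d ≤ 3) : (wt d : ℂ) = 3 * (1 / (Nat.choose 3 d : ℂ)) := by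
  interval_cases d <;> simp [wt, Nat.choose]

theorem codeWeight_code (x y : ℕ) : (codeWeight (code x y) : ℂ) =
    81 * ∏ a, (1 / (Nat.choose 3 ((cyc x + bits y) a) : ℂ)) := by
  have h := cyc_add_bits_le x y
  rw [code_eq]
  generalize cyc x + bits y = e at *
  have h0 := h 0
  have h1 := h 1
  have h2 := h 2
  have h3 := h 3
  rw [codeWeight, show (e 0 + 4 * e 1 + 16 * e 2 + 64 * e 3) % 4 = e 0 by omega,
    show (e 0 + 4 * e 1 + 16 * e 2 + 64 * e 3) / 4 % 4 = e 1 by omega,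
    show (e 0 + 4 * e 1 + 16 * e 2 + 64 * e 3) / 16 % 4 = e 2 by omega,
    show (e 0 + 4 * e 1 + 16 * e 2 + 64 * e 3) / 64 = e 3 by omega, Fin.prod_univ_four]
  push_cast
  rw [wt_eq h0, wt_eq h1, wt_eq h2, wt_eq h3]
  ring

theorem inner_plaqState {y z : ℕ} (hy : y < 16) (hz : z < 16) :
    ⟪plaqState y, plaqState z⟫_ℂ = (gram y z : ℂ) / 81 := by
  rw [← gramSum_eq y hy z hz, eq_div_iff (by norm_num), gramSum, plaqState_eq, plaqState_eq,
    sum_inner, Finset.sum_mul]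
  push_cast
  refine Finset.sum_congr rfl fun x _ => ?_
  rw [inner_sum, Finset.sum_mul]
  refine Finset.sum_congr rfl fun x' _ => ?_
  rw [inner_smul_left, inner_smul_right, inner_ofPoly_monomial (cyc_add_bits_le x y)]
  simp only [code_eq_iff]
  by_cases h : cyc x + bits y = cyc x' + bits z
  · rw [if_pos h, if_pos h, codeWeight_code]
    simp only [map_pow, map_neg, map_one]
    push_cast
    ring
  · rw [if_neg h, if_neg h]
    simp

theorem plaqState_mod (y : ℕ) : plaqState (y % 16) = plaqState y := by
  have : bits (y % 16) = bits y := by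
    ext a
    rw [bits_apply, bits_apply]
    fin_cases a
    · change y % 16 / 1 % 2 = y / 1 % 2
      omega
    · change y % 16 / 2 % 2 = y / 2 % 2
      omega
    · change y % 16 / 4 % 2 = y / 4 % 2
      omega
    · change y % 16 / 8 % 2 = y / 8 % 2
      omega
  rw [plaqState, plaqState, this]

theorem inner_plaqState' (y z : ℕ) : ⟪plaqState y, plaqState z⟫_ℂ = (gram y z : ℂ) / 81 := by
  rw [← plaqState_mod y, ← plaqState_mod z, gram_mod,
    inner_plaqState (Nat.mod_lt _ (by norm_num)) (Nat.mod_lt _ (by norm_num))]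

theorem valency_plaquette (a : Fin 4) : valency (id : Fin 4 → Fin 4) (fun a => a + 1) a = 2 := by
  revert a
  decide

theorem isSimple_plaquette : IsSimple (id : Fin 4 → Fin 4) (· + 1) :=
  ⟨by decide, by decide, by decide⟩

theorem theta_plaqState (y : ℕ) :
    theta (plaqState y) = diffProd id (· + 1) * ∏ a : Fin 4, X a ^ (y / 2 ^ (a : ℕ) % 2) := by
  rw [plaqState, theta_bondState isSimple_plaquette fun v => by
    rw [valency_plaquette]
    have := bits_le y v
    omega, monomial_eq, Finsupp.prod_fintype _ _ fun _ => pow_zero _, map_one, one_mul]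
  rfl

/-! ### Positivity -/

/-- Diagonal dominance. -/
theorem sum_sq_le_of_dominant {ι : Type*} [Fintype ι] [DecidableEq ι] {M : Matrix ι ι ℝ}
    (hM : ∀ i j, M i j = M j i) (h : ∀ i, 1 + ∑ j, (if i = j then 0 else |M i j|) ≤ M i i) :
    (M - 1).PosSemidef := by
  refine Matrix.PosSemidef.of_dotProduct_mulVec_nonneg ?_ fun x => ?_
  · refine Matrix.IsHermitian.sub ?_ Matrix.isHermitian_one
    ext i j
    exact hM j i
  · have h1 : star x ⬝ᵥ (M - 1).mulVec x = ∑ i, ∑ j, x i * (M - 1) i j * x j := by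
      simp only [dotProduct, Matrix.mulVec, Pi.star_apply, star_trivial, Finset.mul_sum, mul_assoc]
    have h2 : ∀ i j, (if i = j then (M i i - 1) * ((x i ^ 2 + x j ^ 2) / 2) else
        -(|M i j| * ((x i ^ 2 + x j ^ 2) / 2))) ≤ x i * (M - 1) i j * x j := fun i j => by
      rw [Matrix.sub_apply, Matrix.one_apply]
      split_ifs with hij
      · subst hij
        exact le_of_eq (by ring)
      · have h3 : |x i * x j| ≤ (x i ^ 2 + x j ^ 2) / 2 := by
          rw [abs_le]
          constructor <;> nlinarith [sq_nonneg (x i + x j), sq_nonneg (x i - x j)]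
        have h4 : |M i j * (x i * x j)| ≤ |M i j| * ((x i ^ 2 + x j ^ 2) / 2) := by
          rw [abs_mul]
          exact mul_le_mul_of_nonneg_left h3 (abs_nonneg _)
        rw [sub_zero]
        linarith [(abs_le.1 h4).1]
    have h3 : ∀ i j, (if i = j then (M i i - 1) * ((x i ^ 2 + x j ^ 2) / 2) else
        -(|M i j| * ((x i ^ 2 + x j ^ 2) / 2))) =
        (if i = j then M i i - 1 else -|M i j|) * x i ^ 2 / 2 +
        (if j = i then M j j - 1 else -|M j i|) * x j ^ 2 / 2 := fun i j => by
      by_cases hij : i = j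
      · subst hij
        simp only [if_true]
        ring
      · rw [if_neg hij, if_neg hij, if_neg (Ne.symm hij), hM j i]
        ring
    have h4 : ∀ i, 0 ≤ ∑ j, (if i = j then M i i - 1 else -|M i j|) := fun i => by
      have h5 : ∀ j, (if i = j then M i i - 1 else -|M i j|) =
          (if i = j then M i i - 1 else 0) - (if i = j then 0 else |M i j|) := fun j => by
        split_ifs <;> ring
      simp only [h5, Finset.sum_sub_distrib, Finset.sum_ite_eq, Finset.mem_univ, if_true]
      linarith [h i]
    rw [h1]
    refine le_trans ?_ (Finset.sum_le_sum fun i _ => Finset.sum_le_sum fun j _ => h2 i j)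
    simp only [h3, Finset.sum_add_distrib]
    rw [Finset.sum_comm (f := fun i j => (if j = i then M j j - 1 else -|M j i|) * x j ^ 2 / 2)]
    simp only [← Finset.sum_div, ← Finset.sum_mul]
    have h6 : 0 ≤ ∑ i, (∑ j, (if i = j then M i i - 1 else -|M i j|)) * x i ^ 2 :=
      Finset.sum_nonneg fun i _ => mul_nonneg (h4 i) (sq_nonneg _)
    linarith

/-- The Gram matrix of the plaquette states, times 81. -/
def gramMatrix : Matrix (Fin 16) (Fin 16) ℝ := Matrix.of fun x y => (gram x y : ℝ)

theorem gram_dominant : ∀ x : Fin 16, 1 + ∑ y : Fin 16, (if x = y then 0 else |gram x y|) ≤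
    gram x x := by
  decide +kernel

theorem gramMatrix_posSemidef : (gramMatrix - 1).PosSemidef := by
  refine sum_sq_le_of_dominant (fun i j => ?_) fun i => ?_
  · change (gram i j : ℝ) = gram j i
    rw [gram_comm]
  · have h : ((1 + ∑ y : Fin 16, (if i = y then 0 else |gram i y|) : ℤ) : ℝ) ≤ (gram i i : ℤ) :=
      Int.cast_le.2 (gram_dominant i)
    push_cast at h
    exact h

open scoped Kronecker

/-- M ⊗ N - 1 is the sum of (M - 1) ⊗ (N - 1), (M - 1) ⊗ 1 and 1 ⊗ (N - 1), all positive. This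
propagates the diagonal dominance of one plaquette to products of three. -/
theorem kronecker_posSemidef {α β : Type*} [Fintype α] [DecidableEq α] [Fintype β] [DecidableEq β]
    {M : Matrix α α ℝ} {N : Matrix β β ℝ} (hM : (M - 1).PosSemidef) (hN : (N - 1).PosSemidef) :
    (M ⊗ₖ N - 1).PosSemidef := by
  have h : M ⊗ₖ N - 1 = (M - 1) ⊗ₖ (N - 1) + (M - 1) ⊗ₖ (1 : Matrix β β ℝ) +
      (1 : Matrix α α ℝ) ⊗ₖ (N - 1) := by
    rw [← Matrix.one_kronecker_one (m := α) (n := β)]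
    ext ⟨i, j⟩ ⟨k, l⟩
    simp only [Matrix.sub_apply, Matrix.add_apply, Matrix.kroneckerMap_apply]
    ring
  rw [h]
  exact ((hM.kronecker hN).add (hM.kronecker Matrix.PosSemidef.one)).add
    (Matrix.PosSemidef.one.kronecker hN)

/-- The Gram matrix of products of three plaquette states is bounded below. -/
theorem sum_sq_le_gram (c : Fin 16 × Fin 16 × Fin 16 → ℝ) : ∑ y, c y ^ 2 ≤ ∑ y, ∑ z,
    c y * c z * (gram y.1 z.1 * (gram y.2.1 z.2.1 * gram y.2.2 z.2.2)) := by
  have h := (kronecker_posSemidef gramMatrix_posSemidef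
    (kronecker_posSemidef gramMatrix_posSemidef gramMatrix_posSemidef)).dotProduct_mulVec_nonneg c
  rw [Matrix.sub_mulVec, dotProduct_sub, Matrix.one_mulVec, sub_nonneg] at h
  refine le_trans (le_of_eq ?_) (h.trans (le_of_eq ?_))
  · simp only [dotProduct, Pi.star_apply, star_trivial, sq]
  · simp only [dotProduct, Matrix.mulVec, Pi.star_apply, star_trivial, Finset.mul_sum]
    refine Finset.sum_congr rfl fun y _ => Finset.sum_congr rfl fun z _ => ?_
    simp only [Matrix.kroneckerMap_apply, gramMatrix, Matrix.of_apply]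
    ring

end PlaquetteGram

end

end SquareOctagon

namespace SquareOctagon

noncomputable section

set_option linter.unusedSectionVars false

/-! ## Three plaquettes

The plaquettes `0`, `1` and `2` are joined by a link between their corners `0`, and by a link which
joins the corner `0` of plaquette `2` to the corner `1` (perpendicular links) or `2` (collinear links)
of plaquette `1`. -/

section Triple

open MvPolynomial

open scoped InnerProductSpace ComplexOrder

/-- The sites of three plaquettes. -/
abbrev Trio := Fin 3 × Fin 4

/-- The next corner of the plaquette. -/
def next {T : Type*} (v : T × Fin 4) : T × Fin 4 := (v.1, v.2 + 1)

/-- The corner of the middle plaquette at the second link. -/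
def far (b : Bool) : Fin 4 := if b then 1 else 2

/-- The product of three plaquette states. -/
def triple (x y z : ℕ) : Spins Trio := tensor fun t => plaqState (![x, y, z] t)

theorem inner_triple (x y z x' y' z' : ℕ) : ⟪triple x y z, triple x' y' z'⟫_ℂ =
    (gram x x' * gram y y' * gram z z' : ℂ) / 81 ^ 3 := by
  rw [triple, triple, inner_tensor, Fin.prod_univ_three]
  simp only [inner_plaqState', Matrix.cons_val_zero, Matrix.cons_val_one, Matrix.cons_val]
  ring

/-- The monomial of the free legs of a plaquette. -/
def legs (t : Fin 3) (y : ℕ) : MvPolynomial Trio ℂ := ∏ a : Fin 4, X (t, a) ^ (y / 2 ^ (a : ℕ) % 2)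

theorem theta_triple (x y z : ℕ) :
    theta (triple x y z) = diffProd id next * (legs 0 x * legs 1 y * legs 2 z) := by
  have h : (diffProd id next : MvPolynomial Trio ℂ) =
      ∏ t : Fin 3, rename (fun a => (t, a)) (diffProd id (fun a => a + 1) : MvPolynomial (Fin 4) ℂ) := by
    simp only [diffProd, map_prod, map_sub, rename_X]
    exact Fintype.prod_prod_type _
  have h1 : ∀ (t : Fin 3) (y : ℕ), rename (fun a : Fin 4 => (t, a)) (theta (plaqState y)) =
      rename (fun a => (t, a)) (diffProd id (fun a => a + 1) : MvPolynomial (Fin 4) ℂ) *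
        legs t y := fun t y => by
    rw [theta_plaqState, map_mul, map_prod, legs]
    simp only [map_pow, rename_X]
  rw [triple, theta_tensor, Finset.prod_congr rfl fun t _ => h1 t _, Finset.prod_mul_distrib, ← h,
    Fin.prod_univ_three (fun t => legs t _)]
  simp only [Matrix.cons_val_zero, Matrix.cons_val_one, Matrix.cons_val]

theorem legs_eq (t : Fin 3) (y : ℕ) : legs t y = X (t, 0) ^ (y % 2) * X (t, 1) ^ (y / 2 % 2) *
    X (t, 2) ^ (y / 4 % 2) * X (t, 3) ^ (y / 8 % 2) := by
  rw [legs, Fin.prod_univ_four]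
  simp [show ((2 : Fin 4) : ℕ) = 2 from rfl, show ((3 : Fin 4) : ℕ) = 3 from rfl]

theorem legs_two_mul_add_one (t : Fin 3) (y : ℕ) :
    legs t (2 * y + 1) = X (t, 0) * legs t (2 * y) := by
  rw [legs_eq, legs_eq, show (2 * y + 1) % 2 = 1 by omega, show 2 * y % 2 = 0 by omega,
    show (2 * y + 1) / 2 = 2 * y / 2 by omega, show (2 * y + 1) / 4 = 2 * y / 4 by omega,
    show (2 * y + 1) / 8 = 2 * y / 8 by omega]
  ring

/-- The product of three plaquette states with a singlet on the first link. -/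
def linkState (i : ℕ) : Spins Trio :=
  triple (2 * (i % 64 % 8)) (2 * (i % 64 / 8) + 1) (i / 64) -
    triple (2 * (i % 64 % 8) + 1) (2 * (i % 64 / 8)) (i / 64)

theorem inner_linkState (i j : ℕ) : ⟪linkState i, linkState j⟫_ℂ = (normMat i j : ℂ) / 81 ^ 3 := by
  rw [linkState, linkState, inner_sub_left, inner_sub_right, inner_sub_right]
  simp only [inner_triple, normMat, full2_eq, half2_eq]
  push_cast
  ring

theorem theta_linkState (i : ℕ) : theta (linkState i) = diffProd id next *
    ((X (1, 0) - X (0, 0)) * (legs 0 (2 * (i % 64 % 8)) * legs 1 (2 * (i % 64 / 8)) *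
      legs 2 (i / 64))) := by
  rw [linkState, map_sub, theta_triple, theta_triple, legs_two_mul_add_one, legs_two_mul_add_one]
  ring

/-- The product of three plaquette states with singlets on both links. -/
def commonState (b : Bool) (o : ℕ) : Spins Trio :=
  linkState (common b o 0) - linkState (common b o 1)

/-- The two terms of a common state differ only by moving one occupied leg from the corner of the
middle plaquette at the second link to the third plaquette. Their difference therefore has the
factor of the second link. The binary bookkeeping of `common` is verified digit by digit. -/
theorem theta_commonState {b : Bool} {o : ℕ} (ho : o < 256) : theta (commonState b o) =
    diffProd id next * ((X (1, 0) - X (0, 0)) * ((X (1, far b) - X (2, 0)) *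
      (legs 0 (2 * (o % 8)) * legs 1 (2 * (common b o 1 % 64 / 8)) * legs 2 (2 * (o / 32))))) := by
  have h1 : ∀ u < 2, common b o u % 64 % 8 = o % 8 := fun u hu => by
    cases b <;> simp only [common] <;> omega
  have h2 : ∀ u < 2, common b o u / 64 = 2 * (o / 32) + u := fun u hu => by
    cases b <;> simp only [common] <;> omega
  have h3 : legs 1 (2 * (common b o 0 % 64 / 8)) =
      X (1, far b) * legs 1 (2 * (common b o 1 % 64 / 8)) := by
    have hd : ∀ x y : ℕ, x < 8 → (x * 2 ^ 0 + 8 * y) % 64 / 8 = y % 8 := fun x y hx => by omega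
    rw [legs_eq, legs_eq]
    cases b
    · have e0 : common false o 0 % 64 / 8 = o / 8 % 4 % 2 + 2 + 4 * (o / 8 % 4 / 2) := by
        simp only [common]; omega
      have e1 : common false o 1 % 64 / 8 = o / 8 % 4 % 2 + 4 * (o / 8 % 4 / 2) := by
        simp only [common]; omega
      rw [e0, e1]
      generalize o / 8 % 4 = w
      rw [show 2 * (w % 2 + 2 + 4 * (w / 2)) % 2 = 0 by omega,
        show 2 * (w % 2 + 2 + 4 * (w / 2)) / 2 % 2 = w % 2 by omega,
        show 2 * (w % 2 + 2 + 4 * (w / 2)) / 4 % 2 = 1 by omega,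
        show 2 * (w % 2 + 2 + 4 * (w / 2)) / 8 % 2 = w / 2 % 2 by omega,
        show 2 * (w % 2 + 4 * (w / 2)) % 2 = 0 by omega,
        show 2 * (w % 2 + 4 * (w / 2)) / 2 % 2 = w % 2 by omega,
        show 2 * (w % 2 + 4 * (w / 2)) / 4 % 2 = 0 by omega,
        show 2 * (w % 2 + 4 * (w / 2)) / 8 % 2 = w / 2 % 2 by omega, far]
      simp only [Bool.false_eq_true, if_false]
      ring
    · have e0 : common true o 0 % 64 / 8 = 1 + 2 * (o / 8 % 4) := by
        simp only [common]; omega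
      have e1 : common true o 1 % 64 / 8 = 2 * (o / 8 % 4) := by
        simp only [common]; omega
      rw [e0, e1]
      generalize o / 8 % 4 = w
      rw [show 2 * (1 + 2 * w) % 2 = 0 by omega, show 2 * (1 + 2 * w) / 2 % 2 = 1 by omega,
        show 2 * (1 + 2 * w) / 4 % 2 = w % 2 by omega,
        show 2 * (1 + 2 * w) / 8 % 2 = w / 2 % 2 by omega,
        show 2 * (2 * w) % 2 = 0 by omega, show 2 * (2 * w) / 2 % 2 = 0 by omega,
        show 2 * (2 * w) / 4 % 2 = w % 2 by omega,
        show 2 * (2 * w) / 8 % 2 = w / 2 % 2 by omega, far]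
      simp only [if_true]
      ring
  rw [commonState, map_sub, theta_linkState, theta_linkState, h1 0 (by norm_num),
    h1 1 (by norm_num), h2 0 (by norm_num), h2 1 (by norm_num), h3, add_zero, legs_two_mul_add_one]
  ring

/-! ### The spaces -/

/-- No component of total spin 3 on the edges of a plaquette. -/
def plaqSub (t : Fin 3) : Submodule ℂ (Spins Trio) := ⨅ a : Fin 4, sing (t, a) (t, a + 1)

/-- No component of total spin 3 on the edges of the first two plaquettes and the first link. -/
def firstSub : Submodule ℂ (Spins Trio) := plaqSub 0 ⊓ plaqSub 1 ⊓ sing (0, 0) (1, 0)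

/-- No component of total spin 3 on the edges of the last two plaquettes and the second link. -/
def secondSub (b : Bool) : Submodule ℂ (Spins Trio) :=
  plaqSub 1 ⊓ plaqSub 2 ⊓ sing (1, far b) (2, 0)

theorem mem_plaquettes_iff (ψ : Spins Trio) :
    (∀ v : Trio, ψ ∈ sing v (next v)) ↔ ψ ∈ plaqSub 0 ∧ ψ ∈ plaqSub 1 ∧ ψ ∈ plaqSub 2 := by
  simp only [plaqSub, Submodule.mem_iInf]
  constructor
  · intro h
    exact ⟨fun a => h (0, a), fun a => h (1, a), fun a => h (2, a)⟩
  · rintro ⟨h0, h1, h2⟩ ⟨t, a⟩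
    fin_cases t
    · exact h0 a
    · exact h1 a
    · exact h2 a

/-- The start of an edge of the plaquettes or of the first link. -/
def oneS : Trio ⊕ Unit → Trio := Sum.elim id fun _ => (0, 0)

/-- The end of an edge of the plaquettes or of the first link. -/
def oneT : Trio ⊕ Unit → Trio := Sum.elim next fun _ => (1, 0)

/-- The start of an edge of the plaquettes or of a link. -/
def bothS : Trio ⊕ Fin 2 → Trio := Sum.elim id ![(0, 0), (2, 0)]

/-- The end of an edge of the plaquettes or of a link. -/
def bothT (b : Bool) : Trio ⊕ Fin 2 → Trio := Sum.elim next ![(1, 0), (1, far b)]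

theorem isSimple_plaquettes : IsSimple (id : Trio → Trio) next := ⟨by decide, by decide, by decide⟩

theorem isSimple_one : IsSimple oneS oneT := ⟨by decide, by decide, by decide⟩

theorem isSimple_both (b : Bool) : IsSimple bothS (bothT b) := by
  cases b <;> exact ⟨by decide, by decide, by decide⟩

theorem valency_plaquettes (v : Trio) : valency id next v = 2 := by
  revert v
  decide

theorem valency_one (v : Trio) :
    valency oneS oneT v = if v = (0, 0) ∨ v = (1, 0) then 3 else 2 := by
  revert v
  decide

theorem valency_both (b : Bool) (v : Trio) : valency bothS (bothT b) v =
    if v = (0, 0) ∨ v = (1, 0) ∨ v = (1, far b) ∨ v = (2, 0) then 3 else 2 := by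
  revert v
  cases b <;> decide

theorem diffProd_one : diffProd oneS oneT = diffProd id next * (X (1, 0) - X (0, 0)) := by
  rw [diffProd, Fintype.prod_sum_type]
  simp [oneS, oneT, diffProd]

theorem diffProd_both (b : Bool) : diffProd bothS (bothT b) =
    diffProd id next * ((X (1, 0) - X (0, 0)) * (X (1, far b) - X (2, 0))) := by
  rw [diffProd, Fintype.prod_sum_type]
  simp [bothS, bothT, diffProd]

theorem iInf_one : ⨅ e, sing (oneS e) (oneT e) = firstSub ⊓ plaqSub 2 := by
  ext ψ
  simp only [Submodule.mem_iInf, Sum.forall, oneS, oneT, Sum.elim_inl, Sum.elim_inr, id,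
    mem_plaquettes_iff, firstSub, Submodule.mem_inf]
  tauto

theorem iInf_both (b : Bool) :
    ⨅ e, sing (bothS e) (bothT b e) = firstSub ⊓ secondSub b := by
  have hne : ((2, 0) : Trio) ≠ (1, far b) := by cases b <;> decide
  ext ψ
  simp only [Submodule.mem_iInf, Sum.forall, bothS, bothT, Sum.elim_inl, Sum.elim_inr, id,
    mem_plaquettes_iff, firstSub, secondSub, Submodule.mem_inf, Fin.forall_fin_two,
    Matrix.cons_val_zero, Matrix.cons_val_one, sing_comm hne]
  tauto

theorem linkState_mem (i : ℕ) : linkState i ∈ firstSub ⊓ plaqSub 2 := by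
  rw [← iInf_one, mem_iInf_sing_iff isSimple_one, theta_linkState, diffProd_one]
  generalize (diffProd id next : MvPolynomial Trio ℂ) = d
  exact Dvd.intro (legs 0 (2 * (i % 64 % 8)) * legs 1 (2 * (i % 64 / 8)) * legs 2 (i / 64))
    (by ring)

theorem commonState_mem {b : Bool} {o : ℕ} (ho : o < 256) :
    commonState b o ∈ firstSub ⊓ secondSub b := by
  rw [← iInf_both, mem_iInf_sing_iff (isSimple_both b), theta_commonState ho, diffProd_both]
  generalize (diffProd id next : MvPolynomial Trio ℂ) = d
  exact Dvd.intro (legs 0 (2 * (o % 8)) * legs 1 (2 * (common b o 1 % 64 / 8)) *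
    legs 2 (2 * (o / 32))) (by ring)

theorem monomial_trio (μ : Trio →₀ ℕ) : (monomial μ 1 : MvPolynomial Trio ℂ) =
    ∏ t, (X (t, 0) ^ μ (t, 0) * X (t, 1) ^ μ (t, 1) * X (t, 2) ^ μ (t, 2) * X (t, 3) ^ μ (t, 3)) := by
  rw [monomial_eq, Finsupp.prod_fintype _ _ fun _ => pow_zero _, map_one, one_mul,
    Fintype.prod_prod_type]
  exact Finset.prod_congr rfl fun t _ => Fin.prod_univ_four _

theorem legs_of_digits (t : Fin 3) {a b c d : ℕ} (ha : a ≤ 1) (hb : b ≤ 1) (hc : c ≤ 1)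
    (hd : d ≤ 1) : legs t (a + 2 * b + 4 * c + 8 * d) =
    X (t, 0) ^ a * X (t, 1) ^ b * X (t, 2) ^ c * X (t, 3) ^ d := by
  rw [legs_eq, show (a + 2 * b + 4 * c + 8 * d) % 2 = a by omega,
    show (a + 2 * b + 4 * c + 8 * d) / 2 % 2 = b by omega,
    show (a + 2 * b + 4 * c + 8 * d) / 4 % 2 = c by omega,
    show (a + 2 * b + 4 * c + 8 * d) / 8 % 2 = d by omega]

/-- The exponents of the cofactor are zero at the two ends of the link and at most one elsewhere.
The ten free exponents are the binary digits of the index. -/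
theorem firstSub_inf_eq : firstSub ⊓ plaqSub 2 =
    Submodule.span ℂ (Set.range fun i : Fin 1024 => linkState i) := by
  refine le_antisymm ?_ (Submodule.span_le.2 ?_)
  · rw [← iInf_one, iInf_sing_eq_span isSimple_one]
    refine Submodule.span_mono ?_
    rintro _ ⟨μ, hμ, rfl⟩
    have h1 : ∀ v, μ v ≤ 1 := fun v => by
      have := hμ v
      rw [valency_one] at this
      split_ifs at this <;> omega
    have h00 : μ (0, 0) = 0 := by
      have := hμ (0, 0)
      rw [valency_one, if_pos (by decide)] at this
      omega
    have h10 : μ (1, 0) = 0 := by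
      have := hμ (1, 0)
      rw [valency_one, if_pos (by decide)] at this
      omega
    set l := μ (0, 1) + 2 * μ (0, 2) + 4 * μ (0, 3) with hl
    set c := μ (1, 1) + 2 * μ (1, 2) + 4 * μ (1, 3) with hc
    set r := μ (2, 0) + 2 * μ (2, 1) + 4 * μ (2, 2) + 8 * μ (2, 3) with hr
    have b1 := h1 (0, 1)
    have b2 := h1 (0, 2)
    have b3 := h1 (0, 3)
    have c1 := h1 (1, 1)
    have c2 := h1 (1, 2)
    have c3 := h1 (1, 3)
    have r0 := h1 (2, 0)
    have r1 := h1 (2, 1)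
    have r2 := h1 (2, 2)
    have r3 := h1 (2, 3)
    refine ⟨⟨l + 8 * c + 64 * r, by omega⟩, theta_injective ?_⟩
    rw [theta_bondState isSimple_one hμ, diffProd_one]
    change theta (linkState (l + 8 * c + 64 * r)) = _
    rw [theta_linkState, show (l + 8 * c + 64 * r) % 64 % 8 = l by omega,
      show (l + 8 * c + 64 * r) % 64 / 8 = c by omega, show (l + 8 * c + 64 * r) / 64 = r by omega,
      monomial_trio, Fin.prod_univ_three, ← legs_of_digits 2 r0 r1 r2 r3,
      ← legs_of_digits 0 (h1 _) b1 b2 b3, ← legs_of_digits 1 (h1 _) c1 c2 c3, h00, h10,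
      show 0 + 2 * μ (0, 1) + 4 * μ (0, 2) + 8 * μ (0, 3) = 2 * l by omega,
      show 0 + 2 * μ (1, 1) + 4 * μ (1, 2) + 8 * μ (1, 3) = 2 * c by omega]
    ring
  · rintro _ ⟨i, rfl⟩
    exact linkState_mem i

theorem firstSub_inf_secondSub_eq (b : Bool) : firstSub ⊓ secondSub b =
    Submodule.span ℂ (Set.range fun o : Fin 256 => commonState b o) := by
  refine le_antisymm ?_ (Submodule.span_le.2 ?_)
  · rw [← iInf_both, iInf_sing_eq_span (isSimple_both b)]
    refine Submodule.span_mono ?_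
    rintro _ ⟨μ, hμ, rfl⟩
    have h1 : ∀ v, μ v ≤ 1 := fun v => by
      have := hμ v
      rw [valency_both] at this
      split_ifs at this <;> omega
    have h0 : ∀ v, v = (0, 0) ∨ v = (1, 0) ∨ v = (1, far b) ∨ v = (2, 0) → μ v = 0 := fun v hv => by
      have := hμ v
      rw [valency_both, if_pos hv] at this
      omega
    have h00 := h0 (0, 0) (by simp)
    have h10 := h0 (1, 0) (by simp)
    have h1k := h0 (1, far b) (by simp)
    have h20 := h0 (2, 0) (by simp)
    obtain ⟨w, hw4, hw⟩ : ∃ w < 4, ∀ l r : ℕ, l < 8 → r < 8 →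
        2 * (common b (l + 8 * w + 32 * r) 1 % 64 / 8) =
          μ (1, 0) + 2 * μ (1, 1) + 4 * μ (1, 2) + 8 * μ (1, 3) := by
      have c1 := h1 (1, 1)
      have c2 := h1 (1, 2)
      have c3 := h1 (1, 3)
      cases b
      · simp only [far, Bool.false_eq_true, if_false] at h1k
        refine ⟨μ (1, 1) + 2 * μ (1, 3), by omega, fun l r hl hr => ?_⟩
        simp only [common]
        omega
      · simp only [far, if_true] at h1k
        refine ⟨μ (1, 2) + 2 * μ (1, 3), by omega, fun l r hl hr => ?_⟩
        simp only [common]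
        omega
    set l := μ (0, 1) + 2 * μ (0, 2) + 4 * μ (0, 3) with hl
    set r := μ (2, 1) + 2 * μ (2, 2) + 4 * μ (2, 3) with hr
    have b1 := h1 (0, 1)
    have b2 := h1 (0, 2)
    have b3 := h1 (0, 3)
    have r1 := h1 (2, 1)
    have r2 := h1 (2, 2)
    have r3 := h1 (2, 3)
    have ho : l + 8 * w + 32 * r < 256 := by omega
    refine ⟨⟨l + 8 * w + 32 * r, ho⟩, theta_injective ?_⟩
    rw [theta_bondState (isSimple_both b) hμ, diffProd_both]
    change theta (commonState b (l + 8 * w + 32 * r)) = _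
    rw [theta_commonState ho, hw l r (by omega) (by omega),
      show (l + 8 * w + 32 * r) % 8 = l by omega, show (l + 8 * w + 32 * r) / 32 = r by omega,
      monomial_trio, Fin.prod_univ_three, ← legs_of_digits 2 (h1 _) r1 r2 r3,
      ← legs_of_digits 0 (h1 _) b1 b2 b3, ← legs_of_digits 1 (h1 _) (h1 _) (h1 _) (h1 _), h00, h20,
      show 0 + 2 * μ (0, 1) + 4 * μ (0, 2) + 8 * μ (0, 3) = 2 * l by omega,
      show 0 + 2 * μ (2, 1) + 4 * μ (2, 2) + 8 * μ (2, 3) = 2 * r by omega]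
    ring
  · rintro _ ⟨o, rfl⟩
    exact commonState_mem o.2

/-- Without links each of the twelve sites has one free leg, and the bond states for the 2 ^ 12
choices of exponents are linearly independent. -/
theorem finrank_plaquettes :
    Module.finrank ℂ (⨅ v : Trio, sing v (next v) : Submodule ℂ (Spins Trio)) = 2 ^ 12 := by
  let e : (Trio → Fin 2) ≃ {μ : Trio →₀ ℕ // ∀ v, μ v + valency id next v ≤ 3} :=
    { toFun := fun x => ⟨Finsupp.equivFunOnFinite.symm fun v => x v, fun v => by
        rw [valency_plaquettes]
        change (x v : ℕ) + 2 ≤ 3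
        omega⟩
      invFun := fun μ v => ⟨μ.1 v, by
        have := μ.2 v
        rw [valency_plaquettes] at this
        omega⟩
      left_inv := fun x => rfl
      right_inv := fun μ => Subtype.ext (Finsupp.ext fun v => rfl) }
  have h1 := iInf_sing_eq_span isSimple_plaquettes
  have h2 := (linearIndependent_bondState isSimple_plaquettes).comp e e.injective
  have h3 : bondState id next '' {μ : Trio →₀ ℕ | ∀ v, μ v + valency id next v ≤ 3} =
      Set.range ((fun μ : {μ : Trio →₀ ℕ // ∀ v, μ v + valency id next v ≤ 3} =>
        bondState id next μ) ∘ e) := by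
    rw [e.surjective.range_comp, Set.image_eq_range]
    rfl
  rw [h3] at h1
  change Module.finrank ℂ ↥(⨅ v : Trio, sing (id v) (next v)) = _
  rw [h1, finrank_span_eq_card h2]
  simp

end Triple

end

end SquareOctagon

namespace SquareOctagon

noncomputable section

set_option linter.unusedSectionVars false

/-! ## The reflection of the three plaquettes -/

section Mirror

open MvPolynomial

open scoped InnerProductSpace ComplexOrder

/-- The reflection which exchanges the two links. -/
def swapSite (b : Bool) (v : Trio) : Trio := (2 - v.1, if v.1 = 1 then far b - v.2 else v.2)

theorem swapSite_swapSite (b : Bool) : Function.Involutive (swapSite b) := by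
  intro v
  revert v
  cases b <;> decide

/-- The reflected state. -/
def mirror (b : Bool) : Spins Trio →ₗ[ℂ] Spins Trio where
  toFun ψ := WithLp.toLp 2 fun σ => ψ (σ ∘ swapSite b)
  map_add' _ _ := rfl
  map_smul' _ _ := rfl

theorem mirror_apply (b : Bool) (ψ : Spins Trio) (σ : Trio → Fin 4) :
    mirror b ψ σ = ψ (σ ∘ swapSite b) := rfl

theorem mirror_mirror (b : Bool) (ψ : Spins Trio) : mirror b (mirror b ψ) = ψ := by
  ext σ
  rw [mirror_apply, mirror_apply, Function.comp_assoc, (swapSite_swapSite b).comp_self,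
    Function.comp_id]

theorem inner_mirror (b : Bool) (ψ φ : Spins Trio) : ⟪mirror b ψ, φ⟫_ℂ = ⟪ψ, mirror b φ⟫_ℂ := by
  simp only [PiLp.inner_apply]
  rw [← Equiv.sum_comp ((swapSite_swapSite b).toPerm.arrowCongr (Equiv.refl (Fin 4)))]
  refine Finset.sum_congr rfl fun σ _ => ?_
  have h : ((swapSite_swapSite b).toPerm.arrowCongr (Equiv.refl (Fin 4))) σ = σ ∘ swapSite b := rfl
  rw [h, mirror_apply, mirror_apply, Function.comp_assoc, (swapSite_swapSite b).comp_self,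
    Function.comp_id]

theorem norm_mirror (b : Bool) (ψ : Spins Trio) : ‖mirror b ψ‖ = ‖ψ‖ := by
  have h : ⟪mirror b ψ, mirror b ψ⟫_ℂ = ⟪ψ, ψ⟫_ℂ := by rw [inner_mirror, mirror_mirror]
  rw [inner_self_eq_norm_sq_to_K, inner_self_eq_norm_sq_to_K] at h
  have h2 : ‖mirror b ψ‖ ^ 2 = ‖ψ‖ ^ 2 := by exact_mod_cast h
  exact (sq_eq_sq₀ (norm_nonneg _) (norm_nonneg _)).1 h2

theorem slice_swapSite (b : Bool) (τ : Trio → Fin 4) (ψ : Spins Trio) :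
    slice (swapSite b) τ ψ = mirror b ψ := by
  ext σ
  rw [slice_apply, mirror_apply]
  refine congrArg ψ.ofLp (funext fun v => ?_)
  conv_lhs => rw [← swapSite_swapSite b v]
  exact (swapSite_swapSite b).injective.extend_apply _ _ _

theorem mirror_mem_sing (b : Bool) (v w : Trio) (ψ : Spins Trio) :
    mirror b ψ ∈ sing v w ↔ ψ ∈ sing (swapSite b v) (swapSite b w) := by
  rw [sing_map (swapSite_swapSite b).injective, mem_liftSub]
  simp only [slice_swapSite, forall_const]

theorem mirror_mem_plaqSub (b : Bool) (t : Fin 3) (ψ : Spins Trio) :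
    mirror b ψ ∈ plaqSub t ↔ ψ ∈ plaqSub (2 - t) := by
  simp only [plaqSub, Submodule.mem_iInf, mirror_mem_sing]
  fin_cases t
  · exact Iff.rfl
  -- The reflection reverses the orientation of the middle plaquette. By the symmetry of `sing` the
  -- image of an edge is again an edge in the standard direction, with another starting corner.
  · have h : ∀ a : Fin 4, (sing (swapSite b (1, a)) (swapSite b (1, a + 1))) =
        sing ((1, far b - a - 1) : Trio) (1, far b - a - 1 + 1) := fun a => by
      rw [sing_comm (by revert a; cases b <;> decide)]
      congr 1
      · revert a
        cases b <;> decide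
      · revert a
        cases b <;> decide
    change (∀ a : Fin 4, ψ ∈ sing (swapSite b (1, a)) (swapSite b (1, a + 1))) ↔
      ∀ a : Fin 4, ψ ∈ sing ((1, a) : Trio) (1, a + 1)
    simp only [h]
    have he : ∀ a : Fin 4, far b - (far b - a - 1) - 1 = a := by cases b <;> decide
    refine ⟨fun h a => ?_, fun h a => h _⟩
    have := h (far b - a - 1)
    rwa [he] at this
  · exact Iff.rfl

theorem mirror_mem_secondSub (b : Bool) (ψ : Spins Trio) :
    mirror b ψ ∈ secondSub b ↔ ψ ∈ firstSub := by
  have h1 : swapSite b (1, far b) = (1, 0) := by cases b <;> rfl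
  have h2 : swapSite b (2, 0) = (0, 0) := by cases b <;> rfl
  rw [secondSub, firstSub]
  simp only [Submodule.mem_inf, mirror_mem_plaqSub, mirror_mem_sing, h1, h2]
  rw [sing_comm (show ((1, 0) : Trio) ≠ (0, 0) by decide),
    show (2 : Fin 3) - 1 = 1 from rfl, show (2 : Fin 3) - 2 = 0 from rfl]
  tauto

theorem mirror_mem_firstSub (b : Bool) (ψ : Spins Trio) :
    mirror b ψ ∈ firstSub ↔ ψ ∈ secondSub b := by
  rw [← mirror_mem_secondSub b, mirror_mirror]

theorem mirror_mem_common (b : Bool) (ψ : Spins Trio) :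
    mirror b ψ ∈ firstSub ⊓ secondSub b ↔ ψ ∈ firstSub ⊓ secondSub b := by
  rw [Submodule.mem_inf, Submodule.mem_inf, mirror_mem_firstSub, mirror_mem_secondSub, and_comm]

theorem reflectSite_involutive (b : Bool) : Function.Involutive (fun a : Fin 4 => far b - a) := by
  intro a
  revert a
  cases b <;> decide

theorem ofPoly_comp {ρ : Fin 4 → Fin 4} (hρ : Function.Involutive ρ) (p : MvPolynomial (Fin 4) ℂ)
    (σ : Fin 4 → Fin 4) : ofPoly p (σ ∘ ρ) = ofPoly (rename ρ p) σ := by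
  have h1 : exps σ = Finsupp.mapDomain ρ (exps (σ ∘ ρ)) := by
    ext v
    conv_rhs => rw [← hρ v]
    rw [Finsupp.mapDomain_apply hρ.injective, exps_apply, exps_apply, Function.comp_apply, hρ]
  have h2 : amp (σ ∘ ρ) = amp σ := Equiv.prod_comp hρ.toPerm fun v => root (σ v)
  rw [ofPoly_apply, ofPoly_apply, h1, coeff_rename_mapDomain ρ hρ.injective, h2]

/-- The reflection permutes the four differences and changes the sign of each. Four signs cancel, so
plaquette states are reflected without a sign. -/
theorem rename_diffProd (b : Bool) : rename (fun a : Fin 4 => far b - a)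
    (diffProd id (fun a => a + 1) : MvPolynomial (Fin 4) ℂ) = diffProd id (fun a => a + 1) := by
  rw [diffProd, map_prod]
  simp only [map_sub, rename_X, Fin.prod_univ_four]
  cases b
  · change (X 1 - X 2) * (X 0 - X 1) * (X 3 - X 0) * (X 2 - X 3) =
      ((X 1 - X 0) * (X 2 - X 1) * (X 3 - X 2) * (X 0 - X 3) : MvPolynomial (Fin 4) ℂ)
    ring
  · change (X 0 - X 1) * (X 3 - X 0) * (X 2 - X 3) * (X 1 - X 2) =
      ((X 1 - X 0) * (X 2 - X 1) * (X 3 - X 2) * (X 0 - X 3) : MvPolynomial (Fin 4) ℂ)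
    ring

theorem reflect_false (y : ℕ) : reflect false y =
    y / 4 % 2 + 2 * (y / 2 % 2) + (4 * (y % 2) + 8 * (y / 8 % 2)) := rfl

theorem reflect_true (y : ℕ) : reflect true y =
    y / 2 % 2 + 2 * (y % 2) + (4 * (y / 8 % 2) + 8 * (y / 4 % 2)) := rfl

theorem mapDomain_bits (b : Bool) (y : ℕ) :
    Finsupp.mapDomain (fun a : Fin 4 => far b - a) (bits y) = bits (reflect b y) := by
  ext a
  conv_lhs => rw [← reflectSite_involutive b a]
  rw [Finsupp.mapDomain_apply (reflectSite_involutive b).injective]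
  have key' : ∀ z, bits z 0 = z % 2 ∧ bits z 1 = z / 2 % 2 ∧ bits z 2 = z / 4 % 2 ∧
      bits z 3 = z / 8 % 2 := fun z => by
    refine ⟨?_, ?_, ?_, ?_⟩ <;> rw [bits_apply] <;>
      simp [show ((2 : Fin 4) : ℕ) = 2 from rfl, show ((3 : Fin 4) : ℕ) = 3 from rfl]
  obtain ⟨k0, k1, k2, k3⟩ := key' (reflect b y)
  obtain ⟨l0, l1, l2, l3⟩ := key' y
  have hdig : ∀ p q r s : ℕ, p < 2 → q < 2 → r < 2 → s < 2 →
      p = (p + 2 * q + (4 * r + 8 * s)) % 2 ∧ q = (p + 2 * q + (4 * r + 8 * s)) / 2 % 2 ∧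
      r = (p + 2 * q + (4 * r + 8 * s)) / 4 % 2 ∧ s = (p + 2 * q + (4 * r + 8 * s)) / 8 % 2 := by
    intro p q r s _ _ _ _
    omega
  have hy := hdig _ _ _ _ (Nat.mod_lt (y / 4) two_pos) (Nat.mod_lt (y / 2) two_pos)
    (Nat.mod_lt y two_pos) (Nat.mod_lt (y / 8) two_pos)
  have hz := hdig _ _ _ _ (Nat.mod_lt (y / 2) two_pos) (Nat.mod_lt y two_pos)
    (Nat.mod_lt (y / 8) two_pos) (Nat.mod_lt (y / 4) two_pos)
  cases b <;> fin_cases a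
  · change bits y 2 = bits (reflect false y) 0
    refine l2.trans (Eq.trans ?_ k0.symm)
    rw [reflect_false]
    exact hy.1
  · change bits y 1 = bits (reflect false y) 1
    refine l1.trans (Eq.trans ?_ k1.symm)
    rw [reflect_false]
    exact hy.2.1
  · change bits y 0 = bits (reflect false y) 2
    refine l0.trans (Eq.trans ?_ k2.symm)
    rw [reflect_false]
    exact hy.2.2.1
  · change bits y 3 = bits (reflect false y) 3
    refine l3.trans (Eq.trans ?_ k3.symm)
    rw [reflect_false]
    exact hy.2.2.2
  · change bits y 1 = bits (reflect true y) 0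
    refine l1.trans (Eq.trans ?_ k0.symm)
    rw [reflect_true]
    exact hz.1
  · change bits y 0 = bits (reflect true y) 1
    refine l0.trans (Eq.trans ?_ k1.symm)
    rw [reflect_true]
    exact hz.2.1
  · change bits y 3 = bits (reflect true y) 2
    refine l3.trans (Eq.trans ?_ k2.symm)
    rw [reflect_true]
    exact hz.2.2.1
  · change bits y 2 = bits (reflect true y) 3
    refine l2.trans (Eq.trans ?_ k3.symm)
    rw [reflect_true]
    exact hz.2.2.2

theorem plaqState_comp (b : Bool) (y : ℕ) (σ : Fin 4 → Fin 4) :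
    plaqState y (fun a => σ (far b - a)) = plaqState (reflect b y) σ := by
  refine (ofPoly_comp (reflectSite_involutive b) _ σ).trans ?_
  rw [map_mul, rename_diffProd, rename_monomial, mapDomain_bits]
  rfl

theorem mirror_triple (b : Bool) (x y z : ℕ) :
    mirror b (triple x y z) = triple z (reflect b y) x := by
  ext σ
  rw [mirror_apply, triple, triple, tensor_apply, tensor_apply, Fin.prod_univ_three,
    Fin.prod_univ_three]
  simp only [Matrix.cons_val_zero, Matrix.cons_val_one, Matrix.cons_val]
  rw [← plaqState_comp b y]
  change plaqState x (fun a => σ (2, a)) * plaqState y (fun a => σ (1, far b - a)) *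
    plaqState z (fun a => σ (0, a)) = plaqState z (fun a => σ (0, a)) *
    plaqState y (fun a => σ (1, far b - a)) * plaqState x (fun a => σ (2, a))
  ring

theorem inner_linkState_mirror (b : Bool) (i j : ℕ) :
    ⟪linkState i, mirror b (linkState j)⟫_ℂ = (crossMat b i j : ℂ) / 81 ^ 3 := by
  rw [linkState, linkState, map_sub, mirror_triple, mirror_triple, inner_sub_left, inner_sub_right,
    inner_sub_right]
  simp only [inner_triple, crossMat_eq, half2_eq]
  push_cast
  ring

end Mirror

end

end SquareOctagon

namespace SquareOctagon

noncomputable section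

set_option linter.unusedSectionVars false

/-! ## The overlap constants on three plaquettes -/

section Overlap

open scoped InnerProductSpace ComplexOrder

/-- A bilinear form with integer coefficients. -/
def bilin (M : ℕ → ℕ → ℤ) (x y : ℕ → ℝ) : ℝ :=
  ∑ i ∈ Finset.range 1024, ∑ j ∈ Finset.range 1024, x i * y j * M i j

theorem normForm_eq_bilin (x : ℕ → ℝ) : normForm x = bilin normMat x x := rfl

theorem crossForm_eq_bilin (b : Bool) (x : ℕ → ℝ) : crossForm b x = bilin (crossMat b) x x := rfl

theorem bilin_comm {M : ℕ → ℕ → ℤ} (hM : ∀ i j, M i j = M j i) (x y : ℕ → ℝ) :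
    bilin M x y = bilin M y x := by
  rw [bilin, Finset.sum_comm]
  exact Finset.sum_congr rfl fun i _ => Finset.sum_congr rfl fun j _ => by rw [hM]; ring

theorem bilin_add (M : ℕ → ℕ → ℤ) (x y x' y' : ℕ → ℝ) : bilin M (x + y) (x' + y') =
    bilin M x x' + bilin M x y' + (bilin M y x' + bilin M y y') := by
  simp only [bilin, ← Finset.sum_add_distrib]
  exact Finset.sum_congr rfl fun i _ => Finset.sum_congr rfl fun j _ => by
    simp only [Pi.add_apply]; ring

theorem bilin_sub (M : ℕ → ℕ → ℤ) (x y x' y' : ℕ → ℝ) : bilin M (x - y) (x' - y') =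
    bilin M x x' - bilin M x y' - (bilin M y x' - bilin M y y') := by
  simp only [bilin, ← Finset.sum_sub_distrib]
  exact Finset.sum_congr rfl fun i _ => Finset.sum_congr rfl fun j _ => by
    simp only [Pi.sub_apply]; ring

/-- A bound for a quadratic form on a subspace is a bound for its polar form. -/
theorem two_mul_bilin_le {b : Bool} {c : ℝ} (h : ∀ x : ℕ → ℝ, (∀ o < 256, commonForm b o x = 0) →
    |crossForm b x| ≤ c * normForm x) {x y : ℕ → ℝ} (hx : ∀ o < 256, commonForm b o x = 0)
    (hy : ∀ o < 256, commonForm b o y = 0) :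
    2 * bilin (crossMat b) x y ≤ c * (normForm x + normForm y) := by
  have h1 := h (x + y) fun o ho => by
    have := congrArg₂ (· + ·) (hx o ho) (hy o ho)
    simp only [commonForm, ← Finset.sum_add_distrib, add_zero] at this
    rw [← this]
    exact Finset.sum_congr rfl fun i _ => by simp only [Pi.add_apply]; ring
  have h2 := h (x - y) fun o ho => by
    have := congrArg₂ (· - ·) (hx o ho) (hy o ho)
    simp only [commonForm, ← Finset.sum_sub_distrib, sub_zero] at this
    rw [← this]
    exact Finset.sum_congr rfl fun i _ => by simp only [Pi.sub_apply]; ring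
  rw [crossForm_eq_bilin, normForm_eq_bilin, bilin_add, bilin_add] at h1
  rw [crossForm_eq_bilin, normForm_eq_bilin, bilin_sub, bilin_sub] at h2
  rw [bilin_comm (crossMat_comm b) y x] at h1 h2
  rw [normForm_eq_bilin, normForm_eq_bilin]
  have h3 := le_abs_self (bilin (crossMat b) x x + bilin (crossMat b) x y +
    (bilin (crossMat b) x y + bilin (crossMat b) y y))
  have h4 := neg_abs_le (bilin (crossMat b) x x - bilin (crossMat b) x y -
    (bilin (crossMat b) x y - bilin (crossMat b) y y))
  linarith

/-- A combination of the states with a singlet on the first link. -/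
def linkComb (a : ℕ → ℂ) : Spins Trio := ∑ i ∈ Finset.range 1024, a i • linkState i

theorem exists_linkComb {p : Spins Trio} (hp : p ∈ firstSub ⊓ plaqSub 2) :
    ∃ a : ℕ → ℂ, p = linkComb a := by
  rw [firstSub_inf_eq, Submodule.mem_span_range_iff_exists_fun] at hp
  obtain ⟨c, rfl⟩ := hp
  refine ⟨fun i => if h : i < 1024 then c ⟨i, h⟩ else 0, ?_⟩
  rw [linkComb, Finset.sum_range]
  exact Finset.sum_congr rfl fun i _ => by rw [dif_pos i.2]

theorem re_sum_mul (M : ℕ → ℕ → ℤ) (a d : ℕ → ℂ) :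
    (∑ i ∈ Finset.range 1024, ∑ j ∈ Finset.range 1024,
      (starRingEnd ℂ) (a i) * (d j * ((M i j : ℂ) / 81 ^ 3))).re =
    (bilin M (fun i => (a i).re) (fun i => (d i).re) +
      bilin M (fun i => (a i).im) (fun i => (d i).im)) / 81 ^ 3 := by
  rw [bilin, bilin, Complex.re_sum, ← Finset.sum_add_distrib, Finset.sum_div]
  refine Finset.sum_congr rfl fun i _ => ?_
  rw [Complex.re_sum, ← Finset.sum_add_distrib, Finset.sum_div]
  refine Finset.sum_congr rfl fun j _ => ?_
  rw [show ((M i j : ℂ) / 81 ^ 3) = (((M i j : ℝ) / 81 ^ 3 : ℝ) : ℂ) by push_cast; rfl, ← mul_assoc,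
    Complex.re_mul_ofReal, Complex.mul_re, Complex.conj_re, Complex.conj_im]
  ring

theorem re_inner_linkComb (a d : ℕ → ℂ) : (⟪linkComb a, linkComb d⟫_ℂ).re =
    (bilin normMat (fun i => (a i).re) (fun i => (d i).re) +
      bilin normMat (fun i => (a i).im) (fun i => (d i).im)) / 81 ^ 3 := by
  rw [← re_sum_mul, linkComb, linkComb, sum_inner]
  refine congrArg Complex.re (Finset.sum_congr rfl fun i _ => ?_)
  rw [inner_smul_left, inner_sum, Finset.mul_sum]
  simp only [inner_smul_right, inner_linkState]

theorem re_inner_linkComb_mirror (b : Bool) (a d : ℕ → ℂ) :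
    (⟪linkComb a, mirror b (linkComb d)⟫_ℂ).re =
    (bilin (crossMat b) (fun i => (a i).re) (fun i => (d i).re) +
      bilin (crossMat b) (fun i => (a i).im) (fun i => (d i).im)) / 81 ^ 3 := by
  rw [← re_sum_mul, linkComb, linkComb, map_sum, sum_inner]
  refine congrArg Complex.re (Finset.sum_congr rfl fun i _ => ?_)
  rw [inner_smul_left, inner_sum, Finset.mul_sum]
  simp only [map_smul, inner_smul_right, inner_linkState_mirror]

theorem inner_commonState_linkComb (b : Bool) (o : ℕ) (a : ℕ → ℂ) :
    ⟪commonState b o, linkComb a⟫_ℂ = ((commonForm b o (fun i => (a i).re) : ℝ) +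
      (commonForm b o (fun i => (a i).im) : ℝ) * Complex.I) / 81 ^ 3 := by
  rw [commonState, linkComb, commonForm, commonForm]
  simp only [inner_sum, inner_smul_right, inner_sub_left, inner_linkState]
  push_cast
  rw [Finset.sum_mul, ← Finset.sum_add_distrib, Finset.sum_div]
  refine Finset.sum_congr rfl fun i _ => ?_
  rw [commonVec, normMat_comm i, normMat_comm i]
  conv_lhs => rw [← Complex.re_add_im (a i)]
  push_cast
  ring

theorem commonForm_eq_zero {b : Bool} {a : ℕ → ℂ}
    (h : ∀ k ∈ firstSub ⊓ secondSub b, ⟪k, linkComb a⟫_ℂ = 0) {o : ℕ} (ho : o < 256) :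
    commonForm b o (fun i => (a i).re) = 0 ∧ commonForm b o (fun i => (a i).im) = 0 := by
  have h1 := h _ (commonState_mem ho)
  rw [inner_commonState_linkComb, div_eq_zero_iff, or_iff_left (by norm_num)] at h1
  have h2 := congrArg Complex.re h1
  have h3 := congrArg Complex.im h1
  simp at h2 h3
  exact ⟨h2, h3⟩

theorem norm_sq_linkComb (a : ℕ → ℂ) : ‖linkComb a‖ ^ 2 =
    (normForm (fun i => (a i).re) + normForm (fun i => (a i).im)) / 81 ^ 3 := by
  rw [normForm_eq_bilin, normForm_eq_bilin, ← re_inner_linkComb]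
  exact (inner_self_eq_norm_sq (𝕜 := ℂ) _).symm

/-- The second vector is the mirror image of a combination of the same 1024 states, so the overlap
is a value of the polar form of `crossMat`. The matrices are real, so the real and imaginary parts
of the coefficients separate and each is orthogonal to the common states. -/
theorem overlap_le {b : Bool} {c : ℝ} (h : ∀ x : ℕ → ℝ, (∀ o < 256, commonForm b o x = 0) →
    |crossForm b x| ≤ c * normForm x) {p q : Spins Trio} (hp : p ∈ firstSub ⊓ plaqSub 2)
    (hq : q ∈ secondSub b ⊓ plaqSub 0) (hpK : ∀ k ∈ firstSub ⊓ secondSub b, ⟪k, p⟫_ℂ = 0)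
    (hqK : ∀ k ∈ firstSub ⊓ secondSub b, ⟪k, q⟫_ℂ = 0) :
    2 * (⟪p, q⟫_ℂ).re ≤ c * (‖p‖ ^ 2 + ‖q‖ ^ 2) := by
  obtain ⟨a, ha⟩ := exists_linkComb hp
  rw [ha] at hpK ⊢
  have hq' : mirror b q ∈ firstSub ⊓ plaqSub 2 := by
    rw [Submodule.mem_inf, mirror_mem_firstSub, mirror_mem_plaqSub]
    exact hq
  obtain ⟨d, hd⟩ := exists_linkComb hq'
  have hqd : q = mirror b (linkComb d) := by rw [← hd, mirror_mirror]
  have hdK : ∀ k ∈ firstSub ⊓ secondSub b, ⟪k, linkComb d⟫_ℂ = 0 := fun k hk => by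
    rw [← hd, ← inner_mirror]
    exact hqK _ ((mirror_mem_common b k).2 hk)
  have h1 := two_mul_bilin_le h (fun o ho => (commonForm_eq_zero hpK ho).1)
    (fun o ho => (commonForm_eq_zero hdK ho).1)
  have h2 := two_mul_bilin_le h (fun o ho => (commonForm_eq_zero hpK ho).2)
    (fun o ho => (commonForm_eq_zero hdK ho).2)
  rw [hqd, norm_mirror, re_inner_linkComb_mirror, norm_sq_linkComb, norm_sq_linkComb]
  linarith

/-! ### The lower bound -/

/-- The three plaquette states in the expansion of a state with singlets on both links. -/
def corner (b : Bool) (x : Fin 256 × Fin 4) : Fin 16 × Fin 16 × Fin 16 :=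
  (Fin.ofNat 16 (2 * (x.1 % 8) + x.2 % 2),
    Fin.ofNat 16 (2 * (common b x.1 (x.2 / 2) % 64 / 8) + (1 - x.2 % 2)),
    Fin.ofNat 16 (2 * (x.1 / 32) + x.2 / 2))

theorem corner_injective (b : Bool) : Function.Injective (corner b) := by
  have h : ∀ x : Fin 256 × Fin 4, x =
      (Fin.ofNat 256 ((corner b x).1 / 2 + 8 * (Bool.rec
        ((corner b x).2.1 / 2 % 2 + 2 * ((corner b x).2.1 / 8)) ((corner b x).2.1 / 4) b) +
        32 * ((corner b x).2.2 / 2)),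
        Fin.ofNat 4 ((corner b x).1 % 2 + 2 * ((corner b x).2.2 % 2))) := by
    cases b <;> decide +kernel
  intro x y hxy
  rw [h x, h y, hxy]

/-- The signs in the expansion of a state with singlets on both links. -/
def cornerSign (j : Fin 4) : ℝ := if j = 0 ∨ j = 3 then 1 else -1

theorem commonState_eq (b : Bool) (o : Fin 256) : commonState b o = ∑ j : Fin 4,
    (cornerSign j : ℂ) • triple (corner b (o, j)).1 (corner b (o, j)).2.1 (corner b (o, j)).2.2 := by
  have h : ∀ o : Fin 256, ∀ j : Fin 4,
      ((corner b (o, j)).1 : ℕ) = 2 * (common b o (j / 2) % 64 % 8) + j % 2 ∧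
      ((corner b (o, j)).2.1 : ℕ) = 2 * (common b o (j / 2) % 64 / 8) + (1 - j % 2) ∧
      ((corner b (o, j)).2.2 : ℕ) = common b o (j / 2) / 64 := by
    cases b <;> decide +kernel
  rw [Fin.sum_univ_four, (h o 0).1, (h o 0).2.1, (h o 0).2.2, (h o 1).1, (h o 1).2.1, (h o 1).2.2,
    (h o 2).1, (h o 2).2.1, (h o 2).2.2, (h o 3).1, (h o 3).2.1, (h o 3).2.2]
  have s0 : cornerSign 0 = 1 := if_pos (by decide)
  have s1 : cornerSign 1 = -1 := if_neg (by decide)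
  have s2 : cornerSign 2 = -1 := if_neg (by decide)
  have s3 : cornerSign 3 = 1 := if_pos (by decide)
  rw [s0, s1, s2, s3, commonState, linkState, linkState]
  simp only [Fin.val_zero, Fin.val_one, Fin.val_two, show ((3 : Fin 4) : ℕ) = 3 from rfl,
    Nat.reduceDiv, Nat.reduceMod, Nat.reduceSub, Nat.zero_div, Nat.zero_mod, add_zero, Nat.sub_zero]
  push_cast
  simp only [one_smul, neg_smul]
  abel

/-- Coefficients are extended by zero to all product states. Injectivity ensures that no two of them
are added together. -/
theorem sum_sq_le_gram_of_injective {ι : Type*} [Fintype ι] {Y : ι → Fin 16 × Fin 16 × Fin 16}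
    (hY : Y.Injective) (d : ι → ℝ) : ∑ x, d x ^ 2 ≤ ∑ x, ∑ z, d x * d z *
      (gram (Y x).1 (Y z).1 * (gram (Y x).2.1 (Y z).2.1 * gram (Y x).2.2 (Y z).2.2)) := by
  set c : Fin 16 × Fin 16 × Fin 16 → ℝ := Function.extend Y d 0 with hc
  have hz : ∀ y ∉ Set.range Y, c y = 0 := fun y hy =>
    Function.extend_apply' _ _ _ fun ⟨x, hx⟩ => hy ⟨x, hx⟩
  have hcd : ∀ x, c (Y x) = d x := fun x => hY.extend_apply _ _ _
  refine le_trans (le_of_eq ?_) ((sum_sq_le_gram c).trans (le_of_eq ?_))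
  · exact Fintype.sum_of_injective Y hY _ _ (fun y hy => by rw [hz y hy]; ring)
      fun x => by rw [hcd]
  · refine (Fintype.sum_of_injective Y hY _ _ (fun y hy => ?_) fun x => ?_).symm
    · exact Finset.sum_eq_zero fun z _ => by rw [hz y hy]; ring
    · exact Fintype.sum_of_injective Y hY _ _ (fun z hz' => by rw [hz z hz']; ring)
        fun z => by rw [hcd, hcd]

/-- Each common state is a signed sum of four product states, and all 1024 product states obtained
in this way are distinct. The Gram bound for products then gives the factor 4. -/
theorem frame_bound (b : Bool) (κ : Fin 256 → ℂ) :
    4 * ∑ o, ‖κ o‖ ^ 2 ≤ 81 ^ 3 * ‖∑ o, κ o • commonState b o‖ ^ 2 := by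
  set d : Fin 256 × Fin 4 → ℂ := fun x => κ x.1 * cornerSign x.2 with hd
  set t : Fin 256 × Fin 4 → Spins Trio := fun x =>
    triple (corner b x).1 (corner b x).2.1 (corner b x).2.2 with ht
  have h1 : ∑ o, κ o • commonState b o = ∑ x, d x • t x := by
    rw [Fintype.sum_prod_type]
    refine Finset.sum_congr rfl fun o _ => ?_
    rw [commonState_eq, Finset.smul_sum]
    exact Finset.sum_congr rfl fun j _ => smul_smul _ _ _
  have h2 : 4 * ∑ o, ‖κ o‖ ^ 2 = ∑ x, ‖d x‖ ^ 2 := by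
    have hs : ∀ j, ‖(cornerSign j : ℂ)‖ = 1 := fun j => by
      rw [cornerSign]; split_ifs <;> simp
    rw [Fintype.sum_prod_type, Finset.mul_sum]
    refine Finset.sum_congr rfl fun o _ => ?_
    simp only [hd, norm_mul, hs, mul_one, Finset.sum_const, Finset.card_univ, Fintype.card_fin,
      nsmul_eq_mul]
    norm_num
  have h3 : 81 ^ 3 * ‖∑ x, d x • t x‖ ^ 2 = ∑ x, ∑ z, ((d x).re * (d z).re + (d x).im * (d z).im) *
      (gram (corner b x).1 (corner b z).1 * (gram (corner b x).2.1 (corner b z).2.1 *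
        gram (corner b x).2.2 (corner b z).2.2)) := by
    have := inner_self_eq_norm_sq (𝕜 := ℂ) (∑ x, d x • t x)
    rw [← this, sum_inner, RCLike.re_to_complex, Complex.re_sum, Finset.mul_sum]
    refine Finset.sum_congr rfl fun x _ => ?_
    rw [inner_smul_left, inner_sum, Finset.mul_sum, Complex.re_sum, Finset.mul_sum]
    refine Finset.sum_congr rfl fun z _ => ?_
    rw [inner_smul_right, ht, inner_triple]
    generalize gram (corner b x).1 (corner b z).1 = g1
    generalize gram (corner b x).2.1 (corner b z).2.1 = g2
    generalize gram (corner b x).2.2 (corner b z).2.2 = g3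
    rw [show ((g1 * g2 * g3 : ℂ) / 81 ^ 3) = (((g1 * g2 * g3 : ℝ) / 81 ^ 3 : ℝ) : ℂ) by
      push_cast; rfl, ← mul_assoc, Complex.re_mul_ofReal, Complex.mul_re, Complex.conj_re,
      Complex.conj_im]
    ring
  rw [h1, h2, h3]
  have k1 := sum_sq_le_gram_of_injective (corner_injective b) fun x => (d x).re
  have k2 := sum_sq_le_gram_of_injective (corner_injective b) fun x => (d x).im
  refine le_trans (le_of_eq ?_) ((add_le_add k1 k2).trans (le_of_eq ?_))
  · rw [← Finset.sum_add_distrib]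
    refine Finset.sum_congr rfl fun x _ => ?_
    rw [Complex.sq_norm, Complex.normSq_apply]
    ring
  · rw [← Finset.sum_add_distrib]
    refine Finset.sum_congr rfl fun x _ => ?_
    rw [← Finset.sum_add_distrib]
    exact Finset.sum_congr rfl fun z _ => by ring

/-- A bound for the norm of the projection onto the states with singlets on both links. -/
theorem norm_sq_le_of_inner {b : Bool} {k : Spins Trio} (hk : k ∈ firstSub ⊓ secondSub b)
    {g : ℕ → ℝ} (hg : ∀ o < 256, ⟪commonState b o, k⟫_ℂ = (g o : ℂ) / 81 ^ 3) :
    4 * (81 ^ 3 * ‖k‖ ^ 2) ≤ ∑ o ∈ Finset.range 256, g o ^ 2 := by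
  rw [firstSub_inf_secondSub_eq, Submodule.mem_span_range_iff_exists_fun] at hk
  obtain ⟨κ, hκ⟩ := hk
  replace hκ : ∑ o, κ o • commonState b o = k := hκ
  have h1 := frame_bound b κ
  rw [hκ] at h1
  have h2 : 81 ^ 3 * ‖k‖ ^ 2 = ∑ o : Fin 256, (κ o).re * g o := by
    rw [← inner_self_eq_norm_sq (𝕜 := ℂ) k]
    nth_rw 1 [← hκ]
    rw [sum_inner, RCLike.re_to_complex, Complex.re_sum, Finset.mul_sum]
    refine Finset.sum_congr rfl fun o _ => ?_
    rw [inner_smul_left, hg o o.2]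
    rw [show ((g o : ℂ) / 81 ^ 3) = ((g o / 81 ^ 3 : ℝ) : ℂ) by push_cast; rfl,
      Complex.re_mul_ofReal, Complex.conj_re]
    ring
  -- Weighted arithmetic-geometric inequality. The weight 2 is chosen so that `frame_bound` absorbs
  -- the first part into half of the left-hand side, which leaves the constant 4.
  have h3 : ∑ o : Fin 256, (κ o).re * g o ≤ ∑ o : Fin 256, (2 * ‖κ o‖ ^ 2 + g o ^ 2 / 8) := by
    refine Finset.sum_le_sum fun o _ => ?_
    rw [Complex.sq_norm, Complex.normSq_apply]
    nlinarith [sq_nonneg ((κ o).re - g o / 4), sq_nonneg (κ o).im]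
  rw [Finset.sum_add_distrib, ← Finset.mul_sum, ← Finset.sum_div] at h3
  rw [Finset.sum_range]
  linarith

theorem re_inner_mirror_abs_le (b : Bool) (k : Spins Trio) :
    |(⟪k, mirror b k⟫_ℂ).re| ≤ ‖k‖ ^ 2 := by
  refine (Complex.abs_re_le_norm _).trans ((norm_inner_le_norm _ _).trans (le_of_eq ?_))
  rw [norm_mirror, sq]

/-- The trial vector is decomposed into its projection k onto the common space and a remainder p
orthogonal to it. If the spectrum respected the bound, the mirror overlap of p would be bounded by
the norm. That of k is at most ‖k‖², which the penalty controls. Adding the two would contradict the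
certified negativity. -/
theorem exists_spectrum_lt {b : Bool} {lo unit : ℕ} (hunit : 0 < unit) {x : ℕ → ℝ}
    (hx : 4 * (lo * normForm x + (if b then 1 else -1) * (unit * crossForm b x)) +
      unit * ∑ o ∈ Finset.range 256, commonForm b o x ^ 2 < 0) :
    ∃ g ∈ spectrum ℝ (defect firstSub (secondSub b)), g ≠ 0 ∧ g < 1 - (lo : ℝ) / unit := by
  by_contra! hcon
  set K := firstSub ⊓ secondSub b with hK
  set p₀ := linkComb fun i => (x i : ℂ) with hp₀
  set k := K.starProjection p₀ with hk
  have hkK : k ∈ K := Submodule.starProjection_apply_mem _ _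
  have hmk : mirror b k ∈ K := (mirror_mem_common b k).2 hkK
  have hpK : ∀ k' ∈ K, ⟪k', p₀ - k⟫_ℂ = 0 := fun k' hk' =>
    (Submodule.mem_orthogonal _ _).1 (Submodule.sub_starProjection_mem_orthogonal p₀) k' hk'
  have hp₀A : p₀ ∈ firstSub := Submodule.sum_mem _ fun i _ =>
    Submodule.smul_mem _ _ (linkState_mem i).1
  have hpA : p₀ - k ∈ firstSub := Submodule.sub_mem _ hp₀A hkK.1
  set p := p₀ - k with hp
  have hpk : p₀ = p + k := by rw [hp, sub_add_cancel]
  set σ : ℝ := if b then 1 else -1 with hσ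
  have hσ1 : |σ| = 1 := by rw [hσ]; split_ifs <;> simp
  have h1 := overlap_le_of_le (div_nonneg (Nat.cast_nonneg lo) (Nat.cast_nonneg unit)) hcon hpA
    (Submodule.smul_mem _ (-(σ : ℂ)) ((mirror_mem_secondSub b p).2 hpA)) hpK fun k' hk' => by
      rw [inner_smul_right, ← inner_mirror, hpK _ ((mirror_mem_common b k').2 hk'), mul_zero]
  have hn : ‖(-(σ : ℂ)) • mirror b p‖ = ‖p‖ := by
    rw [norm_smul, norm_neg, Complex.norm_real, Real.norm_eq_abs, hσ1, one_mul, norm_mirror]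
  have hre : (⟪p, (-(σ : ℂ)) • mirror b p⟫_ℂ).re = -σ * (⟪p, mirror b p⟫_ℂ).re := by
    rw [inner_smul_right, ← Complex.ofReal_neg, Complex.re_ofReal_mul]
  rw [hn, hre] at h1
  have hX : (⟪p₀, mirror b p₀⟫_ℂ).re = crossForm b x / 81 ^ 3 := by
    rw [hp₀, re_inner_linkComb_mirror]
    simp only [Complex.ofReal_re, Complex.ofReal_im]
    rw [← crossForm_eq_bilin]
    simp [bilin]
  have hG : ‖p₀‖ ^ 2 = normForm x / 81 ^ 3 := by
    rw [hp₀, norm_sq_linkComb]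
    simp only [Complex.ofReal_re, Complex.ofReal_im]
    simp [normForm]
  -- The mirror preserves the common space and its orthogonal complement, so there are no mixed
  -- terms.
  have hX2 : (⟪p₀, mirror b p₀⟫_ℂ).re = (⟪p, mirror b p⟫_ℂ).re + (⟪k, mirror b k⟫_ℂ).re := by
    have e1 : ⟪p, mirror b k⟫_ℂ = 0 := inner_eq_zero_symm.1 (hpK _ hmk)
    have e2 : ⟪k, mirror b p⟫_ℂ = 0 := by rw [← inner_mirror]; exact hpK _ hmk
    rw [hpk, map_add, inner_add_left, inner_add_right, inner_add_right, e1, e2, add_zero, zero_add,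
      Complex.add_re]
  have hG2 : ‖p‖ ^ 2 ≤ ‖p₀‖ ^ 2 := by
    have e := norm_add_sq (𝕜 := ℂ) p k
    rw [inner_eq_zero_symm.1 (hpK _ hkK), ← hpk] at e
    simp only [map_zero, mul_zero, add_zero] at e
    nlinarith [sq_nonneg ‖k‖]
  have hkn := norm_sq_le_of_inner hkK (g := fun o => commonForm b o x) fun o ho => by
    have e := hpK _ (commonState_mem ho)
    rw [hp, inner_sub_right, sub_eq_zero] at e
    rw [← e, hp₀, inner_commonState_linkComb]
    simp only [Complex.ofReal_re, Complex.ofReal_im]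
    simp [commonForm]
  have hkm := re_inner_mirror_abs_le b k
  have hσk : -(σ * (⟪k, mirror b k⟫_ℂ).re) ≤ ‖k‖ ^ 2 := by
    refine (neg_le_abs _).trans ?_
    rw [abs_mul, hσ1, one_mul]
    exact hkm
  have hu : (0 : ℝ) < unit := Nat.cast_pos.2 hunit
  have hc : (lo : ℝ) / unit * ‖p‖ ^ 2 ≤ lo / unit * ‖p₀‖ ^ 2 :=
    mul_le_mul_of_nonneg_left hG2 (div_nonneg (Nat.cast_nonneg lo) (Nat.cast_nonneg unit))
  have h4 : -(σ * crossForm b x) ≤ (lo : ℝ) / unit * normForm x + 81 ^ 3 * ‖k‖ ^ 2 := by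
    have e : σ * (⟪p₀, mirror b p₀⟫_ℂ).re =
      σ * (⟪p, mirror b p⟫_ℂ).re + σ * (⟪k, mirror b k⟫_ℂ).re := by rw [hX2, mul_add]
    have e1 : σ * (⟪p₀, mirror b p₀⟫_ℂ).re = σ * crossForm b x / 81 ^ 3 := by rw [hX, mul_div_assoc]
    have e2 : lo / unit * ‖p₀‖ ^ 2 = (lo : ℝ) / unit * normForm x / 81 ^ 3 := by
      rw [hG, mul_div_assoc]
    have e3 : -(σ * crossForm b x / 81 ^ 3) ≤ (lo : ℝ) / unit * normForm x / 81 ^ 3 + ‖k‖ ^ 2 := by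
      rw [← e1, ← e2]; linarith
    linarith
  have h5 : 0 ≤ unit * (4 * ((lo : ℝ) / unit * normForm x + σ * crossForm b x) +
      ∑ o ∈ Finset.range 256, commonForm b o x ^ 2) :=
    mul_nonneg hu.le (by linarith)
  have h6 : unit * (4 * ((lo : ℝ) / unit * normForm x + σ * crossForm b x) +
      ∑ o ∈ Finset.range 256, commonForm b o x ^ 2) =
      4 * (lo * normForm x + σ * (unit * crossForm b x)) +
      unit * ∑ o ∈ Finset.range 256, commonForm b o x ^ 2 := by
    field_simp
  rw [h6] at h5
  exact absurd hx (not_lt.2 h5)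

/-! ### The optimal constants -/

/-- The projection acts on the first two plaquettes only and cannot disturb conditions on the third.
This is what allows the overlap problem to be restricted to ground states of all three plaquettes.
-/
theorem starProjection_firstSub_mem {ψ : Spins Trio} (hψ : ψ ∈ plaqSub 2) :
    firstSub.starProjection ψ ∈ plaqSub 2 := by
  set f : Fin 2 × Fin 4 → Trio := fun v => (v.1.castSucc, v.2) with hf
  set g : Fin 4 → Trio := fun a => (2, a) with hg
  have hfi : f.Injective := by decide
  have hgi : g.Injective := by decide
  have h1 : firstSub = liftSub f ((⨅ a : Fin 4, sing (0, a) (0, a + 1)) ⊓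
      (⨅ a : Fin 4, sing (1, a) (1, a + 1)) ⊓ sing (0, 0) (1, 0)) := by
    rw [liftSub_inf, liftSub_inf, liftSub_iInf, liftSub_iInf]
    simp only [← sing_map hfi]
    rfl
  have h2 : plaqSub 2 = liftSub g (⨅ a : Fin 4, sing a (a + 1)) := by
    rw [liftSub_iInf]
    simp only [← sing_map hgi]
    rfl
  rw [h1, starProjection_liftSub hfi]
  rw [h2] at hψ ⊢
  exact liftOp_mem_liftSub hfi hgi (by decide) _ hψ

theorem starProjection_secondSub_mem {b : Bool} {ψ : Spins Trio} (hψ : ψ ∈ plaqSub 0) :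
    (secondSub b).starProjection ψ ∈ plaqSub 0 := by
  set f : Fin 2 × Fin 4 → Trio := fun v => (v.1.succ, v.2) with hf
  set g : Fin 4 → Trio := fun a => (0, a) with hg
  have hfi : f.Injective := by decide
  have hgi : g.Injective := by decide
  have h1 : secondSub b = liftSub f ((⨅ a : Fin 4, sing (0, a) (0, a + 1)) ⊓
      (⨅ a : Fin 4, sing (1, a) (1, a + 1)) ⊓ sing (0, far b) (1, 0)) := by
    rw [liftSub_inf, liftSub_inf, liftSub_iInf, liftSub_iInf]
    simp only [← sing_map hfi]
    rfl
  have h2 : plaqSub 0 = liftSub g (⨅ a : Fin 4, sing a (a + 1)) := by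
    rw [liftSub_iInf]
    simp only [← sing_map hgi]
    rfl
  rw [h1, starProjection_liftSub hfi]
  rw [h2] at hψ ⊢
  exact liftOp_mem_liftSub hfi hgi (by decide) _ hψ

/-- The trial vector supplies a small nonzero eigenvalue of the defect, hence a least one. The
matrix certificates bound that eigenvalue from below. -/
theorem exists_isOptimal_trio {b : Bool} {A T lo unit : ℕ} (hT : 0 < T) (hunit : 0 < unit)
    (h : ∀ x : ℕ → ℝ, (∀ o < 256, commonForm b o x = 0) → T * |crossForm b x| ≤ A * normForm x)
    (hx : ∃ x : ℕ → ℝ, 4 * (lo * normForm x + (if b then 1 else -1) * (unit * crossForm b x)) +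
      unit * ∑ o ∈ Finset.range 256, commonForm b o x ^ 2 < 0) :
    ∃ η : ℝ, (lo : ℝ) / unit < η ∧ η ≤ (A : ℝ) / T ∧
      IsOptimal (1 - firstSub.starProjection : Spins Trio →L[ℂ] Spins Trio)
        (1 - (secondSub b).starProjection) η := by
  obtain ⟨x, hx⟩ := hx
  obtain ⟨g₁, hg₁, hg₁0, hg₁lt⟩ := exists_spectrum_lt hunit hx
  obtain ⟨g, ⟨hg, hg0⟩, hmin, hopt⟩ := exists_isOptimal ⟨g₁, hg₁, hg₁0⟩
  have hT' : (0 : ℝ) < T := Nat.cast_pos.2 hT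
  have hup : ∀ g ∈ spectrum ℝ (defect firstSub (secondSub b)), g ≠ 0 → 1 - (A : ℝ) / T ≤ g := by
    refine le_of_overlap_le (N₁ := plaqSub 0) (N₂ := plaqSub 2) (inf_le_left.trans inf_le_left)
      (inf_le_left.trans inf_le_right) (fun ψ => starProjection_firstSub_mem)
      (fun ψ => starProjection_secondSub_mem) (by positivity) ?_
    refine fun p hp q hq hpK hqK => overlap_le (fun x hx => ?_) hp hq hpK hqK
    rw [div_mul_eq_mul_div, le_div_iff₀ hT', mul_comm]
    exact h x hx
  exact ⟨1 - g, by linarith [hmin g₁ hg₁ hg₁0], by linarith [hup g hg hg0], hopt⟩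

theorem forall_lt_six {p : ℕ → Prop} (h0 : p 0) (h1 : p 1) (h2 : p 2) (h3 : p 3) (h4 : p 4)
    (h5 : p 5) : ∀ w < 6, p w := by
  intro w hw
  interval_cases w <;> assumption

theorem exists_isOptimal_perp : ∃ η : ℝ, |η - 0.1589663310| < 5 / 10 ^ 11 ∧
    IsOptimal (1 - firstSub.starProjection : Spins Trio →L[ℂ] Spins Trio)
      (1 - (secondSub true).starProjection) η := by
  obtain ⟨η, h1, h2, h3⟩ := exists_isOptimal_trio (b := true) (A := 114547313484925527708173825535)
    (T := 720575940379279360000123456789) (lo := 1589663309500) (unit := 10000000000000)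
    (by norm_num) (by norm_num)
    (fun x hx => abs_crossForm_le (by norm_num) (by norm_num) (by norm_num) (by norm_num)
      (by norm_num) (forall_lt_six blockCheck_perp_zero blockCheck_perp_one blockCheck_perp_two
        blockCheck_perp_three blockCheck_perp_four blockCheck_perp_five) hx)
    (exists_lt_crossForm (by norm_num) (by norm_num) lowerCheck_perp)
  refine ⟨η, ?_, h3⟩
  rw [abs_lt]
  norm_num at h1 h2 ⊢
  -- Strictness: `lo / unit` is the lower end of the interval and η exceeds it, whereas A / T lies
  -- strictly below the upper end.
  constructor <;> linarith

theorem exists_isOptimal_par : ∃ η : ℝ, |η - 0.1061446858| < 5 / 10 ^ 11 ∧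
    IsOptimal (1 - firstSub.starProjection : Spins Trio →L[ℂ] Spins Trio)
      (1 - (secondSub false).starProjection) η := by
  obtain ⟨η, h1, h2, h3⟩ := exists_isOptimal_trio (b := false) (A := 76485306822554879922564232345)
    (T := 720575940379279360000123456789) (lo := 1061446857500) (unit := 10000000000000)
    (by norm_num) (by norm_num)
    (fun x hx => abs_crossForm_le (by norm_num) (by norm_num) (by norm_num) (by norm_num)
      (by norm_num) (forall_lt_six blockCheck_par_zero blockCheck_par_one blockCheck_par_two
        blockCheck_par_three blockCheck_par_four blockCheck_par_five) hx)
    (exists_lt_crossForm (by norm_num) (by norm_num) lowerCheck_par)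
  refine ⟨η, ?_, h3⟩
  rw [abs_lt]
  norm_num at h1 h2 ⊢
  constructor <;> linarith

end Overlap

end

end SquareOctagon

namespace SquareOctagon

noncomputable section

set_option linter.unusedSectionVars false

/-! ## Overlapping pairs of plaquettes on the torus -/

section Geometry

theorem zmod_one_ne_zero {m : ℕ} (hm : 3 ≤ m) : (1 : ZMod m) ≠ 0 := fun h => by
  have := (ZMod.natCast_eq_zero_iff 1 m).1 (by exact_mod_cast h)
  exact absurd (Nat.le_of_dvd one_pos this) (by omega)

theorem zmod_two_ne_zero {m : ℕ} (hm : 3 ≤ m) : (1 + 1 : ZMod m) ≠ 0 := fun h => by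
  have := (ZMod.natCast_eq_zero_iff 2 m).1 (by rw [← h]; norm_num)
  exact absurd (Nat.le_of_dvd two_pos this) (by omega)

theorem zmod_add_one_ne_sub_one {m : ℕ} (hm : 3 ≤ m) (x : ZMod m) : x + 1 ≠ x - 1 := fun h =>
  zmod_two_ne_zero hm (by linear_combination h)

theorem zmod_add_two_ne {m : ℕ} (hm : 3 ≤ m) (x : ZMod m) : x + 1 + 1 ≠ x := fun h =>
  zmod_two_ne_zero hm (by linear_combination h)

theorem zmod_ne_sub_one {m : ℕ} (hm : 3 ≤ m) (x : ZMod m) : x ≠ x - 1 := fun h =>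
  zmod_one_ne_zero hm (by linear_combination h)

variable {m n : ℕ}

/-- The plaquette next to a plaquette in a given direction. -/
def neighbor (p : Plaq m n) (d : Fin 4) : Plaq m n :=
  ![(p.1 + 1, p.2), (p.1, p.2 + 1), (p.1 - 1, p.2), (p.1, p.2 - 1)] d

/-- The link at a plaquette in a given direction. -/
def linkAt (p : Plaq m n) (d : Fin 4) : Link m n :=
  ![(p, 0), (p, 1), ((p.1 - 1, p.2), 0), ((p.1, p.2 - 1), 1)] d

theorem linkAt_fst (i : Link m n) : linkAt i.1 (if i.2 = 0 then 0 else 1) = i := by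
  obtain ⟨p, k⟩ := i
  fin_cases k <;> rfl

theorem linkAt_target (i : Link m n) : linkAt (Link.target i) (if i.2 = 0 then 2 else 3) = i := by
  obtain ⟨⟨x, y⟩, k⟩ := i
  fin_cases k
  · exact Prod.ext (Prod.ext (add_sub_cancel_right x 1) rfl) rfl
  · exact Prod.ext (Prod.ext rfl (add_sub_cancel_right y 1)) rfl

theorem linkAt_snd (p : Plaq m n) (d : Fin 4) : (linkAt p d).2 = if d = 0 ∨ d = 2 then 0 else 1 := by
  fin_cases d <;> rfl

theorem linkAt_ends (p : Plaq m n) (d : Fin 4) :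
    ((linkAt p d).1 = p ∧ Link.target (linkAt p d) = neighbor p d) ∨
      ((linkAt p d).1 = neighbor p d ∧ Link.target (linkAt p d) = p) := by
  fin_cases d
  · exact Or.inl ⟨rfl, rfl⟩
  · exact Or.inl ⟨rfl, rfl⟩
  · exact Or.inr ⟨rfl, Prod.ext (sub_add_cancel p.1 1) rfl⟩
  · exact Or.inr ⟨rfl, Prod.ext rfl (sub_add_cancel p.2 1)⟩

/-- The ends of a link at a plaquette. -/
theorem linkAt_vertices (p : Plaq m n) (d : Fin 4) :
    ((Edge.start (Sum.inr (linkAt p d))).1 = (p, d) ∧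
      (Edge.finish (Sum.inr (linkAt p d))).1 = (neighbor p d, d + 2)) ∨
    ((Edge.start (Sum.inr (linkAt p d))).1 = (neighbor p d, d + 2) ∧
      (Edge.finish (Sum.inr (linkAt p d))).1 = (p, d)) := by
  fin_cases d
  · exact Or.inl ⟨rfl, rfl⟩
  · exact Or.inl ⟨rfl, rfl⟩
  · exact Or.inr ⟨rfl, Prod.ext (Prod.ext (sub_add_cancel p.1 1) rfl) rfl⟩
  · exact Or.inr ⟨rfl, Prod.ext (Prod.ext rfl (sub_add_cancel p.2 1)) rfl⟩

theorem neighbor_ne (hm : 3 ≤ m) (hn : 3 ≤ n) (p : Plaq m n) (d : Fin 4) : neighbor p d ≠ p := by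
  have h1 := zmod_one_ne_zero hm
  have h2 := zmod_one_ne_zero hn
  obtain ⟨x, y⟩ := p
  fin_cases d <;> simp [neighbor, h1, h2]

/-- On a torus of width two the neighbours on opposite sides would coincide. Here the assumption of
width at least three is indispensable. -/
theorem neighbor_injective (hm : 3 ≤ m) (hn : 3 ≤ n) (p : Plaq m n) :
    Function.Injective (neighbor p) := by
  have h1 := zmod_one_ne_zero hm
  have h2 := zmod_one_ne_zero hn
  have h3 := zmod_add_one_ne_sub_one hm
  have h4 := zmod_add_one_ne_sub_one hn
  have h5 := zmod_add_two_ne hm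
  have h6 := zmod_add_two_ne hn
  obtain ⟨x, y⟩ := p
  intro d e h
  fin_cases d <;> fin_cases e <;> first | rfl | (simp [neighbor] at h; grind)

/-- The subgraph induced on two neighbouring plaquettes contains just one link, so Γ_i has no edges
besides those intended. -/
theorem link_eq_of_ends (hm : 3 ≤ m) (hn : 3 ≤ n) {i j : Link m n}
    (h : j.1 = i.1 ∨ j.1 = Link.target i)
    (h' : Link.target j = i.1 ∨ Link.target j = Link.target i) : j = i := by
  have h1 := zmod_one_ne_zero hm
  have h2 := zmod_one_ne_zero hn
  have h3 := zmod_add_one_ne_sub_one hm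
  have h4 := zmod_add_one_ne_sub_one hn
  have h5 := zmod_add_two_ne hm
  have h6 := zmod_add_two_ne hn
  obtain ⟨⟨x, y⟩, k⟩ := i
  obtain ⟨⟨u, v⟩, l⟩ := j
  fin_cases k <;> fin_cases l <;> simp [Link.target] at h h' ⊢ <;> grind

variable [NeZero m] [NeZero n]

theorem mem_pair {i : Link m n} {v : Site m n} :
    v ∈ pair i ↔ v.1 = i.1 ∨ v.1 = Link.target i := by
  simp [pair]

theorem mem_pair_linkAt {p : Plaq m n} {d : Fin 4} {v : Site m n} :
    v ∈ pair (linkAt p d) ↔ v.1 = p ∨ v.1 = neighbor p d := by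
  rw [mem_pair]
  rcases linkAt_ends p d with ⟨h1, h2⟩ | ⟨h1, h2⟩ <;> rw [h1, h2]
  exact or_comm

theorem not_disjoint_iff {i j : Link m n} : ¬ Disjoint (pair i) (pair j) ↔
    i.1 = j.1 ∨ i.1 = Link.target j ∨ Link.target i = j.1 ∨ Link.target i = Link.target j := by
  rw [Finset.not_disjoint_iff]
  simp only [mem_pair]
  constructor
  · rintro ⟨v, h | h, h' | h'⟩ <;> rw [← h, ← h'] <;> simp
  · rintro (h | h | h | h)
    · exact ⟨(i.1, 0), Or.inl rfl, Or.inl h⟩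
    · exact ⟨(i.1, 0), Or.inl rfl, Or.inr h⟩
    · exact ⟨(Link.target i, 0), Or.inr rfl, Or.inl h⟩
    · exact ⟨(Link.target i, 0), Or.inr rfl, Or.inr h⟩

theorem exists_linkAt_of_mem {i : Link m n} {v : Site m n} (h : v ∈ pair i) :
    ∃ d, i = linkAt v.1 d := by
  rcases mem_pair.1 h with h | h <;> rw [h]
  · exact ⟨_, (linkAt_fst i).symm⟩
  · exact ⟨_, (linkAt_target i).symm⟩

theorem exists_linkAt {i j : Link m n} (hij : i ≠ j) (h : ¬ Disjoint (pair i) (pair j)) :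
    ∃ p d e, d ≠ e ∧ i = linkAt p d ∧ j = linkAt p e := by
  obtain ⟨v, hi, hj⟩ := Finset.not_disjoint_iff.1 h
  obtain ⟨d, rfl⟩ := exists_linkAt_of_mem hi
  obtain ⟨e, rfl⟩ := exists_linkAt_of_mem hj
  exact ⟨v.1, d, e, fun h => hij (by rw [h]), rfl, rfl⟩

theorem Collinear.exists_linkAt {i j : Link m n} (h : Collinear i j) :
    ∃ p d, i = linkAt p d ∧ j = linkAt p (d + 1 * far false) := by
  obtain ⟨p, d, e, hde, rfl, rfl⟩ := SquareOctagon.exists_linkAt h.1 h.2.1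
  refine ⟨p, d, rfl, congrArg _ ?_⟩
  have h2 := h.2.2
  rw [linkAt_snd, linkAt_snd] at h2
  clear h
  revert d e
  decide

theorem Perpendicular.exists_linkAt {i j : Link m n} (h : Perpendicular i j) :
    ∃ p d s, (s = 1 ∨ s = 3) ∧ i = linkAt p d ∧ j = linkAt p (d + s * far true) := by
  obtain ⟨p, d, e, hde, rfl, rfl⟩ := SquareOctagon.exists_linkAt h.1 h.2.1
  have h2 := h.2.2
  rw [linkAt_snd, linkAt_snd] at h2
  have h3 : ∃ s : Fin 4, (s = 1 ∨ s = 3) ∧ e = d + s * far true := by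
    clear h
    revert d e
    decide
  obtain ⟨s, hs, he⟩ := h3
  exact ⟨p, d, s, hs, rfl, congrArg _ he⟩

theorem ncard_collinear (hm : 3 ≤ m) (hn : 3 ≤ n) (i : Link m n) : {j | Collinear i j}.ncard = 2 := by
  have h1 := zmod_one_ne_zero hm
  have h2 := zmod_one_ne_zero hn
  have h3 := zmod_add_one_ne_sub_one hm
  have h4 := zmod_add_one_ne_sub_one hn
  have h5 := zmod_add_two_ne hm
  have h6 := zmod_add_two_ne hn
  obtain ⟨⟨x, y⟩, k⟩ := i
  fin_cases k
  · have : {j : Link m n | Collinear ((x, y), 0) j} = {((x - 1, y), 0), ((x + 1, y), 0)} := by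
      ext ⟨⟨u, v⟩, l⟩
      simp only [Set.mem_setOf_eq, Collinear, not_disjoint_iff, Link.target, Set.mem_insert_iff,
        Set.mem_singleton_iff]
      fin_cases l <;> simp <;> grind
    exact (congrArg Set.ncard this).trans (Set.ncard_pair (by simp; grind))
  · have : {j : Link m n | Collinear ((x, y), 1) j} = {((x, y - 1), 1), ((x, y + 1), 1)} := by
      ext ⟨⟨u, v⟩, l⟩
      simp only [Set.mem_setOf_eq, Collinear, not_disjoint_iff, Link.target, Set.mem_insert_iff,
        Set.mem_singleton_iff]
      fin_cases l <;> simp <;> grind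
    exact (congrArg Set.ncard this).trans (Set.ncard_pair (by simp; grind))

theorem ncard_perpendicular (hm : 3 ≤ m) (hn : 3 ≤ n) (i : Link m n) :
    {j | Perpendicular i j}.ncard = 4 := by
  have h1 := zmod_one_ne_zero hm
  have h2 := zmod_one_ne_zero hn
  have h3 := zmod_ne_sub_one hm
  have h4 := zmod_ne_sub_one hn
  obtain ⟨⟨x, y⟩, k⟩ := i
  fin_cases k
  · have : {j : Link m n | Perpendicular ((x, y), 0) j} =
        {((x, y), 1), ((x, y - 1), 1), ((x + 1, y), 1), ((x + 1, y - 1), 1)} := by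
      ext ⟨⟨u, v⟩, l⟩
      simp only [Set.mem_setOf_eq, Perpendicular, not_disjoint_iff, Link.target, Set.mem_insert_iff,
        Set.mem_singleton_iff]
      fin_cases l <;> simp <;> grind
    refine (congrArg Set.ncard this).trans ?_
    rw [Set.ncard_insert_of_notMem (by simp [h1, h2, h3, h4]), Set.ncard_insert_of_notMem (by simp [h1, h2, h3, h4]),
      Set.ncard_pair (by simp [h1, h2, h3, h4])]
  · have : {j : Link m n | Perpendicular ((x, y), 1) j} =
        {((x, y), 0), ((x - 1, y), 0), ((x, y + 1), 0), ((x - 1, y + 1), 0)} := by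
      ext ⟨⟨u, v⟩, l⟩
      simp only [Set.mem_setOf_eq, Perpendicular, not_disjoint_iff, Link.target, Set.mem_insert_iff,
        Set.mem_singleton_iff]
      fin_cases l <;> simp <;> grind
    refine (congrArg Set.ncard this).trans ?_
    rw [Set.ncard_insert_of_notMem (by simp [h1, h2, h3, h4]), Set.ncard_insert_of_notMem (by simp [h1, h2, h3, h4]),
      Set.ncard_pair (by simp [h1, h2, h3, h4])]

/-! ### Images as intersections -/

variable {W : Finset (Site m n)}

/-- No component of total spin 3 on two sites. -/
def Bond (ψ : Phys W) (v w : Site m n) : Prop :=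
  ∀ (hv : v ∈ W) (hw : w ∈ W), ψ ∈ sing (⟨v, hv⟩ : W) ⟨w, hw⟩

theorem Bond.comm {ψ : Phys W} {v w : Site m n} (h : v ≠ w) : Bond ψ v w ↔ Bond ψ w v := by
  constructor
  · intro k hv hw
    rw [sing_comm fun e => h (congrArg Subtype.val e).symm]
    exact k hw hv
  · intro k hv hw
    rw [sing_comm fun e => h (congrArg Subtype.val e)]
    exact k hw hv

theorem mem_image_iff {Γ : Finset (Site m n)} (h : Γ ⊆ W) {ψ : Phys W} :
    ψ ∈ image h ↔ ∀ e : Edge m n, (Edge.start e).1 ∈ Γ → (Edge.finish e).1 ∈ Γ →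
      Bond ψ (Edge.start e).1 (Edge.finish e).1 := by
  rw [image_eq, Submodule.mem_iInf]
  exact ⟨fun k e hs ht _ _ => k ⟨e, hs, ht⟩, fun k e => k e.1 e.2.1 e.2.2 _ _⟩

/-- No component of total spin 3 on the edges of a plaquette. -/
def PlaqBond (ψ : Phys W) (p : Plaq m n) : Prop := ∀ a, Bond ψ (p, a) (p, a + 1)

theorem mem_image_plaquette (hm : 3 ≤ m) (hn : 3 ≤ n) {Γ : Finset (Site m n)} (h : Γ ⊆ W)
    {p : Plaq m n} (hΓ : ∀ v, v ∈ Γ ↔ v.1 = p) {ψ : Phys W} : ψ ∈ image h ↔ PlaqBond ψ p := by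
  rw [mem_image_iff]
  simp only [hΓ]
  constructor
  · exact fun k a => k (Sum.inl (p, a)) rfl rfl
  · rintro k (⟨q, a⟩ | i) hs ht
    · change q = p at hs
      subst hs
      exact k a
    · exfalso
      change i.1 = p at hs
      change Link.target i = p at ht
      have := linkAt_ends i.1 (if i.2 = 0 then 0 else 1)
      rw [linkAt_fst] at this
      rcases this with h | h
      · exact neighbor_ne hm hn _ _ (h.2.symm.trans (ht.trans hs.symm))
      · exact neighbor_ne hm hn _ _ h.1.symm

theorem mem_image_pair (hm : 3 ≤ m) (hn : 3 ≤ n) {p : Plaq m n} {d : Fin 4}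
    (h : pair (linkAt p d) ⊆ W) {ψ : Phys W} : ψ ∈ image h ↔
      PlaqBond ψ p ∧ PlaqBond ψ (neighbor p d) ∧ Bond ψ (p, d) (neighbor p d, d + 2) := by
  have hne : ((p, d) : Site m n) ≠ (neighbor p d, d + 2) := fun e =>
    neighbor_ne hm hn p d (congrArg Prod.fst e).symm
  have hlink : Bond ψ (Edge.start (Sum.inr (linkAt p d))).1 (Edge.finish (Sum.inr (linkAt p d))).1 ↔
      Bond ψ (p, d) (neighbor p d, d + 2) := by
    rcases linkAt_vertices p d with ⟨h1, h2⟩ | ⟨h1, h2⟩ <;> rw [h1, h2]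
    exact Bond.comm hne.symm
  rw [mem_image_iff, ← hlink]
  constructor
  · intro k
    refine ⟨fun a => k (Sum.inl (p, a)) (mem_pair_linkAt.2 (Or.inl rfl))
      (mem_pair_linkAt.2 (Or.inl rfl)), fun a => k (Sum.inl (neighbor p d, a))
      (mem_pair_linkAt.2 (Or.inr rfl)) (mem_pair_linkAt.2 (Or.inr rfl)),
      k (Sum.inr (linkAt p d)) (mem_pair.2 (Or.inl rfl)) (mem_pair.2 (Or.inr rfl))⟩
  · rintro ⟨k1, k2, k3⟩ (⟨q, a⟩ | i) hs ht
    · rcases mem_pair_linkAt.1 hs with e | e <;> change q = _ at e <;> subst e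
      · exact k1 a
      · exact k2 a
    · have := link_eq_of_ends hm hn (mem_pair.1 hs) (mem_pair.1 ht)
      rwa [this]

/-- The corners may be counted from any starting point and in either direction, s = 3 being -1
modulo 4. This lets one model describe both handednesses of a perpendicular pair. -/
theorem plaqBond_iff {ψ : Phys W} {p : Plaq m n} (d : Fin 4) {s : Fin 4} (hs : s = 1 ∨ s = 3) :
    (∀ a, Bond ψ (p, d + s * a) (p, d + s * (a + 1))) ↔ PlaqBond ψ p := by
  rcases hs with rfl | rfl
  · have h : ∀ a d : Fin 4, d + 1 * (a + 1) = d + 1 * a + 1 := by decide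
    have h' : ∀ a d : Fin 4, d + 1 * (a - d) = a := by decide
    refine ⟨fun k a => ?_, fun k a => ?_⟩
    · have := k (a - d)
      rwa [h, h'] at this
    · rw [h]
      exact k _
  · have h : ∀ a d : Fin 4, d + 3 * a = d + 3 * (a + 1) + 1 := by decide
    have h' : ∀ a d : Fin 4, d + 3 * (d - a - 1 + 1) = a := by decide
    have hne : ∀ a : Fin 4, ((p, a + 1) : Site m n) ≠ (p, a) := fun a e => by
      have := congrArg Prod.snd e
      revert a
      simp
    refine ⟨fun k a => ?_, fun k a => ?_⟩
    · have := k (d - a - 1)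
      rw [h, h', Bond.comm (hne _)] at this
      exact this
    · rw [h, Bond.comm (hne _)]
      exact k _

end Geometry

end

end SquareOctagon

namespace SquareOctagon

noncomputable section

set_option linter.unusedSectionVars false

/-! ## The overlap constants on the torus -/

section Projections

variable {V : Type*} [NormedAddCommGroup V] [InnerProductSpace ℂ V] [FiniteDimensional ℂ V]
  {A B N₁ N₂ : Submodule ℂ V}

open scoped InnerProductSpace

/-- If P_A preserves N₁, then P_A x already lies in A ⊓ N₁, and x - P_A x is orthogonal even to A.
-/
theorem starProjection_inf_of_mem (h : ∀ x ∈ N₁, A.starProjection x ∈ N₁) {x : V} (hx : x ∈ N₁) :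
    (A ⊓ N₁).starProjection x = A.starProjection x :=
  Submodule.eq_starProjection_of_mem_orthogonal ⟨Submodule.starProjection_apply_mem _ _, h x hx⟩
    (Submodule.orthogonal_le inf_le_left (Submodule.sub_starProjection_mem_orthogonal x))

/-- The optimal constant is attained on the spaces which carry the overlap. -/
theorem isOptimal_inf (hA : A ≤ N₁) (hB : B ≤ N₂) (hPA : ∀ x ∈ N₂, A.starProjection x ∈ N₂)
    (hPB : ∀ x ∈ N₁, B.starProjection x ∈ N₁) {η : ℝ} (h0 : 0 < η)
    (h : IsOptimal (1 - A.starProjection : V →L[ℂ] V) (1 - B.starProjection) η) :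
    IsOptimal (1 - (A ⊓ N₂).starProjection : V →L[ℂ] V) (1 - (B ⊓ N₁).starProjection) η := by
  have hK : (A ⊓ N₂) ⊓ (B ⊓ N₁) = A ⊓ B := by
    rw [inf_inf_inf_comm, inf_comm N₂, ← inf_inf_inf_comm, inf_eq_left.2 hA, inf_eq_left.2 hB]
  -- Both conditions express the same overlap bound for vectors of A ⊓ N₂ and B ⊓ N₁ modulo the
  -- common intersection. The overlap criterion is available for nonnegative constants only, whence
  -- `max t 0` below.
  have h1 : ∀ t : ℝ, 0 ≤ t → ((∀ g ∈ spectrum ℝ (defect A B), g ≠ 0 → 1 - t ≤ g) ↔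
      ∀ g ∈ spectrum ℝ (defect (A ⊓ N₂) (B ⊓ N₁)), g ≠ 0 → 1 - t ≤ g) := fun t ht => by
    constructor
    · intro k
      refine le_of_overlap_le (N₁ := ⊤) (N₂ := ⊤) le_top le_top (fun _ _ => trivial)
        (fun _ _ => trivial) ht fun p hp q hq hpK hqK => ?_
      rw [hK] at hpK hqK
      exact overlap_le_of_le ht k hp.1.1 hq.1.1 hpK hqK
    · intro k
      refine le_of_overlap_le hA hB hPA hPB ht fun p hp q hq hpK hqK => ?_
      rw [← hK] at hpK hqK
      exact overlap_le_of_le ht k hp hq hpK hqK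
  refine ⟨neg_smul_defect_le_iff.2 ((h1 η h0.le).1 (neg_smul_defect_le_iff.1 h.1)), ?_⟩
  intro t ht
  by_contra! hlt
  have ht' : ∀ g ∈ spectrum ℝ (defect A B), g ≠ 0 → 1 - max t 0 ≤ g :=
    (h1 _ (le_max_right _ _)).2 fun g hg hg0 =>
      le_trans (by linarith [le_max_left t 0]) (neg_smul_defect_le_iff.1 ht g hg hg0)
  exact absurd (h.2 (neg_smul_defect_le_iff.2 ht')) (not_le.2 (max_lt hlt h0))

theorem isGreatest_spectrum_compression_inf {N : Submodule ℂ V} (hAN : A ⊓ N₂ ≤ N)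
    (hBN : B ⊓ N₁ ≤ N) (h1 : N ≤ N₁) (h2 : N ≤ N₂) (hPA : ∀ x ∈ N₂, A.starProjection x ∈ N₂)
    (hPB : ∀ x ∈ N₁, B.starProjection x ∈ N₁) {η : ℝ} (hη0 : 0 < η) (hη1 : η < 1)
    (h : IsOptimal (1 - (A ⊓ N₂).starProjection : V →L[ℂ] V) (1 - (B ⊓ N₁).starProjection) η) :
    IsGreatest {t : ℝ | t ∈ spectrum ℝ (N.orthogonalProjectionOnto ∘L
      (A.starProjection + B.starProjection) ∘L N.subtypeL) ∧ t ∉ Set.range ((↑) : ℤ → ℝ)}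
      (1 + η) := by
  have hop : (A.starProjection + B.starProjection) ∘L N.subtypeL =
      ((A ⊓ N₂).starProjection + (B ⊓ N₁).starProjection) ∘L N.subtypeL := by
    ext x
    rw [ContinuousLinearMap.comp_apply, ContinuousLinearMap.comp_apply,
      ContinuousLinearMap.add_apply, ContinuousLinearMap.add_apply, Submodule.subtypeL_apply,
      starProjection_inf_of_mem hPA (h2 x.2), starProjection_inf_of_mem hPB (h1 x.2)]
  rw [hop]
  exact isGreatest_spectrum_compression hAN hBN hη0 hη1 h

end Projections

/-! ### Transport from three abstract plaquettes to the torus -/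

section Torus

theorem one_sub_starProjection_liftSub {I₀ I : Type*} [Fintype I₀] [DecidableEq I₀] [Fintype I]
    [DecidableEq I] {f : I₀ → I} (hf : f.Injective) (A : Submodule ℂ (Spins I₀)) :
    1 - (liftSub f A).starProjection = liftOp f (1 - A.starProjection) := by
  rw [starProjection_liftSub hf, liftOp_sub, liftOp_one hf]

-- Lifting is multiplicative, linear and reflects the order, so both operators satisfy the
-- inequality for exactly the same constants.
open scoped ComplexOrder in
theorem isOptimal_liftSub {I₀ I : Type*} [Fintype I₀] [DecidableEq I₀] [Fintype I] [DecidableEq I]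
    {f : I₀ → I} (hf : f.Injective) {A B : Submodule ℂ (Spins I₀)} {η : ℝ}
    (h : IsOptimal (1 - A.starProjection : Spins I₀ →L[ℂ] Spins I₀) (1 - B.starProjection) η) :
    IsOptimal (1 - (liftSub f A).starProjection : Spins I →L[ℂ] Spins I)
      (1 - (liftSub f B).starProjection) η := by
  rw [IsOptimal] at h ⊢
  convert h using 1
  ext t
  rw [Set.mem_ofPred_eq, Set.mem_ofPred_eq, one_sub_starProjection_liftSub hf,
    one_sub_starProjection_liftSub hf, ← liftOp_add, ← liftOp_smul, ← liftOp_mul hf,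
    ← liftOp_mul hf, ← liftOp_add, liftOp_le_iff hf]

/-- When no sites are left over, a slice is independent of the outer configuration and is a linear
isomorphism. -/
theorem finrank_liftSub {I₀ I : Type*} [Fintype I₀] [DecidableEq I₀] [Fintype I] [DecidableEq I]
    {f : I₀ → I} (hf : f.Bijective) (U : Submodule ℂ (Spins I₀)) :
    Module.finrank ℂ (liftSub f U) = Module.finrank ℂ U := by
  have h : ∀ τ τ' : I → Fin 4, slice f τ = slice f τ' := fun τ τ' => by
    ext ψ σ
    rw [slice_apply, slice_apply]
    refine congrArg ψ.ofLp (funext fun v => ?_)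
    obtain ⟨u, rfl⟩ := hf.2 v
    rw [hf.1.extend_apply, hf.1.extend_apply]
  let τ₀ : I → Fin 4 := fun _ => 0
  have hi : Function.Injective (slice f τ₀) := fun ψ φ e => slice_ext hf.1 fun τ => by
    rw [h τ τ₀]; exact e
  have hs : Function.Surjective (slice f τ₀) := fun φ => by
    refine ⟨WithLp.toLp 2 fun σ => φ (σ ∘ f), ?_⟩
    ext σ
    rw [slice_apply]
    change φ (Function.extend f σ τ₀ ∘ f) = φ σ
    rw [Function.extend_comp hf.1]
  let e := LinearEquiv.ofBijective (slice f τ₀) ⟨hi, hs⟩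
  have h2 : liftSub f U = U.map (e.symm : Spins I₀ →ₗ[ℂ] Spins I) := by
    ext ψ
    rw [← Submodule.comap_equiv_eq_map_symm, mem_liftSub, Submodule.mem_comap]
    exact ⟨fun k => k τ₀, fun k τ => by rw [h τ τ₀]; exact k⟩
  rw [h2]
  exact LinearEquiv.finrank_map_eq e.symm U

variable {m n : ℕ} [NeZero m] [NeZero n] {W : Finset (Site m n)}

theorem mem_liftSub_sing {I : Type*} [Fintype I] [DecidableEq I] {f : I → W} (hf : f.Injective)
    {v w : I} {ψ : Phys W} : ψ ∈ liftSub f (sing v w) ↔ Bond ψ (f v).1 (f w).1 := by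
  rw [← sing_map hf]
  exact ⟨fun h _ _ => h, fun h => h (f v).2 (f w).2⟩

/-- The sites of the two pairs of plaquettes of two links at a plaquette. -/
def trioSite (p : Plaq m n) (d s e : Fin 4) (v : Trio) : Site m n :=
  ![(neighbor p d, d + 2 + 1 * v.2), (p, d + s * v.2), (neighbor p e, e + 2 + 1 * v.2)] v.1

theorem trioSite_injective (hm : 3 ≤ m) (hn : 3 ≤ n) (p : Plaq m n) {d s e : Fin 4}
    (hs : s = 1 ∨ s = 3) (hde : d ≠ e) : Function.Injective (trioSite p d s e) := by
  have h1 := neighbor_ne hm hn p d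
  have h2 := neighbor_ne hm hn p e
  have h3 : neighbor p d ≠ neighbor p e := fun h => hde (neighbor_injective hm hn p h)
  have hs' : ∀ s : Fin 4, s = 1 ∨ s = 3 → ∀ a b : Fin 4, s * a = s * b → a = b := by decide
  rintro ⟨t, a⟩ ⟨u, b⟩ h
  have hp := congrArg Prod.fst h
  have hc := congrArg Prod.snd h
  fin_cases t <;> fin_cases u <;> simp [trioSite, h1, h2, h3, h1.symm, h2.symm, h3.symm] at hp hc
  · rw [hc]
  · rw [hs' s hs a b hc]
  · rw [hc]

theorem trioSite_mem {p : Plaq m n} {d s e : Fin 4} (hi : pair (linkAt p d) ⊆ W)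
    (hj : pair (linkAt p e) ⊆ W) (v : Trio) : trioSite p d s e v ∈ W := by
  obtain ⟨t, a⟩ := v
  fin_cases t
  · exact hi (mem_pair_linkAt.2 (Or.inr rfl))
  · exact hi (mem_pair_linkAt.2 (Or.inl rfl))
  · exact hj (mem_pair_linkAt.2 (Or.inr rfl))

theorem mem_liftSub_plaqSub {f : Trio → W} (hf : f.Injective) {t : Fin 3} {ψ : Phys W}
    {p : Plaq m n} {d s : Fin 4} (hs : s = 1 ∨ s = 3) (h : ∀ a, (f (t, a)).1 = (p, d + s * a)) :
    ψ ∈ liftSub f (plaqSub t) ↔ PlaqBond ψ p := by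
  rw [plaqSub, liftSub_iInf, Submodule.mem_iInf, ← plaqBond_iff d hs]
  simp only [mem_liftSub_sing hf, h]

variable (hm : 3 ≤ m) (hn : 3 ≤ n) {p : Plaq m n} {d s : Fin 4} (hs : s = 1 ∨ s = 3) {b : Bool}

theorem far_ne (hs : s = 1 ∨ s = 3) (d : Fin 4) (b : Bool) : d ≠ d + s * far b := by
  revert d s
  cases b <;> decide

/-- The sites of the two pairs, inside a set of sites. -/
def trioMap (p : Plaq m n) (d s : Fin 4) (b : Bool) (hi : pair (linkAt p d) ⊆ W)
    (hj : pair (linkAt p (d + s * far b)) ⊆ W) (v : Trio) : W :=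
  ⟨trioSite p d s (d + s * far b) v, trioSite_mem hi hj v⟩

theorem trioMap_injective (hm : 3 ≤ m) (hn : 3 ≤ n) (hs : s = 1 ∨ s = 3)
    (hi : pair (linkAt p d) ⊆ W) (hj : pair (linkAt p (d + s * far b)) ⊆ W) :
    Function.Injective (trioMap p d s b hi hj) := fun _ _ h =>
  trioSite_injective hm hn p hs (far_ne hs d b) (congrArg Subtype.val h)

theorem mem_plaqSub_zero (hm : 3 ≤ m) (hn : 3 ≤ n) (hs : s = 1 ∨ s = 3)
    (hi : pair (linkAt p d) ⊆ W) (hj : pair (linkAt p (d + s * far b)) ⊆ W) {ψ : Phys W} :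
    ψ ∈ liftSub (trioMap p d s b hi hj) (plaqSub 0) ↔ PlaqBond ψ (neighbor p d) :=
  mem_liftSub_plaqSub (trioMap_injective hm hn hs hi hj) (d := d + 2) (Or.inl rfl) fun _ => rfl

theorem mem_plaqSub_one (hm : 3 ≤ m) (hn : 3 ≤ n) (hs : s = 1 ∨ s = 3)
    (hi : pair (linkAt p d) ⊆ W) (hj : pair (linkAt p (d + s * far b)) ⊆ W) {ψ : Phys W} :
    ψ ∈ liftSub (trioMap p d s b hi hj) (plaqSub 1) ↔ PlaqBond ψ p :=
  mem_liftSub_plaqSub (trioMap_injective hm hn hs hi hj) hs fun _ => rfl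

theorem mem_plaqSub_two (hm : 3 ≤ m) (hn : 3 ≤ n) (hs : s = 1 ∨ s = 3)
    (hi : pair (linkAt p d) ⊆ W) (hj : pair (linkAt p (d + s * far b)) ⊆ W) {ψ : Phys W} :
    ψ ∈ liftSub (trioMap p d s b hi hj) (plaqSub 2) ↔ PlaqBond ψ (neighbor p (d + s * far b)) :=
  mem_liftSub_plaqSub (trioMap_injective hm hn hs hi hj) (d := d + s * far b + 2) (Or.inl rfl)
    fun _ => rfl

theorem image_eq_liftSub_firstSub (hm : 3 ≤ m) (hn : 3 ≤ n) (hs : s = 1 ∨ s = 3)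
    (hi : pair (linkAt p d) ⊆ W) (hj : pair (linkAt p (d + s * far b)) ⊆ W) :
    image hi = liftSub (trioMap p d s b hi hj) firstSub := by
  ext ψ
  have h0 : ((trioMap p d s b hi hj (0, 0)).1 : Site m n) = (neighbor p d, d + 2) := by
    change (neighbor p d, d + 2 + 1 * 0) = _
    simp
  have h1 : ((trioMap p d s b hi hj (1, 0)).1 : Site m n) = (p, d) := by
    change (p, d + s * 0) = _
    simp
  rw [mem_image_pair hm hn, firstSub, liftSub_inf, liftSub_inf, Submodule.mem_inf,
    Submodule.mem_inf, mem_plaqSub_zero hm hn hs, mem_plaqSub_one hm hn hs,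
    mem_liftSub_sing (trioMap_injective hm hn hs hi hj), h0, h1,
    Bond.comm fun e => neighbor_ne hm hn p d (congrArg Prod.fst e).symm]
  tauto

theorem image_eq_liftSub_secondSub (hm : 3 ≤ m) (hn : 3 ≤ n) (hs : s = 1 ∨ s = 3)
    (hi : pair (linkAt p d) ⊆ W) (hj : pair (linkAt p (d + s * far b)) ⊆ W) :
    image hj = liftSub (trioMap p d s b hi hj) (secondSub b) := by
  ext ψ
  have h0 : ((trioMap p d s b hi hj (2, 0)).1 : Site m n) =
      (neighbor p (d + s * far b), d + s * far b + 2) := by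
    change (neighbor p (d + s * far b), d + s * far b + 2 + 1 * 0) = _
    simp
  have h1 : ((trioMap p d s b hi hj (1, far b)).1 : Site m n) = (p, d + s * far b) := rfl
  rw [mem_image_pair hm hn, secondSub, liftSub_inf, liftSub_inf, Submodule.mem_inf,
    Submodule.mem_inf, mem_plaqSub_one hm hn hs, mem_plaqSub_two hm hn hs,
    mem_liftSub_sing (trioMap_injective hm hn hs hi hj), h0, h1]
  tauto

theorem mem_reducedSpace (hm : 3 ≤ m) (hn : 3 ≤ n) {e : Fin 4} (hde : d ≠ e)
    {ψ : Phys (pair (linkAt p d) ∪ pair (linkAt p e))} :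
    ψ ∈ reducedSpace (linkAt p d) (linkAt p e) ↔
      PlaqBond ψ (neighbor p d) ∧ PlaqBond ψ p ∧ PlaqBond ψ (neighbor p e) := by
  have h1 := neighbor_ne hm hn p d
  have h2 := neighbor_ne hm hn p e
  have h3 : neighbor p d ≠ neighbor p e := fun h => hde (neighbor_injective hm hn p h)
  have hL : ∀ v, v ∈ pair (linkAt p d) \ pair (linkAt p e) ↔ v.1 = neighbor p d := fun v => by
    rw [Finset.mem_sdiff, mem_pair_linkAt, mem_pair_linkAt]
    constructor
    · tauto
    · intro h
      rw [h]
      tauto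
  have hC : ∀ v, v ∈ pair (linkAt p d) ∩ pair (linkAt p e) ↔ v.1 = p := fun v => by
    rw [Finset.mem_inter, mem_pair_linkAt, mem_pair_linkAt]
    constructor
    · rintro ⟨h | h, h' | h'⟩
      · exact h
      · exact h
      · exact h'
      · exact absurd (h.symm.trans h') h3
    · tauto
  have hR : ∀ v, v ∈ pair (linkAt p e) \ pair (linkAt p d) ↔ v.1 = neighbor p e := fun v => by
    rw [Finset.mem_sdiff, mem_pair_linkAt, mem_pair_linkAt]
    constructor
    · tauto
    · intro h
      rw [h]
      have := h3.symm
      tauto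
  rw [reducedSpace, Submodule.mem_inf, Submodule.mem_inf, mem_image_plaquette hm hn _ hL,
    mem_image_plaquette hm hn _ hC, mem_image_plaquette hm hn _ hR, and_assoc]

/-- The difference sets and the intersection of the two pairs are single plaquettes, with no link
inside. Hence only the twelve plaquette edges impose conditions. -/
theorem reducedSpace_eq (hm : 3 ≤ m) (hn : 3 ≤ n) (hs : s = 1 ∨ s = 3) :
    reducedSpace (linkAt p d) (linkAt p (d + s * far b)) =
      liftSub (trioMap p d s b Finset.subset_union_left Finset.subset_union_right)
        (⨅ v : Trio, sing v (next v)) := by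
  ext ψ
  have h : (⨅ v : Trio, sing v (next v)) = plaqSub 0 ⊓ plaqSub 1 ⊓ plaqSub 2 := by
    ext φ
    rw [Submodule.mem_iInf, mem_plaquettes_iff, Submodule.mem_inf, Submodule.mem_inf, and_assoc]
  rw [mem_reducedSpace hm hn (far_ne hs d b), h, liftSub_inf, liftSub_inf, Submodule.mem_inf,
    Submodule.mem_inf, mem_plaqSub_zero hm hn hs, mem_plaqSub_one hm hn hs,
    mem_plaqSub_two hm hn hs, and_assoc]

theorem trioMap_bijective (hm : 3 ≤ m) (hn : 3 ≤ n) (hs : s = 1 ∨ s = 3) : Function.Bijective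
    (trioMap p d s b (W := pair (linkAt p d) ∪ pair (linkAt p (d + s * far b)))
      Finset.subset_union_left Finset.subset_union_right) := by
  refine ⟨trioMap_injective hm hn hs _ _, ?_⟩
  have h1 : ∀ x y : Fin 4, x + 1 * (y - x) = y := by decide
  have h3 : ∀ s : Fin 4, s = 1 ∨ s = 3 → ∀ x y : Fin 4, x + s * (s * (y - x)) = y := by decide
  rintro ⟨⟨q, a⟩, h⟩
  rw [Finset.mem_union, mem_pair_linkAt, mem_pair_linkAt] at h
  have key : q = p ∨ q = neighbor p d ∨ q = neighbor p (d + s * far b) := by tauto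
  rcases key with rfl | rfl | rfl
  · exact ⟨(1, s * (a - d)), Subtype.ext (Prod.ext rfl (h3 s hs d a))⟩
  · exact ⟨(0, a - (d + 2)), Subtype.ext (Prod.ext rfl (h1 _ a))⟩
  · exact ⟨(2, a - (d + s * far b + 2)), Subtype.ext (Prod.ext rfl (h1 _ a))⟩

theorem isOptimal_enlarged (hm : 3 ≤ m) (hn : 3 ≤ n) (hs : s = 1 ∨ s = 3)
    (hi : pair (linkAt p d) ⊆ W) (hj : pair (linkAt p (d + s * far b)) ⊆ W) {η : ℝ}
    (h : IsOptimal (1 - firstSub.starProjection : Spins Trio →L[ℂ] Spins Trio)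
      (1 - (secondSub b).starProjection) η) : IsOptimal (enlarged _ hi) (enlarged _ hj) η := by
  have h1 := isOptimal_liftSub (trioMap_injective hm hn hs hi hj) h
  simp only [← image_eq_liftSub_firstSub hm hn hs hi hj,
    ← image_eq_liftSub_secondSub hm hn hs hi hj] at h1
  exact h1

theorem starProjection_liftSub_mem {I₀ I : Type*} [Fintype I₀] [DecidableEq I₀] [Fintype I]
    [DecidableEq I] {f : I₀ → I} (hf : f.Injective) {A M : Submodule ℂ (Spins I₀)}
    (h : ∀ φ ∈ M, A.starProjection φ ∈ M) {ψ : Spins I} (hψ : ψ ∈ liftSub f M) :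
    (liftSub f A).starProjection ψ ∈ liftSub f M := fun τ => by
  rw [starProjection_liftSub hf, slice_liftOp hf]
  exact h _ (hψ τ)

theorem mem_reducedSpace_iff (hm : 3 ≤ m) (hn : 3 ≤ n) (hs : s = 1 ∨ s = 3)
    {ψ : Phys (pair (linkAt p d) ∪ pair (linkAt p (d + s * far b)))}
    {f : Trio → ↥(pair (linkAt p d) ∪ pair (linkAt p (d + s * far b)))}
    (hf : f = trioMap p d s b Finset.subset_union_left Finset.subset_union_right) :
    ψ ∈ reducedSpace (linkAt p d) (linkAt p (d + s * far b)) ↔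
      ψ ∈ liftSub f (plaqSub 0) ∧ ψ ∈ liftSub f (plaqSub 1) ∧ ψ ∈ liftSub f (plaqSub 2) := by
  rw [hf, mem_reducedSpace hm hn (far_ne hs d b), mem_plaqSub_zero hm hn hs,
    mem_plaqSub_one hm hn hs, mem_plaqSub_two hm hn hs]

/-- On the reduced space Π_{Γ_i} and Π_{Γ_j} act as the projections onto the subspaces which satisfy
the plaquette condition of the third plaquette as well. These subspaces lie inside the reduced space
and have the same optimal constant, so no eigenvalue is lost or created by the compression. -/
theorem isGreatest_reducedOp (hm : 3 ≤ m) (hn : 3 ≤ n) (hs : s = 1 ∨ s = 3) {η : ℝ}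
    (h0 : 0 < η) (h1 : η < 1)
    (h : IsOptimal (1 - firstSub.starProjection : Spins Trio →L[ℂ] Spins Trio)
      (1 - (secondSub b).starProjection) η) :
    IsGreatest {t : ℝ | t ∈ spectrum ℝ (reducedOp (linkAt p d) (linkAt p (d + s * far b))) ∧
      t ∉ Set.range ((↑) : ℤ → ℝ)} (1 + η) := by
  have hA := image_eq_liftSub_firstSub hm hn hs (p := p) (d := d) (b := b)
    (W := pair (linkAt p d) ∪ pair (linkAt p (d + s * far b)))
    Finset.subset_union_left Finset.subset_union_right
  have hB := image_eq_liftSub_secondSub hm hn hs (p := p) (d := d) (b := b)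
    (W := pair (linkAt p d) ∪ pair (linkAt p (d + s * far b)))
    Finset.subset_union_left Finset.subset_union_right
  obtain ⟨f, hf⟩ : ∃ f, f = trioMap p d s b
    (W := pair (linkAt p d) ∪ pair (linkAt p (d + s * far b)))
    Finset.subset_union_left Finset.subset_union_right := ⟨_, rfl⟩
  have hfi : f.Injective := hf ▸ trioMap_injective hm hn hs _ _
  have hN := fun ψ => mem_reducedSpace_iff (ψ := ψ) hm hn hs hf
  rw [← hf] at hA hB
  have hopt := isOptimal_liftSub hfi (isOptimal_inf (N₁ := plaqSub 0) (N₂ := plaqSub 2)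
    (inf_le_left.trans inf_le_left) (inf_le_left.trans inf_le_right)
    (fun ψ => starProjection_firstSub_mem) (fun ψ => starProjection_secondSub_mem) h0 h)
  have e1 := liftSub_inf f firstSub (plaqSub 2)
  have e2 := liftSub_inf f (secondSub b) (plaqSub 0)
  refine isGreatest_spectrum_compression_inf (N₁ := liftSub f (plaqSub 0))
    (N₂ := liftSub f (plaqSub 2)) ?_ ?_ (fun ψ hψ => ((hN ψ).1 hψ).1)
    (fun ψ hψ => ((hN ψ).1 hψ).2.2) ?_ ?_ h0 h1 ?_
  · intro ψ hψ
    rw [hA, firstSub, liftSub_inf, liftSub_inf] at hψ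
    exact (hN ψ).2 ⟨hψ.1.1.1, hψ.1.1.2, hψ.2⟩
  · intro ψ hψ
    rw [hB, secondSub, liftSub_inf, liftSub_inf] at hψ
    exact (hN ψ).2 ⟨hψ.2, hψ.1.1.1, hψ.1.1.2⟩
  · intro ψ hψ
    simp only [hA]
    exact starProjection_liftSub_mem hfi (fun χ hχ => starProjection_firstSub_mem hχ) hψ
  · intro ψ hψ
    simp only [hB]
    exact starProjection_liftSub_mem hfi (fun χ hχ => starProjection_secondSub_mem hχ) hψ
  · simp only [hA, hB, ← e1, ← e2]
    exact hopt

theorem isOverlapConstant_linkAt (hm : 3 ≤ m) (hn : 3 ≤ n) (hs : s = 1 ∨ s = 3) {η : ℝ}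
    (h0 : 0 < η) (h1 : η < 1)
    (h : IsOptimal (1 - firstSub.starProjection : Spins Trio →L[ℂ] Spins Trio)
      (1 - (secondSub b).starProjection) η) :
    IsOverlapConstant (linkAt p d) (linkAt p (d + s * far b)) η := by
  refine ⟨fun W hi hj => isOptimal_enlarged hm hn hs hi hj h, ?_,
    isGreatest_reducedOp hm hn hs h0 h1 h⟩
  rw [reducedSpace_eq hm hn hs, finrank_liftSub (trioMap_bijective hm hn hs), finrank_plaquettes]

theorem Collinear.isOverlapConstant (hm : 3 ≤ m) (hn : 3 ≤ n) {η : ℝ} (h0 : 0 < η) (h1 : η < 1)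
    (h : IsOptimal (1 - firstSub.starProjection : Spins Trio →L[ℂ] Spins Trio)
      (1 - (secondSub false).starProjection) η) {i j : Link m n} (hij : Collinear i j) :
    IsOverlapConstant i j η := by
  obtain ⟨p, d, rfl, rfl⟩ := hij.exists_linkAt
  exact isOverlapConstant_linkAt hm hn (Or.inl rfl) h0 h1 h

theorem Perpendicular.isOverlapConstant (hm : 3 ≤ m) (hn : 3 ≤ n) {η : ℝ} (h0 : 0 < η) (h1 : η < 1)
    (h : IsOptimal (1 - firstSub.starProjection : Spins Trio →L[ℂ] Spins Trio)
      (1 - (secondSub true).starProjection) η) {i j : Link m n} (hij : Perpendicular i j) :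
    IsOverlapConstant i j η := by
  obtain ⟨p, d, s, hs, rfl, rfl⟩ := hij.exists_linkAt
  exact isOverlapConstant_linkAt hm hn hs h0 h1 h

end Torus

end

end SquareOctagon

namespace SquareOctagon

noncomputable section

set_option linter.unusedSectionVars false

/-! ## Sums of projections -/

section Sums

variable {V : Type*} [NormedAddCommGroup V] [InnerProductSpace ℂ V] [FiniteDimensional ℂ V]

open scoped InnerProductSpace

/-- A self-adjoint operator preserving B commutes with the projection onto it. The product of two
commuting projections is again a projection. -/
theorem mul_nonneg_of_invariant {A B : Submodule ℂ V} (h : ∀ x ∈ B, A.starProjection x ∈ B) :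
    0 ≤ (1 - A.starProjection : V →L[ℂ] V) * (1 - B.starProjection) := by
  have hA := isSelfAdjoint_starProjection A
  have hB := isSelfAdjoint_starProjection B
  have h1 : B.starProjection * A.starProjection * B.starProjection =
      A.starProjection * B.starProjection := by
    ext x
    exact Submodule.starProjection_eq_self_iff.2 (h _ (Submodule.starProjection_apply_mem B x))
  have h2 : B.starProjection * A.starProjection = A.starProjection * B.starProjection := by
    have := congrArg star h1
    rw [star_mul, star_mul, star_mul, hA.star_eq, hB.star_eq, ← mul_assoc] at this
    exact this.symm.trans h1
  set E : V →L[ℂ] V := 1 - A.starProjection with hE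
  set F : V →L[ℂ] V := 1 - B.starProjection with hF
  have h3 : F * E = E * F := by
    rw [hE, hF]
    simp only [mul_sub, sub_mul, mul_one, one_mul, h2]
    abel
  have h4 : E * F = star (F * E) * (F * E) := by
    rw [star_mul, (isSelfAdjoint_one_sub A).star_eq, (isSelfAdjoint_one_sub B).star_eq, mul_assoc,
      ← mul_assoc F F E, one_sub_mul_self, h3, ← mul_assoc, one_sub_mul_self]
  rw [h4]
  exact star_mul_self_nonneg _

/-- The sum of the projections along several subspaces. -/
def defectSum {ι : Type*} [Fintype ι] (U : ι → Submodule ℂ V) : V →L[ℂ] V :=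
  ∑ i, (1 - (U i).starProjection)

variable {ι : Type*} [Fintype ι] (U : ι → Submodule ℂ V)

theorem defectSum_nonneg : 0 ≤ defectSum U := Finset.sum_nonneg fun i _ => one_sub_nonneg (U i)

theorem isSelfAdjoint_defectSum : IsSelfAdjoint (defectSum U) :=
  (ContinuousLinearMap.nonneg_iff_isPositive _).1 (defectSum_nonneg U) |>.isSelfAdjoint

variable {U}

theorem re_inner_one_sub (A : Submodule ℂ V) (x : V) :
    (⟪x, (1 - A.starProjection : V →L[ℂ] V) x⟫_ℂ).re = ‖x - A.starProjection x‖ ^ 2 := by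
  nth_rewrite 1 [← one_sub_mul_self A]
  change (⟪x, (1 - A.starProjection : V →L[ℂ] V) ((1 - A.starProjection : V →L[ℂ] V) x)⟫_ℂ).re = _
  rw [← ContinuousLinearMap.adjoint_inner_left, ← ContinuousLinearMap.star_eq_adjoint,
    (isSelfAdjoint_one_sub A).star_eq]
  exact inner_self_eq_norm_sq (𝕜 := ℂ) _

theorem defectSum_eq_zero_iff {x : V} : defectSum U x = 0 ↔ ∀ i, x ∈ U i := by
  constructor
  · intro h
    have h1 : (⟪x, defectSum U x⟫_ℂ).re = 0 := by rw [h, inner_zero_right]; rfl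
    rw [defectSum, sum_apply, inner_sum, Complex.re_sum] at h1
    simp only [re_inner_one_sub] at h1
    intro i
    have h2 := (Finset.sum_eq_zero_iff_of_nonneg fun i _ => sq_nonneg _).1 h1 i (Finset.mem_univ i)
    rw [sub_eq_zero.1 (norm_eq_zero.1 (pow_eq_zero_iff two_ne_zero |>.1 h2))]
    exact Submodule.starProjection_apply_mem _ _
  · intro h
    rw [defectSum, sum_apply]
    refine Finset.sum_eq_zero fun i _ => ?_
    change x - (U i).starProjection x = 0
    rw [Submodule.starProjection_eq_self_iff.2 (h i), sub_self]

theorem inner_apply_comm {T : V →L[ℂ] V} (hT : IsSelfAdjoint T) (x y : V) :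
    ⟪T x, y⟫_ℂ = ⟪x, T y⟫_ℂ := by
  rw [← ContinuousLinearMap.adjoint_inner_right, ← ContinuousLinearMap.star_eq_adjoint, hT.star_eq]

theorem re_inner_le_of_le {S T : V →L[ℂ] V} (h : S ≤ T) (x : V) :
    (⟪x, S x⟫_ℂ).re ≤ (⟪x, T x⟫_ℂ).re := by
  have := ((ContinuousLinearMap.nonneg_iff_isPositive _).1 (sub_nonneg.2 h)).re_inner_nonneg_right x
  rw [sub_apply, inner_sub_right, map_sub] at this
  exact sub_nonneg.1 this

theorem le_of_re_inner_le {S T : V →L[ℂ] V} (hS : IsSelfAdjoint S) (hT : IsSelfAdjoint T)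
    (h : ∀ x, (⟪x, S x⟫_ℂ).re ≤ (⟪x, T x⟫_ℂ).re) : S ≤ T := by
  rw [← sub_nonneg, ContinuousLinearMap.nonneg_iff_isPositive, ContinuousLinearMap.isPositive_def']
  refine ⟨hT.sub hS, fun x => ?_⟩
  rw [ContinuousLinearMap.reApplyInnerSelf_apply, inner_apply_comm (hT.sub hS),
    sub_apply, inner_sub_right, map_sub]
  exact sub_nonneg.2 (h x)

/-- The gap bounds the quadratic form on the orthogonal complement of the kernel. -/
theorem mul_norm_sq_le_of_gap {T : V →L[ℂ] V} (hT : IsSelfAdjoint T) {c : ℝ}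
    (hc : ∀ μ ∈ spectrum ℝ T, μ ≠ 0 → c ≤ μ) {x : V} (hx : ∀ y, T y = 0 → ⟪y, x⟫_ℂ = 0) :
    c * ‖x‖ ^ 2 ≤ (⟪x, T x⟫_ℂ).re := by
  have h1 : x ∈ LinearMap.range (T : V →ₗ[ℂ] V) := by
    have hsym : LinearMap.IsSymmetric (T : V →ₗ[ℂ] V) := fun x y => inner_apply_comm hT x y
    rw [← Submodule.orthogonal_orthogonal (LinearMap.range (T : V →ₗ[ℂ] V)), hsym.orthogonal_range,
      Submodule.mem_orthogonal]
    exact fun y hy => hx y hy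
  obtain ⟨y, rfl⟩ := h1
  -- With x = T y the claim is ⟨y, (T³ - c T²) y⟩ ≥ 0, and this polynomial is nonnegative on the
  -- spectrum, including at 0.
  have h2 := nonneg_polynomial_of_spectrum hT (Polynomial.X ^ 3 - Polynomial.C c * Polynomial.X ^ 2)
    fun μ hμ => by
      simp only [Polynomial.eval_sub, Polynomial.eval_mul, Polynomial.eval_pow, Polynomial.eval_X,
        Polynomial.eval_C]
      by_cases h0 : μ = 0
      · rw [h0]; norm_num
      · nlinarith [hc μ hμ h0, sq_nonneg μ]
  have h3 : Polynomial.aeval T (Polynomial.X ^ 3 - Polynomial.C c * Polynomial.X ^ 2) =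
      T ^ 3 - c • T ^ 2 := by
    simp [Algebra.smul_def]
  rw [h3] at h2
  have h4 := re_inner_le_of_le (sub_nonneg.1 h2) y
  have h5 : ⟪y, (c • T ^ 2) y⟫_ℂ = (c : ℂ) * ⟪T y, T y⟫_ℂ := by
    change ⟪y, (c : ℂ) • T (T y)⟫_ℂ = _
    rw [inner_smul_right, inner_apply_comm hT]
  have h6 : ⟪y, (T ^ 3) y⟫_ℂ = ⟪T y, T (T y)⟫_ℂ := by
    change ⟪y, T (T (T y))⟫_ℂ = _
    rw [inner_apply_comm hT]
  rw [h5, h6, Complex.re_ofReal_mul] at h4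
  refine le_trans (le_of_eq ?_) h4
  exact congrArg (c * ·) (inner_self_eq_norm_sq (𝕜 := ℂ) _).symm

theorem exists_gap (U : ι → Submodule ℂ V) :
    ∃ γ : ℝ, 0 < γ ∧ ∀ μ ∈ spectrum ℝ (defectSum U), μ ≠ 0 → γ ≤ μ := by
  have hfin : {μ | μ ∈ spectrum ℝ (defectSum U) ∧ μ ≠ 0}.Finite :=
    (finite_spectrum_real (defectSum U)).subset fun μ hμ => hμ.1
  by_cases hne : {μ | μ ∈ spectrum ℝ (defectSum U) ∧ μ ≠ 0}.Nonempty
  · obtain ⟨γ, hγ, hmin⟩ := hfin.exists_minimal hne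
    refine ⟨γ, lt_of_le_of_ne (spectrum_nonneg (defectSum_nonneg U) hγ.1) hγ.2.symm,
      fun μ hμ h0 => ?_⟩
    rcases le_total γ μ with h | h
    · exact h
    · exact hmin ⟨hμ, h0⟩ h
  -- Without nonzero eigenvalues any positive number serves.
  · exact ⟨1, one_pos, fun μ hμ h0 => absurd ⟨μ, hμ, h0⟩ hne⟩

theorem re_inner_smul_apply (c : ℝ) (T : V →L[ℂ] V) (x : V) :
    (⟪x, (c • T) x⟫_ℂ).re = c * (⟪x, T x⟫_ℂ).re := by
  have h : (c • T) x = (c : ℂ) • T x := rfl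
  rw [h, inner_smul_right, Complex.re_ofReal_mul]

/-- K is the kernel of the sum. Splitting off the projection onto K does not change the form of the
sum, and on the orthogonal complement the gap applies. -/
theorem smul_le_defectSum {K : Submodule ℂ V} (hK : ∀ x, x ∈ K ↔ ∀ i, x ∈ U i) {γ : ℝ}
    (hmin : ∀ μ ∈ spectrum ℝ (defectSum U), μ ≠ 0 → γ ≤ μ) :
    γ • (1 - K.starProjection) ≤ defectSum U := by
  have hsa := isSelfAdjoint_defectSum U
  refine le_of_re_inner_le (IsSelfAdjoint.smul (IsSelfAdjoint.all γ) (isSelfAdjoint_one_sub K)) hsa fun x => ?_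
  have hyK : defectSum U (K.starProjection x) = 0 :=
    defectSum_eq_zero_iff.2 ((hK _).1 (Submodule.starProjection_apply_mem K x))
  have h2 := mul_norm_sq_le_of_gap hsa hmin (x := x - K.starProjection x) fun z hz =>
    (Submodule.mem_orthogonal _ _).1 (Submodule.sub_starProjection_mem_orthogonal x) z
      ((hK z).2 (defectSum_eq_zero_iff.1 hz))
  rw [re_inner_smul_apply, re_inner_one_sub]
  refine h2.trans (le_of_eq (congrArg Complex.re ?_))
  rw [map_sub, hyK, sub_zero, inner_sub_left, inner_eq_zero_symm.1 (by
    rw [inner_apply_comm hsa, hyK, inner_zero_right] : ⟪defectSum U x, K.starProjection x⟫_ℂ = 0),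
    sub_zero]

theorem exists_smul_le_defectSum (U : ι → Submodule ℂ V) {K : Submodule ℂ V}
    (hK : ∀ x, x ∈ K ↔ ∀ i, x ∈ U i) :
    ∃ γ : ℝ, 0 < γ ∧ γ • (1 - K.starProjection) ≤ defectSum U := by
  obtain ⟨γ, hγ, hmin⟩ := exists_gap U
  exact ⟨γ, hγ, smul_le_defectSum hK hmin⟩

theorem isLeast_spectrum_defectSum {x : V} (hx0 : x ≠ 0) (hx : ∀ i, x ∈ U i) :
    IsLeast (spectrum ℝ (defectSum U)) 0 := by
  refine ⟨mem_spectrum_real_iff.2 ⟨x, hx0, ?_⟩, fun μ hμ => spectrum_nonneg (defectSum_nonneg U) hμ⟩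
  rw [defectSum_eq_zero_iff.2 hx, Complex.ofReal_zero, zero_smul]

theorem hasGap_defectSum_of_sq {x : V} (hx0 : x ≠ 0) (hx : ∀ i, x ∈ U i) {c : ℝ}
    (h : c • defectSum U ≤ defectSum U ^ 2) : HasGap (defectSum U) c := by
  refine ⟨isSelfAdjoint_defectSum U, isLeast_spectrum_defectSum hx0 hx, fun μ hμ h0 => ?_⟩
  have hpos := lt_of_le_of_ne (spectrum_nonneg (defectSum_nonneg U) hμ) h0.symm
  obtain ⟨y, hy0, hy⟩ := mem_spectrum_real_iff.1 hμ
  have h1 := re_inner_le_of_le h y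
  have h2 : ⟪y, (c • defectSum U) y⟫_ℂ = ((c * μ : ℝ) : ℂ) * ⟪y, y⟫_ℂ := by
    change ⟪y, (c : ℂ) • defectSum U y⟫_ℂ = _
    rw [hy, inner_smul_right, inner_smul_right, ← mul_assoc, Complex.ofReal_mul]
  have h3 : ⟪y, (defectSum U ^ 2) y⟫_ℂ = ((μ * μ : ℝ) : ℂ) * ⟪y, y⟫_ℂ := by
    change ⟪y, defectSum U (defectSum U y)⟫_ℂ = _
    rw [hy, map_smul, hy, inner_smul_right, inner_smul_right, ← mul_assoc, Complex.ofReal_mul]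
  have h4 : 0 < (⟪y, y⟫_ℂ).re := by
    refine lt_of_lt_of_eq ?_ (inner_self_eq_norm_sq (𝕜 := ℂ) y).symm
    have := norm_pos_iff.2 hy0
    positivity
  rw [h2, h3, Complex.re_ofReal_mul, Complex.re_ofReal_mul] at h1
  exact le_of_mul_le_mul_right (le_of_mul_le_mul_right h1 h4) hpos

/-- An eigenvector for a nonzero eigenvalue of the second sum is orthogonal to its kernel, hence to
the smaller kernel of the first sum. The gap of the first sum therefore applies to it, and the
comparison of the two sums transfers the bound. -/
theorem hasGap_defectSum_of_le {κ : Type*} [Fintype κ] {U' : κ → Submodule ℂ V} {x : V}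
    (hx0 : x ≠ 0) (hx : ∀ i, x ∈ U' i) {c γ : ℝ} (hγ : 0 ≤ γ) (h : HasGap (defectSum U) c)
    (hle : γ • defectSum U ≤ defectSum U') (hker : ∀ y, (∀ i, y ∈ U i) → ∀ i, y ∈ U' i) :
    HasGap (defectSum U') (γ * c) := by
  have hsa := isSelfAdjoint_defectSum U'
  refine ⟨hsa, isLeast_spectrum_defectSum hx0 hx, fun μ hμ h0 => ?_⟩
  obtain ⟨y, hy0, hy⟩ := mem_spectrum_real_iff.1 hμ
  have h1 : ∀ z, defectSum U z = 0 → ⟪z, y⟫_ℂ = 0 := fun z hz => by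
    have hz' := defectSum_eq_zero_iff.2 (hker z (defectSum_eq_zero_iff.1 hz))
    have h2 := inner_apply_comm hsa z y
    rw [hz', inner_zero_left, hy, inner_smul_right] at h2
    exact (mul_eq_zero.1 h2.symm).resolve_left (Complex.ofReal_ne_zero.2 h0)
  have h2 := mul_norm_sq_le_of_gap h.1 h.2.2 h1
  have h3 := re_inner_le_of_le hle y
  have h4 : ⟪y, (γ • defectSum U) y⟫_ℂ = (γ : ℂ) * ⟪y, defectSum U y⟫_ℂ := by
    change ⟪y, (γ : ℂ) • defectSum U y⟫_ℂ = _
    rw [inner_smul_right]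
  have h5 : (⟪y, defectSum U' y⟫_ℂ).re = μ * ‖y‖ ^ 2 := by
    rw [hy, inner_smul_right, Complex.re_ofReal_mul]
    exact congrArg (μ * ·) (inner_self_eq_norm_sq (𝕜 := ℂ) y)
  rw [h4, h5, Complex.re_ofReal_mul] at h3
  have h6 : 0 < ‖y‖ ^ 2 := by
    have := norm_pos_iff.2 hy0
    positivity
  refine le_of_mul_le_mul_right (le_trans ?_ h3) h6
  rw [mul_assoc]
  exact mul_le_mul_of_nonneg_left h2 hγ

/-- A sum of projections is bounded below by its square if the overlaps are small. -/
theorem smul_le_sq_of_overlap [DecidableEq ι] (U : ι → Submodule ℂ V) (w : ι → ι → ℝ) {c : ℝ}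
    (hw : ∀ i j, w i j = w j i) (hc : ∀ i, ∑ j, w i j ≤ -c)
    (h : ∀ i j, (-w i j) • ((1 - (U i).starProjection : V →L[ℂ] V) + (1 - (U j).starProjection)) ≤
      (1 - (U i).starProjection) * (1 - (U j).starProjection) +
        (1 - (U j).starProjection) * (1 - (U i).starProjection)) :
    c • defectSum U ≤ defectSum U ^ 2 := by
  set E : ι → V →L[ℂ] V := fun i => 1 - (U i).starProjection with hE
  have h1 : defectSum U ^ 2 = ∑ i, ∑ j, E i * E j := by
    rw [sq, defectSum, Finset.sum_mul]
    exact Finset.sum_congr rfl fun i _ => Finset.mul_sum _ _ _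
  -- Twice the square is a sum of anticommutators over ordered pairs, to which the hypothesis
  -- applies termwise. The symmetry of the weights then collects the coefficient of each projection.
  have h2 : (2 : ℝ) • defectSum U ^ 2 = ∑ i, ∑ j, (E i * E j + E j * E i) := by
    simp only [Finset.sum_add_distrib]
    rw [Finset.sum_comm (f := fun i j => E j * E i), ← h1, two_smul]
  have h3 : ∑ i, ∑ j, (-w i j) • (E i + E j) = (2 : ℝ) • ∑ i, (-∑ j, w i j) • E i := by
    simp only [smul_add, Finset.sum_add_distrib]
    rw [Finset.sum_comm (f := fun i j => (-w i j) • E j), two_smul]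
    simp only [fun i j => hw j i, ← Finset.sum_smul, Finset.sum_neg_distrib]
  have h4 : (2 : ℝ) • ∑ i, (-∑ j, w i j) • E i ≤ (2 : ℝ) • defectSum U ^ 2 := by
    rw [h2, ← h3]
    exact Finset.sum_le_sum fun i _ => Finset.sum_le_sum fun j _ => h i j
  have h5 : c • defectSum U ≤ ∑ i, (-∑ j, w i j) • E i := by
    rw [defectSum, Finset.smul_sum]
    refine Finset.sum_le_sum fun i _ => smul_le_smul_of_nonneg_right ?_ (one_sub_nonneg _)
    linarith [hc i]
  exact h5.trans (le_of_smul_le_smul_left h4 two_pos)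

theorem div_smul_le_of_smul_le {S T : V →L[ℂ] V} {γ k : ℝ} (hk : 0 < k) (h : γ • S ≤ k • T) :
    (γ / k) • S ≤ T := by
  have h1 := smul_le_smul_of_nonneg_left h (one_div_pos.2 hk).le
  rwa [smul_smul, smul_smul, one_div_mul_cancel hk.ne', one_smul, one_div_mul_eq_div] at h1

end Sums

end

end SquareOctagon

namespace SquareOctagon

noncomputable section

set_option linter.unusedSectionVars false

/-! ## The Hamiltonians -/

section Hamiltonians

variable {m n : ℕ} [NeZero m] [NeZero n]

/-- The image of the AKLT construction on an enlarged subgraph. -/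
def linkImage (S : Finset (Link m n)) (i : S) : Submodule ℂ (Phys (region S)) :=
  image (Finset.subset_biUnion_of_mem pair i.2)

/-- No component of total spin 3 on an edge. -/
def edgeSub (S : Finset (Link m n)) (e : RegionEdge S) : Submodule ℂ (Phys (region S)) :=
  sing ⟨(Edge.start e.1).1, e.start_mem⟩ ⟨(Edge.finish e.1).1, e.finish_mem⟩

theorem enlargedHamiltonian_eq (S : Finset (Link m n)) :
    enlargedHamiltonian S = defectSum (linkImage S) := rfl

open Classical in
theorem hamiltonian_eq (S : Finset (Link m n)) : hamiltonian S = defectSum (edgeSub S) := by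
  rw [hamiltonian, defectSum]
  refine Finset.sum_congr rfl fun e _ => ?_
  exact edgeTerm_eq fun h => Edge.start_ne_finish_vertex e.1 (congrArg Subtype.val h)

theorem collinear_comm {i j : Link m n} : Collinear i j ↔ Collinear j i := by
  rw [Collinear, Collinear, ne_comm, disjoint_comm, eq_comm (a := i.2)]

theorem perpendicular_comm {i j : Link m n} : Perpendicular i j ↔ Perpendicular j i := by
  rw [Perpendicular, Perpendicular, ne_comm, disjoint_comm, ne_comm (a := i.2)]

theorem anticommutator_nonneg {W : Finset (Site m n)} {i j : Link m n} (hi : pair i ⊆ W)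
    (hj : pair j ⊆ W) (hd : Disjoint (pair i) (pair j)) :
    0 ≤ enlarged i hi * enlarged j hj + enlarged j hj * enlarged i hi := by
  have key : ∀ {i j : Link m n} (hi : pair i ⊆ W) (hj : pair j ⊆ W), Disjoint (pair i) (pair j) →
      0 ≤ enlarged i hi * enlarged j hj := fun {i j} hi hj hd => by
    refine mul_nonneg_of_invariant fun x hx => ?_
    rw [image_eq_liftSub] at hx ⊢
    simp only [image_eq_liftSub hi]
    rw [starProjection_liftSub (incl_injective hi)]
    refine liftOp_mem_liftSub (incl_injective hi) (incl_injective hj) (fun u v h => ?_) _ hx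
    have h' : u.1 = v.1 := congrArg (fun w : W => w.1) h
    exact Finset.disjoint_left.1 hd u.2 (h' ▸ v.2)
  exact add_nonneg (key hi hj hd) (key hj hi hd.symm)

open Classical in
/-- The overlap constants of all pairs of links. -/
def overlap (α β : ℝ) (i j : Link m n) : ℝ :=
  (if i = j then -1 else 0) + (if Collinear i j then α else 0) + (if Perpendicular i j then β else 0)

theorem overlap_comm (α β : ℝ) (i j : Link m n) : overlap α β i j = overlap α β j i := by
  classical
  simp only [overlap, eq_comm (a := i), collinear_comm (i := i), perpendicular_comm (i := i)]

-- Passing to a subset of the links only removes nonnegative weights, so the neighbour counts of the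
-- whole torus suffice.
open Classical in
theorem sum_ite_le {S : Finset (Link m n)} {q : Link m n → Prop} {α : ℝ} (hα : 0 ≤ α) :
    ∑ j : S, (if q j then α else 0) ≤ {j | q j}.ncard * α := by
  have h1 : ∑ j : S, (if q j then α else 0) = ∑ j ∈ S, if q j then α else 0 :=
    Finset.sum_coe_sort S fun j => if q j then α else 0
  have h2 : ∑ j ∈ S, (if q j then α else 0) ≤ ∑ j : Link m n, if q j then α else 0 :=
    Finset.sum_le_sum_of_subset_of_nonneg (Finset.subset_univ S) fun j _ _ => by
      split_ifs <;> linarith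
  rw [h1]
  refine h2.trans (le_of_eq ?_)
  rw [← Finset.sum_filter, Finset.sum_const, nsmul_eq_mul, Set.ncard_eq_toFinset_card',
    Set.toFinset_ofPred]

/-- The square of the sum of the enlarged terms is bounded below by the sum. -/
theorem smul_enlargedHamiltonian_le_sq (hm : 3 ≤ m) (hn : 3 ≤ n) {α β : ℝ} (hα : 0 ≤ α)
    (hβ : 0 ≤ β) (hpar : ∀ i j : Link m n, Collinear i j → IsOverlapConstant i j α)
    (hperp : ∀ i j : Link m n, Perpendicular i j → IsOverlapConstant i j β)
    (S : Finset (Link m n)) :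
    (1 - 2 * α - 4 * β) • enlargedHamiltonian S ≤ enlargedHamiltonian S ^ 2 := by
  classical
  rw [enlargedHamiltonian_eq]
  refine smul_le_sq_of_overlap _ (fun i j => overlap α β i.1 j.1) (fun i j => overlap_comm _ _ _ _)
    (fun i => ?_) fun i j => ?_
  · simp only [overlap, Finset.sum_add_distrib]
    have h1 : ∑ j : S, (if i.1 = j.1 then (-1 : ℝ) else 0) = -1 := by
      simp only [Subtype.val_inj]
      rw [Finset.sum_ite_eq, if_pos (Finset.mem_univ i)]
    have h2 := sum_ite_le (S := S) (q := fun j => Collinear i.1 j) hα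
    have h3 := sum_ite_le (S := S) (q := fun j => Perpendicular i.1 j) hβ
    rw [ncard_collinear hm hn] at h2
    rw [ncard_perpendicular hm hn] at h3
    push_cast at h2 h3
    rw [h1]
    linarith
  · have hi : pair i.1 ⊆ region S := Finset.subset_biUnion_of_mem pair i.2
    have hj : pair j.1 ⊆ region S := Finset.subset_biUnion_of_mem pair j.2
    change (-overlap α β i.1 j.1) • (enlarged i.1 hi + enlarged j.1 hj) ≤
      enlarged i.1 hi * enlarged j.1 hj + enlarged j.1 hj * enlarged i.1 hi
    by_cases hij : i = j
    · subst hij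
      have hc : ¬ Collinear i.1 i.1 := fun h => h.1 rfl
      have hp : ¬ Perpendicular i.1 i.1 := fun h => h.1 rfl
      have hE : enlarged i.1 hi * enlarged i.1 hj = enlarged i.1 hi := one_sub_mul_self _
      rw [hE, overlap, if_pos rfl, if_neg hc, if_neg hp]
      refine le_of_eq ?_
      norm_num
    · have hij' : i.1 ≠ j.1 := fun h => hij (Subtype.ext h)
      by_cases hd : Disjoint (pair i.1) (pair j.1)
      · have hc : ¬ Collinear i.1 j.1 := fun h => h.2.1 hd
        have hp : ¬ Perpendicular i.1 j.1 := fun h => h.2.1 hd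
        rw [overlap, if_neg hij', if_neg hc, if_neg hp]
        refine le_trans (le_of_eq ?_) (anticommutator_nonneg hi hj hd)
        rw [add_zero, add_zero, neg_zero]
        exact zero_smul ℝ (enlarged i.1 hi + enlarged j.1 hj)
      · by_cases h2 : i.1.2 = j.1.2
        · have hc : Collinear i.1 j.1 := ⟨hij', hd, h2⟩
          have hp : ¬ Perpendicular i.1 j.1 := fun h => h.2.2 h2
          have := ((hpar _ _ hc).1 (region S) hi hj).1
          rw [overlap, if_neg hij', if_pos hc, if_neg hp]
          simpa using this
        · have hc : ¬ Collinear i.1 j.1 := fun h => h2 h.2.2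
          have hp : Perpendicular i.1 j.1 := ⟨hij', hd, h2⟩
          have := ((hperp _ _ hp).1 (region S) hi hj).1
          rw [overlap, if_neg hij', if_neg hc, if_pos hp]
          simpa using this

/-! ### Ground states -/

/-- The contraction with all free legs in the state zero. Its polynomial is a nonzero multiple of a
product of differences of distinct variables. -/
theorem exists_groundState (W : Finset (Site m n)) : ∃ ψ : Phys W, ψ ≠ 0 ∧
    ∀ e : Edge m n, Bond ψ (Edge.start e).1 (Edge.finish e).1 := by
  have := Fintype.ofFinite (InnerEdge W)
  refine ⟨contraction InnerEdge.start InnerEdge.finish (fun h : FreeLeg W => h.1) fun _ => 0,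
    contraction_ne_zero innerEdge_bijective innerEdge_isSimple _, fun e hs ht => ?_⟩
  have h := span_contraction (innerEdge_bijective (Γ := W)) innerEdge_isSimple
  have h2 : contraction InnerEdge.start InnerEdge.finish (fun h : FreeLeg W => h.1) (fun _ => 0) ∈
      ⨅ e : InnerEdge W, sing e.start.1 e.finish.1 := h ▸ Submodule.subset_span ⟨_, rfl⟩
  exact (Submodule.mem_iInf _).1 h2 ⟨e, hs, ht⟩

theorem mem_linkImage_of_bond {S : Finset (Link m n)} {ψ : Phys (region S)}
    (h : ∀ e : Edge m n, Bond ψ (Edge.start e).1 (Edge.finish e).1) (i : S) : ψ ∈ linkImage S i :=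
  (mem_image_iff _).2 fun e _ _ => h e

theorem mem_edgeSub_of_bond {S : Finset (Link m n)} {ψ : Phys (region S)}
    (h : ∀ e : Edge m n, Bond ψ (Edge.start e).1 (Edge.finish e).1) (e : RegionEdge S) :
    ψ ∈ edgeSub S e := h e.1 _ _

theorem mem_edgeSub_of_mem_linkImage {S : Finset (Link m n)} {ψ : Phys (region S)}
    (h : ∀ i, ψ ∈ linkImage S i) (e : RegionEdge S) : ψ ∈ edgeSub S e := by
  obtain ⟨i, hi, hs, ht⟩ := e.2
  exact (mem_image_iff _).1 (h ⟨i, hi⟩) e.1 hs ht _ _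

/-! ### Comparison of the Hamiltonians -/

/-- The sites of two plaquettes. -/
abbrev Duo := Fin 2 × Fin 4

/-- The start of an edge of the two plaquettes or of their link. -/
def duoS : Duo ⊕ Unit → Duo := Sum.elim id fun _ => (0, 0)

/-- The end of an edge of the two plaquettes or of their link. -/
def duoT : Duo ⊕ Unit → Duo := Sum.elim next fun _ => (1, 0)

/-- The sites of the two plaquettes connected by a link. -/
def duoSite (p : Plaq m n) (d : Fin 4) (v : Duo) : Site m n :=
  ![(p, d + 1 * v.2), (neighbor p d, d + 2 + 1 * v.2)] v.1

theorem duoSite_injective (hm : 3 ≤ m) (hn : 3 ≤ n) (p : Plaq m n) (d : Fin 4) :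
    Function.Injective (duoSite p d) := by
  have h1 := neighbor_ne hm hn p d
  rintro ⟨t, a⟩ ⟨u, b⟩ h
  have hp := congrArg Prod.fst h
  have hc := congrArg Prod.snd h
  fin_cases t <;> fin_cases u <;> simp [duoSite, h1, h1.symm] at hp hc
  · rw [hc]
  · rw [hc]

theorem duoSite_mem (p : Plaq m n) (d : Fin 4) (v : Duo) : duoSite p d v ∈ pair (linkAt p d) := by
  obtain ⟨t, a⟩ := v
  fin_cases t
  · exact mem_pair_linkAt.2 (Or.inl rfl)
  · exact mem_pair_linkAt.2 (Or.inr rfl)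

/-- An edge between the two plaquettes connected by a link. -/
theorem exists_edge_duo (p : Plaq m n) (d : Fin 4) (x : Duo ⊕ Unit) : ∃ e : Edge m n,
    ((Edge.start e).1 = duoSite p d (duoS x) ∧ (Edge.finish e).1 = duoSite p d (duoT x)) ∨
    ((Edge.start e).1 = duoSite p d (duoT x) ∧ (Edge.finish e).1 = duoSite p d (duoS x)) := by
  rcases x with ⟨t, a⟩ | _
  · have h : ∀ d a : Fin 4, d + 1 * a + 1 = d + 1 * (a + 1) := by decide
    refine ⟨Sum.inl (duoSite p d (t, a)), Or.inl ⟨rfl, ?_⟩⟩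
    fin_cases t
    · exact Prod.ext rfl (h _ _)
    · exact Prod.ext rfl (h _ _)
  · have h0 : duoSite p d (0, 0) = (p, d) := Prod.ext rfl (by
      change d + 1 * 0 = d
      simp)
    have h1 : duoSite p d (1, 0) = (neighbor p d, d + 2) := Prod.ext rfl (by
      change d + 2 + 1 * 0 = d + 2
      simp)
    refine ⟨Sum.inr (linkAt p d), ?_⟩
    change (_ = duoSite p d (0, 0) ∧ _ = duoSite p d (1, 0)) ∨
      (_ = duoSite p d (1, 0) ∧ _ = duoSite p d (0, 0))
    rw [h0, h1]
    exact linkAt_vertices p d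

/-- The states without a component of total spin 3 on the edges of two plaquettes. -/
def duoSub : Submodule ℂ (Spins Duo) := ⨅ x, sing (duoS x) (duoT x)

theorem duoT_ne (x : Duo ⊕ Unit) : duoT x ≠ duoS x := by
  revert x
  decide

theorem image_eq_liftSub_duoSub (hm : 3 ≤ m) (hn : 3 ≤ n) {W : Finset (Site m n)} {p : Plaq m n}
    {d : Fin 4} (h : pair (linkAt p d) ⊆ W) {f : Duo → W} (hf : f.Injective)
    (hfs : ∀ v, (f v).1 = duoSite p d v) : image h = liftSub f duoSub := by
  have h0 : duoSite p d (0, 0) = (p, d) := Prod.ext rfl (by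
    change d + 1 * 0 = d
    simp)
  have h1 : duoSite p d (1, 0) = (neighbor p d, d + 2) := Prod.ext rfl (by
    change d + 2 + 1 * 0 = d + 2
    simp)
  ext ψ
  rw [mem_image_pair hm hn, duoSub, liftSub_iInf, Submodule.mem_iInf]
  simp only [mem_liftSub_sing hf, hfs]
  rw [← plaqBond_iff d (Or.inl rfl), ← plaqBond_iff (p := neighbor p d) (d + 2) (Or.inl rfl),
    ← h0, ← h1]
  constructor
  · rintro ⟨k0, k1, k2⟩ (⟨t, a⟩ | _)
    · fin_cases t
      · exact k0 a
      · exact k1 a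
    · exact k2
  · intro k
    exact ⟨fun a => k (Sum.inl (0, a)), fun a => k (Sum.inl (1, a)), k (Sum.inr ())⟩

/-- The comparison constant `γ` belongs to one fixed pair of plaquettes and is transported by the
embedding `duoSite`. It is therefore independent of the torus, of the set of links and of the link.
-/
theorem exists_regionEdge (hm : 3 ≤ m) (hn : 3 ≤ n) {γ : ℝ}
    (hγ : γ • (1 - duoSub.starProjection) ≤ defectSum fun x => sing (duoS x) (duoT x))
    {S : Finset (Link m n)} (i : S) : ∃ φ : Duo ⊕ Unit → RegionEdge S,
      (∀ x, (Edge.start (φ x).1).1 ∈ pair i.1) ∧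
      γ • (1 - (linkImage S i).starProjection) ≤ ∑ x, (1 - (edgeSub S (φ x)).starProjection) := by
  obtain ⟨p, d, hi⟩ : ∃ p d, i.1 = linkAt p d := ⟨_, _, (linkAt_fst i.1).symm⟩
  have hsub : pair (linkAt p d) ⊆ region S := hi ▸ Finset.subset_biUnion_of_mem pair i.2
  choose e he using exists_edge_duo p d
  have hmem : ∀ x, (Edge.start (e x)).1 ∈ pair i.1 ∧ (Edge.finish (e x)).1 ∈ pair i.1 := fun x => by
    rw [hi]
    rcases he x with ⟨h1, h2⟩ | ⟨h1, h2⟩ <;> rw [h1, h2] <;>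
      exact ⟨duoSite_mem _ _ _, duoSite_mem _ _ _⟩
  refine ⟨fun x => ⟨e x, i.1, i.2, hmem x⟩, fun x => (hmem x).1, ?_⟩
  set f : Duo → region S := fun v => ⟨duoSite p d v, hsub (duoSite_mem p d v)⟩ with hf
  have hfi : f.Injective := fun v w h => duoSite_injective hm hn p d (congrArg Subtype.val h)
  have h1 : linkImage S i = liftSub f duoSub := by
    have : linkImage S i = image hsub := by
      simp only [linkImage, hi]
    rw [this]
    exact image_eq_liftSub_duoSub hm hn hsub hfi fun v => rfl
  have h2 : ∀ x, edgeSub S ⟨e x, i.1, i.2, hmem x⟩ = liftSub f (sing (duoS x) (duoT x)) := fun x => by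
    rw [← sing_map hfi]
    rcases he x with ⟨k1, k2⟩ | ⟨k1, k2⟩
    · simp only [edgeSub, k1, k2, hf]
    · rw [sing_comm fun h => duoT_ne x (hfi h).symm]
      simp only [edgeSub, k1, k2, hf]
  simp only [h1, h2, one_sub_starProjection_liftSub hfi]
  rw [← liftOp_smul, ← liftOp_sum, liftOp_le_iff hfi]
  exact hγ

theorem exists_smul_enlargedHamiltonian_le : ∃ γ : ℝ, 0 < γ ∧ ∀ (m n : ℕ) [NeZero m] [NeZero n],
    3 ≤ m → 3 ≤ n → ∀ S : Finset (Link m n), γ • enlargedHamiltonian S ≤ hamiltonian S := by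
  classical
  obtain ⟨γ, hγ0, hγ⟩ := exists_smul_le_defectSum (K := duoSub)
    (fun x => sing (duoS x) (duoT x)) fun x => Submodule.mem_iInf _
  -- An edge starts in a plaquette touched by four links, and each link uses nine edges. This bounds
  -- by 36 the number of times an edge term is counted.
  refine ⟨γ / 36, by positivity, fun m n _ _ hm hn S => ?_⟩
  choose φ hφ1 hφ2 using fun i : S => exists_regionEdge hm hn hγ i
  have h1 : γ • enlargedHamiltonian S ≤
      ∑ y : S × (Duo ⊕ Unit), (1 - (edgeSub S (φ y.1 y.2)).starProjection) := by
    rw [enlargedHamiltonian_eq, defectSum, Finset.smul_sum, Fintype.sum_prod_type]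
    exact Finset.sum_le_sum fun i _ => hφ2 i
  have h2 : ∀ e : RegionEdge S,
      (Finset.univ.filter fun y : S × (Duo ⊕ Unit) => φ y.1 y.2 = e).card ≤ 36 := fun e => by
    have hle := Finset.card_le_card_of_injOn
      (s := Finset.univ.filter fun y : S × (Duo ⊕ Unit) => φ y.1 y.2 = e)
      (t := (Finset.univ.image (linkAt (Edge.start e.1).1.1)) ×ˢ (Finset.univ : Finset (Duo ⊕ Unit)))
      (fun y => (y.1.1, y.2)) (fun y hy => by
        have hy' : φ y.1 y.2 = e := (Finset.mem_filter.1 hy).2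
        have hp := hφ1 y.1 y.2
        rw [hy'] at hp
        obtain ⟨d, hd⟩ := exists_linkAt_of_mem hp
        exact Finset.mem_product.2 ⟨Finset.mem_image.2 ⟨d, Finset.mem_univ d, hd.symm⟩,
          Finset.mem_univ _⟩)
      (fun y _ z _ h => by
        rw [Prod.mk.injEq] at h
        exact Prod.ext (Subtype.ext h.1) h.2)
    refine hle.trans ?_
    rw [Finset.card_product]
    have h4 : (Finset.univ.image (linkAt (Edge.start e.1).1.1)).card ≤ 4 := Finset.card_image_le
    have h9 : (Finset.univ : Finset (Duo ⊕ Unit)).card = 9 := rfl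
    rw [h9]
    omega
  have h3 : ∑ y : S × (Duo ⊕ Unit), (1 - (edgeSub S (φ y.1 y.2)).starProjection) ≤
      (36 : ℝ) • hamiltonian S := by
    rw [hamiltonian_eq, Finset.sum_comp (fun e => 1 - (edgeSub S e).starProjection)
      fun y : S × (Duo ⊕ Unit) => φ y.1 y.2, defectSum, Finset.smul_sum]
    refine (Finset.sum_le_sum fun e _ => ?_).trans
      (Finset.sum_le_sum_of_subset_of_nonneg (Finset.subset_univ _) fun e _ _ =>
        smul_nonneg (by norm_num) (one_sub_nonneg _))
    rw [← Nat.cast_smul_eq_nsmul ℝ]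
    exact smul_le_smul_of_nonneg_right (by exact_mod_cast h2 e) (one_sub_nonneg _)
  exact div_smul_le_of_smul_le (by norm_num) (h1.trans h3)

theorem hasGap_hamiltonians {S : Finset (Link m n)} {c γ : ℝ} (hγ : 0 ≤ γ)
    (h : c • enlargedHamiltonian S ≤ enlargedHamiltonian S ^ 2)
    (hle : γ • enlargedHamiltonian S ≤ hamiltonian S) :
    HasGap (enlargedHamiltonian S) c ∧ HasGap (hamiltonian S) (γ * c) := by
  classical
  obtain ⟨ψ, hψ0, hψ⟩ := exists_groundState (region S)
  rw [hamiltonian_eq] at hle ⊢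
  rw [enlargedHamiltonian_eq] at h hle ⊢
  have h1 := hasGap_defectSum_of_sq hψ0 (mem_linkImage_of_bond hψ) h
  exact ⟨h1, hasGap_defectSum_of_le hψ0 (mem_edgeSub_of_bond hψ) hγ h1 hle
    fun y => mem_edgeSub_of_mem_linkImage⟩

end Hamiltonians

end

end SquareOctagon

/-! ### Assembly of the constants and the gap estimates -/

theorem mainTheorem2 :
    ∃ ηpar ηperp : ℝ,
      |ηpar - 0.1061446858| < 5 / 10 ^ 11 ∧
      |ηperp - 0.1589663310| < 5 / 10 ^ 11 ∧
      2 * ηpar + 4 * ηperp < 1 ∧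
      (∀ (m n : ℕ) [NeZero m] [NeZero n], 3 ≤ m → 3 ≤ n →
        (∀ i : SquareOctagon.Link m n,
          {j | SquareOctagon.Collinear i j}.ncard = 2 ∧
          {j | SquareOctagon.Perpendicular i j}.ncard = 4) ∧
        (∀ i j : SquareOctagon.Link m n, SquareOctagon.Collinear i j →
          SquareOctagon.IsOverlapConstant i j ηpar) ∧
        (∀ i j : SquareOctagon.Link m n, SquareOctagon.Perpendicular i j →
          SquareOctagon.IsOverlapConstant i j ηperp) ∧
        (∀ S : Finset (SquareOctagon.Link m n),
          (1 - 2 * ηpar - 4 * ηperp) • SquareOctagon.enlargedHamiltonian S ≤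
            SquareOctagon.enlargedHamiltonian S ^ 2)) ∧
      ∃ γ₀ : ℝ, 0 < γ₀ ∧
        ∀ (m n : ℕ) [NeZero m] [NeZero n], 3 ≤ m → 3 ≤ n →
          ∀ S : Finset (SquareOctagon.Link m n),
            γ₀ • SquareOctagon.enlargedHamiltonian S ≤ SquareOctagon.hamiltonian S ∧
            SquareOctagon.HasGap (SquareOctagon.enlargedHamiltonian S)
              (1 - 2 * ηpar - 4 * ηperp) ∧
            SquareOctagon.HasGap (SquareOctagon.hamiltonian S)
              (γ₀ * (1 - 2 * ηpar - 4 * ηperp)) := by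
  obtain ⟨α, hα, hpar⟩ := SquareOctagon.exists_isOptimal_par
  obtain ⟨β, hβ, hperp⟩ := SquareOctagon.exists_isOptimal_perp
  have hα' := abs_lt.1 hα
  have hβ' := abs_lt.1 hβ
  norm_num at hα' hβ'
  have hα0 : 0 < α := by linarith
  have hβ0 : 0 < β := by linarith
  have h1 : ∀ (m n : ℕ) [NeZero m] [NeZero n], 3 ≤ m → 3 ≤ n →
      ∀ i j : SquareOctagon.Link m n, SquareOctagon.Collinear i j →
        SquareOctagon.IsOverlapConstant i j α := fun m n _ _ hm hn i j h =>
    h.isOverlapConstant hm hn hα0 (by linarith) hpar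
  have h2 : ∀ (m n : ℕ) [NeZero m] [NeZero n], 3 ≤ m → 3 ≤ n →
      ∀ i j : SquareOctagon.Link m n, SquareOctagon.Perpendicular i j →
        SquareOctagon.IsOverlapConstant i j β := fun m n _ _ hm hn i j h =>
    h.isOverlapConstant hm hn hβ0 (by linarith) hperp
  have h3 : ∀ (m n : ℕ) [NeZero m] [NeZero n], 3 ≤ m → 3 ≤ n →
      ∀ S : Finset (SquareOctagon.Link m n),
        (1 - 2 * α - 4 * β) • SquareOctagon.enlargedHamiltonian S ≤
          SquareOctagon.enlargedHamiltonian S ^ 2 := fun m n _ _ hm hn S =>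
    SquareOctagon.smul_enlargedHamiltonian_le_sq hm hn hα0.le hβ0.le (h1 m n hm hn) (h2 m n hm hn) S
  obtain ⟨γ, hγ0, hγ⟩ := SquareOctagon.exists_smul_enlargedHamiltonian_le
  refine ⟨α, β, hα, hβ, by linarith, fun m n _ _ hm hn =>
    ⟨fun i => ⟨SquareOctagon.ncard_collinear hm hn i, SquareOctagon.ncard_perpendicular hm hn i⟩,
      h1 m n hm hn, h2 m n hm hn, h3 m n hm hn⟩, γ, hγ0, fun m n _ _ hm hn S => ?_⟩
  have h4 := hγ m n hm hn S
  exact ⟨h4, SquareOctagon.hasGap_hamiltonians hγ0.le (h3 m n hm hn S) h4⟩
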